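/- **Theorem 4.2** (uniqueness for the time-weighted Gross–Pitaevskii hierarchy). Let $\omega,b_0\in\mathbb R$ and $0\le s\le T<\infty$. Write $\mathbf y_k=(y_1,\dots,y_k)$, $\mathbf y_k'=(y_1',\dots,y_k')\in\mathbb R^{3k}$, $$R^{(k)}=\prod_{j=1}^k|\nabla_{y_j}||\nabla_{y_j'}|,\qquad B_{j,k+1}=B^1_{j,k+1}-B^2_{j,k+1},$$ $$(B^1_{j,k+1}v)(\mathbf y_k;\mathbf y_k')=\iint\delta(y_j-y_{k+1})\,\delta(y_{k+1}-y_{k+1}')\,v(\mathbf y_{k+1};\mathbf y_{k+1}')\,dy_{k+1}\,dy_{k+1}',$$ and $B^2_{j,k+1}$ is the same with $\delta(y_j'-y_{k+1})$ in place of $\delta(y_j-y_{k+1})$; $B_{j,k+1}v$ is the limit, in the sense of tempered distributions, of the expressions in which $\delta$ is replaced by $\rho_\varepsilon=\varepsilon^{-3}\rho(\cdot/\varepsilon)$, $\varepsilon\to0^+$, the same limit for every nonnegative $\rho\in C_c^\infty(\mathbb R^3)$ with $\int\rho=1$. Let $\{u^{(k)}\}_{k\ge1}$ be a solution on $[s,T]$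 of the infinite hierarchy $$\Bigl(i\partial_\tau+\tfrac12\Delta_{\mathbf y_k}-\tfrac12\Delta_{\mathbf y_k'}\Bigr)u^{(k)}=\sqrt{1+\omega^2\tau^2}\;b_0\sum_{j=1}^kB_{j,k+1}u^{(k+1)},\qquad k\ge1,$$ that is: $u^{(k)}$ is a weakly continuous function on $[s,T]$ with values in $L^2(\mathbb R^{3k}\times\mathbb R^{3k})$; each $u^{(k)}(\tau)$ is unchanged when the same permutation is applied to $y_1,\dots,y_k$ and to $y_1',\dots,y_k'$; $B_{j,k+1}u^{(k+1)}(\tau)$ exists for almost every $\tau\in[s,T]$ and is integrable in $\tau$ when tested against any Schwartz function; and the equation, integrated in time from $s$ to any $\tau\in[s,T]$, holds in the sense of tempered distributions on $\mathbb R^{3k}\times\mathbb R^{3k}$. Suppose that $u^{(k)}(s)=0$ for all $k\ge1$ and that there is a constant $C>0$ such that $$\int_s^T\bigl\|R^{(k)}B_{j,k+1}u^{(k+1)}(\tau)\bigr\|_{L^2(\mathbb R^{3k}\times\mathbb R^{3k})}\,d\tau\le C^k\qquad\text{for all }k\ge1,\ 1\le j\le k.$$ Then $$\bigl\|R^{(k)}u^{(k)}(\tau)\bigr\|_{L^2(\mathbb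 R^{3k}\times\mathbb R^{3k})}=0\qquad\text{for all }k\ge1\text{ and all }\tau\in[s,T].$$ -/

import Mathlib

open MeasureTheory Filter Topology
open scoped SchwartzMap FourierTransform LineDeriv ENNReal

noncomputable section

namespace GrossPitaevskii

/-- The physical space of one particle. -/
abbrev Space : Type := EuclideanSpace ℝ (Fin 3)

/-- The space `ℝ³ᵏ × ℝ³ᵏ` of pairs `(𝐲ₖ; 𝐲ₖ')`: the label `Sum.inl j` stands for the unprimed
particle `yⱼ`, the label `Sum.inr j` for the primed particle `yⱼ'`. -/
abbrev Config (k : ℕ) : Type := EuclideanSpace ℝ ((Fin k ⊕ Fin k) × Fin 3)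

/-- Hilbert–Schmidt kernels on `ℝ³ᵏ × ℝ³ᵏ`. -/
abbrev Kernel2 (k : ℕ) : Type := Lp ℂ 2 (volume : Measure (Config k))

/-- The position of the particle with label `p`. -/
def pos {k : ℕ} (z : Config k) (p : Fin k ⊕ Fin k) : Space :=
  WithLp.toLp 2 fun i => z (p, i)

/-- Simultaneous permutation of the unprimed and of the primed particles. -/
def permute {k : ℕ} (σ : Equiv.Perm (Fin k)) (z : Config k) : Config k :=
  WithLp.toLp 2 fun q => z (Sum.map σ σ q.1, q.2)

/-- `(𝐲ₖ, yₖ₊₁; 𝐲ₖ', yₖ₊₁') ↦ (𝐲ₖ; 𝐲ₖ')`. -/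
def dropLast {k : ℕ} (z : Config (k + 1)) : Config k :=
  WithLp.toLp 2 fun q => z (Sum.map Fin.castSucc Fin.castSucc q.1, q.2)

/-- The Laplacian in the variable of one particle, on tempered distributions. -/
def particleLaplacian {k : ℕ} (p : Fin k ⊕ Fin k) (f : 𝓢'(Config k, ℂ)) : 𝓢'(Config k, ℂ) :=
  ∑ i : Fin 3, ∂_{EuclideanSpace.single (p, i) (1 : ℝ)}
    (∂_{EuclideanSpace.single (p, i) (1 : ℝ)} f)

/-- `½ Δ_{𝐲ₖ} f - ½ Δ_{𝐲ₖ'} f`. -/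
def kinetic {k : ℕ} (f : 𝓢'(Config k, ℂ)) : 𝓢'(Config k, ℂ) :=
  (1 / 2 : ℂ) • (∑ j : Fin k, particleLaplacian (Sum.inl j) f)
    - (1 / 2 : ℂ) • (∑ j : Fin k, particleLaplacian (Sum.inr j) f)

/-! ### The norm `‖R⁽ᵏ⁾ f‖_{L²}` -/

/-- The Fourier symbol of `R⁽ᵏ⁾ = ∏ⱼ |∇_{yⱼ}| |∇_{yⱼ'}|`. The Fourier transform is normalised with
the phase `exp (-2πi ⟨x, ξ⟩)`, so that `|∇|` has the symbol `2π|ξ|`. -/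
def rSymbol {k : ℕ} (ξ : Config k) : ℝ :=
  ∏ p : Fin k ⊕ Fin k, (2 * Real.pi * ‖pos ξ p‖)

/-- The Fourier transform of the tempered distribution `f` is the function `F`. -/
def HasFourierDensity {k : ℕ} (f : 𝓢'(Config k, ℂ)) (F : Config k → ℂ) : Prop :=
  AEStronglyMeasurable F volume ∧
    ∀ φ : 𝓢(Config k, ℂ), Integrable (fun ξ => F ξ * φ ξ) volume ∧
      (𝓕 f) φ = ∫ ξ, F ξ * φ ξ

/-- `‖R⁽ᵏ⁾ f‖_{L²(ℝ³ᵏ × ℝ³ᵏ)}` by Plancherel, for a tempered distribution `f`. The density is unique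
up to null sets; the value is `∞` if there is none. -/
def rNorm {k : ℕ} (f : 𝓢'(Config k, ℂ)) : ℝ≥0∞ :=
  ⨅ (F : Config k → ℂ) (_ : HasFourierDensity f F),
    eLpNorm (fun ξ => (rSymbol ξ : ℂ) * F ξ) 2 volume

/-! ### The collapsing operators -/

/-- `ρ` generates an approximate identity. -/
structure IsMollifier (ρ : Space → ℝ) : Prop where
  smooth : ContDiff ℝ (⊤ : ℕ∞) ρ
  compact : HasCompactSupport ρ
  nonneg : ∀ x, 0 ≤ ρ x
  integral_eq_one : ∫ x, ρ x = 1

/-- `ρ_ε(x) = ε⁻³ ρ(x / ε)`. -/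
def rescale (ρ : Space → ℝ) (ε : ℝ) (x : Space) : ℝ := (ε ^ 3)⁻¹ * ρ (ε⁻¹ • x)

/-- The kernel of `B_{j,k+1} = B¹_{j,k+1} - B²_{j,k+1}` with `δ` replaced by `ρ_ε`:
`ρ_ε(yⱼ - yₖ₊₁) ρ_ε(yₖ₊₁ - yₖ₊₁') - ρ_ε(yⱼ' - yₖ₊₁) ρ_ε(yₖ₊₁ - yₖ₊₁')`. -/
def collapseKernel {k : ℕ} (j : Fin k) (ρ : Space → ℝ) (ε : ℝ) (z : Config (k + 1)) : ℝ :=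
  rescale ρ ε (pos z (Sum.inl j.castSucc) - pos z (Sum.inl (Fin.last k)))
      * rescale ρ ε (pos z (Sum.inl (Fin.last k)) - pos z (Sum.inr (Fin.last k)))
    - rescale ρ ε (pos z (Sum.inr j.castSucc) - pos z (Sum.inl (Fin.last k)))
      * rescale ρ ε (pos z (Sum.inl (Fin.last k)) - pos z (Sum.inr (Fin.last k)))

/-- `B_{j,k+1} v = f`: for every approximate identity, the regularised expressions
`∫∫ (ρ_ε(yⱼ - yₖ₊₁) - ρ_ε(yⱼ' - yₖ₊₁)) ρ_ε(yₖ₊₁ - yₖ₊₁') v(𝐲ₖ₊₁; 𝐲ₖ₊₁') dyₖ₊₁ dyₖ₊₁'`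
converge to `f` as tempered distributions in `(𝐲ₖ; 𝐲ₖ')`, as `ε → 0+`. -/
def IsCollapse {k : ℕ} (j : Fin k) (v : Kernel2 (k + 1)) (f : 𝓢'(Config k, ℂ)) : Prop :=
  ∀ ρ : Space → ℝ, IsMollifier ρ → ∀ φ : 𝓢(Config k, ℂ),
    Tendsto (fun ε : ℝ => ∫ z, (collapseKernel j ρ ε z : ℂ) * v z * φ (dropLast z))
      (𝓝[>] 0) (𝓝 (f φ))

/-! ### The hierarchy -/

/-- `{u⁽ᵏ⁾}`, `k ≥ 1`, is a bosonic solution on `[s, T]` of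
`(i ∂_τ + ½ Δ_{𝐲ₖ} - ½ Δ_{𝐲ₖ'}) u⁽ᵏ⁾ = √(1 + ω² τ²) b₀ ∑ⱼ B_{j,k+1} u⁽ᵏ⁺¹⁾`,
where `Bu k j τ` is the distribution `B_{j,k+1} u⁽ᵏ⁺¹⁾(τ)`. The equation is understood in the
sense of tempered distributions in space, integrated in time. Level `0` is unused. -/
structure IsGPSolution (ω b₀ s T : ℝ) (u : ∀ k : ℕ, ℝ → Kernel2 k)
    (Bu : ∀ k : ℕ, Fin k → ℝ → 𝓢'(Config k, ℂ)) : Prop where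
  symmetric : ∀ k : ℕ, 1 ≤ k → ∀ τ ∈ Set.Icc s T, ∀ σ : Equiv.Perm (Fin k),
    ∀ᵐ z : Config k, u k τ (permute σ z) = u k τ z
  weakly_continuous : ∀ k : ℕ, 1 ≤ k → ∀ v : Kernel2 k,
    ContinuousOn (fun τ => inner ℂ v (u k τ)) (Set.Icc s T)
  collapse : ∀ k : ℕ, 1 ≤ k → ∀ j : Fin k,
    ∀ᵐ τ ∂(volume.restrict (Set.Icc s T)), IsCollapse j (u (k + 1) τ) (Bu k j τ)
  integrable : ∀ k : ℕ, 1 ≤ k → ∀ j : Fin k, ∀ φ : 𝓢(Config k, ℂ),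
    IntegrableOn (fun τ => Bu k j τ φ) (Set.Icc s T) volume
  equation : ∀ k : ℕ, 1 ≤ k → ∀ φ : 𝓢(Config k, ℂ), ∀ τ ∈ Set.Icc s T,
    Complex.I * ((u k τ : 𝓢'(Config k, ℂ)) φ - (u k s : 𝓢'(Config k, ℂ)) φ)
        + ∫ r in s..τ, kinetic (u k r : 𝓢'(Config k, ℂ)) φ
      = ∫ r in s..τ, (Real.sqrt (1 + ω ^ 2 * r ^ 2) : ℂ) * (b₀ : ℂ) * ∑ j : Fin k, Bu k j r φ

/-- `∫_s^T ‖R⁽ᵏ⁾ B_{j,k+1} u⁽ᵏ⁺¹⁾(τ)‖_{L²} dτ ≤ Cᵏ` for all `1 ≤ j ≤ k`. -/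
def SpaceTimeBound (s T C : ℝ) (Bu : ∀ k : ℕ, Fin k → ℝ → 𝓢'(Config k, ℂ)) : Prop :=
  ∀ k : ℕ, 1 ≤ k → ∀ j : Fin k,
    AEMeasurable (fun τ => rNorm (Bu k j τ)) (volume.restrict (Set.Icc s T)) ∧
      ∫⁻ τ in Set.Icc s T, rNorm (Bu k j τ) ≤ ENNReal.ofReal (C ^ k)

end GrossPitaevskii

end

/-! In the interaction picture and on the Fourier side, the hierarchy with zero initial data says
that `R⁽ⁿ⁾ û⁽ⁿ⁾(τ)`, up to a free phase, equals `-i` times the time integral of a source. This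
source is `√(1+ω²τ²) b₀` times the sum over `j` of the collapsed kernels `R B_{j,n+1} u⁽ⁿ⁺¹⁾`
(`mild_form`). Only these collapsed kernels are controlled, in `L¹` in time by `Cⁿ`. The expansion
is therefore done by duality: a fixed `L²` function `ψ` at level `k` is paired with the integrated
source, and each use of the equation moves one adjoint collapse onto the `ψ` side
(`collapse_identity`, `IsDuhamelFamily.expand`). After `N` steps the pairing involves the source of
level `k + N` and a function built from `ψ` by `N` adjoint collapses, so the only remainder is this
last term.

There are three ingredients. (a) One collapse is bounded from `L²` in time to `L²` of the last pair.
Plancherel in time reduces this to showing that the weight `|ξ|²/(|p|²|q|²|r|²)` on momenta with sum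
`ξ` has a bounded push-forward under the phase `±|p|² ± |q|² ± |r|²` (`exists_tripleIntegral_le`,
`exists_fiber_estimate`). Bipolar coordinates and an ordering of the three momenta by length prove
the latter.

(b) The ordered expansion has about `k(k+1)⋯(k+N-1)` terms. By bosonic symmetry each collapse can be
taken between neighbouring pairs, and then all time orderings compatible with one binary forest add
up to one nested integral, in which only a collapse and its descendants are ordered. The recursion
`forestSum_succ` expresses this regrouping, and at most `(N+1)ᵏ 8ᴺ` forests occur.

(c) The amplitude of a forest is estimated tree by tree and node by node. Each collapse contributes
`4 c B² T₁` to the squared `L²` norm, where `c` is the fibre constant, `T₁` the length of the time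
window and `B` bounds the coupling (`lintegral_integral_dens_le`). Here every amplitude is
integrated against a finite measure in the time of its root, so that cutting times off costs
nothing.

Together the pairing is at most a polynomial in `N` times `(8 q C)ᴺ` with `q² ≥ 4 c B² T₁`. On a
window so short that `8 q C ≤ 1/2` this tends to `0`, and the integrated source vanishes. The
admissible length depends only on global constants, so finitely many windows cover `[s, T]`. -/

noncomputable section

namespace GrossPitaevskii

/-! ### Bipolar coordinates in three dimensions. -/

/-- Integration of a function of `|q|²` over the plane. -/
lemma lintegral_plane_normSq (g : ℝ → ℝ≥0∞) (hg : Measurable g) :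
    ∫⁻ q : ℝ × ℝ, g (q.1 ^ 2 + q.2 ^ 2) = ENNReal.ofReal Real.pi * ∫⁻ w in Set.Ioi (0 : ℝ), g w := by
  rw [← lintegral_comp_polarCoord_symm]
  have h1 : ∫⁻ p in polarCoord.target, ENNReal.ofReal p.1 •
      g ((polarCoord.symm p).1 ^ 2 + (polarCoord.symm p).2 ^ 2)
      = ∫⁻ p in Set.Ioi (0 : ℝ) ×ˢ Set.Ioo (-Real.pi) Real.pi,
          (ENNReal.ofReal p.1 * g (p.1 ^ 2)) * 1 := by
    rw [polarCoord_target]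
    refine lintegral_congr fun p => ?_
    simp only [polarCoord_symm_apply, smul_eq_mul, mul_one]
    congr 2
    have := Real.sin_sq_add_cos_sq p.2
    linear_combination (p.1 ^ 2) * this
  rw [h1, Measure.volume_eq_prod, ← Measure.prod_restrict,
    lintegral_prod_mul (f := fun r : ℝ => ENNReal.ofReal r * g (r ^ 2)) (g := fun _ : ℝ => 1)
      (by fun_prop) (by fun_prop)]
  have h2 : ∫⁻ w in Set.Ioi (0 : ℝ), g w
      = ∫⁻ r in Set.Ioi (0 : ℝ), ENNReal.ofReal |2 * r| * g (r ^ 2) := by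
    have himg : (fun r : ℝ => r ^ 2) '' Set.Ioi 0 = Set.Ioi 0 := by
      ext w
      constructor
      · rintro ⟨r, hr, rfl⟩
        exact pow_pos (Set.mem_Ioi.1 hr) 2
      · intro hw
        exact ⟨√w, Real.sqrt_pos.2 hw, Real.sq_sqrt (le_of_lt hw)⟩
    conv_lhs => rw [← himg]
    refine lintegral_image_eq_lintegral_abs_deriv_mul measurableSet_Ioi (f' := fun r => 2 * r)
      (fun r _ => ?_) ?_ _
    · simpa using (hasDerivAt_pow 2 r).hasDerivWithinAt
    · intro a ha b hb hab
      exact (pow_left_inj₀ (le_of_lt ha) (le_of_lt hb) two_ne_zero).1 hab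
  have h3 : ∫⁻ r in Set.Ioi (0 : ℝ), ENNReal.ofReal |2 * r| * g (r ^ 2)
      = 2 * ∫⁻ r in Set.Ioi (0 : ℝ), ENNReal.ofReal r * g (r ^ 2) := by
    rw [← lintegral_const_mul _ (by fun_prop)]
    refine setLIntegral_congr_fun measurableSet_Ioi fun r hr => ?_
    rw [abs_of_pos (by have := Set.mem_Ioi.1 hr; positivity),
      ENNReal.ofReal_mul (by norm_num), ENNReal.ofReal_ofNat, mul_assoc]
  rw [h2, h3]
  simp only [lintegral_const, MeasurableSet.univ, Measure.restrict_apply, Set.univ_inter,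
    Real.volume_Ioo, one_mul]
  rw [show Real.pi - -Real.pi = 2 * Real.pi by ring, ENNReal.ofReal_mul (by norm_num),
    ENNReal.ofReal_ofNat]
  ring

/-- An orthonormal frame of `ℝ³` whose first vector points in the direction of `u`. -/
lemma exists_adapted_frame (u : Space) (hu : u ≠ 0) :
    ∃ b : OrthonormalBasis (Fin 3) ℝ Space, b.repr u = EuclideanSpace.single 0 ‖u‖ := by
  have hv : Orthonormal ℝ (({0} : Set (Fin 3)).domRestrict fun _ => (‖u‖⁻¹ : ℝ) • u) := by
    constructor
    · intro i
      change ‖(‖u‖⁻¹ : ℝ) • u‖ = 1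
      rw [norm_smul, norm_inv, norm_norm, inv_mul_cancel₀ (norm_ne_zero_iff.2 hu)]
    · intro i j hij
      exact absurd (Subsingleton.elim i j) hij
  obtain ⟨b, hb⟩ := hv.exists_orthonormalBasis_extension_of_card_eq (by simp)
  refine ⟨b, ?_⟩
  have h0 : u = ‖u‖ • b 0 := by
    rw [hb 0 (by simp), smul_smul, mul_inv_cancel₀ (by simpa using hu), one_smul]
  conv_lhs => rw [h0]
  rw [map_smul, b.repr_self]
  ext i
  simp

lemma lintegral_space_coords (f : ℝ → ℝ → ℝ → ℝ≥0∞) (hf : Measurable fun p : ℝ × ℝ × ℝ =>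
    f p.1 p.2.1 p.2.2) (b : OrthonormalBasis (Fin 3) ℝ Space) :
    ∫⁻ x : Space, f (b.repr x 0) (b.repr x 1) (b.repr x 2)
      = ∫⁻ s : ℝ, ∫⁻ q : ℝ × ℝ, f s q.1 q.2 := by
  have h1 : ∫⁻ x : Space, f (b.repr x 0) (b.repr x 1) (b.repr x 2)
      = ∫⁻ y : Space, f (y 0) (y 1) (y 2) :=
    (b.repr.measurePreserving).lintegral_comp (f := fun y : Space => f (y 0) (y 1) (y 2))
      (hf.comp (by fun_prop : Measurable fun y : Space => (y 0, y 1, y 2)))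
  have h2 : ∫⁻ y : Space, f (y 0) (y 1) (y 2) = ∫⁻ y : Fin 3 → ℝ, f (y 0) (y 1) (y 2) :=
    (PiLp.volume_preserving_ofLp (Fin 3)).lintegral_comp
      (f := fun y : Fin 3 → ℝ => f (y 0) (y 1) (y 2))
      (hf.comp (by fun_prop : Measurable fun y : Fin 3 → ℝ => (y 0, y 1, y 2)))
  have h3 : ∫⁻ y : Fin 3 → ℝ, f (y 0) (y 1) (y 2)
      = ∫⁻ z : ℝ × (Fin 2 → ℝ), f z.1 (z.2 0) (z.2 1) :=
    (volume_preserving_piFinSuccAbove (fun _ : Fin 3 => ℝ) 0).lintegral_comp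
      (f := fun z : ℝ × (Fin 2 → ℝ) => f z.1 (z.2 0) (z.2 1))
      (hf.comp (by fun_prop : Measurable fun z : ℝ × (Fin 2 → ℝ) => (z.1, z.2 0, z.2 1)))
  rw [h1, h2, h3, Measure.volume_eq_prod, lintegral_prod _ (by
    exact (hf.comp (by fun_prop : Measurable fun z : ℝ × (Fin 2 → ℝ) => (z.1, z.2 0, z.2 1))).aemeasurable)]
  refine lintegral_congr fun s => ?_
  exact (volume_preserving_finTwoArrow ℝ).lintegral_comp
    (f := fun q : ℝ × ℝ => f s q.1 q.2)
      (hf.comp (by fun_prop : Measurable fun q : ℝ × ℝ => (s, q.1, q.2)))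

/-- Bipolar coordinates in `ℝ³`, in terms of the squared distances to `0` and to `u`. -/
lemma lintegral_bipolar_le (u : Space) (hu : u ≠ 0) (f : ℝ → ℝ → ℝ≥0∞)
    (hf : Measurable fun p : ℝ × ℝ => f p.1 p.2) :
    ∫⁻ x : Space, f (‖x‖ ^ 2) (‖u - x‖ ^ 2)
      ≤ ENNReal.ofReal (Real.pi / (2 * ‖u‖)) * ∫⁻ R : ℝ, ∫⁻ S : ℝ, f R S := by
  obtain ⟨b, hb⟩ := exists_adapted_frame u hu
  set L := ‖u‖ with hL
  have hLpos : 0 < L := norm_pos_iff.2 hu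
  have e1 : ∀ x : Space, ‖x‖ ^ 2 = (b.repr x 0) ^ 2 + ((b.repr x 1) ^ 2 + (b.repr x 2) ^ 2) := by
    intro x
    rw [← b.repr.norm_map x, EuclideanSpace.norm_sq_eq, Fin.sum_univ_three]
    simp only [Real.norm_eq_abs, sq_abs]
    ring
  have e2 : ∀ x : Space, ‖u - x‖ ^ 2
      = (L - b.repr x 0) ^ 2 + ((b.repr x 1) ^ 2 + (b.repr x 2) ^ 2) := by
    intro x
    rw [e1, map_sub, hb]
    simp
  have h1 : ∫⁻ x : Space, f (‖x‖ ^ 2) (‖u - x‖ ^ 2)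
      = ∫⁻ s : ℝ, ∫⁻ q : ℝ × ℝ, f (s ^ 2 + (q.1 ^ 2 + q.2 ^ 2))
          ((L - s) ^ 2 + (q.1 ^ 2 + q.2 ^ 2)) := by
    simp_rw [e2, e1]
    exact lintegral_space_coords (fun s a c => f (s ^ 2 + (a ^ 2 + c ^ 2))
      ((L - s) ^ 2 + (a ^ 2 + c ^ 2))) (hf.comp (by fun_prop :
        Measurable fun p : ℝ × ℝ × ℝ => (p.1 ^ 2 + (p.2.1 ^ 2 + p.2.2 ^ 2),
          (L - p.1) ^ 2 + (p.2.1 ^ 2 + p.2.2 ^ 2)))) b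
  have h2 : ∀ s : ℝ, ∫⁻ q : ℝ × ℝ, f (s ^ 2 + (q.1 ^ 2 + q.2 ^ 2))
          ((L - s) ^ 2 + (q.1 ^ 2 + q.2 ^ 2))
      ≤ ENNReal.ofReal Real.pi * ∫⁻ R : ℝ, f R (R + (L ^ 2 - 2 * L * s)) := by
    intro s
    rw [lintegral_plane_normSq (fun w => f (s ^ 2 + w) ((L - s) ^ 2 + w))
      (hf.comp (by fun_prop : Measurable fun w : ℝ => (s ^ 2 + w, (L - s) ^ 2 + w)))]
    refine mul_le_mul_right ?_ _
    -- This is the only loss: the constraint `w > 0`, that is `R > s²`, is dropped, after which the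
    -- translation `R = s² + w` runs over all of `ℝ`.
    refine (setLIntegral_le_lintegral _ _).trans_eq ?_
    rw [← lintegral_add_left_eq_self (μ := volume) (fun R => f R (R + (L ^ 2 - 2 * L * s))) (s ^ 2)]
    refine lintegral_congr fun w => ?_
    congr 1
    ring
  -- For fixed `R` the second squared distance is affine in the height `s` with slope `-2L`, which
  -- gives the Jacobian `1/(2L)`.
  have h3 : ∀ R : ℝ, ∫⁻ s : ℝ, f R (R + (L ^ 2 - 2 * L * s))
      = ENNReal.ofReal (2 * L)⁻¹ * ∫⁻ S : ℝ, f R S := by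
    intro R
    have hfR : Measurable (f R) := hf.comp (by fun_prop : Measurable fun S : ℝ => (R, S))
    have := lintegral_add_left_eq_self (μ := volume) (f R) (R + L ^ 2)
    rw [← this]
    have hs : (-2 * L) ≠ 0 := by nlinarith
    have h4 := Real.map_volume_mul_left hs
    have h5 : ∫⁻ s : ℝ, f R (R + (L ^ 2 - 2 * L * s))
        = ∫⁻ y, f R (R + L ^ 2 + y) ∂(Measure.map (fun x : ℝ => (-2 * L) * x) volume) := by
      rw [lintegral_map (by fun_prop) (by fun_prop)]
      refine lintegral_congr fun s => ?_
      congr 1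
      ring
    rw [h5, h4, lintegral_smul_measure, smul_eq_mul]
    congr 2
    rw [abs_inv, abs_mul, abs_of_pos hLpos]
    norm_num
  rw [h1]
  calc _ ≤ ∫⁻ s : ℝ, ENNReal.ofReal Real.pi * ∫⁻ R : ℝ, f R (R + (L ^ 2 - 2 * L * s)) :=
        lintegral_mono h2
    _ = ENNReal.ofReal Real.pi * ∫⁻ R : ℝ, ∫⁻ s : ℝ, f R (R + (L ^ 2 - 2 * L * s)) := by
        have hm : Measurable fun p : ℝ × ℝ => f p.2 (p.2 + (L ^ 2 - 2 * L * p.1)) :=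
          hf.comp (by fun_prop : Measurable fun p : ℝ × ℝ => (p.2, p.2 + (L ^ 2 - 2 * L * p.1)))
        rw [lintegral_const_mul _ hm.lintegral_prod_right', lintegral_lintegral_swap hm.aemeasurable]
    _ = _ := by
        simp_rw [h3]
        rw [lintegral_const_mul _ hf.lintegral_prod_right', ← mul_assoc,
          ← ENNReal.ofReal_mul Real.pi_pos.le, div_eq_mul_inv]


/-! ### Integrals of truncated power weights. -/

/-- The radial weight `r⁻ᵖ max(a, r)^(-q)`. -/
def radialWeight (p q a r : ℝ) : ℝ := r ^ (-p) * max a r ^ (-q)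

lemma radialWeight_nonneg (p q a : ℝ) {r : ℝ} (hr : 0 ≤ r) : 0 ≤ radialWeight p q a r :=
  mul_nonneg (Real.rpow_nonneg hr _) (Real.rpow_nonneg (le_max_of_le_right hr) _)

@[fun_prop]
lemma measurable_radialWeight (p q a : ℝ) : Measurable (radialWeight p q a) := by
  unfold radialWeight
  fun_prop

section Radial

variable {E : Type*} [NormedAddCommGroup E] [NormedSpace ℝ E] [MeasurableSpace E] [BorelSpace E]
  [FiniteDimensional ℝ E] (μ : Measure E) [μ.IsAddHaarMeasure]

/-- Scaling by `a`: the weight is homogeneous of degree `-p - q` in the radius and the cut-off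
together, and Haar measure contributes the dimension. -/
lemma lintegral_radialWeight (p q : ℝ) {a : ℝ} (ha : 0 < a) :
    ∫⁻ y, ENNReal.ofReal (radialWeight p q a ‖y‖) ∂μ
      = ENNReal.ofReal (a ^ ((Module.finrank ℝ E : ℝ) - p - q))
        * ∫⁻ y, ENNReal.ofReal (radialWeight p q 1 ‖y‖) ∂μ := by
  have h1 := Measure.map_addHaar_smul μ ha.ne'
  have h2 : ∫⁻ y, ENNReal.ofReal (radialWeight p q a ‖y‖) ∂(Measure.map (fun x => a • x) μ)
      = ENNReal.ofReal (a ^ (-p - q)) * ∫⁻ y, ENNReal.ofReal (radialWeight p q 1 ‖y‖) ∂μ := by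
    rw [lintegral_map (by fun_prop) (by fun_prop), ← lintegral_const_mul _ (by fun_prop)]
    refine lintegral_congr fun y => ?_
    rw [← ENNReal.ofReal_mul (by positivity)]
    congr 1
    simp only [radialWeight]
    rw [norm_smul, Real.norm_of_nonneg ha.le, Real.mul_rpow ha.le (norm_nonneg _)]
    have : max a (a * ‖y‖) = a * max 1 ‖y‖ := by
      rw [mul_max_of_nonneg _ _ ha.le, mul_one]
    rw [this, Real.mul_rpow ha.le (by positivity), sub_eq_add_neg, Real.rpow_add ha]
    ring
  rw [h1, lintegral_smul_measure, smul_eq_mul] at h2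
  have hd : (a ^ Module.finrank ℝ E) ≠ 0 := by positivity
  have h3 : ENNReal.ofReal (a ^ Module.finrank ℝ E)
      * ENNReal.ofReal |(a ^ Module.finrank ℝ E)⁻¹| = 1 := by
    rw [← ENNReal.ofReal_mul (by positivity), abs_of_pos (by positivity), mul_inv_cancel₀ hd,
      ENNReal.ofReal_one]
  calc _ = ENNReal.ofReal (a ^ Module.finrank ℝ E) * (ENNReal.ofReal |(a ^ Module.finrank ℝ E)⁻¹|
        * ∫⁻ y, ENNReal.ofReal (radialWeight p q a ‖y‖) ∂μ) := by rw [← mul_assoc, h3, one_mul]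
    _ = _ := by
      rw [h2, ← mul_assoc, ← ENNReal.ofReal_mul (by positivity)]
      congr 2
      rw [← Real.rpow_natCast, ← Real.rpow_add ha]
      congr 1
      ring

/-- The weight behaves like `r⁻ᵖ` at the origin and like `r^(-p-q)` at infinity, so the two
hypotheses on the exponents are the two convergence conditions. -/
lemma lintegral_radialWeight_one_lt_top [Nontrivial E] {p q : ℝ}
    (hp : p < Module.finrank ℝ E) (hq : (Module.finrank ℝ E : ℝ) < p + q) :
    ∫⁻ y, ENNReal.ofReal (radialWeight p q 1 ‖y‖) ∂μ < ∞ := by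
  have hd : 1 ≤ Module.finrank ℝ E := Module.finrank_pos
  have key : Integrable (fun y : E => radialWeight p q 1 ‖y‖) μ := by
    rw [integrable_fun_norm_addHaar μ (f := radialWeight p q 1)]
    have hcast : ((Module.finrank ℝ E - 1 : ℕ) : ℝ) = (Module.finrank ℝ E : ℝ) - 1 := by
      push_cast [hd]
      ring
    -- The pieces may overlap, since only integrability is at stake. On the first one the factor
    -- with the maximum is at most `2 ^ |q|`, on the second the weight is a pure power.
    have hu : Set.Ioi (0 : ℝ) = Set.Ioo 0 2 ∪ Set.Ioi 1 := by
      ext x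
      simp only [Set.mem_Ioi, Set.mem_union, Set.mem_Ioo]
      constructor
      · intro h
        rcases lt_or_ge x 2 with h2 | h2
        · exact Or.inl ⟨h, h2⟩
        · exact Or.inr (by linarith)
      · rintro (h | h)
        · exact h.1
        · linarith
    rw [hu]
    refine IntegrableOn.union ?_ ?_
    · have h1 : IntegrableOn (fun x : ℝ => x ^ ((Module.finrank ℝ E : ℝ) - 1 - p)) (Set.Ioo 0 2) :=
        (intervalIntegral.integrableOn_Ioo_rpow_iff (by norm_num)).2 (by linarith)
      have h1' := h1.mul_const ((2 : ℝ) ^ |q|)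
      refine h1'.mono' (by fun_prop) ?_
      refine (ae_restrict_mem measurableSet_Ioo).mono fun x hx => ?_
      have hx0 : 0 < x := hx.1
      rw [smul_eq_mul, Real.norm_of_nonneg
        (mul_nonneg (by positivity) (radialWeight_nonneg _ _ _ hx0.le)),
        radialWeight, ← mul_assoc, ← Real.rpow_natCast, hcast, ← Real.rpow_add hx0, ← sub_eq_add_neg]
      have hm1 : 1 ≤ max 1 x := le_max_left _ _
      have hm2 : max 1 x ≤ 2 := max_le (by norm_num) hx.2.le
      gcongr
      calc max 1 x ^ (-q) ≤ max 1 x ^ |q| := Real.rpow_le_rpow_of_exponent_le hm1 (neg_le_abs q)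
        _ ≤ 2 ^ |q| := by gcongr
    · have h1 : IntegrableOn (fun x : ℝ => x ^ ((Module.finrank ℝ E : ℝ) - 1 - p - q)) (Set.Ioi 1) :=
        integrableOn_Ioi_rpow_of_lt (by linarith) one_pos
      refine h1.congr_fun (fun x hx => ?_) measurableSet_Ioi
      have hx1 : 1 < x := hx
      have hx0 : 0 < x := by linarith
      simp only [smul_eq_mul, radialWeight]
      rw [max_eq_right hx1.le, ← mul_assoc, ← Real.rpow_natCast, hcast, ← Real.rpow_add hx0,
        ← Real.rpow_add hx0]
      congr 1
  exact key.lintegral_lt_top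

/-- `∫ |y|⁻ᵖ max(a, |y|)^(-q) dy = C a^(d - p - q)` for `p < d < p + q`. -/
lemma exists_lintegral_radialWeight_le [Nontrivial E] {p q : ℝ}
    (hp : p < Module.finrank ℝ E) (hq : (Module.finrank ℝ E : ℝ) < p + q) :
    ∃ C : ℝ, 0 ≤ C ∧ ∀ a : ℝ, 0 < a → ∫⁻ y, ENNReal.ofReal (radialWeight p q a ‖y‖) ∂μ
      ≤ ENNReal.ofReal (C * a ^ ((Module.finrank ℝ E : ℝ) - p - q)) := by
  refine ⟨(∫⁻ y, ENNReal.ofReal (radialWeight p q 1 ‖y‖) ∂μ).toReal, ENNReal.toReal_nonneg,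
    fun a ha => ?_⟩
  rw [lintegral_radialWeight μ p q ha, ENNReal.ofReal_mul ENNReal.toReal_nonneg,
    ENNReal.ofReal_toReal (lintegral_radialWeight_one_lt_top μ hp hq).ne, mul_comm]

end Radial

/-! ### The collapsing estimate for three ordered momenta. -/

/-- The integral over the position of the shortest of the three momenta. -/
lemma exists_lintegral_shortest_le : ∃ C : ℝ, 0 ≤ C ∧ ∀ ξ : Space, ξ ≠ 0 →
    ∫⁻ v : Space, ENNReal.ofReal (‖ξ‖ ^ 2 * ‖v‖ ^ (-(5 / 2) : ℝ) * ‖ξ - v‖⁻¹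
      * max (‖ξ‖ / 3) ‖v‖ ^ (-(3 / 2) : ℝ)) ≤ ENNReal.ofReal C := by
  have hfr : Module.finrank ℝ Space = 3 := by simp
  obtain ⟨C₁, hC₁, h₁⟩ := exists_lintegral_radialWeight_le (volume : Measure Space)
    (p := 5 / 2) (q := 5 / 2) (by rw [hfr]; norm_num) (by rw [hfr]; norm_num)
  obtain ⟨C₂, hC₂, h₂⟩ := exists_lintegral_radialWeight_le (volume : Measure Space)
    (p := 1) (q := 4) (by rw [hfr]; norm_num) (by rw [hfr]; norm_num)
  refine ⟨9 * C₁ + 9 * C₂, by positivity, fun ξ hξ => ?_⟩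
  have hl : 0 < ‖ξ‖ := norm_pos_iff.2 hξ
  set a := ‖ξ‖ / 3 with ha
  have hapos : 0 < a := by positivity
  have hpt : ∀ v : Space, ENNReal.ofReal (‖ξ‖ ^ 2 * ‖v‖ ^ (-(5 / 2) : ℝ) * ‖ξ - v‖⁻¹
      * max a ‖v‖ ^ (-(3 / 2) : ℝ))
      ≤ ENNReal.ofReal (‖ξ‖ ^ 2) * ENNReal.ofReal (radialWeight (5 / 2) (5 / 2) a ‖v‖)
        + ENNReal.ofReal (‖ξ‖ ^ 2) * ENNReal.ofReal (radialWeight 1 4 a ‖ξ - v‖) := by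
    intro v
    have htri : ‖ξ‖ ≤ ‖v‖ + ‖ξ - v‖ := by
      have := norm_add_le v (ξ - v)
      simpa using this
    have hw1 := radialWeight_nonneg (5 / 2) (5 / 2) a (norm_nonneg v)
    have hw2 := radialWeight_nonneg 1 4 a (norm_nonneg (ξ - v))
    rw [← ENNReal.ofReal_mul (by positivity), ← ENNReal.ofReal_mul (by positivity),
      ← ENNReal.ofReal_add (by positivity) (by positivity)]
    refine ENNReal.ofReal_le_ofReal ?_
    -- The longer of `v` and `ξ - v` has length at least `|ξ|/2`, hence dominates `max a` of the
    -- shorter one. Replacing it leaves a radial weight of total degree `5` centred at `0` or at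
    -- `ξ`, whose integral is of order `a⁻² ∼ |ξ|⁻²`.
    rcases le_total ‖v‖ ‖ξ - v‖ with hle | hle
    · refine le_add_of_le_of_nonneg ?_ (by positivity)
      have hM : max a ‖v‖ ≤ ‖ξ - v‖ := max_le (by linarith) hle
      have hMpos : 0 < max a ‖v‖ := lt_max_of_lt_left hapos
      have hinv : ‖ξ - v‖⁻¹ ≤ max a ‖v‖ ^ (-1 : ℝ) := by
        rw [Real.rpow_neg_one]
        gcongr
      calc _ ≤ ‖ξ‖ ^ 2 * ‖v‖ ^ (-(5 / 2) : ℝ) * max a ‖v‖ ^ (-1 : ℝ)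
            * max a ‖v‖ ^ (-(3 / 2) : ℝ) := by gcongr
        _ = _ := by
            rw [mul_assoc, mul_assoc, ← Real.rpow_add hMpos, radialWeight]
            norm_num
    · refine le_add_of_nonneg_of_le (by positivity) ?_
      have hvpos : 0 < ‖v‖ := by linarith
      set M := max a ‖ξ - v‖ with hMdef
      have hMpos : 0 < M := lt_max_of_lt_left hapos
      have hMv : M ≤ ‖v‖ := max_le (by linarith) hle
      have hMN : M ≤ max a ‖v‖ := max_le (le_max_left _ _) (hle.trans (le_max_right _ _))
      have e1 : ‖v‖ ^ (-(5 / 2) : ℝ) ≤ M ^ (-(5 / 2) : ℝ) :=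
        Real.rpow_le_rpow_of_nonpos hMpos hMv (by norm_num)
      have e2 : max a ‖v‖ ^ (-(3 / 2) : ℝ) ≤ M ^ (-(3 / 2) : ℝ) :=
        Real.rpow_le_rpow_of_nonpos hMpos hMN (by norm_num)
      calc _ ≤ ‖ξ‖ ^ 2 * M ^ (-(5 / 2) : ℝ) * ‖ξ - v‖⁻¹ * M ^ (-(3 / 2) : ℝ) := by gcongr
        _ = ‖ξ‖ ^ 2 * (‖ξ - v‖⁻¹ * (M ^ (-(5 / 2) : ℝ) * M ^ (-(3 / 2) : ℝ))) := by ring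
        _ = _ := by
            rw [← Real.rpow_add hMpos, radialWeight, ← hMdef, Real.rpow_neg_one]
            norm_num
  have hsq : ‖ξ‖ ^ 2 = 9 * a ^ 2 := by rw [ha]; ring
  have hapow : a ^ 2 * a ^ ((3 : ℝ) - 5) = 1 := by
    rw [← Real.rpow_natCast, ← Real.rpow_add hapos]
    norm_num
  calc _ ≤ ∫⁻ v : Space, (ENNReal.ofReal (‖ξ‖ ^ 2)
          * ENNReal.ofReal (radialWeight (5 / 2) (5 / 2) a ‖v‖)
        + ENNReal.ofReal (‖ξ‖ ^ 2) * ENNReal.ofReal (radialWeight 1 4 a ‖ξ - v‖)) :=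
        lintegral_mono hpt
    _ = ENNReal.ofReal (‖ξ‖ ^ 2)
          * (∫⁻ v : Space, ENNReal.ofReal (radialWeight (5 / 2) (5 / 2) a ‖v‖))
        + ENNReal.ofReal (‖ξ‖ ^ 2) * ∫⁻ v : Space, ENNReal.ofReal (radialWeight 1 4 a ‖v‖) := by
        rw [lintegral_add_left (by fun_prop), lintegral_const_mul _ (by fun_prop),
          lintegral_const_mul _ (by fun_prop),
          lintegral_sub_left_eq_self (fun v : Space => ENNReal.ofReal (radialWeight 1 4 a ‖v‖)) ξ]
    _ ≤ ENNReal.ofReal (‖ξ‖ ^ 2) * ENNReal.ofReal (C₁ * a ^ ((3 : ℝ) - 5))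
        + ENNReal.ofReal (‖ξ‖ ^ 2) * ENNReal.ofReal (C₂ * a ^ ((3 : ℝ) - 5)) := by
        have e1 := h₁ a hapos
        have e2 := h₂ a hapos
        rw [hfr] at e1 e2
        gcongr
        · refine e1.trans_eq ?_
          norm_num
        · refine e2.trans_eq ?_
          norm_num
    _ = _ := by
        rw [← ENNReal.ofReal_mul (by positivity), ← ENNReal.ofReal_mul (by positivity),
          ← ENNReal.ofReal_add (by positivity) (by positivity)]
        congr 1
        rw [hsq]
        linear_combination (9 * C₁ + 9 * C₂) * hapow

/-- The integral over the squared length of the intermediate momentum. -/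
lemma exists_lintegral_middle_le : ∃ C : ℝ, 0 ≤ C ∧ ∀ δ N : ℝ, 0 < δ → 0 < N →
    ∫⁻ R in Set.Ici (δ ^ 2), ENNReal.ofReal (R⁻¹ * (max (N ^ 2) R)⁻¹)
      ≤ ENNReal.ofReal (C * (δ ^ (-(1 / 2) : ℝ) * N ^ (-(3 / 2) : ℝ))) := by
  -- The power `R⁻¹` is critical and would produce `log (N / δ)`. Giving up `R^(-1/4) ≤ δ^(-1/2)`
  -- leaves the convergent exponent `3/4`.
  obtain ⟨C, hC, h⟩ := exists_lintegral_radialWeight_le (volume : Measure ℝ)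
    (p := 3 / 4) (q := 1) (by simp; norm_num) (by simp)
  refine ⟨C, hC, fun δ N hδ hN => ?_⟩
  calc _ ≤ ∫⁻ R in Set.Ici (δ ^ 2), ENNReal.ofReal (δ ^ (-(1 / 2) : ℝ))
          * ENNReal.ofReal (radialWeight (3 / 4) 1 (N ^ 2) ‖R‖) := by
        refine setLIntegral_mono (by fun_prop) fun R hR => ?_
        have hR' : δ ^ 2 ≤ R := hR
        have hRpos : 0 < R := lt_of_lt_of_le (by positivity) hR'
        rw [← ENNReal.ofReal_mul (by positivity), Real.norm_of_nonneg hRpos.le, radialWeight,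
          Real.rpow_neg_one, ← mul_assoc]
        refine ENNReal.ofReal_le_ofReal ?_
        have e : R⁻¹ = R ^ (-(1 / 4) : ℝ) * R ^ (-(3 / 4) : ℝ) := by
          rw [← Real.rpow_add hRpos, ← Real.rpow_neg_one]
          norm_num
        have e2 : R ^ (-(1 / 4) : ℝ) ≤ δ ^ (-(1 / 2) : ℝ) := by
          calc R ^ (-(1 / 4) : ℝ) ≤ (δ ^ 2) ^ (-(1 / 4) : ℝ) :=
                Real.rpow_le_rpow_of_nonpos (by positivity) hR' (by norm_num)
            _ = _ := by
                rw [← Real.rpow_natCast, ← Real.rpow_mul hδ.le]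
                norm_num
        rw [e]
        gcongr
    _ ≤ ENNReal.ofReal (δ ^ (-(1 / 2) : ℝ))
          * ∫⁻ R : ℝ, ENNReal.ofReal (radialWeight (3 / 4) 1 (N ^ 2) ‖R‖) := by
        rw [lintegral_const_mul _ (by fun_prop)]
        gcongr
        exact Measure.restrict_le_self
    _ ≤ ENNReal.ofReal (δ ^ (-(1 / 2) : ℝ)) * ENNReal.ofReal (C * (N ^ 2) ^ (-(3 / 4) : ℝ)) := by
        gcongr
        refine (h (N ^ 2) (by positivity)).trans_eq ?_
        simp
    _ = _ := by
        rw [← ENNReal.ofReal_mul (by positivity), ← Real.rpow_natCast N 2, ← Real.rpow_mul hN.le]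
        congr 1
        norm_num
        ring


lemma lintegral_sign_add (G : ℝ → ℝ≥0∞) (c e : ℝ) (he : e = 1 ∨ e = -1) :
    ∫⁻ S : ℝ, G (c + e * S) = ∫⁻ S : ℝ, G S := by
  rcases he with rfl | rfl
  · simp only [one_mul]
    exact lintegral_add_left_eq_self G c
  · simp only [neg_mul, one_mul, ← sub_eq_add_neg]
    exact lintegral_sub_left_eq_self G c

/-- The contribution of the region where the three momenta `v`, `x`, `ξ - v - x` are ordered by
length. -/
lemma exists_lintegral_ordered_le : ∃ C : ℝ, 0 ≤ C ∧ ∀ ξ : Space, ξ ≠ 0 →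
    ∀ (G : ℝ → ℝ≥0∞), Measurable G → ∀ (h : Space → ℝ), Measurable h →
    ∀ e₁ e₂ : ℝ, (e₁ = 1 ∨ e₁ = -1) → (e₂ = 1 ∨ e₂ = -1) →
    ∫⁻ v : Space, ∫⁻ x : Space, (if ‖v‖ ≤ ‖x‖ ∧ ‖x‖ ≤ ‖ξ - v - x‖ then
      ENNReal.ofReal (‖ξ‖ ^ 2 * (‖v‖ ^ 2 * ‖x‖ ^ 2 * ‖ξ - v - x‖ ^ 2)⁻¹)
        * G (h v + e₁ * ‖x‖ ^ 2 + e₂ * ‖ξ - v - x‖ ^ 2) else 0)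
      ≤ ENNReal.ofReal C * ∫⁻ t, G t := by
  obtain ⟨C₁, hC₁, h₁⟩ := exists_lintegral_shortest_le
  obtain ⟨C₂, hC₂, h₂⟩ := exists_lintegral_middle_le
  refine ⟨Real.pi / 2 * C₂ * C₁, by positivity, fun ξ hξ G hG h hh e₁ e₂ he₁ he₂ => ?_⟩
  have hl : 0 < ‖ξ‖ := norm_pos_iff.2 hξ
  have hinner : ∀ v : Space, v ≠ 0 → v ≠ ξ →
      ∫⁻ x : Space, (if ‖v‖ ≤ ‖x‖ ∧ ‖x‖ ≤ ‖ξ - v - x‖ then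
        ENNReal.ofReal (‖ξ‖ ^ 2 * (‖v‖ ^ 2 * ‖x‖ ^ 2 * ‖ξ - v - x‖ ^ 2)⁻¹)
          * G (h v + e₁ * ‖x‖ ^ 2 + e₂ * ‖ξ - v - x‖ ^ 2) else 0)
        ≤ ENNReal.ofReal (Real.pi / 2 * C₂) * ENNReal.ofReal (‖ξ‖ ^ 2 * ‖v‖ ^ (-(5 / 2) : ℝ)
            * ‖ξ - v‖⁻¹ * max (‖ξ‖ / 3) ‖v‖ ^ (-(3 / 2) : ℝ)) * ∫⁻ t, G t := by
    intro v hv hvξ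
    have hvpos : 0 < ‖v‖ := norm_pos_iff.2 hv
    have hu : ξ - v ≠ 0 := sub_ne_zero.2 (Ne.symm hvξ)
    -- A lower bound for the longest momentum: the three add up to `ξ`, and `v` is the shortest.
    set N := max (‖ξ‖ / 3) ‖v‖ with hN
    have hNpos : 0 < N := lt_max_of_lt_right hvpos
    -- `R` and `S` stand for the squared lengths of the middle and of the longest momentum. The
    -- weight of the longest one is replaced by `max (N²) R`, so `S` survives only inside `G`, where
    -- it enters with slope `±1`; integrating in `S` first yields `∫ G`.
    set f : ℝ → ℝ → ℝ≥0∞ := fun R S =>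
      (Set.Ici (‖v‖ ^ 2)).indicator (fun R => ENNReal.ofReal (‖ξ‖ ^ 2 * (‖v‖ ^ 2)⁻¹)
        * ENNReal.ofReal (R⁻¹ * (max (N ^ 2) R)⁻¹)) R * G (h v + e₁ * R + e₂ * S) with hf
    have hfm : Measurable fun p : ℝ × ℝ => f p.1 p.2 := by
      have m1 : Measurable ((Set.Ici (‖v‖ ^ 2)).indicator
          (fun R : ℝ => ENNReal.ofReal (‖ξ‖ ^ 2 * (‖v‖ ^ 2)⁻¹)
            * ENNReal.ofReal (R⁻¹ * (max (N ^ 2) R)⁻¹))) :=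
        Measurable.indicator (by fun_prop) measurableSet_Ici
      exact (m1.comp measurable_fst).mul (by fun_prop)
    have hpt : ∀ x : Space, (if ‖v‖ ≤ ‖x‖ ∧ ‖x‖ ≤ ‖ξ - v - x‖ then
        ENNReal.ofReal (‖ξ‖ ^ 2 * (‖v‖ ^ 2 * ‖x‖ ^ 2 * ‖ξ - v - x‖ ^ 2)⁻¹)
          * G (h v + e₁ * ‖x‖ ^ 2 + e₂ * ‖ξ - v - x‖ ^ 2) else 0)
        ≤ f (‖x‖ ^ 2) (‖ξ - v - x‖ ^ 2) := by
      intro x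
      split_ifs with hx
      · obtain ⟨hvx, hxs⟩ := hx
        have hmem : ‖x‖ ^ 2 ∈ Set.Ici (‖v‖ ^ 2) := by
          simp only [Set.mem_Ici]
          gcongr
        simp only [hf, Set.indicator_of_mem hmem]
        refine mul_le_mul_left ?_ _
        rw [← ENNReal.ofReal_mul (by positivity)]
        refine ENNReal.ofReal_le_ofReal ?_
        have hxpos : 0 < ‖x‖ := lt_of_lt_of_le hvpos hvx
        have htri : ‖ξ‖ ≤ ‖v‖ + ‖x‖ + ‖ξ - v - x‖ := by
          have := norm_add₃_le (a := v) (b := x) (c := ξ - v - x)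
          simpa using this
        have hNs : N ≤ ‖ξ - v - x‖ := max_le (by linarith) (hvx.trans hxs)
        have hmax : max (N ^ 2) (‖x‖ ^ 2) ≤ ‖ξ - v - x‖ ^ 2 := max_le (by gcongr) (by gcongr)
        have hmaxpos : 0 < max (N ^ 2) (‖x‖ ^ 2) := lt_max_of_lt_left (by positivity)
        calc ‖ξ‖ ^ 2 * (‖v‖ ^ 2 * ‖x‖ ^ 2 * ‖ξ - v - x‖ ^ 2)⁻¹
            = ‖ξ‖ ^ 2 * (‖v‖ ^ 2)⁻¹ * ((‖x‖ ^ 2)⁻¹ * (‖ξ - v - x‖ ^ 2)⁻¹) := by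
              rw [mul_inv, mul_inv]; ring
          _ ≤ _ := by gcongr
      · exact zero_le
    have hstep : ∫⁻ R : ℝ, ∫⁻ S : ℝ, f R S
        ≤ ENNReal.ofReal (‖ξ‖ ^ 2 * (‖v‖ ^ 2)⁻¹)
          * ENNReal.ofReal (C₂ * (‖v‖ ^ (-(1 / 2) : ℝ) * N ^ (-(3 / 2) : ℝ))) * ∫⁻ t, G t := by
      simp only [hf]
      calc _ = ∫⁻ R : ℝ, (Set.Ici (‖v‖ ^ 2)).indicator
            (fun R => ENNReal.ofReal (‖ξ‖ ^ 2 * (‖v‖ ^ 2)⁻¹)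
              * ENNReal.ofReal (R⁻¹ * (max (N ^ 2) R)⁻¹)) R * ∫⁻ t, G t := by
            refine lintegral_congr fun R => ?_
            rw [lintegral_const_mul _ (by fun_prop), lintegral_sign_add G _ _ he₂]
        _ = (∫⁻ R in Set.Ici (‖v‖ ^ 2), ENNReal.ofReal (‖ξ‖ ^ 2 * (‖v‖ ^ 2)⁻¹)
              * ENNReal.ofReal (R⁻¹ * (max (N ^ 2) R)⁻¹)) * ∫⁻ t, G t := by
            rw [lintegral_mul_const _ (Measurable.indicator (by fun_prop) measurableSet_Ici),
              lintegral_indicator measurableSet_Ici]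
        _ ≤ _ := by
            rw [lintegral_const_mul _ (by fun_prop)]
            gcongr
            exact h₂ ‖v‖ N hvpos hNpos
    calc _ ≤ ∫⁻ x : Space, f (‖x‖ ^ 2) (‖ξ - v - x‖ ^ 2) := lintegral_mono hpt
      _ ≤ ENNReal.ofReal (Real.pi / (2 * ‖ξ - v‖)) * ∫⁻ R : ℝ, ∫⁻ S : ℝ, f R S :=
          lintegral_bipolar_le _ hu f hfm
      _ ≤ ENNReal.ofReal (Real.pi / (2 * ‖ξ - v‖)) * (ENNReal.ofReal (‖ξ‖ ^ 2 * (‖v‖ ^ 2)⁻¹)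
          * ENNReal.ofReal (C₂ * (‖v‖ ^ (-(1 / 2) : ℝ) * N ^ (-(3 / 2) : ℝ))) * ∫⁻ t, G t) := by
          gcongr
      _ = _ := by
          rw [← ENNReal.ofReal_mul (by positivity), ← ENNReal.ofReal_mul (by positivity),
            ← mul_assoc, ← ENNReal.ofReal_mul (by positivity)]
          congr 2
          have e : ‖v‖ ^ (-(5 / 2) : ℝ) = (‖v‖ ^ 2)⁻¹ * ‖v‖ ^ (-(1 / 2) : ℝ) := by
            rw [← Real.rpow_natCast, ← Real.rpow_neg hvpos.le, ← Real.rpow_add hvpos]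
            norm_num
          rw [e, div_eq_mul_inv, mul_inv]
          ring
  calc _ ≤ ∫⁻ v : Space, ENNReal.ofReal (Real.pi / 2 * C₂) * ENNReal.ofReal (‖ξ‖ ^ 2
            * ‖v‖ ^ (-(5 / 2) : ℝ) * ‖ξ - v‖⁻¹ * max (‖ξ‖ / 3) ‖v‖ ^ (-(3 / 2) : ℝ))
            * ∫⁻ t, G t := by
        refine lintegral_mono_ae ?_
        have n0 : ∀ᵐ v : Space, v ≠ 0 := Measure.ae_ne volume 0
        have n1 : ∀ᵐ v : Space, v ≠ ξ := Measure.ae_ne volume ξ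
        filter_upwards [n0, n1] with v hv hvξ using hinner v hv hvξ
    _ = ENNReal.ofReal (Real.pi / 2 * C₂) * (∫⁻ v : Space, ENNReal.ofReal (‖ξ‖ ^ 2
            * ‖v‖ ^ (-(5 / 2) : ℝ) * ‖ξ - v‖⁻¹ * max (‖ξ‖ / 3) ‖v‖ ^ (-(3 / 2) : ℝ)))
            * ∫⁻ t, G t := by
        rw [lintegral_mul_const _ (by fun_prop), lintegral_const_mul _ (by fun_prop)]
    _ ≤ ENNReal.ofReal (Real.pi / 2 * C₂) * ENNReal.ofReal C₁ * ∫⁻ t, G t := by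
        gcongr
        exact h₁ ξ hξ
    _ = _ := by rw [← ENNReal.ofReal_mul (by positivity)]


/-! ### Removing the ordering of the momenta. -/

/-- Integration over the triples of momenta with sum `ξ`. -/
def tripleIntegral (ξ : Space) (Ψ : Space → Space → Space → ℝ≥0∞) : ℝ≥0∞ :=
  ∫⁻ p, ∫⁻ q, Ψ p q (ξ - p - q)

lemma tripleIntegral_swap_fst_snd (ξ : Space) (Ψ : Space → Space → Space → ℝ≥0∞)
    (hΨ : Measurable fun x : Space × Space × Space => Ψ x.1 x.2.1 x.2.2) :
    tripleIntegral ξ (fun p q r => Ψ q p r) = tripleIntegral ξ Ψ := by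
  unfold tripleIntegral
  rw [lintegral_lintegral_swap]
  · refine lintegral_congr fun p => lintegral_congr fun q => ?_
    congr 1
    abel
  · exact (hΨ.comp (by fun_prop : Measurable fun x : Space × Space =>
      (x.2, x.1, ξ - x.1 - x.2))).aemeasurable

lemma tripleIntegral_swap_snd_thd (ξ : Space) (Ψ : Space → Space → Space → ℝ≥0∞) :
    tripleIntegral ξ (fun p q r => Ψ p r q) = tripleIntegral ξ Ψ := by
  unfold tripleIntegral
  refine lintegral_congr fun p => ?_
  rw [← lintegral_sub_left_eq_self (fun q => Ψ p q (ξ - p - q)) (ξ - p)]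
  refine lintegral_congr fun q => ?_
  congr 1
  abel

/-- The collapsing estimate: the push-forward of the weight `|ξ|² / (|p|² |q|² |r|²)` on the triples
of momenta with sum `ξ` under the quadratic phase has a bounded density. -/
lemma exists_tripleIntegral_le : ∃ C : ℝ, 0 ≤ C ∧ ∀ ξ : Space,
    ∀ (G : ℝ → ℝ≥0∞), Measurable G → ∀ c e₀ e₁ e₂ : ℝ,
    (e₀ = 1 ∨ e₀ = -1) → (e₁ = 1 ∨ e₁ = -1) → (e₂ = 1 ∨ e₂ = -1) →
    tripleIntegral ξ (fun p q r => ENNReal.ofReal (‖ξ‖ ^ 2 * (‖p‖ ^ 2 * ‖q‖ ^ 2 * ‖r‖ ^ 2)⁻¹)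
        * G (c + e₀ * ‖p‖ ^ 2 + e₁ * ‖q‖ ^ 2 + e₂ * ‖r‖ ^ 2))
      ≤ ENNReal.ofReal C * ∫⁻ t, G t := by
  obtain ⟨C, hC, h⟩ := exists_lintegral_ordered_le
  refine ⟨6 * C, by positivity, fun ξ G hG c e₀ e₁ e₂ he₀ he₁ he₂ => ?_⟩
  rcases eq_or_ne ξ 0 with rfl | hξ
  · simp [tripleIntegral]
  -- The integrand restricted to one ordering of its arguments. The signs are parameters because
  -- they travel with the momenta under a permutation.
  set O : ℝ → ℝ → ℝ → Space → Space → Space → ℝ≥0∞ := fun a₀ a₁ a₂ p q r =>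
    if ‖p‖ ≤ ‖q‖ ∧ ‖q‖ ≤ ‖r‖ then ENNReal.ofReal (‖ξ‖ ^ 2 * (‖p‖ ^ 2 * ‖q‖ ^ 2 * ‖r‖ ^ 2)⁻¹)
        * G (c + a₀ * ‖p‖ ^ 2 + a₁ * ‖q‖ ^ 2 + a₂ * ‖r‖ ^ 2) else 0 with hO
  have hOm : ∀ a₀ a₁ a₂, Measurable fun x : Space × Space × Space => O a₀ a₁ a₂ x.1 x.2.1 x.2.2 := by
    intro a₀ a₁ a₂
    simp only [hO]
    refine Measurable.ite ?_ (by fun_prop) measurable_const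
    exact (measurableSet_le (f := fun x : Space × Space × Space => ‖x.1‖) (g := fun x => ‖x.2.1‖)
        (by fun_prop) (by fun_prop)).inter
      (measurableSet_le (f := fun x : Space × Space × Space => ‖x.2.1‖) (g := fun x => ‖x.2.2‖)
        (by fun_prop) (by fun_prop))
  have hOb : ∀ a₀ a₁ a₂ : ℝ, (a₀ = 1 ∨ a₀ = -1) → (a₁ = 1 ∨ a₁ = -1) → (a₂ = 1 ∨ a₂ = -1) →
      tripleIntegral ξ (O a₀ a₁ a₂) ≤ ENNReal.ofReal C * ∫⁻ t, G t := fun a₀ a₁ a₂ _ h₁ h₂ =>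
    h ξ hξ G hG (fun v => c + a₀ * ‖v‖ ^ 2) (by fun_prop) a₁ a₂ h₁ h₂
  have hcover : ∀ p q r : Space,
      ENNReal.ofReal (‖ξ‖ ^ 2 * (‖p‖ ^ 2 * ‖q‖ ^ 2 * ‖r‖ ^ 2)⁻¹)
        * G (c + e₀ * ‖p‖ ^ 2 + e₁ * ‖q‖ ^ 2 + e₂ * ‖r‖ ^ 2)
      ≤ O e₀ e₁ e₂ p q r + O e₀ e₂ e₁ p r q + O e₁ e₀ e₂ q p r + O e₁ e₂ e₀ q r p
        + O e₂ e₀ e₁ r p q + O e₂ e₁ e₀ r q p := by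
    intro p q r
    have key : ∀ a b d : Space, ∀ a₀ a₁ a₂ : ℝ, ‖a‖ ≤ ‖b‖ → ‖b‖ ≤ ‖d‖ →
        ‖a‖ ^ 2 * ‖b‖ ^ 2 * ‖d‖ ^ 2 = ‖p‖ ^ 2 * ‖q‖ ^ 2 * ‖r‖ ^ 2 →
        c + a₀ * ‖a‖ ^ 2 + a₁ * ‖b‖ ^ 2 + a₂ * ‖d‖ ^ 2
          = c + e₀ * ‖p‖ ^ 2 + e₁ * ‖q‖ ^ 2 + e₂ * ‖r‖ ^ 2 →
        ENNReal.ofReal (‖ξ‖ ^ 2 * (‖p‖ ^ 2 * ‖q‖ ^ 2 * ‖r‖ ^ 2)⁻¹)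
          * G (c + e₀ * ‖p‖ ^ 2 + e₁ * ‖q‖ ^ 2 + e₂ * ‖r‖ ^ 2) = O a₀ a₁ a₂ a b d := by
      intro a b d a₀ a₁ a₂ h1 h2 h3 h4
      simp only [hO]
      rw [if_pos ⟨h1, h2⟩, h3, h4]
    -- Three comparisons give eight patterns for six orderings. The two cyclic patterns force equal
    -- lengths and are covered by a neighbouring ordering.
    rcases le_total ‖p‖ ‖q‖ with hpq | hpq <;> rcases le_total ‖q‖ ‖r‖ with hqr | hqr <;>
      rcases le_total ‖p‖ ‖r‖ with hpr | hpr
    · rw [key p q r e₀ e₁ e₂ hpq hqr rfl rfl]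
      simp only [add_assoc]
      exact le_self_add
    · rw [key p q r e₀ e₁ e₂ hpq hqr rfl rfl]
      simp only [add_assoc]
      exact le_self_add
    · rw [key p r q e₀ e₂ e₁ hpr hqr (by ring) (by ring)]
      simp only [add_assoc]
      exact le_add_left le_self_add
    · rw [key r p q e₂ e₀ e₁ hpr hpq (by ring) (by ring)]
      exact le_add_right le_add_self
    · rw [key q p r e₁ e₀ e₂ hpq hpr (by ring) (by ring)]
      simp only [add_assoc]
      exact le_add_left (le_add_left le_self_add)
    · rw [key q r p e₁ e₂ e₀ hqr hpr (by ring) (by ring)]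
      simp only [add_assoc]
      exact le_add_left (le_add_left (le_add_left le_self_add))
    · rw [key r q p e₂ e₁ e₀ hqr hpq (by ring) (by ring)]
      exact le_add_self
    · rw [key r q p e₂ e₁ e₀ hqr hpq (by ring) (by ring)]
      exact le_add_self
  clear_value O
  have e2 : tripleIntegral ξ (fun p q r => O e₀ e₂ e₁ p r q) = tripleIntegral ξ (O e₀ e₂ e₁) :=
    tripleIntegral_swap_snd_thd ξ _
  have e3 : tripleIntegral ξ (fun p q r => O e₁ e₀ e₂ q p r) = tripleIntegral ξ (O e₁ e₀ e₂) :=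
    tripleIntegral_swap_fst_snd ξ _ (hOm _ _ _)
  have e4 : tripleIntegral ξ (fun p q r => O e₁ e₂ e₀ q r p) = tripleIntegral ξ (O e₁ e₂ e₀) := by
    rw [← tripleIntegral_swap_snd_thd ξ (O e₁ e₂ e₀)]
    exact tripleIntegral_swap_fst_snd ξ (fun p q r => O e₁ e₂ e₀ p r q)
      ((hOm e₁ e₂ e₀).comp (by fun_prop : Measurable fun x : Space × Space × Space =>
        (x.1, x.2.2, x.2.1)))
  have e5 : tripleIntegral ξ (fun p q r => O e₂ e₀ e₁ r p q) = tripleIntegral ξ (O e₂ e₀ e₁) := by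
    rw [← tripleIntegral_swap_fst_snd ξ (O e₂ e₀ e₁) (hOm _ _ _)]
    exact tripleIntegral_swap_snd_thd ξ (fun p q r => O e₂ e₀ e₁ q p r)
  have e6 : tripleIntegral ξ (fun p q r => O e₂ e₁ e₀ r q p) = tripleIntegral ξ (O e₂ e₁ e₀) := by
    rw [← tripleIntegral_swap_snd_thd ξ (O e₂ e₁ e₀),
      ← tripleIntegral_swap_fst_snd ξ (fun p q r => O e₂ e₁ e₀ p r q)
      ((hOm e₂ e₁ e₀).comp (by fun_prop : Measurable fun x : Space × Space × Space =>
        (x.1, x.2.2, x.2.1)))]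
    exact tripleIntegral_swap_snd_thd ξ (fun p q r => O e₂ e₁ e₀ q r p)
  have hadd : ∀ Ψ₁ Ψ₂ : Space → Space → Space → ℝ≥0∞,
      Measurable (fun x : Space × Space × Space => Ψ₂ x.1 x.2.1 x.2.2) →
      tripleIntegral ξ (fun p q r => Ψ₁ p q r + Ψ₂ p q r)
        = tripleIntegral ξ Ψ₁ + tripleIntegral ξ Ψ₂ := by
    intro Ψ₁ Ψ₂ h2
    have h2' : Measurable fun x : Space × Space => Ψ₂ x.1 x.2 (ξ - x.1 - x.2) :=
      h2.comp (by fun_prop : Measurable fun x : Space × Space => (x.1, x.2, ξ - x.1 - x.2))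
    unfold tripleIntegral
    rw [← lintegral_add_right _ h2'.lintegral_prod_right']
    refine lintegral_congr fun p => ?_
    exact lintegral_add_right (fun q => Ψ₁ p q (ξ - p - q)) (h2'.comp measurable_prodMk_left)
  calc _ ≤ tripleIntegral ξ (fun p q r => O e₀ e₁ e₂ p q r + O e₀ e₂ e₁ p r q + O e₁ e₀ e₂ q p r
        + O e₁ e₂ e₀ q r p + O e₂ e₀ e₁ r p q + O e₂ e₁ e₀ r q p) :=
        lintegral_mono fun p => lintegral_mono fun q => hcover p q _
    _ = tripleIntegral ξ (O e₀ e₁ e₂) + tripleIntegral ξ (O e₀ e₂ e₁)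
        + tripleIntegral ξ (O e₁ e₀ e₂) + tripleIntegral ξ (O e₁ e₂ e₀)
        + tripleIntegral ξ (O e₂ e₀ e₁) + tripleIntegral ξ (O e₂ e₁ e₀) := by
        rw [hadd _ (fun p q r => O e₂ e₁ e₀ r q p) ((hOm e₂ e₁ e₀).comp (by fun_prop : Measurable fun x : Space × Space × Space =>
            (x.2.2, x.2.1, x.1))), e6,
          hadd _ (fun p q r => O e₂ e₀ e₁ r p q) ((hOm e₂ e₀ e₁).comp (by fun_prop : Measurable fun x : Space × Space × Space =>
            (x.2.2, x.1, x.2.1))), e5,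
          hadd _ (fun p q r => O e₁ e₂ e₀ q r p) ((hOm e₁ e₂ e₀).comp (by fun_prop : Measurable fun x : Space × Space × Space =>
            (x.2.1, x.2.2, x.1))), e4,
          hadd _ (fun p q r => O e₁ e₀ e₂ q p r) ((hOm e₁ e₀ e₂).comp (by fun_prop : Measurable fun x : Space × Space × Space =>
            (x.2.1, x.1, x.2.2))), e3,
          hadd _ (fun p q r => O e₀ e₂ e₁ p r q) ((hOm e₀ e₂ e₁).comp (by fun_prop : Measurable fun x : Space × Space × Space =>
            (x.1, x.2.2, x.2.1))), e2]
    _ ≤ ENNReal.ofReal C * (∫⁻ t, G t) + ENNReal.ofReal C * (∫⁻ t, G t)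
        + ENNReal.ofReal C * (∫⁻ t, G t) + ENNReal.ofReal C * (∫⁻ t, G t)
        + ENNReal.ofReal C * (∫⁻ t, G t) + ENNReal.ofReal C * (∫⁻ t, G t) := by
        gcongr <;> apply hOb <;> assumption
    _ = _ := by
        rw [ENNReal.ofReal_mul (by norm_num), ENNReal.ofReal_ofNat]
        ring


/-! ### Plancherel for Fourier integrals and for phases in time. -/

section Plancherel

variable {E : Type*} [NormedAddCommGroup E] [InnerProductSpace ℝ E] [FiniteDimensional ℝ E]
  [MeasurableSpace E] [BorelSpace E]

/-- On `L¹ ∩ L²` the `L²` Fourier transform is given by the Fourier integral. -/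
lemma fourier_toLp_ae_eq (f : E → ℂ) (h1 : Integrable f) (h2 : MemLp f 2) :
    ((𝓕 (h2.toLp f) : Lp ℂ 2 (volume : Measure E)) : E → ℂ) =ᵐ[volume] 𝓕 f := by
  have hcont : Continuous (𝓕 f) :=
    VectorFourier.fourierIntegral_continuous Real.continuous_fourierChar continuous_inner h1
  -- Both sides are tested against smooth compactly supported functions; there each transform can be
  -- moved onto the test function, once as a distribution and once by Fubini.
  refine ae_eq_of_integral_contDiff_smul_eq
    ((Lp.memLp (𝓕 (h2.toLp f) : Lp ℂ 2 (volume : Measure E))).locallyIntegrable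
      (by norm_num)) hcont.locallyIntegrable fun g hg hgc => ?_
  have hg₁ : HasCompactSupport (Complex.ofRealCLM ∘ g) := hgc.comp_left rfl
  have hg₂ : ContDiff ℝ (⊤ : ℕ∞) (Complex.ofRealCLM ∘ g) := by fun_prop
  set φ : 𝓢(E, ℂ) := hg₁.toSchwartzMap hg₂ with hφ
  have hφg : ∀ x, φ x = (g x : ℂ) := fun x => by simp [hφ]
  have e1 : ∫ x, g x • (𝓕 (h2.toLp f) : Lp ℂ 2 (volume : Measure E)) x
      = (Lp.toTemperedDistribution (𝓕 (h2.toLp f) : Lp ℂ 2 (volume : Measure E)) : 𝓢'(E, ℂ)) φ := by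
    rw [Lp.toTemperedDistribution_apply]
    refine integral_congr_ae (.of_forall fun x => ?_)
    simp only [hφg, smul_eq_mul, Complex.real_smul]
  have e2 : ∫ x, g x • 𝓕 f x = ∫ x, φ x • 𝓕 f x := by
    refine integral_congr_ae (.of_forall fun x => ?_)
    simp only [hφg, smul_eq_mul, Complex.real_smul]
  rw [e1, e2, ← Lp.fourier_toTemperedDistribution_eq, TemperedDistribution.fourier_apply,
    Lp.toTemperedDistribution_apply]
  have e3 : ∫ x, (𝓕 φ) x • (h2.toLp f) x = ∫ x, 𝓕 (φ : E → ℂ) x • f x := by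
    refine integral_congr_ae ?_
    filter_upwards [h2.coeFn_toLp] with x hx
    rw [hx, SchwartzMap.fourier_coe]
  rw [e3]
  simpa using! (VectorFourier.integral_fourierIntegral_smul_eq_flip (L := innerₗ E)
    Real.continuous_fourierChar continuous_inner (f := (φ : E → ℂ)) (g := f) φ.integrable h1)

/-- Plancherel's inequality for the Fourier integral. -/
lemma lintegral_fourier_sq_eq (f : E → ℂ) (h1 : Integrable f) (h2 : MemLp f 2) :
    ∫⁻ x, ‖𝓕 f x‖ₑ ^ 2 = ∫⁻ x, ‖f x‖ₑ ^ 2 := by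
  have key : ∀ g : E → ℂ, ∫⁻ x, ‖g x‖ₑ ^ 2 = (eLpNorm g 2 volume) ^ 2 := by
    intro g
    rw [eLpNorm_eq_lintegral_rpow_enorm_toReal (by norm_num) (by norm_num)]
    simp only [ENNReal.toReal_ofNat, ENNReal.rpow_ofNat]
    rw [← ENNReal.rpow_natCast, ← ENNReal.rpow_mul]
    norm_num
  rw [key, key, ← eLpNorm_congr_ae (fourier_toLp_ae_eq f h1 h2), ← Lp.enorm_def,
    ← eLpNorm_congr_ae h2.coeFn_toLp, ← Lp.enorm_def, ← ofReal_norm, ← ofReal_norm,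
    Lp.norm_fourier_eq]

end Plancherel

/-- Plancherel in the time variable, for the phases that occur in the free evolution. -/
lemma lintegral_phase_le (A : Set ℝ) (hA : MeasurableSet A) (hfin : volume A ≠ ∞) (c : ℝ → ℂ)
    (hc : AEStronglyMeasurable c (volume.restrict A)) :
    (∫⁻ t : ℝ, ‖∫ τ in A, c τ * Complex.exp (Complex.I * (2 * Real.pi ^ 2 * τ * t : ℝ))‖ₑ ^ 2)
      ≤ ∫⁻ τ in A, ‖c τ‖ₑ ^ 2 := by
  by_cases htop : ∫⁻ τ in A, ‖c τ‖ₑ ^ 2 = ∞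
  · rw [htop]; exact le_top
  have hmem : MemLp c 2 (volume.restrict A) := by
    refine ⟨hc, ?_⟩
    rw [eLpNorm_lt_top_iff_lintegral_rpow_enorm_lt_top (by norm_num) (by norm_num)]
    simpa using lt_top_iff_ne_top.2 htop
  have : IsFiniteMeasure (volume.restrict A) := ⟨by simpa using lt_top_iff_ne_top.2 hfin⟩
  have hint : Integrable c (volume.restrict A) := hmem.integrable (by norm_num)
  set f : ℝ → ℂ := A.indicator c with hf
  have h1 : Integrable f := by rwa [hf, integrable_indicator_iff hA]
  have h2 : MemLp f 2 := by rwa [hf, memLp_indicator_iff_restrict hA]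
  -- The phase is the Fourier character at frequency `-π t`. The substitution in `t` gives a factor
  -- `1/π ≤ 1`, which is discarded.
  have e1 : ∀ t : ℝ, ∫ τ in A, c τ * Complex.exp (Complex.I * (2 * Real.pi ^ 2 * τ * t : ℝ))
      = 𝓕 f (-Real.pi * t) := by
    intro t
    rw [Real.fourier_real_eq_integral_exp_smul, ← integral_indicator hA]
    refine integral_congr_ae (.of_forall fun τ => ?_)
    simp only [hf, Set.indicator, smul_eq_mul]
    split_ifs
    · rw [mul_comm]
      congr 2
      push_cast
      ring
    · simp
  have hcont : Continuous (𝓕 f) :=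
    VectorFourier.fourierIntegral_continuous Real.continuous_fourierChar (by fun_prop) h1
  simp_rw [e1]
  have hpi : (-Real.pi) ≠ 0 := by simp [Real.pi_ne_zero]
  have e2 := Real.map_volume_mul_left hpi
  have e3 : ∫⁻ t : ℝ, ‖𝓕 f (-Real.pi * t)‖ₑ ^ 2
      = ∫⁻ t, ‖𝓕 f t‖ₑ ^ 2 ∂(Measure.map (fun x : ℝ => -Real.pi * x) volume) := by
    rw [lintegral_map (by fun_prop) (by fun_prop)]
  rw [e3, e2, lintegral_smul_measure, lintegral_fourier_sq_eq f h1 h2, smul_eq_mul]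
  have e4 : ∫⁻ x, ‖f x‖ₑ ^ 2 = ∫⁻ τ in A, ‖c τ‖ₑ ^ 2 := by
    rw [← lintegral_indicator hA]
    refine lintegral_congr fun x => ?_
    by_cases hx : x ∈ A <;> simp [hf, hx]
  rw [e4]
  refine mul_le_of_le_one_left zero_le ?_
  rw [ENNReal.ofReal_le_one, abs_inv, abs_neg, abs_of_pos Real.pi_pos]
  exact inv_le_one_of_one_le₀ (by linarith [Real.pi_gt_three])

/-! ### Collapses of pairs of momenta and the estimate on a fibre. -/

/-- The momenta of a particle and of its primed partner. -/
abbrev Pair : Type := Space × Space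

/-- The momentum `B` transferred to the unprimed (`false`) or to the primed (`true`) particle. -/
def transfer (b : Bool) (B : Space) : Pair := if b then (0, B) else (B, 0)

/-- The momenta of a pair after the pair `q` has been collapsed onto it. -/
def merge (b : Bool) (p q : Pair) : Pair := p + transfer b (q.1 + q.2)

/-- The kinetic energy of a pair. -/
def energy (p : Pair) : ℝ := ‖p.1‖ ^ 2 - ‖p.2‖ ^ 2

/-- The symbol of `|∇_y| |∇_{y'}|`. -/
def pairSymbol (p : Pair) : ℝ := (2 * Real.pi * ‖p.1‖) * (2 * Real.pi * ‖p.2‖)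

/-- The sign of the two halves of the collapsing operator. -/
def branchSign (b : Bool) : ℂ := if b then -1 else 1

/-- The weight of the collapsing operator, conjugated with `R` and with the free evolution. -/
def vertex (b : Bool) (p q : Pair) (τ : ℝ) : ℂ :=
  branchSign b * (pairSymbol (merge b p q) / (pairSymbol p * pairSymbol q) : ℝ)
    * Complex.exp (Complex.I * (2 * Real.pi ^ 2 * τ * (energy (merge b p q) - energy p - energy q) : ℝ))

@[fun_prop]
lemma measurable_transfer (b : Bool) : Measurable (transfer b) := by
  unfold transfer
  cases b <;> simp <;> fun_prop

@[fun_prop]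
lemma measurable_energy : Measurable energy := by
  unfold energy
  fun_prop

@[fun_prop]
lemma measurable_pairSymbol : Measurable pairSymbol := by
  unfold pairSymbol
  fun_prop

lemma measurable_merge (b : Bool) : Measurable fun x : Pair × Pair => merge b x.1 x.2 := by
  unfold merge
  fun_prop

lemma measurable_vertex (b : Bool) :
    Measurable fun x : Pair × Pair × ℝ => vertex b x.1 x.2.1 x.2.2 := by
  have h : Measurable fun x : Pair × Pair × ℝ => merge b x.1 x.2.1 :=
    (measurable_merge b).comp (by fun_prop : Measurable fun x : Pair × Pair × ℝ => (x.1, x.2.1))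
  unfold vertex
  refine Measurable.mul (Measurable.mul measurable_const ?_) ?_
  · exact Complex.measurable_ofReal.comp (by fun_prop)
  · refine Complex.measurable_exp.comp (Measurable.mul measurable_const ?_)
    exact Complex.measurable_ofReal.comp (by fun_prop)

/-- The collapsing estimate on the fibre over the momenta `Ξ` of the collapsed pair. -/
lemma exists_fiber_estimate : ∃ C : ℝ, 0 < C ∧ ∀ (b : Bool) (Ξ : Pair) (A : Set ℝ),
    MeasurableSet A → volume A ≠ ∞ → ∀ c : ℝ → ℂ, AEStronglyMeasurable c (volume.restrict A) →
    ∫⁻ q : Pair, ‖∫ τ in A, c τ * vertex b (Ξ - transfer b (q.1 + q.2)) q τ‖ₑ ^ 2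
      ≤ ENNReal.ofReal C * ∫⁻ τ in A, ‖c τ‖ₑ ^ 2 := by
  obtain ⟨C, hC, h⟩ := exists_tripleIntegral_le
  refine ⟨C + 1, by positivity, fun b Ξ A hA hfin c hc => ?_⟩
  -- The time integral depends on the momenta only through the energy defect, apart from the weight.
  -- Thus `G` is a squared Fourier transform in time, evaluated at the defect, and `∫ G` is
  -- controlled by Plancherel for an arbitrary measurable set `A` of times.
  set G : ℝ → ℝ≥0∞ := fun t =>
    ‖∫ τ in A, c τ * Complex.exp (Complex.I * (2 * Real.pi ^ 2 * τ * t : ℝ))‖ₑ ^ 2 with hG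
  have hGm : Measurable G := by
    have hm : StronglyMeasurable fun t : ℝ =>
        ∫ τ in A, hc.mk c τ * Complex.exp (Complex.I * (2 * Real.pi ^ 2 * τ * t : ℝ)) := by
      refine StronglyMeasurable.integral_prod_right (f := fun (t τ : ℝ) =>
        hc.mk c τ * Complex.exp (Complex.I * (2 * Real.pi ^ 2 * τ * t : ℝ))) ?_
      refine (hc.stronglyMeasurable_mk.comp_measurable measurable_snd).mul ?_
      exact (by fun_prop : Continuous fun x : ℝ × ℝ =>
        Complex.exp (Complex.I * (2 * Real.pi ^ 2 * x.2 * x.1 : ℝ))).stronglyMeasurable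
    have he : (fun t : ℝ => ∫ τ in A, c τ
          * Complex.exp (Complex.I * (2 * Real.pi ^ 2 * τ * t : ℝ)))
        = fun t : ℝ => ∫ τ in A, hc.mk c τ
          * Complex.exp (Complex.I * (2 * Real.pi ^ 2 * τ * t : ℝ)) := by
      funext t
      refine integral_congr_ae ?_
      filter_upwards [hc.ae_eq_mk] with τ hτ
      rw [hτ]
    simp only [hG]
    simp_rw [congrFun he]
    exact hm.measurable.enorm.pow_const 2
  have hGle : ∫⁻ t, G t ≤ ∫⁻ τ in A, ‖c τ‖ₑ ^ 2 := lintegral_phase_le A hA hfin c hc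
  -- The component that receives the momentum. The other component is a spectator: it cancels from
  -- the quotient of symbols and from the energy defect, which leaves a triple of momenta with sum
  -- `x`.
  set x : Space := if b then Ξ.2 else Ξ.1 with hx
  set e : ℝ := if b then 1 else -1 with he
  have hpt : ∀ q : Pair, ‖∫ τ in A, c τ * vertex b (Ξ - transfer b (q.1 + q.2)) q τ‖ₑ ^ 2
      ≤ ENNReal.ofReal (‖x‖ ^ 2 * (‖q.1‖ ^ 2 * ‖q.2‖ ^ 2 * ‖x - q.1 - q.2‖ ^ 2)⁻¹)
        * G (-e * ‖x‖ ^ 2 + -1 * ‖q.1‖ ^ 2 + 1 * ‖q.2‖ ^ 2 + e * ‖x - q.1 - q.2‖ ^ 2) := by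
    intro q
    set p := Ξ - transfer b (q.1 + q.2) with hp
    have hm : merge b p q = Ξ := by simp [merge, hp]
    set φ : ℝ := energy Ξ - energy p - energy q with hφ
    set r : ℝ := pairSymbol Ξ / (pairSymbol p * pairSymbol q) with hr
    have e1 : ∫ τ in A, c τ * vertex b p q τ = (branchSign b * r)
        * ∫ τ in A, c τ * Complex.exp (Complex.I * (2 * Real.pi ^ 2 * τ * φ : ℝ)) := by
      rw [← integral_const_mul]
      refine integral_congr_ae (.of_forall fun τ => ?_)
      simp only [vertex, hm]
      ring
    have e2 : φ = -e * ‖x‖ ^ 2 + -1 * ‖q.1‖ ^ 2 + 1 * ‖q.2‖ ^ 2 + e * ‖x - q.1 - q.2‖ ^ 2 := by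
      simp only [hφ, hp, hx, he, energy, transfer]
      cases b
      · simp only [Bool.false_eq_true, if_false, Prod.fst_sub, Prod.snd_sub, sub_zero,
          sub_add_eq_sub_sub]
        ring
      · simp only [if_true, Prod.fst_sub, Prod.snd_sub, sub_zero, sub_add_eq_sub_sub]
        ring
    have e3 : ‖branchSign b * (r : ℂ)‖ ^ 2
        ≤ ‖x‖ ^ 2 * (‖q.1‖ ^ 2 * ‖q.2‖ ^ 2 * ‖x - q.1 - q.2‖ ^ 2)⁻¹ := by
      have hs : ‖branchSign b‖ = 1 := by
        unfold branchSign
        cases b <;> simp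
      rw [norm_mul, hs, one_mul, Complex.norm_real, Real.norm_eq_abs, sq_abs]
      have key : ∀ (a X y : ℝ), 0 ≤ a → ((2 * Real.pi * X) * (2 * Real.pi * a)
          / (((2 * Real.pi * y) * (2 * Real.pi * a)) *
            ((2 * Real.pi * ‖q.1‖) * (2 * Real.pi * ‖q.2‖)))) ^ 2
          ≤ X ^ 2 * (‖q.1‖ ^ 2 * ‖q.2‖ ^ 2 * y ^ 2)⁻¹ := by
        intro a X y ha
        -- `a` is the length of the spectator. For `a = 0` the quotient is `0 / 0 = 0`.
        rcases ha.eq_or_lt with rfl | ha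
        · exact le_of_eq_of_le (b := 0) (by simp) (by positivity)
        have : (2 * Real.pi * X) * (2 * Real.pi * a)
          / (((2 * Real.pi * y) * (2 * Real.pi * a)) *
            ((2 * Real.pi * ‖q.1‖) * (2 * Real.pi * ‖q.2‖)))
            = ((2 * Real.pi) ^ 2)⁻¹ * (X * (‖q.1‖ * ‖q.2‖ * y)⁻¹) := by
          rw [div_eq_mul_inv]
          have hpi0 := Real.pi_ne_zero
          simp only [mul_inv]
          field_simp
        have e0 : X ^ 2 * (‖q.1‖ ^ 2 * ‖q.2‖ ^ 2 * y ^ 2)⁻¹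
            = (X * (‖q.1‖ * ‖q.2‖ * y)⁻¹) ^ 2 := by
          rw [mul_pow, inv_pow, mul_pow, mul_pow]
        rw [this, mul_pow, e0]
        refine mul_le_of_le_one_left (sq_nonneg _) (pow_le_one₀ (by positivity) ?_)
        exact inv_le_one_of_one_le₀ (one_le_pow₀ (by linarith [Real.pi_gt_three]))
      simp only [hr, hp, hx, pairSymbol, transfer]
      cases b
      · have := key ‖Ξ.2‖ ‖Ξ.1‖ ‖Ξ.1 - q.1 - q.2‖ (norm_nonneg _)
        simpa [sub_add_eq_sub_sub] using this
      · have := key ‖Ξ.1‖ ‖Ξ.2‖ ‖Ξ.2 - q.1 - q.2‖ (norm_nonneg _)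
        simp only [if_true, Prod.fst_sub, Prod.snd_sub, sub_zero, sub_add_eq_sub_sub]
        refine le_of_eq_of_le ?_ this
        congr 1
        ring
    rw [e1, enorm_mul, mul_pow, ← e2]
    refine mul_le_mul_left ?_ _
    rw [← ofReal_norm, ← ENNReal.ofReal_pow (norm_nonneg _)]
    exact ENNReal.ofReal_le_ofReal e3
  have hmeas : Measurable fun q : Pair =>
      ENNReal.ofReal (‖x‖ ^ 2 * (‖q.1‖ ^ 2 * ‖q.2‖ ^ 2 * ‖x - q.1 - q.2‖ ^ 2)⁻¹)
        * G (-e * ‖x‖ ^ 2 + -1 * ‖q.1‖ ^ 2 + 1 * ‖q.2‖ ^ 2 + e * ‖x - q.1 - q.2‖ ^ 2) := by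
    fun_prop
  calc _ ≤ ∫⁻ q : Pair,
        ENNReal.ofReal (‖x‖ ^ 2 * (‖q.1‖ ^ 2 * ‖q.2‖ ^ 2 * ‖x - q.1 - q.2‖ ^ 2)⁻¹)
        * G (-e * ‖x‖ ^ 2 + -1 * ‖q.1‖ ^ 2 + 1 * ‖q.2‖ ^ 2 + e * ‖x - q.1 - q.2‖ ^ 2) :=
        lintegral_mono hpt
    _ = tripleIntegral x (fun p q r =>
        ENNReal.ofReal (‖x‖ ^ 2 * (‖p‖ ^ 2 * ‖q‖ ^ 2 * ‖r‖ ^ 2)⁻¹)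
        * G (-e * ‖x‖ ^ 2 + -1 * ‖p‖ ^ 2 + 1 * ‖q‖ ^ 2 + e * ‖r‖ ^ 2)) := by
        rw [Measure.volume_eq_prod, lintegral_prod _ hmeas.aemeasurable]
        rfl
    _ ≤ ENNReal.ofReal C * ∫⁻ t, G t := by
        refine h x G hGm _ _ _ _ (Or.inr rfl) (Or.inl rfl) ?_
        simp only [he]
        cases b <;> simp
    _ ≤ _ := by
        gcongr
        linarith


/-! ### Fubini on triangles and products of primitives. -/

/-- Fubini on the triangle `s ≤ σ ≤ r ≤ t`. -/
lemma intervalIntegral_triangle {s t : ℝ} (hst : s ≤ t) (F : ℝ → ℝ → ℂ)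
    (hF : Integrable (fun p : ℝ × ℝ => F p.1 p.2)
      ((volume.restrict (Set.Ioc s t)).prod (volume.restrict (Set.Ioc s t)))) :
    ∫ r in s..t, ∫ σ in s..r, F r σ = ∫ σ in s..t, ∫ r in σ..t, F r σ := by
  set G : ℝ → ℝ → ℂ := fun r σ => {p : ℝ × ℝ | p.2 ≤ p.1}.indicator (fun p => F p.1 p.2) (r, σ)
    with hG
  have hm : MeasurableSet {p : ℝ × ℝ | p.2 ≤ p.1} := measurableSet_le measurable_snd measurable_fst
  have hGi : Integrable (Function.uncurry G)
      ((volume.restrict (Set.Ioc s t)).prod (volume.restrict (Set.Ioc s t))) :=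
    hF.indicator hm
  have hswap := integral_integral_swap hGi
  have e1 : ∀ r ∈ Set.Ioc s t, ∫ σ in s..r, F r σ = ∫ σ in Set.Ioc s t, G r σ := by
    intro r hr
    rw [intervalIntegral.integral_of_le hr.1.le, ← integral_indicator measurableSet_Ioc,
      ← integral_indicator measurableSet_Ioc]
    refine integral_congr_ae (.of_forall fun σ => ?_)
    simp only [hG, Set.indicator, Set.mem_Ioc, Set.mem_ofPred_eq]
    by_cases h1 : s < σ
    · by_cases h2 : σ ≤ r
      · simp [h1, h2, h2.trans hr.2]
      · simp [h2]
    · simp [h1]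
  have e2 : ∀ σ ∈ Set.Ioc s t, ∫ r in σ..t, F r σ = ∫ r in Set.Ioc s t, G r σ := by
    intro σ hσ
    rw [intervalIntegral.integral_of_le hσ.2, ← integral_Icc_eq_integral_Ioc,
      ← integral_indicator measurableSet_Icc, ← integral_indicator measurableSet_Ioc]
    refine integral_congr_ae (.of_forall fun r => ?_)
    simp only [hG, Set.indicator, Set.mem_Ioc, Set.mem_Icc, Set.mem_ofPred_eq]
    by_cases h1 : σ ≤ r
    · simp [h1, lt_of_lt_of_le hσ.1 h1]
    · simp [h1]
  rw [intervalIntegral.integral_of_le hst, intervalIntegral.integral_of_le hst,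
    setIntegral_congr_fun measurableSet_Ioc e1, setIntegral_congr_fun measurableSet_Ioc e2]
  exact hswap

lemma intervalIntegral_triangle_of_continuous {s t : ℝ} (hst : s ≤ t) (F : ℝ → ℝ → ℂ)
    (hF : Continuous fun p : ℝ × ℝ => F p.1 p.2) :
    ∫ r in s..t, ∫ σ in s..r, F r σ = ∫ σ in s..t, ∫ r in σ..t, F r σ := by
  refine intervalIntegral_triangle hst F ?_
  rw [Measure.prod_restrict]
  exact (hF.continuousOn.integrableOn_compact (isCompact_Icc.prod isCompact_Icc)).mono_set
    (Set.prod_mono Set.Ioc_subset_Icc_self Set.Ioc_subset_Icc_self)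

/-- The product rule for functions that are given as integrals. -/
lemma mul_eq_add_integral {A₁ A₂ a₁ a₂ : ℝ → ℂ} {τ : ℝ} (h₁ : Continuous a₁) (h₂ : Continuous a₂)
    (H₁ : ∀ σ ≤ τ, A₁ σ = A₁ τ + ∫ r in σ..τ, a₁ r)
    (H₂ : ∀ σ ≤ τ, A₂ σ = A₂ τ + ∫ r in σ..τ, a₂ r) {σ : ℝ} (hσ : σ ≤ τ) :
    A₁ σ * A₂ σ = A₁ τ * A₂ τ + ∫ r in σ..τ, (a₁ r * A₂ r + A₁ r * a₂ r) := by
  -- The integral formulas are known only for times up to `τ`. The primitives `B₁`, `B₂` agree with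
  -- `A₁`, `A₂` there and are differentiable everywhere.
  set B₁ : ℝ → ℂ := fun x => A₁ τ + ∫ r in x..τ, a₁ r with hB₁
  set B₂ : ℝ → ℂ := fun x => A₂ τ + ∫ r in x..τ, a₂ r with hB₂
  have d : ∀ (a : ℝ → ℂ) (c : ℂ), Continuous a → ∀ x,
      HasDerivAt (fun x => c + ∫ r in x..τ, a r) (-a x) x := fun a c ha x =>
    (intervalIntegral.integral_hasDerivAt_left (ha.intervalIntegrable _ _)
      ha.aestronglyMeasurable.stronglyMeasurableAtFilter ha.continuousAt).const_add c
  have d₁ : ∀ x, HasDerivAt B₁ (-a₁ x) x := d a₁ _ h₁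
  have d₂ : ∀ x, HasDerivAt B₂ (-a₂ x) x := d a₂ _ h₂
  have c₁ : Continuous B₁ := continuous_iff_continuousAt.2 fun x => (d₁ x).continuousAt
  have c₂ : Continuous B₂ := continuous_iff_continuousAt.2 fun x => (d₂ x).continuousAt
  have ftc := intervalIntegral.integral_eq_sub_of_hasDerivAt (a := σ) (b := τ)
    (fun x _ => (d₁ x).mul (d₂ x)) (by
      apply Continuous.intervalIntegrable
      fun_prop)
  have e : ∫ r in σ..τ, (a₁ r * A₂ r + A₁ r * a₂ r)
      = - ∫ r in σ..τ, (-a₁ r * B₂ r + B₁ r * -a₂ r) := by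
    rw [← intervalIntegral.integral_neg]
    refine intervalIntegral.integral_congr fun r hr => ?_
    rw [Set.uIcc_of_le hσ] at hr
    simp only [hB₁, hB₂, ← H₁ r hr.2, ← H₂ r hr.2]
    ring
  rw [e, ftc, H₁ σ hσ, H₂ σ hσ]
  simp [hB₁, hB₂]

/-! ### Binary trees of collapses and their amplitudes. -/

/-- Histories of a single pair: a node is a collapse, read from the root. -/
inductive CollapseTree : Type
  | leaf : CollapseTree
  | node (b : Bool) (l r : CollapseTree) : CollapseTree

namespace CollapseTree

/-- The number of collapses. -/
def nodes : CollapseTree → ℕ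
  | leaf => 0
  | node _ l r => l.nodes + r.nodes + 1

/-- The momenta at the root, when the leaves carry the momenta `ξ o, ξ (o + 1), …`. -/
def root : CollapseTree → ℕ → (ℕ → Pair) → Pair
  | leaf, o, ξ => ξ o
  | node b l r, o, ξ => merge b (root l o ξ) (root r (o + l.nodes + 1) ξ)

/-- The amplitude of a history between the times `σ` (leaves) and `t` (root). -/
def amp (β : ℝ → ℝ) : CollapseTree → ℕ → (ℕ → Pair) → ℝ → ℝ → ℂ
  | leaf, _, _, _, _ => 1
  | node b l r, o, ξ, σ, t => ∫ τ in σ..t,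
      (β τ : ℂ) * vertex b (root l o ξ) (root r (o + l.nodes + 1) ξ) τ
        * (amp β l o ξ σ τ * amp β r (o + l.nodes + 1) ξ σ τ)

/-- Minus the derivative of the amplitude in the time `σ` of the leaves. -/
def damp (β : ℝ → ℝ) : CollapseTree → ℕ → (ℕ → Pair) → ℝ → ℝ → ℂ
  | leaf, _, _, _, _ => 0
  | node b l r, o, ξ, σ, t =>
      (β σ : ℂ) * vertex b (root l o ξ) (root r (o + l.nodes + 1) ξ) σ
        * (amp β l o ξ σ σ * amp β r (o + l.nodes + 1) ξ σ σ)
      + ∫ τ in σ..t, (β τ : ℂ) * vertex b (root l o ξ) (root r (o + l.nodes + 1) ξ) τ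
        * (damp β l o ξ σ τ * amp β r (o + l.nodes + 1) ξ σ τ
          + amp β l o ξ σ τ * damp β r (o + l.nodes + 1) ξ σ τ)

end CollapseTree

lemma continuous_vertex (b : Bool) (p q : Pair) : Continuous (vertex b p q) := by
  unfold vertex
  fun_prop

lemma continuous_intervalIntegral_param {f : ℝ → ℝ → ℂ}
    (hf : Continuous fun p : ℝ × ℝ => f p.1 p.2) :
    Continuous fun p : ℝ × ℝ => ∫ τ in p.1..p.2, f p.1 τ := by
  have h : ∀ p : ℝ × ℝ, ∫ τ in p.1..p.2, f p.1 τ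
      = (∫ τ in (0 : ℝ)..p.2, f p.1 τ) - ∫ τ in (0 : ℝ)..p.1, f p.1 τ := by
    intro p
    have hc : Continuous (f p.1) := hf.comp (by fun_prop : Continuous fun τ : ℝ => (p.1, τ))
    rw [intervalIntegral.integral_interval_sub_left (hc.intervalIntegrable _ _)
      (hc.intervalIntegrable _ _)]
  simp_rw [h]
  have hc : Continuous (Function.uncurry fun (p : ℝ × ℝ) τ => f p.1 τ) :=
    hf.comp (by fun_prop : Continuous fun x : (ℝ × ℝ) × ℝ => (x.1.1, x.2))
  exact (intervalIntegral.continuous_parametric_intervalIntegral_of_continuous hc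
    continuous_snd).sub (intervalIntegral.continuous_parametric_intervalIntegral_of_continuous hc
    continuous_fst)

namespace CollapseTree

variable {β : ℝ → ℝ}

lemma continuous_amp (hβ : Continuous β) (T : CollapseTree) : ∀ (o : ℕ) (ξ : ℕ → Pair),
    Continuous fun p : ℝ × ℝ => amp β T o ξ p.1 p.2 := by
  induction T with
  | leaf => intro o ξ; simp only [amp]; fun_prop
  | node b l r ihl ihr =>
    intro o ξ
    simp only [amp]
    refine continuous_intervalIntegral_param (f := fun σ τ => (β τ : ℂ) *
      vertex b (root l o ξ) (root r (o + l.nodes + 1) ξ) τ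
        * (amp β l o ξ σ τ * amp β r (o + l.nodes + 1) ξ σ τ)) ?_
    have := continuous_vertex b (root l o ξ) (root r (o + l.nodes + 1) ξ)
    have h1 := ihl o ξ
    have h2 := ihr (o + l.nodes + 1) ξ
    fun_prop

lemma continuous_damp (hβ : Continuous β) (T : CollapseTree) : ∀ (o : ℕ) (ξ : ℕ → Pair),
    Continuous fun p : ℝ × ℝ => damp β T o ξ p.1 p.2 := by
  induction T with
  | leaf => intro o ξ; simp only [damp]; fun_prop
  | node b l r ihl ihr =>
    intro o ξ
    simp only [damp]
    have hv := continuous_vertex b (root l o ξ) (root r (o + l.nodes + 1) ξ)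
    have h1 := continuous_amp hβ l o ξ
    have h2 := continuous_amp hβ r (o + l.nodes + 1) ξ
    have h3 := ihl o ξ
    have h4 := ihr (o + l.nodes + 1) ξ
    refine Continuous.add ?_ (continuous_intervalIntegral_param (f := fun σ τ => (β τ : ℂ) *
      vertex b (root l o ξ) (root r (o + l.nodes + 1) ξ) τ
        * (damp β l o ξ σ τ * amp β r (o + l.nodes + 1) ξ σ τ
          + amp β l o ξ σ τ * damp β r (o + l.nodes + 1) ξ σ τ)) ?_)
    · have h5 := h1.comp (by fun_prop : Continuous fun p : ℝ × ℝ => (p.1, p.1))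
      have h6 := h2.comp (by fun_prop : Continuous fun p : ℝ × ℝ => (p.1, p.1))
      simp only [Function.comp_def] at h5 h6
      fun_prop
    · fun_prop

/-- The time `σ` enters as the lower limit of the root integral and inside both subtrees. The
product rule expands the subtrees from the time of the root back to `σ`, and Fubini on the triangle
makes the leaf time the outer variable. -/
lemma amp_eq_add_integral (hβ : Continuous β) (T : CollapseTree) : ∀ (o : ℕ) (ξ : ℕ → Pair) (t σ : ℝ),
    σ ≤ t → amp β T o ξ σ t = amp β T o ξ t t + ∫ r in σ..t, damp β T o ξ r t := by
  induction T with
  | leaf => intro o ξ t σ _; simp [amp, damp]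
  | node b l r ihl ihr =>
    intro o ξ t σ hσ
    have hv := continuous_vertex b (root l o ξ) (root r (o + l.nodes + 1) ξ)
    have h1 := continuous_amp hβ l o ξ
    have h2 := continuous_amp hβ r (o + l.nodes + 1) ξ
    have h3 := continuous_damp hβ l o ξ
    have h4 := continuous_damp hβ r (o + l.nodes + 1) ξ
    set v : ℝ → ℂ := fun τ => (β τ : ℂ) * vertex b (root l o ξ) (root r (o + l.nodes + 1) ξ) τ
      with hvdef
    set e : ℝ → ℝ → ℂ := fun σ τ => damp β l o ξ σ τ * amp β r (o + l.nodes + 1) ξ σ τ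
          + amp β l o ξ σ τ * damp β r (o + l.nodes + 1) ξ σ τ with he
    have hvc : Continuous v := by fun_prop
    have hec : Continuous fun p : ℝ × ℝ => e p.1 p.2 := by fun_prop
    have h5 := h1.comp (by fun_prop : Continuous fun τ : ℝ => (τ, τ))
    have h6 := h2.comp (by fun_prop : Continuous fun τ : ℝ => (τ, τ))
    simp only [Function.comp_def] at h5 h6
    have hprod : ∀ τ ∈ Set.uIcc σ t, v τ * (amp β l o ξ σ τ * amp β r (o + l.nodes + 1) ξ σ τ)
        = v τ * (amp β l o ξ τ τ * amp β r (o + l.nodes + 1) ξ τ τ)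
          + ∫ x in σ..τ, v τ * e x τ := by
      intro τ hτ
      rw [Set.uIcc_of_le hσ] at hτ
      have := mul_eq_add_integral (A₁ := fun x => amp β l o ξ x τ)
        (A₂ := fun x => amp β r (o + l.nodes + 1) ξ x τ)
        (h3.comp (by fun_prop : Continuous fun x : ℝ => (x, τ)))
        (h4.comp (by fun_prop : Continuous fun x : ℝ => (x, τ)))
        (fun x hx => ihl o ξ τ x hx) (fun x hx => ihr (o + l.nodes + 1) ξ τ x hx) hτ.1
      rw [this, mul_add, intervalIntegral.integral_const_mul]
      rfl
    have hz : amp β (node b l r) o ξ t t = 0 := by simp [amp]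
    rw [hz, zero_add]
    have hpar : Continuous fun p : ℝ × ℝ => ∫ x in p.1..p.2, v p.2 * e x p.2 := by
      have := continuous_intervalIntegral_param (f := fun τ x => v τ * e x τ) (by
        have := hec.comp (by fun_prop : Continuous fun p : ℝ × ℝ => (p.2, p.1))
        simp only [Function.comp_def] at this
        fun_prop)
      have h' := (this.comp (by fun_prop : Continuous fun p : ℝ × ℝ => (p.2, p.1))).neg
      refine h'.congr fun p => ?_
      simp only [Function.comp_def, Pi.neg_apply]
      rw [← intervalIntegral.integral_symm]
    calc amp β (node b l r) o ξ σ t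
        = ∫ τ in σ..t, v τ * (amp β l o ξ σ τ * amp β r (o + l.nodes + 1) ξ σ τ) := rfl
      _ = ∫ τ in σ..t, (v τ * (amp β l o ξ τ τ * amp β r (o + l.nodes + 1) ξ τ τ)
          + ∫ x in σ..τ, v τ * e x τ) := intervalIntegral.integral_congr hprod
      _ = (∫ τ in σ..t, v τ * (amp β l o ξ τ τ * amp β r (o + l.nodes + 1) ξ τ τ))
          + ∫ τ in σ..t, ∫ x in σ..τ, v τ * e x τ := by
          refine intervalIntegral.integral_add ?_ ?_
          · apply Continuous.intervalIntegrable
            fun_prop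
          · exact (hpar.comp (by fun_prop : Continuous fun τ : ℝ => (σ, τ))).intervalIntegrable _ _
      _ = (∫ τ in σ..t, v τ * (amp β l o ξ τ τ * amp β r (o + l.nodes + 1) ξ τ τ))
          + ∫ x in σ..t, ∫ τ in x..t, v τ * e x τ := by
          rw [intervalIntegral_triangle_of_continuous hσ (fun τ x => v τ * e x τ)]
          have := hec.comp (by fun_prop : Continuous fun p : ℝ × ℝ => (p.2, p.1))
          simp only [Function.comp_def] at this
          fun_prop
      _ = ∫ x in σ..t, damp β (node b l r) o ξ x t := by
          rw [← intervalIntegral.integral_add]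
          · rfl
          · apply Continuous.intervalIntegrable
            fun_prop
          · have := continuous_intervalIntegral_param (f := fun x τ => v τ * e x τ) (by fun_prop)
            exact (this.comp (by fun_prop : Continuous fun x : ℝ => (x, t))).intervalIntegrable _ _

end CollapseTree


/-! ### Enumeration of trees and forests. -/

namespace CollapseTree

open Classical in
/-- The histories with `n` collapses. -/
def trees : ℕ → Finset CollapseTree
  | 0 => {leaf}
  | n + 1 => (Finset.HasAntidiagonal.antidiagonal n).attach.biUnion fun p =>
      have h := Finset.HasAntidiagonal.mem_antidiagonal.1 p.2
      have h1 : p.1.1 < n + 1 := by omega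
      have h2 : p.1.2 < n + 1 := by omega
      ((Finset.univ : Finset Bool) ×ˢ (trees p.1.1 ×ˢ trees p.1.2)).image
        fun x => node x.1 x.2.1 x.2.2

lemma trees_zero : trees 0 = {leaf} := by rw [trees]

lemma nodes_of_mem_trees : ∀ (n : ℕ) {T : CollapseTree}, T ∈ trees n → T.nodes = n := by
  intro n
  induction n using Nat.strong_induction_on with
  | _ n ih =>
    intro T hT
    cases n with
    | zero =>
      rw [trees_zero, Finset.mem_singleton] at hT
      rw [hT, nodes]
    | succ n =>
      rw [trees] at hT
      simp only [Finset.mem_biUnion, Finset.mem_attach, true_and, Finset.mem_image,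
        Finset.mem_product, Finset.mem_univ] at hT
      obtain ⟨p, ⟨b, L, R⟩, ⟨hL, hR⟩, rfl⟩ := hT
      have hp := Finset.HasAntidiagonal.mem_antidiagonal.1 p.2
      have h1 := ih p.1.1 (by omega) hL
      have h2 := ih p.1.2 (by omega) hR
      simp only [nodes] at h1 h2 ⊢
      omega

/-- A tree determines its branch and its subtrees, and these determine their numbers of nodes, so
the union over the antidiagonal is disjoint. -/
lemma sum_trees_succ {M : Type*} [AddCommMonoid M] (n : ℕ) (f : CollapseTree → M) :
    ∑ T ∈ trees (n + 1), f T = ∑ b : Bool, ∑ p ∈ Finset.HasAntidiagonal.antidiagonal n,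
      ∑ L ∈ trees p.1, ∑ R ∈ trees p.2, f (node b L R) := by
  classical
  rw [trees, Finset.sum_biUnion]
  · rw [Finset.sum_comm, ← Finset.sum_attach (Finset.HasAntidiagonal.antidiagonal n)]
    refine Finset.sum_congr rfl fun p _ => ?_
    rw [Finset.sum_image]
    · rw [Finset.sum_product]
      refine Finset.sum_congr rfl fun b _ => ?_
      rw [Finset.sum_product]
    · rintro ⟨b, L, R⟩ _ ⟨b', L', R'⟩ _ h
      simp only [node.injEq] at h
      obtain ⟨rfl, rfl, rfl⟩ := h
      rfl
  · intro p _ q _ hpq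
    rw [Function.onFun, Finset.disjoint_left]
    intro T hT hT'
    simp only [Finset.mem_image, Finset.mem_product, Finset.mem_univ, true_and] at hT hT'
    obtain ⟨⟨b, L, R⟩, ⟨hL, hR⟩, rfl⟩ := hT
    obtain ⟨⟨b', L', R'⟩, ⟨hL', hR'⟩, h⟩ := hT'
    simp only [node.injEq] at h
    obtain ⟨rfl, rfl, rfl⟩ := h
    apply hpq
    apply Subtype.ext
    apply Prod.ext
    · rw [← nodes_of_mem_trees _ hL, ← nodes_of_mem_trees _ hL']
    · rw [← nodes_of_mem_trees _ hR, ← nodes_of_mem_trees _ hR']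

open Classical in
/-- The histories of `k` pairs with `N` collapses. -/
def forests : ℕ → ℕ → Finset (List CollapseTree)
  | 0, N => if N = 0 then {[]} else ∅
  | k + 1, N => (Finset.HasAntidiagonal.antidiagonal N).biUnion fun p =>
      (trees p.1 ×ˢ forests k p.2).image fun x => x.1 :: x.2

lemma sum_forests_zero {M : Type*} [AddCommMonoid M] (N : ℕ) (f : List CollapseTree → M) :
    ∑ F ∈ forests 0 N, f F = if N = 0 then f [] else 0 := by
  rw [forests]
  split_ifs <;> simp

lemma sum_forests_succ {M : Type*} [AddCommMonoid M] (k N : ℕ) (f : List CollapseTree → M) :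
    ∑ F ∈ forests (k + 1) N, f F = ∑ p ∈ Finset.HasAntidiagonal.antidiagonal N,
      ∑ T ∈ trees p.1, ∑ F ∈ forests k p.2, f (T :: F) := by
  classical
  rw [forests, Finset.sum_biUnion]
  · refine Finset.sum_congr rfl fun p _ => ?_
    rw [Finset.sum_image]
    · rw [Finset.sum_product]
    · rintro ⟨T, F⟩ _ ⟨T', F'⟩ _ h
      simp only [List.cons.injEq] at h
      obtain ⟨rfl, rfl⟩ := h
      rfl
  · intro p hp q hq hpq
    rw [Function.onFun, Finset.disjoint_left]
    intro F hF hF'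
    simp only [Finset.mem_image, Finset.mem_product] at hF hF'
    obtain ⟨⟨T, F⟩, ⟨hT, hF⟩, rfl⟩ := hF
    obtain ⟨⟨T', F'⟩, ⟨hT', hF'⟩, h⟩ := hF'
    simp only [List.cons.injEq] at h
    obtain ⟨rfl, rfl⟩ := h
    have h1 : p.1 = q.1 := by rw [← nodes_of_mem_trees _ hT, ← nodes_of_mem_trees _ hT']
    have hp' := Finset.HasAntidiagonal.mem_antidiagonal.1 hp
    have hq' := Finset.HasAntidiagonal.mem_antidiagonal.1 hq
    exact hpq (Prod.ext h1 (by omega))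

/-- The momenta at the roots of a forest. -/
def roots : List CollapseTree → ℕ → (ℕ → Pair) → List Pair
  | [], _, _ => []
  | T :: F, o, ξ => root T o ξ :: roots F (o + T.nodes + 1) ξ

/-- The amplitude of a forest. -/
def famp (β : ℝ → ℝ) : List CollapseTree → ℕ → (ℕ → Pair) → ℝ → ℝ → ℂ
  | [], _, _, _, _ => 1
  | T :: F, o, ξ, σ, t => amp β T o ξ σ t * famp β F (o + T.nodes + 1) ξ σ t

/-- Minus the derivative of the amplitude of a forest in the time of the leaves. -/
def dfamp (β : ℝ → ℝ) : List CollapseTree → ℕ → (ℕ → Pair) → ℝ → ℝ → ℂ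
  | [], _, _, _, _ => 0
  | T :: F, o, ξ, σ, t => damp β T o ξ σ t * famp β F (o + T.nodes + 1) ξ σ t
      + amp β T o ξ σ t * dfamp β F (o + T.nodes + 1) ξ σ t

variable {β : ℝ → ℝ}

lemma continuous_famp (hβ : Continuous β) (F : List CollapseTree) : ∀ (o : ℕ) (ξ : ℕ → Pair),
    Continuous fun p : ℝ × ℝ => famp β F o ξ p.1 p.2 := by
  induction F with
  | nil => intro o ξ; simp only [famp]; fun_prop
  | cons T F ih =>
    intro o ξ
    simp only [famp]
    exact (continuous_amp hβ T o ξ).mul (ih _ ξ)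

lemma continuous_dfamp (hβ : Continuous β) (F : List CollapseTree) : ∀ (o : ℕ) (ξ : ℕ → Pair),
    Continuous fun p : ℝ × ℝ => dfamp β F o ξ p.1 p.2 := by
  induction F with
  | nil => intro o ξ; simp only [dfamp]; fun_prop
  | cons T F ih =>
    intro o ξ
    simp only [dfamp]
    exact ((continuous_damp hβ T o ξ).mul (continuous_famp hβ F _ ξ)).add
      ((continuous_amp hβ T o ξ).mul (ih _ ξ))

lemma famp_eq_add_integral (hβ : Continuous β) (F : List CollapseTree) :
    ∀ (o : ℕ) (ξ : ℕ → Pair) (t σ : ℝ), σ ≤ t →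
      famp β F o ξ σ t = famp β F o ξ t t + ∫ r in σ..t, dfamp β F o ξ r t := by
  induction F with
  | nil => intro o ξ t σ _; simp [famp, dfamp]
  | cons T F ih =>
    intro o ξ t σ hσ
    exact mul_eq_add_integral (A₁ := fun x => amp β T o ξ x t)
      (A₂ := fun x => famp β F (o + T.nodes + 1) ξ x t)
      ((continuous_damp hβ T o ξ).comp (by fun_prop : Continuous fun x : ℝ => (x, t)))
      ((continuous_dfamp hβ F _ ξ).comp (by fun_prop : Continuous fun x : ℝ => (x, t)))
      (fun x hx => amp_eq_add_integral hβ T o ξ t x hx) (fun x hx => ih _ ξ t x hx) hσ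

/-- Collapse of the neighbouring pairs with the labels `j` and `j + 1`. -/
def mergeAt (j : ℕ) (b : Bool) (ξ : ℕ → Pair) (i : ℕ) : Pair :=
  if i < j then ξ i else if i = j then merge b (ξ j) (ξ (j + 1)) else ξ (i + 1)

/-- A tree reads only its own `nodes + 1` consecutive leaves. This locality lets labels be shifted
and leaves a tree unchanged when the collapse happens in another one. -/
lemma root_congr (T : CollapseTree) : ∀ (o o' : ℕ) (ξ ξ' : ℕ → Pair),
    (∀ i ≤ T.nodes, ξ (o + i) = ξ' (o' + i)) → root T o ξ = root T o' ξ' := by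
  induction T with
  | leaf => intro o o' ξ ξ' h; simpa [root] using h 0 (Nat.zero_le _)
  | node b l r ihl ihr =>
    intro o o' ξ ξ' h
    simp only [root, nodes] at h ⊢
    rw [ihl o o' ξ ξ' fun i hi => h i (by omega),
      ihr (o + l.nodes + 1) (o' + l.nodes + 1) ξ ξ' fun i hi => by
        have := h (l.nodes + 1 + i) (by omega)
        simpa [add_assoc] using this]

lemma amp_congr (T : CollapseTree) : ∀ (o o' : ℕ) (ξ ξ' : ℕ → Pair) (σ t : ℝ),
    (∀ i ≤ T.nodes, ξ (o + i) = ξ' (o' + i)) → amp β T o ξ σ t = amp β T o' ξ' σ t := by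
  induction T with
  | leaf => intro o o' ξ ξ' σ t h; simp [amp]
  | node b l r ihl ihr =>
    intro o o' ξ ξ' σ t h
    simp only [nodes] at h
    have h1 : ∀ i ≤ l.nodes, ξ (o + i) = ξ' (o' + i) := fun i hi => h i (by omega)
    have h2 : ∀ i ≤ r.nodes, ξ (o + l.nodes + 1 + i) = ξ' (o' + l.nodes + 1 + i) := fun i hi => by
      have := h (l.nodes + 1 + i) (by omega)
      simpa [add_assoc] using this
    simp only [amp]
    rw [root_congr l o o' ξ ξ' h1, root_congr r _ _ ξ ξ' h2]
    refine intervalIntegral.integral_congr fun τ _ => ?_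
    rw [ihl o o' ξ ξ' σ τ h1, ihr _ _ ξ ξ' σ τ h2]

lemma nodes_sum_of_mem_forests : ∀ (k N : ℕ) {F : List CollapseTree}, F ∈ forests k N →
    F.length = k ∧ (F.map nodes).sum = N := by
  classical
  intro k
  induction k with
  | zero =>
    intro N F hF
    rw [forests] at hF
    split_ifs at hF with h
    · rw [Finset.mem_singleton] at hF
      simp [hF, h]
    · simp at hF
  | succ k ih =>
    intro N F hF
    rw [forests] at hF
    simp only [Finset.mem_biUnion, Finset.mem_image, Finset.mem_product] at hF
    obtain ⟨p, hp, ⟨T, F⟩, ⟨hT, hF⟩, rfl⟩ := hF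
    have hp' := Finset.HasAntidiagonal.mem_antidiagonal.1 hp
    have h1 := nodes_of_mem_trees _ hT
    obtain ⟨h2, h3⟩ := ih p.2 hF
    simp only [List.length_cons, h2, List.map_cons, List.sum_cons, h3, true_and]
    dsimp only at h1
    omega

lemma forest_congr (F : List CollapseTree) : ∀ (o o' : ℕ) (ξ ξ' : ℕ → Pair),
    (∀ i < (F.map nodes).sum + F.length, ξ (o + i) = ξ' (o' + i)) →
      roots F o ξ = roots F o' ξ' ∧ ∀ σ t, famp β F o ξ σ t = famp β F o' ξ' σ t := by
  induction F with
  | nil => intro o o' ξ ξ' h; simp [roots, famp]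
  | cons T F ih =>
    intro o o' ξ ξ' h
    simp only [List.map_cons, List.sum_cons, List.length_cons] at h
    have h1 : ∀ i ≤ T.nodes, ξ (o + i) = ξ' (o' + i) := fun i hi => h i (by omega)
    obtain ⟨h2, h3⟩ := ih (o + T.nodes + 1) (o' + T.nodes + 1) ξ ξ' fun i hi => by
      have := h (T.nodes + 1 + i) (by omega)
      simpa [add_assoc] using this
    simp only [roots, famp]
    rw [root_congr T o o' ξ ξ' h1, h2]
    refine ⟨rfl, fun σ t => ?_⟩
    rw [amp_congr T o o' ξ ξ' σ t h1, h3]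

end CollapseTree


/-! ### Splitting off the earliest collapse. -/

namespace CollapseTree

variable {β : ℝ → ℝ}

lemma mergeAt_of_lt {i j : ℕ} (h : i < j) (b : Bool) (ξ : ℕ → Pair) : mergeAt j b ξ i = ξ i := by
  simp [mergeAt, h]

lemma mergeAt_self (j : ℕ) (b : Bool) (ξ : ℕ → Pair) :
    mergeAt j b ξ j = merge b (ξ j) (ξ (j + 1)) := by
  simp [mergeAt]

lemma mergeAt_of_gt {i j : ℕ} (h : j < i) (b : Bool) (ξ : ℕ → Pair) :
    mergeAt j b ξ i = ξ (i + 1) := by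
  simp [mergeAt, h.not_gt, h.ne']

lemma sum_forests_one {M : Type*} [AddCommMonoid M] (N : ℕ) (f : List CollapseTree → M) :
    ∑ F ∈ forests 1 N, f F = ∑ T ∈ trees N, f [T] := by
  rw [sum_forests_succ, Finset.sum_eq_single (N, 0)]
  · refine Finset.sum_congr rfl fun T _ => ?_
    simp [sum_forests_zero]
  · rintro ⟨n, m⟩ hp hne
    have hp' := Finset.HasAntidiagonal.mem_antidiagonal.1 hp
    have hm : m ≠ 0 := by
      rintro rfl
      simp at hp'
      exact hne (by rw [hp'])
    simp [sum_forests_zero, hm]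
  · intro h
    exact absurd (Finset.HasAntidiagonal.mem_antidiagonal.2 (by simp)) h

lemma sum_forests_two {M : Type*} [AddCommMonoid M] (N : ℕ) (f : List CollapseTree → M) :
    ∑ F ∈ forests 2 N, f F = ∑ p ∈ Finset.HasAntidiagonal.antidiagonal N,
      ∑ L ∈ trees p.1, ∑ R ∈ trees p.2, f [L, R] := by
  rw [sum_forests_succ]
  simp_rw [sum_forests_one]

lemma dfamp_of_mem_forests_zero (k : ℕ) : ∀ {F : List CollapseTree}, F ∈ forests k 0 →
    ∀ (o : ℕ) (ξ : ℕ → Pair) (σ t : ℝ), dfamp β F o ξ σ t = 0 := by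
  classical
  induction k with
  | zero => 
    intro F hF
    simp [forests] at hF
    simp [hF, dfamp]
  | succ k ih =>
    intro F hF o ξ σ t
    rw [forests] at hF
    simp only [Finset.mem_biUnion, Finset.mem_image, Finset.mem_product] at hF
    obtain ⟨p, hp, ⟨T, F⟩, ⟨hT, hF⟩, rfl⟩ := hF
    have hp' := Finset.HasAntidiagonal.mem_antidiagonal.1 hp
    have h1 : p.1 = 0 := by omega
    have h2 : p.2 = 0 := by omega
    rw [h1, trees_zero, Finset.mem_singleton] at hT
    rw [h2] at hF
    dsimp only at hT hF
    rw [hT]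
    simp [dfamp, damp, ih hF]

/-- Splitting off the first collapse of a history of a single pair. -/
def TreeStep (β : ℝ → ℝ) (n : ℕ) : Prop :=
  ∀ (Ψ : Pair → ℂ) (o : ℕ) (ξ : ℕ → Pair) (σ t : ℝ),
    ∑ T ∈ trees (n + 1), Ψ (root T o ξ) * damp β T o ξ σ t
      = ∑ j ∈ Finset.range (n + 1), ∑ b : Bool,
        (β σ : ℂ) * vertex b (ξ (o + j)) (ξ (o + j + 1)) σ *
          ∑ T ∈ trees n, Ψ (root T o (mergeAt (o + j) b ξ)) * amp β T o (mergeAt (o + j) b ξ) σ t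

/-- Splitting off the first collapse of a history of several pairs. -/
def ForestStep (β : ℝ → ℝ) (k N : ℕ) : Prop :=
  ∀ (Ψ : List Pair → ℂ) (o : ℕ) (ξ : ℕ → Pair) (σ t : ℝ),
    ∑ F ∈ forests k (N + 1), Ψ (roots F o ξ) * dfamp β F o ξ σ t
      = ∑ j ∈ Finset.range (k + N), ∑ b : Bool,
        (β σ : ℂ) * vertex b (ξ (o + j)) (ξ (o + j + 1)) σ *
          ∑ F ∈ forests k N, Ψ (roots F o (mergeAt (o + j) b ξ))
            * famp β F o (mergeAt (o + j) b ξ) σ t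

/-- The amplitude of a forest is a product, so its derivative places the earliest collapse in
exactly one tree. If this is the first tree, the labels of the others move up by one, which is what
`mergeAt` does; otherwise the first tree does not notice it. -/
lemma forestStep_of_treeStep (k : ℕ) : ∀ N, (∀ n ≤ N, TreeStep β n) → ForestStep β k N := by
  induction k with
  | zero =>
    intro N _ Ψ o ξ σ t
    rw [sum_forests_zero]
    simp only [Nat.add_eq_zero_iff, one_ne_zero, and_false, if_false, zero_add]
    cases N with
    | zero => simp
    | succ N =>
      symm
      refine Finset.sum_eq_zero fun j _ => Finset.sum_eq_zero fun b _ => ?_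
      rw [sum_forests_zero]
      simp
  | succ k ih =>
    intro N hN Ψ o ξ σ t
    set V : ℕ → Bool → ℂ := fun j b => (β σ : ℂ) * vertex b (ξ (o + j)) (ξ (o + j + 1)) σ with hV
    -- the first collapse in the first tree
    have first : ∑ p ∈ Finset.HasAntidiagonal.antidiagonal (N + 1),
        ∑ T ∈ trees p.1, ∑ F ∈ forests k p.2, Ψ (root T o ξ :: roots F (o + p.1 + 1) ξ) *
          (damp β T o ξ σ t * famp β F (o + p.1 + 1) ξ σ t)
        = ∑ p ∈ Finset.HasAntidiagonal.antidiagonal N, ∑ j ∈ Finset.range (p.1 + 1), ∑ b : Bool,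
          V j b * ∑ T ∈ trees p.1, ∑ F ∈ forests k p.2,
            Ψ (root T o (mergeAt (o + j) b ξ) :: roots F (o + p.1 + 1) (mergeAt (o + j) b ξ)) *
            (amp β T o (mergeAt (o + j) b ξ) σ t
              * famp β F (o + p.1 + 1) (mergeAt (o + j) b ξ) σ t) := by
      rw [Finset.Nat.sum_antidiagonal_succ]
      have z : ∑ T ∈ trees (0, N + 1).1, ∑ F ∈ forests k (0, N + 1).2,
          Ψ (root T o ξ :: roots F (o + (0, N + 1).1 + 1) ξ) *
          (damp β T o ξ σ t * famp β F (o + (0, N + 1).1 + 1) ξ σ t) = 0 := by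
        rw [trees_zero]
        simp [damp]
      rw [z, zero_add]
      refine Finset.sum_congr rfl fun p hp => ?_
      rw [Finset.sum_comm]
      have hp' := Finset.HasAntidiagonal.mem_antidiagonal.1 hp
      have key : ∀ F ∈ forests k p.2, ∑ T ∈ trees (p.1 + 1),
          Ψ (root T o ξ :: roots F (o + (p.1 + 1) + 1) ξ) *
          (damp β T o ξ σ t * famp β F (o + (p.1 + 1) + 1) ξ σ t)
          = ∑ j ∈ Finset.range (p.1 + 1), ∑ b : Bool, V j b * ∑ T ∈ trees p.1,
            Ψ (root T o (mergeAt (o + j) b ξ) :: roots F (o + p.1 + 1) (mergeAt (o + j) b ξ)) *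
            (amp β T o (mergeAt (o + j) b ξ) σ t
              * famp β F (o + p.1 + 1) (mergeAt (o + j) b ξ) σ t) := by
        intro F _
        have := hN p.1 (by omega) (fun x => Ψ (x :: roots F (o + (p.1 + 1) + 1) ξ)
          * famp β F (o + (p.1 + 1) + 1) ξ σ t) o ξ σ t
        rw [Finset.sum_congr rfl fun T _ => (by ring :
          Ψ (root T o ξ :: roots F (o + (p.1 + 1) + 1) ξ) *
          (damp β T o ξ σ t * famp β F (o + (p.1 + 1) + 1) ξ σ t)
          = Ψ (root T o ξ :: roots F (o + (p.1 + 1) + 1) ξ)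
            * famp β F (o + (p.1 + 1) + 1) ξ σ t * damp β T o ξ σ t), this]
        refine Finset.sum_congr rfl fun j hj => Finset.sum_congr rfl fun b _ => ?_
        congr 1
        refine Finset.sum_congr rfl fun T _ => ?_
        have hc := forest_congr (β := β) F (o + (p.1 + 1) + 1) (o + p.1 + 1) ξ
          (mergeAt (o + j) b ξ) fun i _ => by
            rw [mergeAt_of_gt (by have := Finset.mem_range.1 hj; omega)]
            congr 1
            omega
        rw [hc.1, hc.2]
        ring
      rw [Finset.sum_congr rfl key, Finset.sum_comm]
      refine Finset.sum_congr rfl fun j _ => ?_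
      rw [Finset.sum_comm]
      refine Finset.sum_congr rfl fun b _ => ?_
      rw [← Finset.mul_sum, Finset.sum_comm]
    -- the first collapse in one of the other trees
    have other : ∑ p ∈ Finset.HasAntidiagonal.antidiagonal (N + 1),
        ∑ T ∈ trees p.1, ∑ F ∈ forests k p.2, Ψ (root T o ξ :: roots F (o + p.1 + 1) ξ) *
          (amp β T o ξ σ t * dfamp β F (o + p.1 + 1) ξ σ t)
        = ∑ p ∈ Finset.HasAntidiagonal.antidiagonal N, ∑ j ∈ Finset.range (k + p.2), ∑ b : Bool,
          V (p.1 + 1 + j) b * ∑ T ∈ trees p.1, ∑ F ∈ forests k p.2,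
            Ψ (root T o (mergeAt (o + (p.1 + 1 + j)) b ξ)
              :: roots F (o + p.1 + 1) (mergeAt (o + (p.1 + 1 + j)) b ξ)) *
            (amp β T o (mergeAt (o + (p.1 + 1 + j)) b ξ) σ t
              * famp β F (o + p.1 + 1) (mergeAt (o + (p.1 + 1 + j)) b ξ) σ t) := by
      rw [Finset.Nat.sum_antidiagonal_succ']
      have z : ∑ T ∈ trees (N + 1, 0).1, ∑ F ∈ forests k (N + 1, 0).2,
          Ψ (root T o ξ :: roots F (o + (N + 1, 0).1 + 1) ξ) *
          (amp β T o ξ σ t * dfamp β F (o + (N + 1, 0).1 + 1) ξ σ t) = 0 := by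
        refine Finset.sum_eq_zero fun T _ => Finset.sum_eq_zero fun F hF => ?_
        rw [dfamp_of_mem_forests_zero k hF]
        ring
      rw [z, zero_add]
      refine Finset.sum_congr rfl fun p hp => ?_
      have hp' := Finset.HasAntidiagonal.mem_antidiagonal.1 hp
      have key : ∀ T ∈ trees p.1, ∑ F ∈ forests k (p.2 + 1),
          Ψ (root T o ξ :: roots F (o + p.1 + 1) ξ) *
          (amp β T o ξ σ t * dfamp β F (o + p.1 + 1) ξ σ t)
          = ∑ j ∈ Finset.range (k + p.2), ∑ b : Bool, V (p.1 + 1 + j) b * ∑ F ∈ forests k p.2,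
            Ψ (root T o (mergeAt (o + (p.1 + 1 + j)) b ξ)
              :: roots F (o + p.1 + 1) (mergeAt (o + (p.1 + 1 + j)) b ξ)) *
            (amp β T o (mergeAt (o + (p.1 + 1 + j)) b ξ) σ t
              * famp β F (o + p.1 + 1) (mergeAt (o + (p.1 + 1 + j)) b ξ) σ t) := by
        intro T hT
        have := ih p.2 (fun n hn => hN n (by omega)) (fun x => Ψ (root T o ξ :: x)
          * amp β T o ξ σ t) (o + p.1 + 1) ξ σ t
        rw [Finset.sum_congr rfl fun F _ => (by ring :
          Ψ (root T o ξ :: roots F (o + p.1 + 1) ξ) *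
          (amp β T o ξ σ t * dfamp β F (o + p.1 + 1) ξ σ t)
          = Ψ (root T o ξ :: roots F (o + p.1 + 1) ξ)
            * amp β T o ξ σ t * dfamp β F (o + p.1 + 1) ξ σ t), this]
        refine Finset.sum_congr rfl fun j hj => Finset.sum_congr rfl fun b _ => ?_
        simp only [hV]
        have e : o + p.1 + 1 + j = o + (p.1 + 1 + j) := by omega
        rw [e]
        congr 1
        refine Finset.sum_congr rfl fun F _ => ?_
        have hs : ∀ i ≤ T.nodes, ξ (o + i) = mergeAt (o + (p.1 + 1 + j)) b ξ (o + i) :=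
          fun i hi => by
            rw [nodes_of_mem_trees _ hT] at hi
            rw [mergeAt_of_lt (by omega)]
        rw [root_congr T o o _ _ hs, amp_congr T o o _ _ σ t hs]
        ring
      rw [Finset.sum_congr rfl key, Finset.sum_comm]
      refine Finset.sum_congr rfl fun j _ => ?_
      rw [Finset.sum_comm]
      refine Finset.sum_congr rfl fun b _ => ?_
      rw [← Finset.mul_sum]
    rw [sum_forests_succ]
    have lhs : ∑ p ∈ Finset.HasAntidiagonal.antidiagonal (N + 1),
        ∑ T ∈ trees p.1, ∑ F ∈ forests k p.2, Ψ (roots (T :: F) o ξ) * dfamp β (T :: F) o ξ σ t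
        = (∑ p ∈ Finset.HasAntidiagonal.antidiagonal (N + 1),
        ∑ T ∈ trees p.1, ∑ F ∈ forests k p.2, Ψ (root T o ξ :: roots F (o + p.1 + 1) ξ) *
          (damp β T o ξ σ t * famp β F (o + p.1 + 1) ξ σ t))
        + ∑ p ∈ Finset.HasAntidiagonal.antidiagonal (N + 1),
        ∑ T ∈ trees p.1, ∑ F ∈ forests k p.2, Ψ (root T o ξ :: roots F (o + p.1 + 1) ξ) *
          (amp β T o ξ σ t * dfamp β F (o + p.1 + 1) ξ σ t) := by
      simp only [← Finset.sum_add_distrib]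
      refine Finset.sum_congr rfl fun p _ => Finset.sum_congr rfl fun T hT =>
        Finset.sum_congr rfl fun F _ => ?_
      simp only [roots, dfamp, nodes_of_mem_trees _ hT]
      ring
    rw [lhs, first, other, ← Finset.sum_add_distrib]
    set W : ℕ → Bool → ℕ × ℕ → ℂ := fun j b p => ∑ T ∈ trees p.1, ∑ F ∈ forests k p.2,
      Ψ (root T o (mergeAt (o + j) b ξ) :: roots F (o + p.1 + 1) (mergeAt (o + j) b ξ)) *
            (amp β T o (mergeAt (o + j) b ξ) σ t
              * famp β F (o + p.1 + 1) (mergeAt (o + j) b ξ) σ t) with hW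
    -- Once the collapse is removed, the first tree owns the positions `0, …, p.1` and the remaining
    -- forest the next `k + p.2` ones. The two blocks fill `range (k + 1 + N)`, independently of
    -- `p`.
    have merge : ∀ p ∈ Finset.HasAntidiagonal.antidiagonal N,
        (∑ j ∈ Finset.range (p.1 + 1), ∑ b : Bool, V j b * W j b p)
          + ∑ j ∈ Finset.range (k + p.2), ∑ b : Bool, V (p.1 + 1 + j) b * W (p.1 + 1 + j) b p
        = ∑ j ∈ Finset.range (k + 1 + N), ∑ b : Bool, V j b * W j b p := by
      intro p hp
      have hp' := Finset.HasAntidiagonal.mem_antidiagonal.1 hp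
      have e : k + 1 + N = (p.1 + 1) + (k + p.2) := by omega
      rw [e, Finset.sum_range_add _ (p.1 + 1)]
    rw [Finset.sum_congr rfl merge, Finset.sum_comm]
    refine Finset.sum_congr rfl fun j _ => ?_
    rw [Finset.sum_comm]
    refine Finset.sum_congr rfl fun b _ => ?_
    rw [← Finset.mul_sum, sum_forests_succ]
    congr 1
    refine Finset.sum_congr rfl fun p _ => Finset.sum_congr rfl fun T hT =>
        Finset.sum_congr rfl fun F _ => ?_
    simp only [roots, famp, nodes_of_mem_trees _ hT]

/-- Deleting the root of a tree leaves a forest of two trees under an integral over the time of the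
root. If further collapses remain, the earliest one is split off from this forest inside the
integral; otherwise the root itself is the earliest. -/
lemma treeStep (hβ : Continuous β) : ∀ n, TreeStep β n := by
  intro n
  induction n using Nat.strong_induction_on with
  | _ n ih =>
    intro Ψ o ξ σ t
    cases n with
    | zero =>
      rw [sum_trees_succ]
      simp [trees_zero, damp, root, amp, nodes, mergeAt_self]
      ring
    | succ n =>
      have hF := forestStep_of_treeStep (β := β) 2 n fun m hm => ih m (by omega)
      -- The root collapse, read as an observable of the two subtrees. Lists of any other length do
      -- not occur, and their value is a dummy.
      set Φ : Bool → ℝ → List Pair → ℂ := fun b τ x => match x with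
        | [x, y] => Ψ (merge b x y) * ((β τ : ℂ) * vertex b x y τ)
        | _ => 0 with hΦ
      have hc : ∀ (b : Bool) (x : List Pair), Continuous fun τ => Φ b τ x := by
        intro b x
        simp only [hΦ]
        split
        · have := continuous_vertex b
          fun_prop
        · fun_prop
      have hc2 : ∀ (ζ : ℕ → Pair) (F : List CollapseTree),
          Continuous fun τ => famp β F o ζ σ τ := fun ζ F =>
        (continuous_famp hβ F o ζ).comp (by fun_prop : Continuous fun τ : ℝ => (σ, τ))
      have hc3 : ∀ (ζ : ℕ → Pair) (F : List CollapseTree),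
          Continuous fun τ => dfamp β F o ζ σ τ := fun ζ F =>
        (continuous_dfamp hβ F o ζ).comp (by fun_prop : Continuous fun τ : ℝ => (σ, τ))
      have lhs : ∑ T ∈ trees (n + 1 + 1), Ψ (root T o ξ) * damp β T o ξ σ t
          = ∑ b : Bool, ∫ τ in σ..t, ∑ F ∈ forests 2 (n + 1),
            Φ b τ (roots F o ξ) * dfamp β F o ξ σ τ := by
        rw [sum_trees_succ]
        refine Finset.sum_congr rfl fun b _ => ?_
        rw [intervalIntegral.integral_finsetSum (by
          intro F _
          apply Continuous.intervalIntegrable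
          exact (hc b _).mul (hc3 ξ F)), sum_forests_two]
        refine Finset.sum_congr rfl fun p hp => Finset.sum_congr rfl fun L hL =>
          Finset.sum_congr rfl fun R hR => ?_
        have hp' := Finset.HasAntidiagonal.mem_antidiagonal.1 hp
        -- The boundary term would have the root collapse at the leaf time `σ`. At least one subtree
        -- still contains a collapse, and its amplitude over the empty time interval is zero.
        have hLR : amp β L o ξ σ σ * amp β R (o + L.nodes + 1) ξ σ σ = 0 := by
          cases L with
          | node b l r => simp [amp]
          | leaf =>
            cases R with
            | node b l r => simp [amp]
            | leaf =>
              have h1 := nodes_of_mem_trees _ hL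
              have h2 := nodes_of_mem_trees _ hR
              simp only [nodes] at h1 h2
              omega
        simp only [damp, hLR, mul_zero, zero_add, root]
        rw [← intervalIntegral.integral_const_mul]
        refine intervalIntegral.integral_congr fun τ _ => ?_
        simp only [hΦ, roots, dfamp, famp]
        ring
      have rhs : ∀ ζ : ℕ → Pair, ∑ T ∈ trees (n + 1), Ψ (root T o ζ) * amp β T o ζ σ t
          = ∑ b : Bool, ∫ τ in σ..t, ∑ F ∈ forests 2 n,
            Φ b τ (roots F o ζ) * famp β F o ζ σ τ := by
        intro ζ
        rw [sum_trees_succ]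
        refine Finset.sum_congr rfl fun b _ => ?_
        rw [intervalIntegral.integral_finsetSum (by
          intro F _
          apply Continuous.intervalIntegrable
          exact (hc b _).mul (hc2 ζ F)), sum_forests_two]
        refine Finset.sum_congr rfl fun p hp => Finset.sum_congr rfl fun L hL =>
          Finset.sum_congr rfl fun R hR => ?_
        simp only [amp, root]
        rw [← intervalIntegral.integral_const_mul]
        refine intervalIntegral.integral_congr fun τ _ => ?_
        simp only [hΦ, roots, famp]
        ring
      have step : ∀ b : Bool, (∫ τ in σ..t, ∑ F ∈ forests 2 (n + 1),
            Φ b τ (roots F o ξ) * dfamp β F o ξ σ τ)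
          = ∑ j ∈ Finset.range (2 + n), ∑ b' : Bool,
            (β σ : ℂ) * vertex b' (ξ (o + j)) (ξ (o + j + 1)) σ *
              ∫ τ in σ..t, ∑ F ∈ forests 2 n, Φ b τ (roots F o (mergeAt (o + j) b' ξ))
                * famp β F o (mergeAt (o + j) b' ξ) σ τ := by
        intro b
        have hcont : ∀ ζ : ℕ → Pair, Continuous fun τ => ∑ F ∈ forests 2 n,
            Φ b τ (roots F o ζ) * famp β F o ζ σ τ := fun ζ =>
          continuous_finsetSum _ fun F _ => (hc b _).mul (hc2 ζ F)
        rw [intervalIntegral.integral_congr fun τ _ => hF (Φ b τ) o ξ σ τ,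
          intervalIntegral.integral_finsetSum]
        · refine Finset.sum_congr rfl fun j _ => ?_
          rw [intervalIntegral.integral_finsetSum]
          · refine Finset.sum_congr rfl fun b' _ => ?_
            rw [intervalIntegral.integral_const_mul]
          · intro b' _
            exact (continuous_const.mul (hcont _)).intervalIntegrable _ _
        · intro j _
          exact (continuous_finsetSum _ fun b' _ =>
            continuous_const.mul (hcont _)).intervalIntegrable _ _
      rw [lhs, Finset.sum_congr rfl fun b _ => step b, Finset.sum_comm, add_comm 2 n]
      refine Finset.sum_congr rfl fun j _ => ?_
      rw [Finset.sum_comm]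
      refine Finset.sum_congr rfl fun b' _ => ?_
      rw [rhs, Finset.mul_sum]

/-- The sum over all histories with `N` collapses. -/
def forestSum (β : ℝ → ℝ) (k N : ℕ) (Ψ : List Pair → ℂ) (ξ : ℕ → Pair) (σ t : ℝ) : ℂ :=
  ∑ F ∈ forests k N, Ψ (roots F 0 ξ) * famp β F 0 ξ σ t

lemma continuous_forestSum (hβ : Continuous β) (k N : ℕ) (Ψ : List Pair → ℂ) (ξ : ℕ → Pair) :
    Continuous fun p : ℝ × ℝ => forestSum β k N Ψ ξ p.1 p.2 :=
  continuous_finsetSum _ fun F _ => continuous_const.mul (continuous_famp hβ F 0 ξ)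

lemma famp_self_of_mem_forests_succ (k : ℕ) : ∀ (N : ℕ) {F : List CollapseTree},
    F ∈ forests k (N + 1) → ∀ (o : ℕ) (ξ : ℕ → Pair) (t : ℝ), famp β F o ξ t t = 0 := by
  classical
  induction k with
  | zero => intro N F hF; simp [forests] at hF
  | succ k ih =>
    intro N F hF o ξ t
    rw [forests] at hF
    simp only [Finset.mem_biUnion, Finset.mem_image, Finset.mem_product] at hF
    obtain ⟨p, hp, ⟨T, F⟩, ⟨hT, hF⟩, rfl⟩ := hF
    have hp' := Finset.HasAntidiagonal.mem_antidiagonal.1 hp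
    cases T with
    | node b l r => simp [famp, amp]
    | leaf =>
      have h1 := nodes_of_mem_trees _ hT
      simp only [nodes] at h1
      obtain ⟨m, hm⟩ : ∃ m, p.2 = m + 1 := ⟨N, by omega⟩
      rw [hm] at hF
      simp [famp, ih m hF]

lemma forestSum_zero (k : ℕ) (Ψ : List Pair → ℂ) (ξ : ℕ → Pair) (σ t : ℝ) :
    forestSum β k 0 Ψ ξ σ t = Ψ ((List.range k).map ξ) := by
  suffices h : ∀ (k o : ℕ) (Ψ : List Pair → ℂ), ∑ F ∈ forests k 0, Ψ (roots F o ξ) * famp β F o ξ σ t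
      = Ψ ((List.range k).map fun i => ξ (o + i)) by
    have := h k 0 Ψ
    simp only [zero_add] at this
    exact this
  intro k
  induction k with
  | zero => intro o Ψ; simp [sum_forests_zero, roots, famp]
  | succ k ih =>
    intro o Ψ
    rw [sum_forests_succ]
    have := ih (o + 1) fun x => Ψ (ξ o :: x)
    simp [trees_zero, roots, famp, amp, root, nodes, this, List.range_succ_eq_map,
      Function.comp_def]
    congr 3
    funext i
    congr 1
    omega

/-- With at least one collapse the amplitudes vanish at `σ = t`, so they are integrals of their
derivatives, and the derivatives are summed by the step for forests. The right side is one step of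
the time-ordered Duhamel expansion, while a forest orders only a collapse and its descendants; so
the ordered terms are regrouped without loss. -/
theorem forestSum_succ (hβ : Continuous β) (k N : ℕ) (Ψ : List Pair → ℂ) (ξ : ℕ → Pair)
    {σ t : ℝ} (hσ : σ ≤ t) :
    forestSum β k (N + 1) Ψ ξ σ t = ∫ r in σ..t, ∑ j ∈ Finset.range (k + N), ∑ b : Bool,
      (β r : ℂ) * vertex b (ξ j) (ξ (j + 1)) r * forestSum β k N Ψ (mergeAt j b ξ) r t := by
  have hstep := forestStep_of_treeStep (β := β) k N fun n _ => treeStep hβ n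
  have e := fun r => hstep Ψ 0 ξ r t
  simp only [zero_add] at e
  simp only [forestSum]
  simp_rw [← e]
  rw [intervalIntegral.integral_finsetSum]
  · refine Finset.sum_congr rfl fun F hF => ?_
    rw [famp_eq_add_integral hβ F 0 ξ t σ hσ, famp_self_of_mem_forests_succ k N hF, zero_add,
      intervalIntegral.integral_const_mul]
  · intro F _
    exact (continuous_const.mul ((continuous_dfamp hβ F 0 ξ).comp
      (by fun_prop : Continuous fun r : ℝ => (r, t)))).intervalIntegrable _ _

end CollapseTree


/-! ### Measurability with parameters and concatenation of finite families. -/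

lemma measurable_intervalIntegral_param {X : Type*} [MeasurableSpace X] {f : X → ℝ → ℂ}
    {a b : X → ℝ} (hf : Measurable fun p : X × ℝ => f p.1 p.2) (ha : Measurable a)
    (hb : Measurable b) : Measurable fun x => ∫ τ in a x..b x, f x τ := by
  have key : ∀ {a b : X → ℝ}, Measurable a → Measurable b →
      Measurable fun x => ∫ τ in Set.Ioc (a x) (b x), f x τ := by
    intro a b ha hb
    have hs : MeasurableSet {p : X × ℝ | p.2 ∈ Set.Ioc (a p.1) (b p.1)} :=
      (measurableSet_lt (ha.comp measurable_fst) measurable_snd).inter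
        (measurableSet_le measurable_snd (hb.comp measurable_fst))
    have := (hf.indicator hs).stronglyMeasurable.integral_prod_right' (ν := volume)
    convert this.measurable using 2 with x
    rw [← integral_indicator measurableSet_Ioc]
    rfl
  simp only [intervalIntegral]
  exact (key ha hb).sub (key hb ha)

/-- A finite family as the beginning of a sequence. -/
def extendSeq {n : ℕ} (x : Fin n → Pair) (i : ℕ) : Pair := if h : i < n then x ⟨i, h⟩ else 0

lemma measurable_extendSeq {n : ℕ} : Measurable (extendSeq : (Fin n → Pair) → ℕ → Pair) := by
  refine measurable_pi_lambda _ fun i => ?_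
  unfold extendSeq
  split_ifs <;> fun_prop

lemma extendSeq_append_left {m n : ℕ} (x : Fin m → Pair) (y : Fin n → Pair) {i : ℕ} (hi : i < m) :
    extendSeq (Fin.append x y) i = extendSeq x i := by
  have h : i < m + n := by omega
  simp only [extendSeq, h, hi, dif_pos]
  exact Fin.append_left x y ⟨i, hi⟩

lemma extendSeq_append_right {m n : ℕ} (x : Fin m → Pair) (y : Fin n → Pair) {i : ℕ} (hi : i < n) :
    extendSeq (Fin.append x y) (m + i) = extendSeq y i := by
  have h : m + i < m + n := by omega
  simp only [extendSeq, h, hi, dif_pos]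
  exact Fin.append_right x y ⟨i, hi⟩

lemma measurable_append {X : Type*} [MeasurableSpace X] {m n : ℕ} :
    Measurable fun p : (Fin m → X) × (Fin n → X) => Fin.append p.1 p.2 := by
  refine measurable_pi_lambda _ fun i => ?_
  refine Fin.addCases (fun i => ?_) (fun i => ?_) i
  · simp only [Fin.append_left]; fun_prop
  · simp only [Fin.append_right]; fun_prop

lemma measurePreserving_append {X : Type*} [MeasureSpace X] [SigmaFinite (volume : Measure X)]
    (m n : ℕ) : MeasurePreserving (fun p : (Fin m → X) × (Fin n → X) => Fin.append p.1 p.2) := by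
  have h1 := (volume_measurePreserving_sumPiEquivProdPi fun _ : Fin m ⊕ Fin n => X).symm
  have h2 := volume_measurePreserving_piCongrLeft (fun _ : Fin (m + n) => X) finSumFinEquiv
  have e : (fun p : (Fin m → X) × (Fin n → X) => Fin.append p.1 p.2)
      = MeasurableEquiv.piCongrLeft (fun _ : Fin (m + n) => X) finSumFinEquiv ∘
        (MeasurableEquiv.sumPiEquivProdPi fun _ : Fin m ⊕ Fin n => X).symm := by
    funext p i
    refine Fin.addCases (fun i => ?_) (fun i => ?_) i
    · simp only [Fin.append_left, Function.comp]
      rw [MeasurableEquiv.coe_piCongrLeft, ← finSumFinEquiv_apply_left,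
        Equiv.piCongrLeft_apply_apply]
      rfl
    · simp only [Fin.append_right, Function.comp]
      rw [MeasurableEquiv.coe_piCongrLeft, ← finSumFinEquiv_apply_right,
        Equiv.piCongrLeft_apply_apply]
      rfl
  rw [e]
  exact h2.comp h1

lemma lintegral_append {X : Type*} [MeasureSpace X] [SigmaFinite (volume : Measure X)]
    {m n : ℕ} {f : (Fin (m + n) → X) → ℝ≥0∞} (hf : Measurable f) :
    ∫⁻ z, f z = ∫⁻ x : Fin m → X, ∫⁻ y : Fin n → X, f (Fin.append x y) := by
  rw [← (measurePreserving_append m n).lintegral_comp hf, Measure.volume_eq_prod]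
  exact lintegral_prod _ (hf.comp measurable_append).aemeasurable

lemma lintegral_fin_one {X : Type*} [MeasureSpace X] [SigmaFinite (volume : Measure X)]
    {f : (Fin 1 → X) → ℝ≥0∞} : ∫⁻ z, f z = ∫⁻ x : X, f fun _ => x :=
  (((volume_preserving_funUnique (Fin 1) X).symm).lintegral_comp_emb
    (MeasurableEquiv.measurableEmbedding _) f).symm

/-- Exchange of integrals for a bounded kernel. -/
lemma integral_mul_integral_kernel {X Y : Type*} [MeasurableSpace X] [MeasurableSpace Y]
    {μ : Measure X} {ν : Measure Y} [SFinite μ] [SFinite ν] {f : X → ℂ} {d : Y → ℂ}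
    {k : X → Y → ℂ} (hf : Integrable f μ) (hd : Integrable d ν)
    (hk : Measurable fun p : X × Y => k p.1 p.2) {M : ℝ} (hM : ∀ x y, ‖k x y‖ ≤ M) :
    ∫ x, f x * ∫ y, k x y * d y ∂ν ∂μ = ∫ y, (∫ x, f x * k x y ∂μ) * d y ∂ν := by
  have hi : Integrable (Function.uncurry fun x y => f x * (k x y * d y)) (μ.prod ν) := by
    have := (hf.mul_prod hd).bdd_mul (f := fun p : X × Y => k p.1 p.2) hk.aestronglyMeasurable
      (.of_forall fun p => hM p.1 p.2)
    refine this.congr (.of_forall fun p => ?_)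
    simp only [Function.uncurry]
    ring
  have := integral_integral_swap hi
  simp_rw [integral_const_mul] at this
  rw [this]
  refine integral_congr_ae (.of_forall fun y => ?_)
  dsimp only
  rw [← integral_mul_const]
  refine integral_congr_ae (.of_forall fun x => ?_)
  dsimp only
  ring

/-! ### Amplitudes as integrals over the time of the root. -/

namespace CollapseTree

variable {β : ℝ → ℝ}

lemma measurable_root (T : CollapseTree) : ∀ o, Measurable (root T o) := by
  induction T with
  | leaf => intro o; simp only [root]; fun_prop
  | node b l r ihl ihr =>
    intro o
    simp only [root]
    exact (measurable_merge b).comp ((ihl o).prodMk (ihr _))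

lemma measurable_amp (hβ : Continuous β) (T : CollapseTree) : ∀ o,
    Measurable fun p : (ℕ → Pair) × ℝ × ℝ => amp β T o p.1 p.2.1 p.2.2 := by
  induction T with
  | leaf => intro o; simp only [amp]; fun_prop
  | node b l r ihl ihr =>
    intro o
    simp only [amp]
    refine measurable_intervalIntegral_param (X := (ℕ → Pair) × ℝ × ℝ)
      (f := fun p τ => (β τ : ℂ) * vertex b (root l o p.1) (root r (o + l.nodes + 1) p.1) τ
        * (amp β l o p.1 p.2.1 τ * amp β r (o + l.nodes + 1) p.1 p.2.1 τ)) ?_ (by fun_prop)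
        (by fun_prop)
    have h1 := (ihl o).comp (by fun_prop : Measurable fun p : ((ℕ → Pair) × ℝ × ℝ) × ℝ =>
      (p.1.1, p.1.2.1, p.2))
    have h2 := (ihr (o + l.nodes + 1)).comp
      (by fun_prop : Measurable fun p : ((ℕ → Pair) × ℝ × ℝ) × ℝ => (p.1.1, p.1.2.1, p.2))
    have h3 := measurable_root l o
    have h4 := measurable_root r (o + l.nodes + 1)
    have h5 := (measurable_vertex b).comp (((h3.comp measurable_fst).comp measurable_fst).prodMk
      (((h4.comp measurable_fst).comp measurable_fst).prodMk measurable_snd) :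
      Measurable fun p : ((ℕ → Pair) × ℝ × ℝ) × ℝ =>
        (root l o p.1.1, root r (o + l.nodes + 1) p.1.1, p.2))
    simp only [Function.comp_def] at h1 h2 h5
    have h6 := hβ.measurable
    fun_prop

/-- The measure `δ_σ + T⁻¹ dτ` on `[σ, σ + T]`. -/
def timeMeasure (σ T : ℝ) : Measure ℝ :=
  Measure.dirac σ + (ENNReal.ofReal T)⁻¹ • volume.restrict (Set.Ioc σ (σ + T))

lemma timeMeasure_univ {σ T : ℝ} (hT : 0 < T) : timeMeasure σ T Set.univ = 2 := by
  simp [timeMeasure, ENNReal.inv_mul_cancel (ENNReal.ofReal_pos.2 hT).ne' ENNReal.ofReal_ne_top]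
  norm_num

lemma isFiniteMeasure_timeMeasure {σ T : ℝ} (hT : 0 < T) : IsFiniteMeasure (timeMeasure σ T) :=
  ⟨by rw [timeMeasure_univ hT]; simp⟩

lemma lintegral_Ioc_le_timeMeasure {σ T : ℝ} (hT : 0 < T) (f : ℝ → ℝ≥0∞) :
    ∫⁻ τ in Set.Ioc σ (σ + T), f τ ≤ ENNReal.ofReal T * ∫⁻ τ, f τ ∂timeMeasure σ T := by
  rw [timeMeasure, lintegral_add_measure, lintegral_smul_measure, mul_add, smul_eq_mul,
    ← mul_assoc, ENNReal.mul_inv_cancel (ENNReal.ofReal_pos.2 hT).ne' ENNReal.ofReal_ne_top,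
    one_mul]
  exact le_add_self

/-- The density of the amplitude, in the time of the root, with respect to `timeMeasure`. -/
def dens (β : ℝ → ℝ) (T : ℝ) : CollapseTree → (ℕ → Pair) → ℝ → ℝ → ℂ
  | leaf, _, σ, τ => if τ = σ then 1 else 0
  | node b l r, ξ, σ, τ => if σ < τ then (T : ℂ) * ((β τ : ℂ) *
      vertex b (root l 0 ξ) (root r (0 + l.nodes + 1) ξ) τ
        * (amp β l 0 ξ σ τ * amp β r (0 + l.nodes + 1) ξ σ τ)) else 0

lemma measurable_dens (hβ : Continuous β) (T₁ : ℝ) (T : CollapseTree) (σ : ℝ) :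
    Measurable fun p : (ℕ → Pair) × ℝ => dens β T₁ T p.1 σ p.2 := by
  cases T with
  | leaf =>
    simp only [dens]
    exact Measurable.ite (measurableSet_eq_fun measurable_snd measurable_const) measurable_const
      measurable_const
  | node b l r =>
    simp only [dens]
    refine Measurable.ite (measurableSet_lt measurable_const measurable_snd) ?_ measurable_const
    have h1 := (measurable_amp hβ l 0).comp (by fun_prop : Measurable fun p : (ℕ → Pair) × ℝ =>
      (p.1, σ, p.2))
    have h2 := (measurable_amp hβ r (0 + l.nodes + 1)).comp
      (by fun_prop : Measurable fun p : (ℕ → Pair) × ℝ => (p.1, σ, p.2))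
    have h3 := measurable_root l 0
    have h4 := measurable_root r (0 + l.nodes + 1)
    have h5 := (measurable_vertex b).comp ((h3.comp measurable_fst).prodMk
      ((h4.comp measurable_fst).prodMk measurable_snd) :
      Measurable fun p : (ℕ → Pair) × ℝ =>
        (root l 0 p.1, root r (0 + l.nodes + 1) p.1, p.2))
    simp only [Function.comp_def] at h1 h2 h5
    have h6 := hβ.measurable
    fun_prop

lemma integral_timeMeasure {σ T : ℝ} (hT : 0 < T) {f : ℝ → ℂ}
    (hf : IntegrableOn f (Set.Ioc σ (σ + T))) :
    ∫ τ, f τ ∂timeMeasure σ T = f σ + (T : ℂ)⁻¹ * ∫ τ in Set.Ioc σ (σ + T), f τ := by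
  have hn : (ENNReal.ofReal T)⁻¹ ≠ ∞ := ENNReal.inv_ne_top.2 (ENNReal.ofReal_pos.2 hT).ne'
  rw [timeMeasure, integral_add_measure, integral_dirac, integral_smul_measure]
  · rw [ENNReal.toReal_inv, ENNReal.toReal_ofReal hT.le, Complex.real_smul]
    push_cast
    rfl
  · exact integrable_dirac (by simp)
  · exact hf.smul_measure hn

lemma integrable_dens (hβ : Continuous β) {T₁ : ℝ} (hT : 0 < T₁) (T : CollapseTree)
    (ξ : ℕ → Pair) (σ : ℝ) : Integrable (dens β T₁ T ξ σ) (timeMeasure σ T₁) := by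
  have := isFiniteMeasure_timeMeasure (σ := σ) hT
  have hm : Measurable (dens β T₁ T ξ σ) :=
    (measurable_dens hβ T₁ T σ).comp (by fun_prop : Measurable fun τ : ℝ => (ξ, τ))
  cases T with
  | leaf =>
    refine Integrable.of_bound hm.aestronglyMeasurable 1 (.of_forall fun τ => ?_)
    simp only [dens]
    split_ifs <;> simp
  | node b l r =>
    have h1 := (continuous_amp hβ l 0 ξ).comp (by fun_prop : Continuous fun τ : ℝ => (σ, τ))
    have h2 := (continuous_amp hβ r (0 + l.nodes + 1) ξ).comp
      (by fun_prop : Continuous fun τ : ℝ => (σ, τ))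
    have h3 := continuous_vertex b (root l 0 ξ) (root r (0 + l.nodes + 1) ξ)
    simp only [Function.comp_def] at h1 h2
    set g : ℝ → ℂ := fun τ => (T₁ : ℂ) * ((β τ : ℂ) *
      vertex b (root l 0 ξ) (root r (0 + l.nodes + 1) ξ) τ
        * (amp β l 0 ξ σ τ * amp β r (0 + l.nodes + 1) ξ σ τ)) with hg
    have hgc : Continuous g := by fun_prop
    obtain ⟨M, hM⟩ := (isCompact_Icc (a := σ) (b := σ + T₁)).exists_bound_of_continuousOn
      hgc.continuousOn
    refine Integrable.of_bound hm.aestronglyMeasurable M ?_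
    have hM0 : 0 ≤ M := (norm_nonneg _).trans (hM σ ⟨le_rfl, by linarith⟩)
    have hb : ∀ τ ∈ Set.Icc σ (σ + T₁), ‖dens β T₁ (node b l r) ξ σ τ‖ ≤ M := by
      intro τ hτ
      simp only [dens]
      split_ifs
      · exact hM τ hτ
      · simpa using hM0
    rw [timeMeasure]
    refine ae_add_measure_iff.2 ⟨?_, ?_⟩
    · rw [ae_dirac_iff]
      · exact hb σ ⟨le_rfl, by linarith⟩
      · exact measurableSet_le hm.norm measurable_const
    · refine Measure.ae_smul_measure ?_ _
      exact (ae_restrict_mem measurableSet_Ioc).mono fun τ hτ => hb τ ⟨hτ.1.le, hτ.2⟩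

lemma integral_mul_dens_leaf {T₁ : ℝ} (hT : 0 < T₁) (ξ : ℕ → Pair) (σ : ℝ) (c : ℝ → ℂ) :
    ∫ τ, c τ * dens β T₁ leaf ξ σ τ ∂timeMeasure σ T₁ = c σ := by
  have h0 : ∀ τ ∈ Set.Ioc σ (σ + T₁), c τ * dens β T₁ leaf ξ σ τ = 0 := by
    intro τ hτ
    simp [dens, hτ.1.ne']
  rw [integral_timeMeasure hT, setIntegral_congr_fun measurableSet_Ioc h0]
  · simp [dens]
  · exact (integrableOn_congr_fun h0 measurableSet_Ioc).2 integrableOn_zero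

lemma integral_mul_dens_node (hβ : Continuous β) {T₁ : ℝ} (hT : 0 < T₁) (b : Bool)
    (l r : CollapseTree) (ξ : ℕ → Pair) (σ : ℝ) {c : ℝ → ℂ} (hc : Measurable c) {M : ℝ}
    (hM : ∀ τ, ‖c τ‖ ≤ M) :
    ∫ τ, c τ * dens β T₁ (node b l r) ξ σ τ ∂timeMeasure σ T₁
      = ∫ τ in Set.Ioc σ (σ + T₁), c τ * ((β τ : ℂ) *
      vertex b (root l 0 ξ) (root r (0 + l.nodes + 1) ξ) τ
        * (amp β l 0 ξ σ τ * amp β r (0 + l.nodes + 1) ξ σ τ)) := by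
  have h1 := (continuous_amp hβ l 0 ξ).comp (by fun_prop : Continuous fun τ : ℝ => (σ, τ))
  have h2 := (continuous_amp hβ r (0 + l.nodes + 1) ξ).comp
      (by fun_prop : Continuous fun τ : ℝ => (σ, τ))
  have h3 := continuous_vertex b (root l 0 ξ) (root r (0 + l.nodes + 1) ξ)
  simp only [Function.comp_def] at h1 h2
  set g : ℝ → ℂ := fun τ => (β τ : ℂ) *
      vertex b (root l 0 ξ) (root r (0 + l.nodes + 1) ξ) τ
        * (amp β l 0 ξ σ τ * amp β r (0 + l.nodes + 1) ξ σ τ) with hg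
  have hgc : Continuous g := by fun_prop
  have h0 : ∀ τ ∈ Set.Ioc σ (σ + T₁), c τ * dens β T₁ (node b l r) ξ σ τ
      = (T₁ : ℂ) * (c τ * g τ) := by
    intro τ hτ
    simp only [dens, hτ.1, if_true, hg]
    ring
  have hi : IntegrableOn (fun τ => (T₁ : ℂ) * (c τ * g τ)) (Set.Ioc σ (σ + T₁)) := by
    refine Integrable.const_mul ?_ _
    refine Integrable.bdd_mul (c := M) ?_ hc.aestronglyMeasurable (.of_forall hM)
    exact (hgc.continuousOn.integrableOn_compact isCompact_Icc).mono_set Set.Ioc_subset_Icc_self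
  rw [integral_timeMeasure hT, setIntegral_congr_fun measurableSet_Ioc h0, integral_const_mul,
    ← mul_assoc, inv_mul_cancel₀ (by exact_mod_cast hT.ne'), one_mul]
  · have hz : dens β T₁ (node b l r) ξ σ σ = 0 := by simp [dens]
    rw [hz, mul_zero, zero_add]
  · exact (integrableOn_congr_fun h0 measurableSet_Ioc).2 hi

/-- A leaf contributes the atom at `σ`; a node contributes the Lebesgue part, whose factor `T₁⁻¹` is
offset in `dens`. Leaves and nodes are thus treated alike, and the end time `θ` is visible only in
an indicator, which can be made part of the observable. -/
lemma amp_eq_integral_dens (hβ : Continuous β) {T₁ : ℝ} (hT : 0 < T₁) (T : CollapseTree)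
    (ξ : ℕ → Pair) {σ θ : ℝ} (h1 : σ ≤ θ) (h2 : θ ≤ σ + T₁) :
    amp β T 0 ξ σ θ
      = ∫ τ, (if τ ≤ θ then 1 else 0) * dens β T₁ T ξ σ τ ∂timeMeasure σ T₁ := by
  cases T with
  | leaf =>
    rw [integral_mul_dens_leaf hT ξ σ fun τ => if τ ≤ θ then 1 else 0, if_pos h1, amp]
  | node b l r =>
    rw [integral_mul_dens_node hβ hT b l r ξ σ (c := fun τ => if τ ≤ θ then 1 else 0) (M := 1), amp, intervalIntegral.integral_of_le h1,
      ← integral_indicator measurableSet_Ioc, ← integral_indicator measurableSet_Ioc]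
    · refine integral_congr_ae (.of_forall fun τ => ?_)
      simp only [Set.indicator, Set.mem_Ioc]
      by_cases ha : σ < τ
      · by_cases hb : τ ≤ θ
        · simp [ha, hb, hb.trans h2]
        · simp [hb]
      · simp [ha]
    · exact Measurable.ite (measurableSet_le measurable_id measurable_const) measurable_const
        measurable_const
    · intro τ
      split_ifs <;> simp

end CollapseTree


/-! ### The `L²` bound for a single tree. -/

instance sigmaFinite_volume_pi_pair (n : ℕ) : SigmaFinite (volume : Measure (Fin n → Pair)) :=
  Measure.pi.sigmaFinite fun _ : Fin n => (volume : Measure Pair)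

/-- Tonelli bookkeeping for a node. The bounds for the left and for the right subtree are applied
with the other data frozen; what remains is the kernel at fixed times, and integrating out the two
times costs the total mass twice. -/
lemma lintegral_le_of_kernel_le {R P S : Type*} [MeasurableSpace R] [MeasurableSpace P]
    [MeasurableSpace S] {ρ : Measure R} {π : Measure P} {lam : Measure S} [SFinite ρ] [SFinite π]
    [SFinite lam] {A : R → ℝ≥0∞} {c : R → P → S → ℝ≥0∞} {N : P → P → S → S → ℝ≥0∞}
    (hc : Measurable fun p : R × P × S => c p.1 p.2.1 p.2.2)
    (hN : Measurable fun p : P × P × S × S => N p.1 p.2.1 p.2.2.1 p.2.2.2)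
    {a r D : ℝ≥0∞} (ha : a ≠ ∞) (hr : r ≠ ∞)
    (hA : ∀ y, A y ≤ a * ∫⁻ x, ∫⁻ τ₁, c y x τ₁ ∂lam ∂π)
    (hcN : ∀ x τ₁, ∫⁻ y, c y x τ₁ ∂ρ ≤ r * ∫⁻ y, ∫⁻ τ₂, N x y τ₁ τ₂ ∂lam ∂π)
    (hD : ∀ τ₁ τ₂, ∫⁻ y, ∫⁻ x, N x y τ₁ τ₂ ∂π ∂π ≤ D) :
    ∫⁻ y, A y ∂ρ ≤ a * r * (D * lam Set.univ * lam Set.univ) := by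
  calc ∫⁻ y, A y ∂ρ ≤ ∫⁻ y, a * ∫⁻ x, ∫⁻ τ₁, c y x τ₁ ∂lam ∂π ∂ρ := lintegral_mono hA
    _ = a * ∫⁻ y, ∫⁻ x, ∫⁻ τ₁, c y x τ₁ ∂lam ∂π ∂ρ := lintegral_const_mul' _ _ ha
    _ = a * ∫⁻ x, ∫⁻ y, ∫⁻ τ₁, c y x τ₁ ∂lam ∂ρ ∂π := by
        rw [lintegral_lintegral_swap]
        refine Measurable.aemeasurable ?_
        refine Measurable.lintegral_prod_right' (f := fun p : (R × P) × S => c p.1.1 p.1.2 p.2) ?_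
        exact hc.comp (by fun_prop : Measurable fun p : (R × P) × S => (p.1.1, p.1.2, p.2))
    _ = a * ∫⁻ x, ∫⁻ τ₁, ∫⁻ y, c y x τ₁ ∂ρ ∂lam ∂π := by
        congr 1
        refine lintegral_congr fun x => ?_
        rw [lintegral_lintegral_swap]
        exact (hc.comp (by fun_prop : Measurable fun p : R × S => (p.1, x, p.2))).aemeasurable
    _ ≤ a * ∫⁻ x, ∫⁻ τ₁, r * ∫⁻ y, ∫⁻ τ₂, N x y τ₁ τ₂ ∂lam ∂π ∂lam ∂π :=
        mul_le_mul_right (lintegral_mono fun x => lintegral_mono fun τ₁ => hcN x τ₁) _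
    _ = a * r * ∫⁻ x, ∫⁻ τ₁, ∫⁻ y, ∫⁻ τ₂, N x y τ₁ τ₂ ∂lam ∂π ∂lam ∂π := by
        simp_rw [lintegral_const_mul' _ _ hr]
        rw [← mul_assoc]
    _ = a * r * ∫⁻ τ₁, ∫⁻ x, ∫⁻ τ₂, ∫⁻ y, N x y τ₁ τ₂ ∂π ∂lam ∂π ∂lam := by
        congr 1
        rw [lintegral_lintegral_swap]
        · refine lintegral_congr fun τ₁ => lintegral_congr fun x => ?_
          rw [lintegral_lintegral_swap]
          exact (hN.comp (by fun_prop : Measurable fun p : P × S =>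
            (x, p.1, τ₁, p.2))).aemeasurable
        · refine Measurable.aemeasurable ?_
          refine Measurable.lintegral_prod_right' (f := fun p : (P × S) × P =>
            ∫⁻ τ₂, N p.1.1 p.2 p.1.2 τ₂ ∂lam) ?_
          refine Measurable.lintegral_prod_right' (f := fun p : ((P × S) × P) × S =>
            N p.1.1.1 p.1.2 p.1.1.2 p.2) ?_
          exact hN.comp (by fun_prop : Measurable fun p : ((P × S) × P) × S =>
            (p.1.1.1, p.1.2, p.1.1.2, p.2))
    _ = a * r * ∫⁻ τ₁, ∫⁻ τ₂, ∫⁻ y, ∫⁻ x, N x y τ₁ τ₂ ∂π ∂π ∂lam ∂lam := by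
        congr 1
        refine lintegral_congr fun τ₁ => ?_
        rw [lintegral_lintegral_swap]
        · refine lintegral_congr fun τ₂ => ?_
          rw [lintegral_lintegral_swap]
          exact (hN.comp (by fun_prop : Measurable fun p : P × P =>
            (p.1, p.2, τ₁, τ₂))).aemeasurable
        · refine Measurable.aemeasurable ?_
          refine Measurable.lintegral_prod_right' (f := fun p : (P × S) × P =>
            N p.1.1 p.2 τ₁ p.1.2) ?_
          exact hN.comp (by fun_prop : Measurable fun p : (P × S) × P =>
            (p.1.1, p.2, τ₁, p.1.2))
    _ ≤ a * r * ∫⁻ _τ₁, ∫⁻ _τ₂, D ∂lam ∂lam :=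
        mul_le_mul_right (lintegral_mono fun τ₁ => lintegral_mono fun τ₂ => hD τ₁ τ₂) _
    _ = _ := by rw [lintegral_const, lintegral_const]

namespace CollapseTree

variable {β : ℝ → ℝ}

/-- The kernel that describes a collapse, in the times of the two collapsing pairs. -/
def nodeKernel (β : ℝ → ℝ) (σ T : ℝ) (c : Pair → ℝ → ℂ) (b : Bool) (x y : Pair) (τ₁ τ₂ : ℝ) : ℂ :=
  ∫ τ in Set.Ioc σ (σ + T), (c (merge b x y) τ * ((β τ : ℂ) * vertex b x y τ)
    * (if τ₁ ≤ τ then 1 else 0)) * (if τ₂ ≤ τ then 1 else 0)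

lemma measurable_ite_le {X : Type*} [MeasurableSpace X] {f g : X → ℝ} (hf : Measurable f)
    (hg : Measurable g) : Measurable fun x => if f x ≤ g x then (1 : ℂ) else 0 :=
  Measurable.ite (measurableSet_le hf hg) measurable_const measurable_const

lemma measurable_nodeKernel (hβ : Continuous β) (σ T : ℝ) {c : Pair → ℝ → ℂ}
    (hc : Measurable fun p : Pair × ℝ => c p.1 p.2) (b : Bool) :
    Measurable fun p : Pair × Pair × ℝ × ℝ =>
      nodeKernel β σ T c b p.1 p.2.1 p.2.2.1 p.2.2.2 := by
  unfold nodeKernel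
  refine StronglyMeasurable.measurable ?_
  refine StronglyMeasurable.integral_prod_right' (f := fun p : (Pair × Pair × ℝ × ℝ) × ℝ =>
    (c (merge b p.1.1 p.1.2.1) p.2 * ((β p.2 : ℂ) * vertex b p.1.1 p.1.2.1 p.2)
    * (if p.1.2.2.1 ≤ p.2 then 1 else 0)) * (if p.1.2.2.2 ≤ p.2 then 1 else 0)) ?_
  refine Measurable.stronglyMeasurable ?_
  have h1 := (measurable_merge b).comp (by fun_prop :
    Measurable fun p : (Pair × Pair × ℝ × ℝ) × ℝ => (p.1.1, p.1.2.1))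
  have h2 := hc.comp (h1.prodMk measurable_snd)
  have h3 := (measurable_vertex b).comp (by fun_prop :
    Measurable fun p : (Pair × Pair × ℝ × ℝ) × ℝ => (p.1.1, p.1.2.1, p.2))
  have h4 := hβ.measurable
  have h5 := measurable_ite_le (X := (Pair × Pair × ℝ × ℝ) × ℝ) (f := fun p => p.1.2.2.1)
    (g := fun p => p.2) (by fun_prop) (by fun_prop)
  have h6 := measurable_ite_le (X := (Pair × Pair × ℝ × ℝ) × ℝ) (f := fun p => p.1.2.2.2)
    (g := fun p => p.2) (by fun_prop) (by fun_prop)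
  simp only [Function.comp_def] at h2 h3
  fun_prop

lemma integrable_nodeKernel_aux (hβ : Continuous β) (σ T : ℝ) {c : Pair → ℝ → ℂ}
    (hc : Measurable fun p : Pair × ℝ => c p.1 p.2) (hb : ∀ Ξ, ∃ M, ∀ τ, ‖c Ξ τ‖ ≤ M) (b : Bool)
    (x y : Pair) : IntegrableOn (fun τ => c (merge b x y) τ * ((β τ : ℂ) * vertex b x y τ))
      (Set.Ioc σ (σ + T)) := by
  obtain ⟨M, hM⟩ := hb (merge b x y)
  have h := continuous_vertex b x y
  refine Integrable.bdd_mul (c := M) ?_ ?_ (.of_forall hM)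
  · have : Continuous fun τ => (β τ : ℂ) * vertex b x y τ := by fun_prop
    exact (this.continuousOn.integrableOn_compact isCompact_Icc).mono_set Set.Ioc_subset_Icc_self
  · exact (hc.comp (by fun_prop : Measurable fun τ : ℝ => (merge b x y, τ))).aestronglyMeasurable

lemma exists_norm_nodeKernel_le (hβ : Continuous β) (σ T : ℝ) {c : Pair → ℝ → ℂ}
    (hc : Measurable fun p : Pair × ℝ => c p.1 p.2) (hb : ∀ Ξ, ∃ M, ∀ τ, ‖c Ξ τ‖ ≤ M) (b : Bool)
    (x y : Pair) : ∃ M, ∀ τ₁ τ₂, ‖nodeKernel β σ T c b x y τ₁ τ₂‖ ≤ M := by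
  have hi := integrable_nodeKernel_aux hβ σ T hc hb b x y
  refine ⟨∫ τ in Set.Ioc σ (σ + T), ‖c (merge b x y) τ * ((β τ : ℂ) * vertex b x y τ)‖,
    fun τ₁ τ₂ => ?_⟩
  refine norm_integral_le_of_norm_le hi.norm (.of_forall fun τ => ?_)
  rw [mul_assoc, norm_mul]
  refine mul_le_of_le_one_right (norm_nonneg _) ?_
  split_ifs <;> simp

/-- Both subtree amplitudes are written as integrals of their densities, and the time of the node is
integrated before theirs. The subtrees then interact only through a kernel of their root momenta and
root times, so the bounds for them can be applied one after the other. -/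
lemma integral_dens_node_eq (hβ : Continuous β) {T₁ : ℝ} (hT : 0 < T₁) (σ : ℝ) {c : Pair → ℝ → ℂ}
    (hc : Measurable fun p : Pair × ℝ => c p.1 p.2) (hb : ∀ Ξ, ∃ M, ∀ τ, ‖c Ξ τ‖ ≤ M) (b : Bool)
    (l r : CollapseTree) {ξ ξ₁ ξ₂ : ℕ → Pair} (h₁ : ∀ i ≤ l.nodes, ξ (0 + i) = ξ₁ (0 + i))
    (h₂ : ∀ i ≤ r.nodes, ξ (0 + l.nodes + 1 + i) = ξ₂ (0 + i)) :
    ∫ τ, c (root (node b l r) 0 ξ) τ * dens β T₁ (node b l r) ξ σ τ ∂timeMeasure σ T₁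
      = ∫ τ₁, (∫ τ₂, nodeKernel β σ T₁ c b (root l 0 ξ₁) (root r 0 ξ₂) τ₁ τ₂
        * dens β T₁ r ξ₂ σ τ₂ ∂timeMeasure σ T₁) * dens β T₁ l ξ₁ σ τ₁ ∂timeMeasure σ T₁ := by
  have := isFiniteMeasure_timeMeasure (σ := σ) hT
  obtain ⟨M, hM⟩ := hb (root (node b l r) 0 ξ)
  rw [integral_mul_dens_node hβ hT b l r ξ σ (c := c (root (node b l r) 0 ξ))
    (hc.comp (by fun_prop : Measurable fun τ : ℝ => (root (node b l r) 0 ξ, τ))) hM]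
  have er : root l 0 ξ = root l 0 ξ₁ := root_congr l 0 0 _ _ h₁
  have er' : root r (0 + l.nodes + 1) ξ = root r 0 ξ₂ := root_congr r _ 0 _ _ h₂
  have ea := fun τ => amp_congr (β := β) l 0 0 ξ ξ₁ σ τ h₁
  have ea' := fun τ => amp_congr (β := β) r _ 0 ξ ξ₂ σ τ h₂
  simp only [root, er, er', ea, ea']
  set f : ℝ → ℂ := fun τ => c (merge b (root l 0 ξ₁) (root r 0 ξ₂)) τ
    * ((β τ : ℂ) * vertex b (root l 0 ξ₁) (root r 0 ξ₂) τ) with hf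
  have hfi : IntegrableOn f (Set.Ioc σ (σ + T₁)) := integrable_nodeKernel_aux hβ σ T₁ hc hb b _ _
  have hca : Continuous fun τ => amp β r 0 ξ₂ σ τ :=
    (continuous_amp hβ r 0 ξ₂).comp (by fun_prop : Continuous fun τ : ℝ => (σ, τ))
  have hk : Measurable fun p : ℝ × ℝ => if p.2 ≤ p.1 then (1 : ℂ) else 0 :=
    measurable_ite_le measurable_snd measurable_fst
  have hk1 : ∀ x y : ℝ, ‖if y ≤ x then (1 : ℂ) else 0‖ ≤ 1 := by
    intro x y
    split_ifs <;> simp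
  obtain ⟨B, hB⟩ := (isCompact_Icc (a := σ) (b := σ + T₁)).exists_bound_of_continuousOn
      hca.continuousOn
  have hfa : IntegrableOn (fun τ => amp β r 0 ξ₂ σ τ * f τ) (Set.Ioc σ (σ + T₁)) := by
    refine Integrable.bdd_mul (c := B) hfi hca.aestronglyMeasurable ?_
    exact (ae_restrict_mem measurableSet_Ioc).mono fun τ hτ => hB τ ⟨hτ.1.le, hτ.2⟩
  calc ∫ τ in Set.Ioc σ (σ + T₁), c (merge b (root l 0 ξ₁) (root r 0 ξ₂)) τ * ((β τ : ℂ)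
        * vertex b (root l 0 ξ₁) (root r 0 ξ₂) τ * (amp β l 0 ξ₁ σ τ * amp β r 0 ξ₂ σ τ))
      = ∫ τ in Set.Ioc σ (σ + T₁), (amp β r 0 ξ₂ σ τ * f τ)
          * ∫ τ₁, (if τ₁ ≤ τ then 1 else 0) * dens β T₁ l ξ₁ σ τ₁ ∂timeMeasure σ T₁ := by
        refine setIntegral_congr_fun measurableSet_Ioc fun τ hτ => ?_
        rw [← amp_eq_integral_dens hβ hT l ξ₁ hτ.1.le hτ.2]
        simp only [hf]
        ring
    _ = ∫ τ₁, (∫ τ in Set.Ioc σ (σ + T₁), (amp β r 0 ξ₂ σ τ * f τ) * (if τ₁ ≤ τ then 1 else 0))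
          * dens β T₁ l ξ₁ σ τ₁ ∂timeMeasure σ T₁ :=
        integral_mul_integral_kernel hfa (integrable_dens hβ hT l ξ₁ σ) hk hk1
    _ = _ := by
        refine integral_congr_ae (.of_forall fun τ₁ => ?_)
        dsimp only
        congr 1
        have hfk : IntegrableOn (fun τ => f τ * (if τ₁ ≤ τ then 1 else 0))
            (Set.Ioc σ (σ + T₁)) := by
          have := Integrable.bdd_mul (c := 1) hfi
            (hk.comp (by fun_prop : Measurable fun τ : ℝ => (τ, τ₁))).aestronglyMeasurable
            (.of_forall fun τ => hk1 τ τ₁)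
          refine this.congr (.of_forall fun τ => ?_)
          simp only [Function.comp]
          ring
        rw [show (fun τ₂ => nodeKernel β σ T₁ c b (root l 0 ξ₁) (root r 0 ξ₂) τ₁ τ₂
          * dens β T₁ r ξ₂ σ τ₂) = fun τ₂ => (∫ τ in Set.Ioc σ (σ + T₁),
            (f τ * (if τ₁ ≤ τ then 1 else 0)) * (if τ₂ ≤ τ then 1 else 0))
          * dens β T₁ r ξ₂ σ τ₂ from rfl,
          ← integral_mul_integral_kernel hfk (integrable_dens hβ hT r ξ₂ σ) hk hk1]
        refine setIntegral_congr_fun measurableSet_Ioc fun τ hτ => ?_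
        rw [← amp_eq_integral_dens hβ hT r ξ₂ hτ.1.le hτ.2]
        ring

/-- The constant of the fiber estimate. -/
def fiberConst : ℝ := exists_fiber_estimate.choose

lemma fiberConst_pos : 0 < fiberConst := exists_fiber_estimate.choose_spec.1

/-- For fixed `y` the shift `x = Ξ - transfer b (y.1 + y.2)` replaces the left pair by the merged
pair `Ξ`; for fixed `Ξ` the fibre estimate applies in `y`. The conditions `τ₁ ≤ τ` and `τ₂ ≤ τ`
merely shrink the set of times, so the bound is uniform in both. -/
lemma lintegral_nodeKernel_le (hβ : Continuous β) {σ T B : ℝ} (hT : 0 < T)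
    (hB : ∀ τ ∈ Set.Icc σ (σ + T), |β τ| ≤ B) {c : Pair → ℝ → ℂ}
    (hc : Measurable fun p : Pair × ℝ => c p.1 p.2) (b : Bool) (τ₁ τ₂ : ℝ) :
    ∫⁻ y, ∫⁻ x, ‖nodeKernel β σ T c b x y τ₁ τ₂‖ₑ ^ 2
      ≤ ENNReal.ofReal (fiberConst * B ^ 2 * T)
        * ∫⁻ Ξ, ∫⁻ τ, ‖c Ξ τ‖ₑ ^ 2 ∂timeMeasure σ T := by
  have hm := measurable_nodeKernel hβ σ T hc b
  have hB0 : 0 ≤ B := (abs_nonneg _).trans (hB σ ⟨le_rfl, by linarith⟩)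
  set A : Set ℝ := Set.Ioc σ (σ + T) ∩ (Set.Ici τ₁ ∩ Set.Ici τ₂) with hA
  have hAm : MeasurableSet A := measurableSet_Ioc.inter (measurableSet_Ici.inter measurableSet_Ici)
  have hinv : (volume : Measure Pair).IsAddRightInvariant :=
    inferInstanceAs (Measure.IsAddRightInvariant
      ((volume : Measure Space).prod (volume : Measure Space)))
  have hshift : ∀ y : Pair, ∫⁻ x, ‖nodeKernel β σ T c b x y τ₁ τ₂‖ₑ ^ 2
      = ∫⁻ Ξ, ‖∫ τ in A, (c Ξ τ * (β τ : ℂ))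
        * vertex b (Ξ - transfer b (y.1 + y.2)) y τ‖ₑ ^ 2 := by
    intro y
    rw [← lintegral_sub_right_eq_self (μ := volume) _ (transfer b (y.1 + y.2))]
    refine lintegral_congr fun Ξ => ?_
    congr 2
    unfold nodeKernel
    have em : merge b (Ξ - transfer b (y.1 + y.2)) y = Ξ := by simp [merge]
    rw [em, hA, ← integral_indicator measurableSet_Ioc, ← integral_indicator hAm]
    refine integral_congr_ae (.of_forall fun τ => ?_)
    by_cases h0 : τ ∈ Set.Ioc σ (σ + T)
    · by_cases h1 : τ₁ ≤ τ
      · by_cases h2 : τ₂ ≤ τ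
        · have : τ ∈ A := ⟨h0, h1, h2⟩
          rw [Set.indicator_of_mem h0, Set.indicator_of_mem this]
          simp [h1, h2]
          ring
        · have : τ ∉ A := fun h => h2 h.2.2
          rw [Set.indicator_of_mem h0, Set.indicator_of_notMem this]
          simp [h2]
      · have : τ ∉ A := fun h => h1 h.2.1
        rw [Set.indicator_of_mem h0, Set.indicator_of_notMem this]
        simp [h1]
    · have : τ ∉ A := fun h => h0 h.1
      rw [Set.indicator_of_notMem h0, Set.indicator_of_notMem this]
  simp_rw [hshift]
  rw [lintegral_lintegral_swap]
  · rw [← lintegral_const_mul' _ _ ENNReal.ofReal_ne_top]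
    refine lintegral_mono fun Ξ => ?_
    have hcm : Measurable (c Ξ) := hc.comp (by fun_prop : Measurable fun τ : ℝ => (Ξ, τ))
    have hAvol : volume A ≠ ∞ :=
      ((measure_mono Set.inter_subset_left).trans_lt measure_Ioc_lt_top).ne
    have hβm := hβ.measurable
    refine (exists_fiber_estimate.choose_spec.2 b Ξ A hAm hAvol (fun τ => c Ξ τ * (β τ : ℂ))
      (by fun_prop : Measurable fun τ => c Ξ τ * (β τ : ℂ)).aestronglyMeasurable).trans ?_
    have h1 : ∫⁻ τ in A, ‖c Ξ τ * (β τ : ℂ)‖ₑ ^ 2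
        ≤ ENNReal.ofReal (B ^ 2) * ∫⁻ τ in Set.Ioc σ (σ + T), ‖c Ξ τ‖ₑ ^ 2 := by
      rw [← lintegral_const_mul' _ _ ENNReal.ofReal_ne_top]
      refine (lintegral_mono_set Set.inter_subset_left).trans ?_
      refine setLIntegral_mono' measurableSet_Ioc fun τ hτ => ?_
      rw [enorm_mul, mul_pow, mul_comm]
      refine mul_le_mul_left ?_ _
      rw [ENNReal.ofReal_pow hB0]
      gcongr
      rw [← ofReal_norm]
      refine ENNReal.ofReal_le_ofReal ?_
      simpa using hB τ ⟨hτ.1.le, hτ.2⟩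
    calc ENNReal.ofReal fiberConst * ∫⁻ τ in A, ‖c Ξ τ * (β τ : ℂ)‖ₑ ^ 2
        ≤ ENNReal.ofReal fiberConst * (ENNReal.ofReal (B ^ 2) * (ENNReal.ofReal T *
          ∫⁻ τ, ‖c Ξ τ‖ₑ ^ 2 ∂timeMeasure σ T)) := by
          refine mul_le_mul_right (h1.trans (mul_le_mul_right ?_ _)) _
          exact lintegral_Ioc_le_timeMeasure hT _
      _ = _ := by
          rw [← mul_assoc, ← mul_assoc, ENNReal.ofReal_mul (by have := fiberConst_pos; positivity),
            ENNReal.ofReal_mul fiberConst_pos.le]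
  · refine Measurable.aemeasurable ?_
    simp only [Function.uncurry_def]
    have : ∀ p : Pair × Pair, ∫ τ in A, (c p.2 τ * (β τ : ℂ))
        * vertex b (p.2 - transfer b (p.1.1 + p.1.2)) p.1 τ
        = ∫ τ, (A.indicator (fun τ => (c p.2 τ * (β τ : ℂ))
        * vertex b (p.2 - transfer b (p.1.1 + p.1.2)) p.1 τ) τ) := fun p =>
      (integral_indicator hAm).symm
    have h2 : Measurable fun p : Pair × Pair => ∫ τ in A, (c p.2 τ * (β τ : ℂ))
        * vertex b (p.2 - transfer b (p.1.1 + p.1.2)) p.1 τ := by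
      refine StronglyMeasurable.measurable ?_
      refine StronglyMeasurable.integral_prod_right' (f := fun q : (Pair × Pair) × ℝ =>
        (c q.1.2 q.2 * (β q.2 : ℂ))
        * vertex b (q.1.2 - transfer b (q.1.1.1 + q.1.1.2)) q.1.1 q.2) ?_
      refine Measurable.stronglyMeasurable ?_
      have ht := measurable_transfer b
      have h3 := hc.comp (by fun_prop : Measurable fun q : (Pair × Pair) × ℝ => (q.1.2, q.2))
      have h4 := (measurable_vertex b).comp (by fun_prop : Measurable fun q : (Pair × Pair) × ℝ =>
        (q.1.2 - transfer b (q.1.1.1 + q.1.1.2), q.1.1, q.2))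
      have hβm := hβ.measurable
      simp only [Function.comp_def] at h3 h4
      fun_prop
    fun_prop

lemma measurable_integral_dens (hβ : Continuous β) {σ T₁ : ℝ} (hT : 0 < T₁) (T : CollapseTree)
    (n : ℕ) {X : Type*} [MeasurableSpace X] {k : X → Pair → ℝ → ℂ}
    (hk : Measurable fun p : X × Pair × ℝ => k p.1 p.2.1 p.2.2) :
    Measurable fun p : X × (Fin n → Pair) => ∫ τ, k p.1 (root T 0 (extendSeq p.2)) τ
        * dens β T₁ T (extendSeq p.2) σ τ ∂timeMeasure σ T₁ := by
  have := isFiniteMeasure_timeMeasure (σ := σ) hT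
  refine StronglyMeasurable.measurable ?_
  refine StronglyMeasurable.integral_prod_right' (f := fun p : (X × (Fin n → Pair)) × ℝ =>
    k p.1.1 (root T 0 (extendSeq p.1.2)) p.2 * dens β T₁ T (extendSeq p.1.2) σ p.2) ?_
  refine Measurable.stronglyMeasurable ?_
  have h0 : Measurable fun p : (X × (Fin n → Pair)) × ℝ => extendSeq p.1.2 :=
    measurable_extendSeq.comp (by fun_prop)
  have h1 := (measurable_root T 0).comp h0
  have h2 := (measurable_dens hβ T₁ T σ).comp (h0.prodMk measurable_snd)
  refine Measurable.mul ?_ h2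
  exact hk.comp ((measurable_fst.comp measurable_fst).prodMk (h1.prodMk measurable_snd))

set_option maxHeartbeats 800000 in
/-- The `L²` bound for the history of a single pair. -/
lemma lintegral_integral_dens_le (hβ : Continuous β) {σ T₁ B : ℝ} (hT : 0 < T₁)
    (hB : ∀ τ ∈ Set.Icc σ (σ + T₁), |β τ| ≤ B) (T : CollapseTree) :
    ∀ (n : ℕ), n = T.nodes + 1 → ∀ c : Pair → ℝ → ℂ, Measurable (fun p : Pair × ℝ => c p.1 p.2) →
      (∀ Ξ, ∃ M, ∀ τ, ‖c Ξ τ‖ ≤ M) →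
      ∫⁻ x : Fin n → Pair, ‖∫ τ, c (root T 0 (extendSeq x)) τ
        * dens β T₁ T (extendSeq x) σ τ ∂timeMeasure σ T₁‖ₑ ^ 2
      ≤ ENNReal.ofReal (4 * (fiberConst * B ^ 2 * T₁)) ^ T.nodes
        * ∫⁻ Ξ, ∫⁻ τ, ‖c Ξ τ‖ₑ ^ 2 ∂timeMeasure σ T₁ := by
  have := isFiniteMeasure_timeMeasure (σ := σ) hT
  have hmeas : ∀ (T : CollapseTree) (n : ℕ) {c : Pair → ℝ → ℂ},
      Measurable (fun p : Pair × ℝ => c p.1 p.2) → Measurable fun x : Fin n → Pair =>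
      ∫ τ, c (root T 0 (extendSeq x)) τ
        * dens β T₁ T (extendSeq x) σ τ ∂timeMeasure σ T₁ := by
    intro T n c hc
    exact (measurable_integral_dens hβ hT T n (X := Unit) (k := fun _ => c)
      (hc.comp measurable_snd)).comp (measurable_const.prodMk measurable_id : Measurable
        fun x : Fin n → Pair => ((), x))
  induction T with
  | leaf =>
    intro n hn c hc hb
    simp only [nodes, zero_add] at hn
    subst hn
    rw [lintegral_fin_one]
    simp only [nodes, pow_zero, one_mul]
    refine lintegral_mono fun x => ?_
    rw [integral_mul_dens_leaf hT]
    have hx : root leaf 0 (extendSeq fun _ : Fin 1 => x) = x := by simp [root, extendSeq]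
    -- The value at a leaf is that of the observable at `σ`, and the atom alone dominates it.
    rw [hx, timeMeasure, lintegral_add_measure]
    refine le_trans ?_ le_self_add
    have hcm : Measurable fun τ => ‖c x τ‖ₑ ^ 2 := by
      have : Measurable (c x) := hc.comp (by fun_prop : Measurable fun τ : ℝ => (x, τ))
      fun_prop
    rw [lintegral_dirac' _ hcm]
  | node b l r ihl ihr =>
    intro n hn c hc hb
    have hn' : n = (l.nodes + 1) + (r.nodes + 1) := by simp only [nodes] at hn; omega
    subst hn'
    set κ : ℝ≥0∞ := ENNReal.ofReal (4 * (fiberConst * B ^ 2 * T₁)) with hκ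
    have hκ' : κ = 4 * ENNReal.ofReal (fiberConst * B ^ 2 * T₁) := by
      rw [hκ, ENNReal.ofReal_mul (by norm_num)]
      simp
    have hκt : κ ≠ ∞ := ENNReal.ofReal_ne_top
    have hN := measurable_nodeKernel hβ σ T₁ hc b
    have hNb := exists_norm_nodeKernel_le hβ σ T₁ hc hb b
    have hNle := lintegral_nodeKernel_le hβ hT hB hc b
    have hNeq := fun z x y =>
      integral_dens_node_eq hβ hT σ hc hb b l r (ξ := z) (ξ₁ := x) (ξ₂ := y)
    -- From here on only the measurability, the boundedness in time and the `L²` bound of the kernel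
    -- are used.
    generalize nodeKernel β σ T₁ c b = N at hN hNb hNle hNeq
    set lam := timeMeasure σ T₁ with hlam
    -- The right subtree is absorbed into the observable of the left one. The left bound is applied
    -- to `c₁ y`, and then the right bound to `N x · τ₁ ·`.
    set c₁ : (Fin (r.nodes + 1) → Pair) → Pair → ℝ → ℂ := fun y x τ₁ =>
      ∫ τ₂, N x (root r 0 (extendSeq y)) τ₁ τ₂ * dens β T₁ r (extendSeq y) σ τ₂ ∂lam with hc₁
    have hc₁m : Measurable fun p : (Fin (r.nodes + 1) → Pair) × Pair × ℝ => c₁ p.1 p.2.1 p.2.2 := by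
      have hN' : Measurable fun p : (Pair × ℝ) × Pair × ℝ => N p.1.1 p.2.1 p.1.2 p.2.2 :=
        hN.comp (by fun_prop : Measurable fun p : (Pair × ℝ) × Pair × ℝ =>
          (p.1.1, p.2.1, p.1.2, p.2.2))
      exact (measurable_integral_dens hβ hT r (r.nodes + 1)
        (k := fun (p : Pair × ℝ) y τ₂ => N p.1 y p.2 τ₂) hN').comp (by fun_prop : Measurable
        fun p : (Fin (r.nodes + 1) → Pair) × Pair × ℝ => (p.2, p.1))
    have step : ∀ (x : Fin (l.nodes + 1) → Pair) (y : Fin (r.nodes + 1) → Pair),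
        ∫ τ, c (root (node b l r) 0 (extendSeq (Fin.append x y))) τ
          * dens β T₁ (node b l r) (extendSeq (Fin.append x y)) σ τ ∂lam
        = ∫ τ₁, c₁ y (root l 0 (extendSeq x)) τ₁ * dens β T₁ l (extendSeq x) σ τ₁ ∂lam := by
      intro x y
      refine hNeq _ _ _ (fun i hi => ?_) (fun i hi => ?_)
      · rw [zero_add, extendSeq_append_left x y (by omega)]
      · rw [zero_add, zero_add, extendSeq_append_right x y (by omega)]
    have hLm : Measurable fun p : (Fin (l.nodes + 1) → Pair) × (Fin (r.nodes + 1) → Pair) =>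
        ‖∫ τ₁, c₁ p.2 (root l 0 (extendSeq p.1)) τ₁
          * dens β T₁ l (extendSeq p.1) σ τ₁ ∂lam‖ₑ ^ 2 := by
      have := ((hmeas (node b l r) (l.nodes + 1 + (r.nodes + 1)) hc).comp
        (measurable_append (X := Pair))).enorm.pow_const 2
      simp only [Function.comp_def, step] at this
      exact this
    rw [lintegral_append ((hmeas (node b l r) _ hc).enorm.pow_const 2)]
    simp_rw [step]
    rw [lintegral_lintegral_swap hLm.aemeasurable]
    have bl : ∀ y, ∫⁻ x : Fin (l.nodes + 1) → Pair, ‖∫ τ₁, c₁ y (root l 0 (extendSeq x)) τ₁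
          * dens β T₁ l (extendSeq x) σ τ₁ ∂lam‖ₑ ^ 2
        ≤ κ ^ l.nodes * ∫⁻ x, ∫⁻ τ₁, ‖c₁ y x τ₁‖ₑ ^ 2 ∂lam := by
      intro y
      refine ihl _ rfl (c₁ y) (hc₁m.comp (by fun_prop : Measurable fun p : Pair × ℝ =>
        (y, p.1, p.2))) fun x => ?_
      obtain ⟨M, hM⟩ := hNb x (root r 0 (extendSeq y))
      refine ⟨∫ τ₂, M * ‖dens β T₁ r (extendSeq y) σ τ₂‖ ∂lam, fun τ₁ => ?_⟩
      refine norm_integral_le_of_norm_le ((integrable_dens hβ hT r _ σ).norm.const_mul M)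
        (.of_forall fun τ₂ => ?_)
      rw [norm_mul]
      exact mul_le_mul_of_nonneg_right (hM _ _) (norm_nonneg _)
    have br : ∀ x τ₁, ∫⁻ y : Fin (r.nodes + 1) → Pair, ‖c₁ y x τ₁‖ₑ ^ 2
        ≤ κ ^ r.nodes * ∫⁻ y, ∫⁻ τ₂, ‖N x y τ₁ τ₂‖ₑ ^ 2 ∂lam := by
      intro x τ₁
      refine ihr _ rfl (fun y τ₂ => N x y τ₁ τ₂) (hN.comp (by fun_prop :
        Measurable fun p : Pair × ℝ => (x, p.1, τ₁, p.2))) fun y => ?_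
      obtain ⟨M, hM⟩ := hNb x y
      exact ⟨M, fun τ₂ => hM τ₁ τ₂⟩
    have hN2 : Measurable fun p : Pair × Pair × ℝ × ℝ => ‖N p.1 p.2.1 p.2.2.1 p.2.2.2‖ₑ ^ 2 :=
      hN.enorm.pow_const 2
    have hc₁2 : Measurable fun p : (Fin (r.nodes + 1) → Pair) × Pair × ℝ =>
      ‖c₁ p.1 p.2.1 p.2.2‖ₑ ^ 2 := hc₁m.enorm.pow_const 2
    refine (lintegral_le_of_kernel_le hc₁2 hN2 (ENNReal.pow_ne_top hκt) (ENNReal.pow_ne_top hκt)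
      bl br hNle).trans (le_of_eq ?_)
    have e : κ ^ (node b l r).nodes = κ ^ l.nodes * κ ^ r.nodes
        * (4 * ENNReal.ofReal (fiberConst * B ^ 2 * T₁)) := by
      rw [nodes, pow_succ, pow_add, ← hκ']
    -- The total mass `2` of the time measure, once for each subtree, is the factor `4` per
    -- collapse.
    have h4 : (2 : ℝ≥0∞) * 2 = 4 := by norm_num
    rw [hlam, timeMeasure_univ hT, e, ← h4]
    ring

end CollapseTree


/-! ### Configurations as families of pairs -/

/-- The pairs of a configuration. -/
def pairs {n : ℕ} (z : Config n) (i : Fin n) : Pair := (pos z (Sum.inl i), pos z (Sum.inr i))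

/-- The configuration with given pairs. -/
def ofPairs {n : ℕ} (x : Fin n → Pair) : Config n :=
  WithLp.toLp 2 fun q => Sum.elim (fun i => (x i).1 q.2) (fun i => (x i).2 q.2) q.1

lemma pairs_ofPairs {n : ℕ} (x : Fin n → Pair) : pairs (ofPairs x) = x := by
  rfl

lemma ofPairs_pairs {n : ℕ} (z : Config n) : ofPairs (pairs z) = z := by
  ext ⟨p, i⟩
  cases p <;> rfl

lemma measurable_pos {n : ℕ} (p : Fin n ⊕ Fin n) : Measurable fun z : Config n => pos z p := by
  unfold pos
  fun_prop

lemma measurable_pairs {n : ℕ} : Measurable (pairs : Config n → Fin n → Pair) :=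
  measurable_pi_lambda _ fun _ => (measurable_pos _).prodMk (measurable_pos _)

lemma measurable_ofPairs {n : ℕ} : Measurable (ofPairs : (Fin n → Pair) → Config n) := by
  unfold ofPairs
  refine (WithLp.measurable_toLp 2 _).comp (measurable_pi_lambda _ fun q => ?_)
  obtain ⟨p, i⟩ := q
  cases p
  · simp only [Sum.elim_inl]; fun_prop
  · simp only [Sum.elim_inr]; fun_prop

lemma volume_space_box (s : Fin 3 → Set ℝ) (hs : ∀ i, MeasurableSet (s i)) :
    volume {x : Space | ∀ i, x i ∈ s i} = ∏ i, volume (s i) := by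
  have h := (PiLp.volume_preserving_ofLp (Fin 3)).measure_preimage
    (MeasurableSet.univ_pi hs).nullMeasurableSet
  rw [volume_pi, Measure.pi_pi] at h
  rw [← h]
  congr 1
  ext x
  simp

lemma measurePreserving_ofPairs (n : ℕ) :
    MeasurePreserving (ofPairs : (Fin n → Pair) → Config n) := by
  set G : (Fin n → Pair) → ((Fin n ⊕ Fin n) × Fin 3 → ℝ) := fun x q =>
    Sum.elim (fun i => (x i).1 q.2) (fun i => (x i).2 q.2) q.1 with hG
  have hGm : Measurable G := (WithLp.measurable_ofLp 2 _).comp measurable_ofPairs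
  have h : MeasurePreserving G := by
    refine ⟨hGm, ?_⟩
    rw [eq_comm]
    refine Measure.pi_eq fun s hs => ?_
    rw [Measure.map_apply hGm (MeasurableSet.univ_pi hs)]
    have e : G ⁻¹' Set.pi Set.univ s = Set.pi Set.univ fun i : Fin n =>
        {x : Space | ∀ a, x a ∈ s (Sum.inl i, a)} ×ˢ {x : Space | ∀ a, x a ∈ s (Sum.inr i, a)} := by
      ext x
      simp only [Set.mem_preimage, Set.mem_pi, Set.mem_univ, true_imp_iff, Set.mem_prod,
        Set.mem_ofPred_eq, Prod.forall, Sum.forall, hG, Sum.elim_inl, Sum.elim_inr]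
      exact forall_and.symm
    rw [e, volume_pi, Measure.pi_pi]
    simp_rw [Measure.volume_eq_prod, Measure.prod_prod]
    rw [Fintype.prod_prod_type, Fintype.prod_sum_type, ← Finset.prod_mul_distrib]
    refine Finset.prod_congr rfl fun i _ => ?_
    rw [volume_space_box _ fun a => hs _, volume_space_box _ fun a => hs _]
  exact (PiLp.volume_preserving_toLp _).comp h

/-- Configurations as families of pairs. -/
def pairsEquiv (n : ℕ) : Config n ≃ᵐ (Fin n → Pair) where
  toFun := pairs
  invFun := ofPairs
  left_inv := ofPairs_pairs
  right_inv := pairs_ofPairs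
  measurable_toFun := measurable_pairs
  measurable_invFun := measurable_ofPairs

lemma measurePreserving_pairs (n : ℕ) : MeasurePreserving (pairs : Config n → Fin n → Pair) :=
  MeasurePreserving.symm (pairsEquiv n).symm (measurePreserving_ofPairs n)

/-- The pairs of a configuration as the beginning of a sequence. -/
def pairSeq {n : ℕ} (z : Config n) : ℕ → Pair := extendSeq (pairs z)

lemma measurable_pairSeq {n : ℕ} : Measurable (pairSeq : Config n → ℕ → Pair) :=
  measurable_extendSeq.comp measurable_pairs

/-! ### The `L²` bound for a forest. -/

namespace CollapseTree

variable {β : ℝ → ℝ}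

lemma exists_roots_eq (F : List CollapseTree) : ∀ o : ℕ,
    ∃ g : (ℕ → Pair) → Fin F.length → Pair, Measurable g ∧ ∀ ξ, roots F o ξ = List.ofFn (g ξ) := by
  induction F with
  | nil => exact fun o => ⟨fun _ => Fin.elim0, measurable_pi_lambda _ fun i => i.elim0, fun ξ => by
      simp [roots]⟩
  | cons T F ih =>
    intro o
    obtain ⟨g, hg, h⟩ := ih (o + T.nodes + 1)
    refine ⟨fun ξ => Fin.cons (root T o ξ) (g ξ), measurable_pi_lambda _ fun i => ?_, fun ξ => ?_⟩
    · refine Fin.cases ?_ (fun i => ?_) i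
      · exact measurable_root T o
      · exact (measurable_pi_apply i).comp hg
    · rw [roots, h]
      exact (List.ofFn_cons _ _).symm

lemma measurable_famp (hβ : Continuous β) (F : List CollapseTree) : ∀ o,
    Measurable fun p : (ℕ → Pair) × ℝ × ℝ => famp β F o p.1 p.2.1 p.2.2 := by
  induction F with
  | nil => intro o; simp only [famp]; fun_prop
  | cons T F ih =>
    intro o
    simp only [famp]
    exact (measurable_amp hβ T o).mul (ih _)

lemma measurable_roots_comp {F : List CollapseTree} {k : ℕ} (hF : F.length = k)
    {Ψ : List Pair → ℂ} (hΨ : Measurable fun x : Fin k → Pair => Ψ (List.ofFn x)) (o : ℕ) :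
    Measurable fun ξ : ℕ → Pair => Ψ (roots F o ξ) := by
  subst hF
  obtain ⟨g, hg, h⟩ := exists_roots_eq F o
  simp_rw [h]
  exact hΨ.comp hg

/-- The tree bound is applied to the observable `Ψ Ξ` times the indicator of `τ ≤ t`, which selects
the end time; its integral over `τ` costs at most the mass `2`. -/
lemma lintegral_amp_le (hβ : Continuous β) {σ t T₁ B : ℝ} (hT : 0 < T₁) (h1 : σ ≤ t)
    (h2 : t ≤ σ + T₁) (hB : ∀ τ ∈ Set.Icc σ (σ + T₁), |β τ| ≤ B) (T : CollapseTree)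
    {Ψ : Pair → ℂ} (hΨ : Measurable Ψ) :
    ∫⁻ x : Fin (T.nodes + 1) → Pair, ‖Ψ (root T 0 (extendSeq x)) * amp β T 0 (extendSeq x) σ t‖ₑ ^ 2
      ≤ 2 * ENNReal.ofReal (4 * (fiberConst * B ^ 2 * T₁)) ^ T.nodes * ∫⁻ Ξ, ‖Ψ Ξ‖ₑ ^ 2 := by
  have hk := measurable_ite_le (X := Pair × ℝ) (f := fun p => p.2) (g := fun _ => t)
    (by fun_prop) (by fun_prop)
  have := lintegral_integral_dens_le hβ hT hB T _ rfl (fun Ξ τ => Ψ Ξ * if τ ≤ t then 1 else 0)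
    (by fun_prop) (fun Ξ => ⟨‖Ψ Ξ‖, fun τ => by split_ifs <;> simp⟩)
  have e : ∀ x : Fin (T.nodes + 1) → Pair, ∫ τ, (Ψ (root T 0 (extendSeq x)) * if τ ≤ t then 1 else 0)
        * dens β T₁ T (extendSeq x) σ τ ∂timeMeasure σ T₁
      = Ψ (root T 0 (extendSeq x)) * amp β T 0 (extendSeq x) σ t := by
    intro x
    rw [amp_eq_integral_dens hβ hT T _ h1 h2, ← integral_const_mul]
    simp_rw [mul_assoc]
  simp_rw [e] at this
  refine this.trans ?_
  rw [mul_comm (2 : ℝ≥0∞), mul_assoc (_ ^ _)]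
  gcongr
  rw [← lintegral_const_mul' _ _ (by simp)]
  refine lintegral_mono fun Ξ => ?_
  calc ∫⁻ τ, ‖Ψ Ξ * if τ ≤ t then 1 else 0‖ₑ ^ 2 ∂timeMeasure σ T₁
      ≤ ∫⁻ _τ, ‖Ψ Ξ‖ₑ ^ 2 ∂timeMeasure σ T₁ := by
        refine lintegral_mono fun τ => ?_
        split_ifs <;> simp
    _ = 2 * ‖Ψ Ξ‖ₑ ^ 2 := by
        rw [lintegral_const, timeMeasure_univ hT, mul_comm]

lemma lintegral_fin_cons {n : ℕ} {f : (Fin (n + 1) → Pair) → ℝ≥0∞} (hf : Measurable f) :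
    ∫⁻ w, f w = ∫⁻ z : Fin n → Pair, ∫⁻ Ξ : Pair, f (Fin.cons Ξ z) := by
  have h := (volume_preserving_piFinSuccAbove (fun _ : Fin (n + 1) => Pair) 0).symm
  have e : ⇑(MeasurableEquiv.piFinSuccAbove (fun _ : Fin (n + 1) => Pair) 0).symm
      = fun p : Pair × (Fin n → Pair) => (Fin.cons p.1 p.2 : Fin (n + 1) → Pair) := by
    funext p
    exact Fin.insertNth_zero' _ _
  have hc : Measurable fun p : Pair × (Fin n → Pair) => (Fin.cons p.1 p.2 : Fin (n + 1) → Pair) := by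
    rw [← e]
    exact MeasurableEquiv.measurable _
  rw [← h.lintegral_comp hf, e]
  have := lintegral_prod_symm (μ := (volume : Measure Pair)) (ν := (volume : Measure (Fin n → Pair)))
    _ (hf.comp hc).aemeasurable
  exact this

/-- Different trees own disjoint blocks of leaves. The trees are integrated out one at a time, with
the other roots as parameters; every tree costs a factor `2` and every collapse its own constant. -/
lemma lintegral_famp_le (hβ : Continuous β) {σ t T₁ B : ℝ} (hT : 0 < T₁) (h1 : σ ≤ t)
    (h2 : t ≤ σ + T₁) (hB : ∀ τ ∈ Set.Icc σ (σ + T₁), |β τ| ≤ B) (F : List CollapseTree) :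
    ∀ (n : ℕ), n = (F.map nodes).sum + F.length → ∀ Ψ : List Pair → ℂ,
      Measurable (fun x : Fin F.length → Pair => Ψ (List.ofFn x)) →
    ∫⁻ x : Fin n → Pair, ‖Ψ (roots F 0 (extendSeq x)) * famp β F 0 (extendSeq x) σ t‖ₑ ^ 2
      ≤ 2 ^ F.length * ENNReal.ofReal (4 * (fiberConst * B ^ 2 * T₁)) ^ (F.map nodes).sum
        * ∫⁻ y : Fin F.length → Pair, ‖Ψ (List.ofFn y)‖ₑ ^ 2 := by
  set κ : ℝ≥0∞ := ENNReal.ofReal (4 * (fiberConst * B ^ 2 * T₁)) with hκ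
  have hκt : κ ≠ ∞ := ENNReal.ofReal_ne_top
  have hfm : ∀ (F : List CollapseTree) (n : ℕ), Measurable fun x : Fin n → Pair =>
      famp β F 0 (extendSeq x) σ t := fun F n =>
    (measurable_famp hβ F 0).comp (measurable_extendSeq.prodMk (measurable_const (a := (σ, t))))
  induction F with
  | nil =>
    intro n hn Ψ hΨ
    simp only [List.map_nil, List.sum_nil, List.length_nil, add_zero] at hn
    subst hn
    simp [roots, famp]
  | cons T F ih =>
    intro n hn Ψ hΨ
    have hn' : n = (T.nodes + 1) + ((F.map nodes).sum + F.length) := by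
      simp only [List.map_cons, List.sum_cons, List.length_cons] at hn
      omega
    subst hn'
    set m := (F.map nodes).sum + F.length with hm
    have hΨc : Measurable fun p : Pair × (Fin F.length → Pair) => Ψ (p.1 :: List.ofFn p.2) := by
      have hc : Measurable fun p : Pair × (Fin F.length → Pair) =>
          (Fin.cons p.1 p.2 : Fin (F.length + 1) → Pair) := by
        refine measurable_pi_lambda _ fun i => Fin.cases ?_ (fun i => ?_) i
        · exact measurable_fst
        · exact (measurable_pi_apply i).comp measurable_snd
      have := hΨ.comp hc
      simpa only [Function.comp_def, List.ofFn_cons] using this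
    have hmeas : Measurable fun x : Fin (T.nodes + 1 + m) → Pair =>
        ‖Ψ (roots (T :: F) 0 (extendSeq x)) * famp β (T :: F) 0 (extendSeq x) σ t‖ₑ ^ 2 :=
      (((measurable_roots_comp rfl hΨ 0).comp measurable_extendSeq).mul (hfm _ _)).enorm.pow_const 2
    have e : ∀ (x : Fin (T.nodes + 1) → Pair) (y : Fin m → Pair),
        ‖Ψ (roots (T :: F) 0 (extendSeq (Fin.append x y)))
          * famp β (T :: F) 0 (extendSeq (Fin.append x y)) σ t‖ₑ ^ 2
        = ‖amp β T 0 (extendSeq x) σ t‖ₑ ^ 2 * ‖Ψ (root T 0 (extendSeq x) :: roots F 0 (extendSeq y))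
          * famp β F 0 (extendSeq y) σ t‖ₑ ^ 2 := by
      intro x y
      have hx : ∀ i ≤ T.nodes, extendSeq (Fin.append x y) (0 + i) = extendSeq x (0 + i) :=
        fun i hi => by rw [zero_add, extendSeq_append_left x y (by omega)]
      have hy := forest_congr (β := β) F (0 + T.nodes + 1) 0 (extendSeq (Fin.append x y))
        (extendSeq y) fun i hi => by
          rw [zero_add, zero_add, extendSeq_append_right x y (by omega)]
      rw [roots, famp, root_congr T 0 0 _ _ hx, amp_congr T 0 0 _ _ σ t hx, hy.1, hy.2,
        ← mul_pow, ← enorm_mul]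
      congr 2
      ring
    have hΨx : ∀ X : Pair, Measurable fun x : Fin F.length → Pair => Ψ (X :: List.ofFn x) :=
      fun X => hΨc.comp (measurable_const.prodMk measurable_id)
    have ham : Measurable fun x : Fin (T.nodes + 1) → Pair => amp β T 0 (extendSeq x) σ t :=
      (measurable_amp hβ T 0).comp (measurable_extendSeq.prodMk (measurable_const (a := (σ, t))))
    have hrm : Measurable fun x : Fin (T.nodes + 1) → Pair => root T 0 (extendSeq x) :=
      (measurable_root T 0).comp measurable_extendSeq
    set D : ℝ≥0∞ := 2 ^ F.length * κ ^ (F.map nodes).sum with hD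
    have hDt : D ≠ ∞ := ENNReal.mul_ne_top (by simp) (ENNReal.pow_ne_top hκt)
    have hswap : Measurable fun p : (Fin (T.nodes + 1) → Pair) × (Fin F.length → Pair) =>
        ‖Ψ (root T 0 (extendSeq p.1) :: List.ofFn p.2) * amp β T 0 (extendSeq p.1) σ t‖ₑ ^ 2 :=
      ((hΨc.comp ((hrm.comp measurable_fst).prodMk measurable_snd)).mul
        (ham.comp measurable_fst)).enorm.pow_const 2
    rw [lintegral_append hmeas]
    simp_rw [e]
    calc ∫⁻ x : Fin (T.nodes + 1) → Pair, ∫⁻ y : Fin m → Pair, ‖amp β T 0 (extendSeq x) σ t‖ₑ ^ 2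
          * ‖Ψ (root T 0 (extendSeq x) :: roots F 0 (extendSeq y))
          * famp β F 0 (extendSeq y) σ t‖ₑ ^ 2
        ≤ ∫⁻ x : Fin (T.nodes + 1) → Pair, D * ∫⁻ z : Fin F.length → Pair,
          ‖Ψ (root T 0 (extendSeq x) :: List.ofFn z) * amp β T 0 (extendSeq x) σ t‖ₑ ^ 2 := by
          refine lintegral_mono fun x => ?_
          rw [lintegral_const_mul' _ _ (by finiteness)]
          refine (mul_le_mul_right (ih m rfl (fun l => Ψ (root T 0 (extendSeq x) :: l))
            (hΨx _)) _).trans (le_of_eq ?_)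
          rw [mul_left_comm, ← lintegral_const_mul' _ _ (by finiteness)]
          congr 1
          refine lintegral_congr fun z => ?_
          rw [enorm_mul, mul_pow, mul_comm]
      _ = D * ∫⁻ z : Fin F.length → Pair, ∫⁻ x : Fin (T.nodes + 1) → Pair,
          ‖Ψ (root T 0 (extendSeq x) :: List.ofFn z) * amp β T 0 (extendSeq x) σ t‖ₑ ^ 2 := by
          rw [lintegral_const_mul' _ _ hDt, lintegral_lintegral_swap hswap.aemeasurable]
      _ ≤ D * ∫⁻ z : Fin F.length → Pair, 2 * κ ^ T.nodes * ∫⁻ Ξ, ‖Ψ (Ξ :: List.ofFn z)‖ₑ ^ 2 := by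
          refine mul_le_mul_right (lintegral_mono fun z => ?_) _
          exact lintegral_amp_le hβ hT h1 h2 hB T (Ψ := fun Ξ => Ψ (Ξ :: List.ofFn z))
            (hΨc.comp (measurable_id.prodMk measurable_const))
      _ = D * (2 * κ ^ T.nodes) * ∫⁻ y : Fin (F.length + 1) → Pair, ‖Ψ (List.ofFn y)‖ₑ ^ 2 := by
          rw [lintegral_const_mul' _ _ (ENNReal.mul_ne_top (by simp) (ENNReal.pow_ne_top hκt)),
            lintegral_fin_cons (hΨ.enorm.pow_const 2)]
          simp only [List.ofFn_cons]
          rw [mul_assoc D]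
      _ = _ := by
          rw [hD]
          simp only [List.length_cons, List.map_cons, List.sum_cons, pow_succ, pow_add]
          congr 1
          ring

end CollapseTree


/-! ### Counting the histories. -/

lemma enorm_sum_sq_le {ι : Type*} (s : Finset ι) (f : ι → ℂ) :
    ‖∑ i ∈ s, f i‖ₑ ^ 2 ≤ s.card * ∑ i ∈ s, ‖f i‖ₑ ^ 2 := by
  have h : ‖∑ i ∈ s, f i‖ ^ 2 ≤ s.card * ∑ i ∈ s, ‖f i‖ ^ 2 :=
    (pow_le_pow_left₀ (norm_nonneg _) (norm_sum_le _ _) 2).trans sq_sum_le_card_mul_sum_sq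
  have := ENNReal.ofReal_le_ofReal h
  rw [ENNReal.ofReal_mul (by positivity), ENNReal.ofReal_sum_of_nonneg (by intros; positivity),
    ENNReal.ofReal_natCast, ENNReal.ofReal_pow (norm_nonneg _), ofReal_norm] at this
  simpa only [ENNReal.ofReal_pow (norm_nonneg _), ofReal_norm] using this

namespace CollapseTree

variable {β : ℝ → ℝ}

/-- The recursion over the two subtrees is that of the Catalan numbers, with a choice of branch at
every node. -/
lemma card_trees (n : ℕ) : (trees n).card = 2 ^ n * catalan n := by
  induction n using Nat.strong_induction_on with
  | _ n ih =>
    cases n with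
    | zero => simp [trees_zero]
    | succ n =>
      rw [Finset.card_eq_sum_ones, sum_trees_succ, catalan_succ']
      simp only [Finset.sum_const, smul_eq_mul, mul_one, Finset.card_univ, Fintype.card_bool]
      have key : ∀ p ∈ Finset.HasAntidiagonal.antidiagonal n,
          (trees p.1).card * (trees p.2).card = 2 ^ n * (catalan p.1 * catalan p.2) := by
        intro p hp
        have hp' := Finset.HasAntidiagonal.mem_antidiagonal.1 hp
        rw [ih p.1 (by omega), ih p.2 (by omega), ← hp', pow_add]
        ring
      rw [Finset.sum_congr rfl key, ← Finset.mul_sum]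
      ring

lemma card_trees_le (n : ℕ) : (trees n).card ≤ 8 ^ n := by
  rw [card_trees, show 8 = 2 * 4 from rfl, mul_pow]
  refine Nat.mul_le_mul_left _ ?_
  rw [catalan_eq_centralBinom_div]
  refine (Nat.div_le_self _ _).trans ?_
  rw [Nat.centralBinom_eq_two_mul_choose]
  calc (2 * n).choose n ≤ 2 ^ (2 * n) := Nat.choose_le_two_pow _ _
    _ = 4 ^ n := by rw [pow_mul]; norm_num

/-- For fixed `k` the growth is exponential in `N`, in contrast to the factorial number of
time-ordered sequences of collapses. A small factor per collapse can beat it. -/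
lemma card_forests_le (k : ℕ) : ∀ N, (forests k N).card ≤ (N + 1) ^ k * 8 ^ N := by
  induction k with
  | zero =>
    intro N
    rw [forests]
    split_ifs with h
    · simp [h]
    · simp
  | succ k ih =>
    intro N
    rw [Finset.card_eq_sum_ones, sum_forests_succ]
    simp only [Finset.sum_const, smul_eq_mul, mul_one]
    calc ∑ p ∈ Finset.HasAntidiagonal.antidiagonal N, (trees p.1).card * (forests k p.2).card
        ≤ ∑ _p ∈ Finset.HasAntidiagonal.antidiagonal N, (N + 1) ^ k * 8 ^ N := by
          refine Finset.sum_le_sum fun p hp => ?_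
          have hp' := Finset.HasAntidiagonal.mem_antidiagonal.1 hp
          calc (trees p.1).card * (forests k p.2).card
              ≤ 8 ^ p.1 * ((p.2 + 1) ^ k * 8 ^ p.2) := Nat.mul_le_mul (card_trees_le _) (ih _)
            _ = (p.2 + 1) ^ k * 8 ^ N := by rw [← hp', pow_add]; ring
            _ ≤ (N + 1) ^ k * 8 ^ N := by
                gcongr
                omega
      _ = (N + 1) ^ (k + 1) * 8 ^ N := by
          rw [Finset.sum_const, Finset.Nat.card_antidiagonal, smul_eq_mul, pow_succ]
          ring

end CollapseTree

/-! ### Sums over histories as functions on configurations. -/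

open CollapseTree

/-- A function on configurations, as a function on lists of pairs. -/
def onLists {k : ℕ} (ψ : Config k → ℂ) (l : List Pair) : ℂ :=
  if h : l.length = k then ψ (ofPairs fun i => l.get (i.cast h.symm)) else 0

lemma onLists_ofFn {k : ℕ} (ψ : Config k → ℂ) (y : Fin k → Pair) :
    onLists ψ (List.ofFn y) = ψ (ofPairs y) := by
  have h : (List.ofFn y).length = k := by simp
  rw [onLists, dif_pos h]
  congr 2
  funext i
  simp

variable {β : ℝ → ℝ}

/-- The sum over all histories of `k` pairs with `N` collapses, tested against `ψ`. -/
def historySum (β : ℝ → ℝ) (k N : ℕ) (ψ : Config k → ℂ) (ζ : Config (k + N)) (σ t : ℝ) : ℂ :=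
  forestSum β k N (onLists ψ) (pairSeq ζ) σ t

lemma measurable_historySum (hβ : Continuous β) {k : ℕ} (N : ℕ) {ψ : Config k → ℂ}
    (hψ : Measurable ψ) :
    Measurable fun p : Config (k + N) × ℝ × ℝ => historySum β k N ψ p.1 p.2.1 p.2.2 := by
  unfold historySum forestSum
  refine Finset.measurable_fun_sum _ fun F hF => ?_
  have hΨ : Measurable fun x : Fin k → Pair => onLists ψ (List.ofFn x) := by
    simp_rw [onLists_ofFn]
    exact hψ.comp measurable_ofPairs
  have h0 : Measurable fun p : Config (k + N) × ℝ × ℝ => pairSeq p.1 :=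
    measurable_pairSeq.comp measurable_fst
  exact ((measurable_roots_comp (nodes_sum_of_mem_forests k N hF).1 hΨ 0).comp h0).mul
    ((measurable_famp hβ F 0).comp (h0.prodMk measurable_snd))

lemma historySum_zero {k : ℕ} (ψ : Config k → ℂ) (ζ : Config (k + 0)) (σ t : ℝ) :
    historySum β k 0 ψ ζ σ t = ψ ζ := by
  rw [historySum, forestSum_zero]
  have : (List.range k).map (pairSeq ζ) = List.ofFn (pairs (n := k) ζ) := by
    rw [List.ofFn_eq_map, ← List.map_coe_finRange_eq_range, List.map_map]
    refine List.map_congr_left fun i _ => ?_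
    simp [pairSeq, extendSeq]
  rw [this, onLists_ofFn]
  exact congrArg ψ (ofPairs_pairs (n := k) ζ)

/-- The number of forests enters squared, once through Cauchy–Schwarz and once as the number of
summands. The bound of a single forest depends only on its numbers of trees and of collapses. -/
lemma lintegral_historySum_le (hβ : Continuous β) {σ t T₁ B : ℝ} (hT : 0 < T₁) (h1 : σ ≤ t)
    (h2 : t ≤ σ + T₁) (hB : ∀ τ ∈ Set.Icc σ (σ + T₁), |β τ| ≤ B) {k : ℕ} (N : ℕ)
    {ψ : Config k → ℂ} (hψ : Measurable ψ) :
    ∫⁻ ζ : Config (k + N), ‖historySum β k N ψ ζ σ t‖ₑ ^ 2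
      ≤ (((N + 1) ^ k * 8 ^ N : ℕ) : ℝ≥0∞) ^ 2 *
        (2 ^ k * ENNReal.ofReal (4 * (fiberConst * B ^ 2 * T₁)) ^ N) * ∫⁻ z, ‖ψ z‖ₑ ^ 2 := by
  set κ : ℝ≥0∞ := ENNReal.ofReal (4 * (fiberConst * B ^ 2 * T₁)) with hκ
  have hΨ : Measurable fun x : Fin k → Pair => onLists ψ (List.ofFn x) := by
    simp_rw [onLists_ofFn]
    exact hψ.comp measurable_ofPairs
  have hterm : ∀ F ∈ forests k N, Measurable fun ζ : Config (k + N) =>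
      ‖onLists ψ (roots F 0 (pairSeq ζ)) * famp β F 0 (pairSeq ζ) σ t‖ₑ ^ 2 := fun F hF =>
    (((measurable_roots_comp (nodes_sum_of_mem_forests k N hF).1 hΨ 0).comp
      measurable_pairSeq).mul ((measurable_famp hβ F 0).comp
      (measurable_pairSeq.prodMk (measurable_const (a := (σ, t)))))).enorm.pow_const 2
  have hF : ∀ F ∈ forests k N, ∫⁻ ζ : Config (k + N),
      ‖onLists ψ (roots F 0 (pairSeq ζ)) * famp β F 0 (pairSeq ζ) σ t‖ₑ ^ 2
      ≤ 2 ^ k * κ ^ N * ∫⁻ z, ‖ψ z‖ₑ ^ 2 := by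
    intro F hF
    obtain ⟨hl, hn⟩ := nodes_sum_of_mem_forests k N hF
    have e1 := (measurePreserving_ofPairs (k + N)).lintegral_comp (hterm F hF)
    have e2 := (measurePreserving_ofPairs k).lintegral_comp (hψ.enorm.pow_const 2)
    have hΨ' : Measurable fun x : Fin F.length → Pair => onLists ψ (List.ofFn x) := by
      rw [hl]; exact hΨ
    have hb := lintegral_famp_le hβ hT h1 h2 hB F (k + N) (by omega) (onLists ψ) hΨ'
    rw [hl, hn] at hb
    rw [← e1, ← e2]
    simp_rw [onLists_ofFn] at hb
    simpa only [pairSeq, pairs_ofPairs] using hb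
  calc ∫⁻ ζ : Config (k + N), ‖historySum β k N ψ ζ σ t‖ₑ ^ 2
      ≤ ∫⁻ ζ : Config (k + N), (forests k N).card * ∑ F ∈ forests k N,
        ‖onLists ψ (roots F 0 (pairSeq ζ)) * famp β F 0 (pairSeq ζ) σ t‖ₑ ^ 2 :=
        lintegral_mono fun ζ => enorm_sum_sq_le _ _
    _ = (forests k N).card * ∑ F ∈ forests k N, ∫⁻ ζ : Config (k + N),
        ‖onLists ψ (roots F 0 (pairSeq ζ)) * famp β F 0 (pairSeq ζ) σ t‖ₑ ^ 2 := by
        rw [lintegral_const_mul' _ _ (by simp), lintegral_finsetSum' _ fun F hF =>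
          (hterm F hF).aemeasurable]
    _ ≤ (forests k N).card * ∑ _F ∈ forests k N, 2 ^ k * κ ^ N * ∫⁻ z, ‖ψ z‖ₑ ^ 2 :=
        mul_le_mul_right (Finset.sum_le_sum hF) _
    _ = ((forests k N).card : ℝ≥0∞) ^ 2 * (2 ^ k * κ ^ N) * ∫⁻ z, ‖ψ z‖ₑ ^ 2 := by
        rw [Finset.sum_const, nsmul_eq_mul]
        ring
    _ ≤ _ := by
        gcongr
        exact card_forests_le k N

/-! ### The collapse of a pair with the last pair -/

/-- The momenta after the collapse of the pair `j` with the last pair. -/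
def mergeLast {n : ℕ} (j : Fin n) (b : Bool) (ζ : Config (n + 1)) : Config n :=
  ofPairs (Function.update (fun i => pairs ζ i.castSucc) j
    (merge b (pairs ζ j.castSucc) (pairs ζ (Fin.last n))))

/-- The factor that belongs to the collapse of the pair `j` with the last pair. -/
def vertexLast {n : ℕ} (j : Fin n) (b : Bool) (ζ : Config (n + 1)) (τ : ℝ) : ℂ :=
  vertex b (pairs ζ j.castSucc) (pairs ζ (Fin.last n)) τ

lemma pairs_mergeLast {n : ℕ} (j : Fin n) (b : Bool) (ζ : Config (n + 1)) :
    pairs (mergeLast j b ζ) = Function.update (fun i => pairs ζ i.castSucc) j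
      (merge b (pairs ζ j.castSucc) (pairs ζ (Fin.last n))) := pairs_ofPairs _

lemma measurable_mergeLast {n : ℕ} (j : Fin n) (b : Bool) :
    Measurable (mergeLast j b : Config (n + 1) → Config n) := by
  refine measurable_ofPairs.comp (measurable_pi_lambda _ fun i => ?_)
  have h : ∀ i, Measurable fun ζ : Config (n + 1) => pairs ζ i := fun i =>
    (measurable_pi_apply i).comp measurable_pairs
  by_cases hi : i = j
  · subst hi
    simp only [Function.update_self]
    exact (measurable_merge b).comp ((h _).prodMk (h _))
  · simp only [Function.update_of_ne hi]
    exact h _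

lemma measurable_vertexLast {n : ℕ} (j : Fin n) (b : Bool) :
    Measurable fun p : Config (n + 1) × ℝ => vertexLast j b p.1 p.2 := by
  have h : ∀ i, Measurable fun p : Config (n + 1) × ℝ => pairs p.1 i := fun i =>
    ((measurable_pi_apply i).comp measurable_pairs).comp measurable_fst
  have h2 : Measurable fun p : Config (n + 1) × ℝ =>
      (pairs p.1 j.castSucc, pairs p.1 (Fin.last n), p.2) :=
    (h _).prodMk ((h _).prodMk measurable_snd)
  have h3 := (measurable_vertex b).comp h2
  unfold vertexLast
  simpa only [Function.comp_def] using h3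

lemma pairs_permute {n : ℕ} (σ : Equiv.Perm (Fin n)) (z : Config n) (i : Fin n) :
    pairs (permute σ z) i = pairs z (σ i) := rfl

/-- The permutation that moves the last particle behind the particle `j`. -/
def movePerm {n : ℕ} (j : Fin n) : Equiv.Perm (Fin (n + 1)) :=
  (finSuccEquiv' j.succ).trans (finSuccEquivLast).symm

lemma movePerm_succ {n : ℕ} (j : Fin n) : movePerm j j.succ = Fin.last n := by
  simp [movePerm]

lemma movePerm_succAbove {n : ℕ} (j i : Fin n) : movePerm j (j.succ.succAbove i) = i.castSucc := by
  simp [movePerm]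

/-- After a permutation, a collapse with the last pair is a collapse with the next pair. -/
lemma mergeAt_permute {n : ℕ} (j : Fin n) (b : Bool) (ζ : Config (n + 1)) :
    mergeAt j b (pairSeq (permute (movePerm j) ζ)) = pairSeq (mergeLast j b ζ) := by
  have hs : ∀ i : Fin n, i ≤ j → pairSeq (permute (movePerm j) ζ) i = pairs ζ i.castSucc := by
    intro i hi
    have h : (i : ℕ) < n + 1 := by omega
    have e : (⟨i, h⟩ : Fin (n + 1)) = j.succ.succAbove i := by
      rw [Fin.succAbove_of_castSucc_lt _ _ (by
        rw [Fin.lt_def]; simp only [Fin.val_castSucc, Fin.val_succ]; rw [Fin.le_def] at hi; omega)]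
      rfl
    simp only [pairSeq, extendSeq, h, dif_pos]
    rw [e, pairs_permute, movePerm_succAbove]
  have hg : ∀ i : Fin n, j < i → pairSeq (permute (movePerm j) ζ) (i + 1) = pairs ζ i.castSucc := by
    intro i hi
    have h : (i : ℕ) + 1 < n + 1 := by omega
    have e : (⟨i + 1, h⟩ : Fin (n + 1)) = j.succ.succAbove i := by
      rw [Fin.succAbove_of_le_castSucc _ _ (by
        rw [Fin.le_def]; simp only [Fin.val_castSucc, Fin.val_succ]; rw [Fin.lt_def] at hi; omega)]
      rfl
    simp only [pairSeq, extendSeq, h, dif_pos]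
    rw [e, pairs_permute, movePerm_succAbove]
  have hl : pairSeq (permute (movePerm j) ζ) (j + 1) = pairs ζ (Fin.last n) := by
    have h : (j : ℕ) + 1 < n + 1 := by omega
    have e : (⟨j + 1, h⟩ : Fin (n + 1)) = j.succ := rfl
    simp only [pairSeq, extendSeq, h, dif_pos]
    rw [e, pairs_permute, movePerm_succ]
  funext i
  by_cases hi : i < n
  · have er : pairSeq (mergeLast j b ζ) i = pairs (mergeLast j b ζ) ⟨i, hi⟩ := by
      simp [pairSeq, extendSeq, hi]
    rw [er, pairs_mergeLast]
    rcases lt_trichotomy i (j : ℕ) with h | h | h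
    · rw [mergeAt_of_lt h, Function.update_of_ne (by
        intro he; rw [← he] at h; simp at h)]
      exact hs ⟨i, hi⟩ (by rw [Fin.le_def]; exact h.le)
    · subst h
      rw [mergeAt_self, hs j le_rfl, hl]
      simp
    · rw [mergeAt_of_gt h, Function.update_of_ne (by
        intro he; rw [← he] at h; simp at h)]
      exact hg ⟨i, hi⟩ (by rw [Fin.lt_def]; exact h)
  · rw [mergeAt_of_gt (by omega)]
    simp [pairSeq, extendSeq, hi]

lemma vertex_permute {n : ℕ} (j : Fin n) (b : Bool) (ζ : Config (n + 1)) (τ : ℝ) :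
    vertex b (pairSeq (permute (movePerm j) ζ) j) (pairSeq (permute (movePerm j) ζ) (j + 1)) τ
      = vertexLast j b ζ τ := by
  have h : (j : ℕ) < n + 1 := by omega
  have h' : (j : ℕ) + 1 < n + 1 := by omega
  have e : (⟨j, h⟩ : Fin (n + 1)) = j.succ.succAbove j := by
    rw [Fin.succAbove_of_castSucc_lt _ _ (by
        rw [Fin.lt_def]; simp)]
    rfl
  have e' : (⟨j + 1, h'⟩ : Fin (n + 1)) = j.succ := rfl
  simp only [pairSeq, extendSeq, h, h', dif_pos, vertexLast]
  rw [e, e', pairs_permute, pairs_permute, movePerm_succ, movePerm_succAbove]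

/-- The forest recursion collapses neighbouring pairs, whereas the hierarchy collapses a pair with
the last one. The permutation `movePerm j` translates between the two, and the symmetry of the
solution will absorb it. -/
theorem historySum_succ (hβ : Continuous β) (k N : ℕ) (ψ : Config k → ℂ) (ζ : Config (k + N + 1))
    {σ t : ℝ} (hσ : σ ≤ t) :
    historySum β k (N + 1) ψ ζ σ t = ∑ j : Fin (k + N), ∑ b : Bool, ∫ r in σ..t,
      (β r : ℂ) * vertexLast j b (permute (movePerm j).symm ζ) r
        * historySum β k N ψ (mergeLast j b (permute (movePerm j).symm ζ)) r t := by
  have hp : ∀ j : Fin (k + N), permute (movePerm j) (permute (movePerm j).symm ζ) = ζ := by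
    intro j
    ext ⟨p, i⟩
    cases p <;> simp [permute]
  have hc : ∀ (j : ℕ) (b : Bool), Continuous fun r => (β r : ℂ) *
      vertex b (pairSeq (n := k + N + 1) ζ j) (pairSeq (n := k + N + 1) ζ (j + 1)) r
        * forestSum β k N (onLists ψ) (mergeAt j b (pairSeq (n := k + N + 1) ζ)) r t := by
    intro j b
    have h1 := continuous_vertex b (pairSeq (n := k + N + 1) ζ j) (pairSeq (n := k + N + 1) ζ (j + 1))
    have h2 := (continuous_forestSum hβ k N (onLists ψ)
      (mergeAt j b (pairSeq (n := k + N + 1) ζ))).comp (by fun_prop : Continuous fun r : ℝ => (r, t))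
    simp only [Function.comp_def] at h2
    fun_prop
  rw [historySum, forestSum_succ hβ k N _ _ hσ]
  have hs : ∀ r, ∑ j ∈ Finset.range (k + N), ∑ b : Bool, (β r : ℂ) *
      vertex b (pairSeq (n := k + N + 1) ζ j) (pairSeq (n := k + N + 1) ζ (j + 1)) r
        * forestSum β k N (onLists ψ) (mergeAt j b (pairSeq (n := k + N + 1) ζ)) r t
      = ∑ j : Fin (k + N), ∑ b : Bool, (β r : ℂ) *
      vertex b (pairSeq (n := k + N + 1) ζ j) (pairSeq (n := k + N + 1) ζ (j + 1)) r
        * forestSum β k N (onLists ψ) (mergeAt j b (pairSeq (n := k + N + 1) ζ)) r t := fun r =>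
    Finset.sum_range _
  rw [intervalIntegral.integral_congr fun r _ => hs r, intervalIntegral.integral_finsetSum]
  · refine Finset.sum_congr rfl fun j _ => ?_
    rw [intervalIntegral.integral_finsetSum]
    · refine Finset.sum_congr rfl fun b _ => ?_
      refine intervalIntegral.integral_congr fun r _ => ?_
      have e1 := mergeAt_permute j b (permute (movePerm j).symm ζ)
      have e2 := vertex_permute j b (permute (movePerm j).symm ζ) r
      rw [hp] at e1 e2
      simp only [e1, e2]
      rfl
    · intro b _
      exact (hc j b).intervalIntegrable _ _
  · intro j _
    exact (continuous_finsetSum _ fun b _ => hc j b).intervalIntegrable _ _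


/-! ### The bilinear pairing on `L²` -/

section Pairing

variable {α : Type*} [MeasurableSpace α] {μ : Measure α}

instance holderTriple_two_two_one : ENNReal.HolderTriple 2 2 1 := ⟨by
  rw [inv_one, ENNReal.inv_two_add_inv_two]⟩

/-- The bilinear pairing `∫ f g` on `L²`. -/
def pair2 : Lp ℂ 2 μ →L[ℂ] Lp ℂ 2 μ →L[ℂ] ℂ := (ContinuousLinearMap.mul ℂ ℂ).lpPairing μ 2 2

lemma pair2_apply (f g : Lp ℂ 2 μ) : pair2 f g = ∫ x, f x * g x ∂μ := by
  rw [pair2, ContinuousLinearMap.lpPairing_eq_integral]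
  rfl

lemma pair2_comm (f g : Lp ℂ 2 μ) : pair2 f g = pair2 g f := by
  simp_rw [pair2_apply, mul_comm]

lemma integrable_mul_lp (f g : Lp ℂ 2 μ) : Integrable (fun x => f x * g x) μ :=
  (Lp.memLp f).integrable_mul (Lp.memLp g)

lemma pair2_toLp {f : α → ℂ} (hf : MemLp f 2 μ) (g : Lp ℂ 2 μ) :
    pair2 (hf.toLp f) g = ∫ x, f x * g x ∂μ := by
  rw [pair2_apply]
  refine integral_congr_ae ?_
  filter_upwards [hf.coeFn_toLp] with x hx
  rw [hx]

/-- Complex conjugation of a square integrable function. -/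
def conjLp (f : Lp ℂ 2 μ) : Lp ℂ 2 μ := (Lp.memLp f).star.toLp _

lemma conjLp_ae (f : Lp ℂ 2 μ) : conjLp f =ᵐ[μ] fun x => (starRingEnd ℂ) (f x) :=
  (Lp.memLp f).star.coeFn_toLp

lemma inner_conjLp (f g : Lp ℂ 2 μ) : inner ℂ (conjLp f) g = pair2 f g := by
  rw [L2.inner_def, pair2_apply]
  refine integral_congr_ae ?_
  filter_upwards [conjLp_ae f] with x hx
  rw [hx, RCLike.inner_apply, RCLike.conj_conj, mul_comm]

lemma pair2_conjLp (f g : Lp ℂ 2 μ) : pair2 (conjLp f) g = inner ℂ f g := by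
  rw [L2.inner_def, pair2_apply]
  refine integral_congr_ae ?_
  filter_upwards [conjLp_ae f] with x hx
  rw [hx, RCLike.inner_apply, mul_comm]

lemma norm_conjLp (f : Lp ℂ 2 μ) : ‖conjLp f‖ = ‖f‖ := by
  rw [Lp.norm_def, Lp.norm_def]
  congr 1
  refine eLpNorm_congr_norm_ae ?_
  filter_upwards [conjLp_ae f] with x hx
  rw [hx, RCLike.norm_conj]

lemma norm_pair2_le (f g : Lp ℂ 2 μ) : ‖pair2 f g‖ ≤ ‖f‖ * ‖g‖ := by
  rw [← inner_conjLp, ← norm_conjLp f]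
  exact norm_inner_le_norm _ _

lemma eq_zero_of_pair2_eq_zero {g : Lp ℂ 2 μ} (h : ∀ f : Lp ℂ 2 μ, pair2 f g = 0) : g = 0 :=
  inner_self_eq_zero.1 (by rw [← pair2_conjLp, h])

end Pairing

/-! ### Weak and strong measurability -/

/-- Distinct vectors of the family are `√2` apart, so points of a countable dense set within `1/2`
of them are distinct as well. -/
lemma Orthonormal.countable_of_separable {H ι : Type*} [NormedAddCommGroup H] [InnerProductSpace ℂ H]
    [TopologicalSpace.SeparableSpace H] {v : ι → H} (hv : Orthonormal ℂ v) : Countable ι := by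
  have hd : ∀ i j, i ≠ j → 1 ≤ dist (v i) (v j) := by
    intro i j hij
    have h : ‖v i - v j‖ ^ 2 = 2 := by
      rw [@norm_sub_sq ℂ, hv.1 i, hv.1 j, hv.2 hij]
      norm_num
    rw [dist_eq_norm]
    nlinarith [norm_nonneg (v i - v j)]
  obtain ⟨D, hDc, hD⟩ := TopologicalSpace.exists_countable_dense H
  have hc : ∀ i, ∃ d : D, dist (v i) d < 1 / 2 := by
    intro i
    obtain ⟨d, hd, h⟩ := Metric.dense_iff.1 hD (v i) (1 / 2) (by norm_num)
    exact ⟨⟨d, h⟩, by rw [dist_comm]; exact hd⟩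
  choose d hd' using hc
  have : Countable D := hDc
  refine Function.Injective.countable (f := d) fun i j hij => ?_
  by_contra hne
  have h1 := hd i j hne
  have h2 := hd' i
  have h3 := hd' j
  rw [hij] at h2
  have h4 := dist_triangle_right (v i) (v j) (d j : H)
  linarith

/-- Pettis' theorem for a separable Hilbert space: the partial sums of the expansion in a countable
basis are measurable, and scalar measurability passes from a dense set of vectors to all of them by
limits. -/
lemma aestronglyMeasurable_of_inner {H Ω : Type*} [NormedAddCommGroup H] [InnerProductSpace ℂ H]
    [CompleteSpace H] [TopologicalSpace.SeparableSpace H] [MeasurableSpace Ω] {ν : Measure Ω}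
    {f : Ω → H} {D : Set H} (hD : Dense D)
    (h : ∀ v ∈ D, AEStronglyMeasurable (fun ω => inner ℂ v (f ω)) ν) :
    AEStronglyMeasurable f ν := by
  have hall : ∀ v, AEStronglyMeasurable (fun ω => inner ℂ v (f ω)) ν := by
    intro v
    obtain ⟨x, hx, hxl⟩ := mem_closure_iff_seq_limit.1 (hD v)
    exact aestronglyMeasurable_of_tendsto_ae atTop (fun n => h _ (hx n))
      (Eventually.of_forall fun ω => ((continuous_id.inner continuous_const).tendsto v).comp hxl)
  obtain ⟨w, b, hb⟩ := exists_hilbertBasis ℂ H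
  have : Countable w := Orthonormal.countable_of_separable b.orthonormal
  refine aestronglyMeasurable_of_tendsto_ae (atTop : Filter (Finset w))
    (f := fun S ω => ∑ i ∈ S, inner ℂ (b i) (f ω) • b i) (fun S => ?_)
    (Eventually.of_forall fun ω => ?_)
  · refine Finset.aestronglyMeasurable_fun_sum _ fun i _ => ?_
    exact (hall (b i)).smul aestronglyMeasurable_const
  · have := b.hasSum_repr (f ω)
    simp only [b.repr_apply_apply] at this
    exact this

instance secondCountableTopology_kernel2 (k : ℕ) : SecondCountableTopology (Kernel2 k) := by
  have : Fact ((2 : ℝ≥0∞) ≠ ∞) := ⟨by simp⟩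
  exact Lp.SecondCountableTopology

lemma aestronglyMeasurable_of_pair2 {k : ℕ} {Ω : Type*} [MeasurableSpace Ω] {ν : Measure Ω}
    {f : Ω → Kernel2 k} {D : Set (Kernel2 k)} (hD : Dense D)
    (h : ∀ v ∈ D, AEStronglyMeasurable (fun ω => pair2 v (f ω)) ν) :
    AEStronglyMeasurable f ν := by
  have hall : ∀ v, AEStronglyMeasurable (fun ω => pair2 v (f ω)) ν := by
    intro v
    obtain ⟨x, hx, hxl⟩ := mem_closure_iff_seq_limit.1 (hD v)
    refine aestronglyMeasurable_of_tendsto_ae atTop (fun n => h _ (hx n))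
      (Eventually.of_forall fun ω => ?_)
    have hc : Continuous fun v : Kernel2 k => pair2 v (f ω) :=
      (pair2.flip (f ω)).continuous
    exact (hc.tendsto v).comp hxl
  refine aestronglyMeasurable_of_inner (D := Set.univ) dense_univ fun v _ => ?_
  simp_rw [← pair2_conjLp]
  exact hall _

/-- A jointly measurable function with square integrable slices is a strongly measurable path. -/
lemma aestronglyMeasurable_toLp {k : ℕ} {Ω : Type*} [MeasurableSpace Ω] {ν : Measure Ω}
    [SFinite ν] {F : Ω → Config k → ℂ} (hF : Measurable fun p : Ω × Config k => F p.1 p.2)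
    (h2 : ∀ ω, MemLp (F ω) 2) : AEStronglyMeasurable (fun ω => (h2 ω).toLp (F ω)) ν := by
  refine aestronglyMeasurable_of_pair2 (D := Set.univ) dense_univ fun v _ => ?_
  simp_rw [pair2_comm v, pair2_toLp]
  refine StronglyMeasurable.aestronglyMeasurable ?_
  refine StronglyMeasurable.integral_prod_right
    (f := fun (ω : Ω) (ζ : Config k) => F ω ζ * v ζ) ?_
  exact hF.stronglyMeasurable.mul
    ((Lp.stronglyMeasurable v).comp_measurable measurable_snd)

/-! ### Dominated convergence in `L²` -/

lemma tendsto_toLp_of_dominated {α : Type*} [MeasurableSpace α] {μ : Measure α}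
    {F : ℕ → α → ℂ} {f : α → ℂ} {G : α → ℝ≥0∞} (hF : ∀ n, MemLp (F n) 2 μ) (hf : MemLp f 2 μ)
    (hG : ∫⁻ x, G x ^ 2 ∂μ ≠ ∞) (hb : ∀ n, ∀ᵐ x ∂μ, ‖F n x‖ₑ ≤ G x)
    (hb' : ∀ᵐ x ∂μ, ‖f x‖ₑ ≤ G x)
    (hl : ∀ᵐ x ∂μ, Tendsto (fun n => F n x) atTop (𝓝 (f x))) :
    Tendsto (fun n => (hF n).toLp (F n)) atTop (𝓝 (hf.toLp f)) := by
  rw [Lp.tendsto_Lp_iff_tendsto_eLpNorm'']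
  have h1 : Tendsto (fun n => ∫⁻ x, ‖F n x - f x‖ₑ ^ 2 ∂μ) atTop (𝓝 0) := by
    have h0 : (∫⁻ x, (0 : ℝ≥0∞) ∂μ) = 0 := by simp
    rw [← h0]
    refine tendsto_lintegral_of_dominated_convergence' (fun x => 4 * G x ^ 2)
      (fun n => (((hF n).1.sub hf.1).enorm.pow_const 2)) (fun n => ?_) ?_ ?_
    · filter_upwards [hb n, hb'] with x h1 h2
      calc ‖F n x - f x‖ₑ ^ 2 ≤ (G x + G x) ^ 2 := by
            gcongr
            exact (enorm_sub_le).trans (add_le_add h1 h2)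
        _ = 4 * G x ^ 2 := by ring
    · rw [lintegral_const_mul' _ _ (by simp)]
      exact ENNReal.mul_ne_top (by simp) hG
    · filter_upwards [hl] with x hx
      have h3 : Tendsto (fun n => F n x - f x) atTop (𝓝 0) := by
        simpa using hx.sub_const (f x)
      have h4 := ((continuous_enorm.tendsto (0 : ℂ)).comp h3)
      have h5 := ((ENNReal.continuous_pow 2).tendsto ‖(0 : ℂ)‖ₑ).comp h4
      simpa [Function.comp_def] using h5
  have h2 : ∀ n, eLpNorm (F n - f) 2 μ = (∫⁻ x, ‖F n x - f x‖ₑ ^ 2 ∂μ) ^ (1 / 2 : ℝ) := by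
    intro n
    rw [eLpNorm_eq_lintegral_rpow_enorm_toReal (by simp) (by simp)]
    simp
  simp_rw [h2]
  have h3 := ((ENNReal.continuous_rpow_const (y := (1 / 2 : ℝ))).tendsto 0).comp h1
  simpa [Function.comp_def] using h3

lemma enorm_toLp_sq {α : Type*} [MeasurableSpace α] {μ : Measure α} {f : α → ℂ}
    (hf : MemLp f 2 μ) : ‖hf.toLp f‖ₑ ^ 2 = ∫⁻ x, ‖f x‖ₑ ^ 2 ∂μ := by
  rw [Lp.enorm_toLp, eLpNorm_eq_lintegral_rpow_enorm_toReal (by simp) (by simp),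
    ← ENNReal.rpow_natCast, ← ENNReal.rpow_mul]
  simp

lemma memLp_two_of_lintegral {α : Type*} [MeasurableSpace α] {μ : Measure α} {f : α → ℂ}
    (hf : AEStronglyMeasurable f μ) (h : ∫⁻ x, ‖f x‖ₑ ^ 2 ∂μ ≠ ∞) : MemLp f 2 μ := by
  refine ⟨hf, ?_⟩
  rw [eLpNorm_eq_lintegral_rpow_enorm_toReal (by simp) (by simp)]
  refine ENNReal.rpow_lt_top_of_nonneg (by simp) ?_
  simpa using h

lemma lintegral_enorm_sq_ne_top {α : Type*} [MeasurableSpace α] {μ : Measure α} {f : α → ℂ}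
    (hf : MemLp f 2 μ) : ∫⁻ x, ‖f x‖ₑ ^ 2 ∂μ ≠ ∞ := by
  rw [← enorm_toLp_sq hf]
  exact ENNReal.pow_ne_top enorm_ne_top

lemma lintegral_lp_sq {α : Type*} [MeasurableSpace α] {μ : Measure α} (f : Lp ℂ 2 μ) :
    ∫⁻ x, ‖f x‖ₑ ^ 2 ∂μ = ‖f‖ₑ ^ 2 := by
  rw [← enorm_toLp_sq (Lp.memLp f), Lp.toLp_coeFn]


/-! ### The Fourier transform of square integrable kernels -/

lemma hasFourierDensity_fourier {k : ℕ} (u : Kernel2 k) :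
    HasFourierDensity (u : 𝓢'(Config k, ℂ)) (𝓕 u : Kernel2 k) := by
  refine ⟨Lp.aestronglyMeasurable _, fun φ => ⟨?_, ?_⟩⟩
  · exact (Lp.memLp (𝓕 u)).integrable_mul (φ.memLp 2 volume)
  · rw [Lp.fourier_toTemperedDistribution_eq, Lp.toTemperedDistribution_apply]
    simp_rw [smul_eq_mul, mul_comm]

lemma pair2_schwartz {k : ℕ} (u : Kernel2 k) (φ : 𝓢(Config k, ℂ)) :
    pair2 u (φ.toLp 2 volume) = (u : 𝓢'(Config k, ℂ)) φ := by
  rw [pair2_comm, Lp.toTemperedDistribution_apply, SchwartzMap.toLp, pair2_toLp]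
  rfl

/-- For a Schwartz function `v` this is the definition of the transform of a distribution; both
sides are continuous in `v` and Schwartz functions are dense. -/
lemma pair2_fourier {k : ℕ} (u v : Kernel2 k) : pair2 (𝓕 u) v = pair2 u (𝓕 v) := by
  have h := (SchwartzMap.denseRange_toLpCLM (E := Config k) (F := ℂ) (p := 2) (by simp)
    (μ := (volume : Measure (Config k))))
  have hc1 : Continuous fun v : Kernel2 k => pair2 (𝓕 u) v := (pair2 (𝓕 u)).continuous
  have hc2 : Continuous fun v : Kernel2 k => pair2 u (𝓕 v) :=
    (pair2 u).continuous.comp (Lp.fourierTransformₗᵢ (Config k) ℂ).continuous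
  have := h.equalizer hc1 hc2 (by
    funext φ
    simp only [Function.comp_apply, SchwartzMap.toLpCLM_apply]
    rw [pair2_schwartz, SchwartzMap.toLp_fourier_eq, pair2_schwartz,
      ← Lp.fourier_toTemperedDistribution_eq, TemperedDistribution.fourier_apply])
  exact congrFun this v

/-! ### The kinetic energy on the Fourier side -/

/-- The symbol of `-½ Δ_{𝐲ₖ} + ½ Δ_{𝐲ₖ'}`, up to the factor `2π²`. -/
def theta {k : ℕ} (ξ : Config k) : ℝ := ∑ i, energy (pairs ξ i)

lemma norm_pos_sq {k : ℕ} (ξ : Config k) (p : Fin k ⊕ Fin k) :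
    ‖pos ξ p‖ ^ 2 = ∑ i : Fin 3, (ξ (p, i)) ^ 2 := by
  rw [EuclideanSpace.norm_sq_eq]
  simp [pos]

/-- Each derivative, moved onto `𝓕 χ`, becomes multiplication of `χ` by `-2πi` times a coordinate.
The signs from the two integrations by parts cancel. -/
lemma particleLaplacian_fourier {k : ℕ} (p : Fin k ⊕ Fin k) (f : 𝓢'(Config k, ℂ))
    (χ χ' : 𝓢(Config k, ℂ)) (h : ∀ ξ, χ' ξ = (‖pos ξ p‖ ^ 2 : ℝ) * χ ξ) :
    particleLaplacian p f (𝓕 χ) = -(4 * Real.pi ^ 2) * (𝓕 f) χ' := by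
  set c : ℂ := -(2 * Real.pi * Complex.I) with hc
  set S : Fin 3 → 𝓢(Config k, ℂ) →L[ℝ] 𝓢(Config k, ℂ) := fun i =>
    SchwartzMap.smulLeftCLM ℂ fun x => (inner ℝ x (EuclideanSpace.single (p, i) (1 : ℝ)) : ℝ) with hS
  have hSa : ∀ i φ x, S i φ x = (x (p, i) : ℂ) * φ x := by
    intro i φ x
    rw [hS]
    simp only
    rw [SchwartzMap.smulLeftCLM_apply_apply (by fun_prop)]
    simp [EuclideanSpace.inner_single_right]
  have hi : ∀ i : Fin 3, (∂_{EuclideanSpace.single (p, i) (1 : ℝ)}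
      (∂_{EuclideanSpace.single (p, i) (1 : ℝ)} f)) (𝓕 χ) = (𝓕 f) (c • S i (c • S i χ)) := by
    intro i
    rw [TemperedDistribution.lineDerivOp_apply_apply, TemperedDistribution.lineDerivOp_apply_apply,
      TemperedDistribution.fourier_apply, map_neg, LineDeriv.lineDerivOp_neg, map_neg, neg_neg,
      SchwartzMap.lineDerivOp_fourier_eq, SchwartzMap.lineDerivOp_fourier_eq]
  have hs : particleLaplacian p f (𝓕 χ) = ∑ i : Fin 3, (𝓕 f) (c • S i (c • S i χ)) := by
    rw [← Finset.sum_congr rfl fun i _ => hi i]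
    simp [particleLaplacian]
  rw [hs, ← map_sum]
  have : ∑ i : Fin 3, c • S i (c • S i χ) = (-(4 * Real.pi ^ 2) : ℂ) • χ' := by
    ext x
    rw [sum_apply]
    simp only [smul_apply, hSa, h, norm_pos_sq, smul_eq_mul]
    push_cast
    rw [Finset.sum_mul, Finset.mul_sum]
    refine Finset.sum_congr rfl fun i _ => ?_
    rw [hc]
    ring_nf
    rw [Complex.I_sq]
    ring
  rw [this, map_smul, smul_eq_mul]

lemma theta_eq {k : ℕ} (ξ : Config k) :
    theta ξ = ∑ j : Fin k, ‖pos ξ (Sum.inl j)‖ ^ 2 - ∑ j : Fin k, ‖pos ξ (Sum.inr j)‖ ^ 2 := by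
  rw [theta, ← Finset.sum_sub_distrib]
  rfl

lemma contDiff_norm_pos_sq {k : ℕ} (p : Fin k ⊕ Fin k) :
    ContDiff ℝ (⊤ : ℕ∞) fun ξ : Config k => ‖pos ξ p‖ ^ 2 := by
  simp_rw [norm_pos_sq]
  fun_prop

lemma contDiff_theta {k : ℕ} : ContDiff ℝ (⊤ : ℕ∞) (theta : Config k → ℝ) := by
  have : (theta : Config k → ℝ) = fun ξ => ∑ j : Fin k, ‖pos ξ (Sum.inl j)‖ ^ 2
      - ∑ j : Fin k, ‖pos ξ (Sum.inr j)‖ ^ 2 := funext theta_eq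
  rw [this]
  exact (ContDiff.sum fun i _ => contDiff_norm_pos_sq _).sub
    (ContDiff.sum fun i _ => contDiff_norm_pos_sq _)

/-! ### Test functions away from the zeros of the symbol -/

/-- Smooth functions with compact support where `R` does not vanish. -/
structure IsTest {k : ℕ} (χ : Config k → ℂ) : Prop where
  smooth : ContDiff ℝ (⊤ : ℕ∞) χ
  compact : HasCompactSupport χ
  support : tsupport χ ⊆ {ξ | rSymbol ξ ≠ 0}

/-- A test function as a Schwartz function. -/
def IsTest.toSchwartz {k : ℕ} {χ : Config k → ℂ} (h : IsTest χ) : 𝓢(Config k, ℂ) :=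
  h.compact.toSchwartzMap h.smooth

@[simp] lemma IsTest.toSchwartz_apply {k : ℕ} {χ : Config k → ℂ} (h : IsTest χ) (ξ : Config k) :
    h.toSchwartz ξ = χ ξ := rfl

lemma IsTest.mul_left {k : ℕ} {χ g : Config k → ℂ} (h : IsTest χ)
    (hg : ContDiff ℝ (⊤ : ℕ∞) g) : IsTest fun ξ => g ξ * χ ξ :=
  ⟨hg.mul h.smooth, h.compact.mul_left, (tsupport_mul_subset_right).trans h.support⟩

lemma IsTest.add {k : ℕ} {χ χ' : Config k → ℂ} (h : IsTest χ) (h' : IsTest χ') :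
    IsTest fun ξ => χ ξ + χ' ξ :=
  ⟨h.smooth.add h'.smooth, h.compact.add h'.compact,
    (tsupport_add χ χ').trans (Set.union_subset h.support h'.support)⟩

lemma isTest_zero {k : ℕ} : IsTest (fun _ : Config k => (0 : ℂ)) :=
  ⟨contDiff_const, HasCompactSupport.zero, by
    have : tsupport (fun _ : Config k => (0 : ℂ)) = ∅ := tsupport_eq_empty_iff.2 rfl
    rw [this]; exact Set.empty_subset _⟩

lemma continuous_pos {k : ℕ} (p : Fin k ⊕ Fin k) : Continuous fun ξ : Config k => pos ξ p := by
  unfold pos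
  fun_prop

lemma continuous_rSymbol {k : ℕ} : Continuous (rSymbol : Config k → ℝ) :=
  continuous_finsetProd _ fun p _ => continuous_const.mul (continuous_pos p).norm

lemma rSymbol_nonneg {k : ℕ} (ξ : Config k) : 0 ≤ rSymbol ξ :=
  Finset.prod_nonneg fun p _ => by positivity

lemma rSymbol_eq_prod {k : ℕ} (ξ : Config k) : rSymbol ξ = ∏ i, pairSymbol (pairs ξ i) := by
  rw [rSymbol, Fintype.prod_sum_type, ← Finset.prod_mul_distrib]
  rfl

/-- The zero set is a finite union of proper linear subspaces, one for every particle. -/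
lemma ae_rSymbol_ne_zero (k : ℕ) : ∀ᵐ ξ : Config k, rSymbol ξ ≠ 0 := by
  have h : ∀ p : Fin k ⊕ Fin k, ∀ᵐ ξ : Config k, pos ξ p ≠ 0 := by
    intro p
    let S : Submodule ℝ (Config k) :=
      { carrier := {ξ | pos ξ p = 0}
        add_mem' := fun {a b} ha hb => by
          have : pos (a + b) p = pos a p + pos b p := rfl
          simp only [Set.mem_ofPred_eq] at *
          rw [this, ha, hb, add_zero]
        zero_mem' := rfl
        smul_mem' := fun c a ha => by
          have : pos (c • a) p = c • pos a p := rfl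
          simp only [Set.mem_ofPred_eq] at *
          rw [this, ha, smul_zero] }
    have hS : S ≠ ⊤ := by
      intro hS
      have h1 : (EuclideanSpace.single (p, (0 : Fin 3)) (1 : ℝ) : Config k) ∈ S := by
        rw [hS]; exact Submodule.mem_top
      have h2 : pos (EuclideanSpace.single (p, (0 : Fin 3)) (1 : ℝ) : Config k) p = 0 := h1
      have h3 := congrArg (fun x : Space => x 0) h2
      simp [pos] at h3
    have := Measure.addHaar_submodule (volume : Measure (Config k)) S hS
    rw [ae_iff]
    simp only [not_not]
    exact this
  filter_upwards [ae_all_iff.2 h] with ξ hξ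
  exact Finset.prod_ne_zero_iff.2 fun p _ => by
    have := norm_ne_zero_iff.2 (hξ p)
    have := Real.pi_ne_zero
    positivity

lemma isOpen_rSymbol_ne_zero (k : ℕ) : IsOpen {ξ : Config k | rSymbol ξ ≠ 0} :=
  isOpen_ne_fun continuous_rSymbol continuous_const

lemma IsTest.continuous_div {k : ℕ} {χ : Config k → ℂ} (h : IsTest χ) :
    Continuous fun ξ => χ ξ / (rSymbol ξ : ℂ) := by
  refine continuous_of_tsupport fun ξ hξ => ?_
  have h1 : tsupport (fun ξ => χ ξ / (rSymbol ξ : ℂ)) ⊆ tsupport χ := by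
    simp_rw [div_eq_mul_inv]
    exact tsupport_mul_subset_left
  have h2 : rSymbol ξ ≠ 0 := h.support (h1 hξ)
  exact h.smooth.continuous.continuousAt.div
    (Complex.continuous_ofReal.comp continuous_rSymbol).continuousAt (by exact_mod_cast h2)

lemma IsTest.hasCompactSupport_div {k : ℕ} {χ : Config k → ℂ} (h : IsTest χ) :
    HasCompactSupport fun ξ => χ ξ / (rSymbol ξ : ℂ) := by
  simp_rw [div_eq_mul_inv]
  exact h.compact.mul_right

lemma IsTest.memLp {k : ℕ} {χ : Config k → ℂ} (h : IsTest χ) : MemLp χ 2 :=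
  h.smooth.continuous.memLp_of_hasCompactSupport h.compact

lemma IsTest.memLp_div {k : ℕ} {χ : Config k → ℂ} (h : IsTest χ) :
    MemLp (fun ξ => χ ξ / (rSymbol ξ : ℂ)) 2 :=
  h.continuous_div.memLp_of_hasCompactSupport h.hasCompactSupport_div

/-- The element `χ` of `L²`. -/
def IsTest.elt {k : ℕ} {χ : Config k → ℂ} (h : IsTest χ) : Kernel2 k := h.memLp.toLp _

/-- The element `χ / R` of `L²`. -/
def IsTest.eltDiv {k : ℕ} {χ : Config k → ℂ} (h : IsTest χ) : Kernel2 k := h.memLp_div.toLp _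

/-- The admissible test functions see everything on the open set where `R` is nonzero, and its
complement is a null set. Local integrability is required only on this set, which admits quotients
by `R`. -/
lemma ae_eq_zero_of_isTest {k : ℕ} {F : Config k → ℂ}
    (hF : LocallyIntegrableOn F {ξ : Config k | rSymbol ξ ≠ 0})
    (h : ∀ χ : Config k → ℂ, IsTest χ → ∫ ξ, χ ξ * F ξ = 0) : F =ᵐ[volume] 0 := by
  have := (isOpen_rSymbol_ne_zero k).ae_eq_zero_of_integral_contDiff_smul_eq_zero hF
    (fun g hg hgc hgs => by
      have ht : tsupport (fun ξ => (g ξ : ℂ)) = tsupport g := by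
        unfold tsupport
        congr 1
        ext ξ
        simp
      have := h (fun ξ => (g ξ : ℂ)) ⟨Complex.ofRealCLM.contDiff.comp hg,
        by unfold HasCompactSupport; rw [ht]; exact hgc, by rw [ht]; exact hgs⟩
      simpa using this)
  filter_upwards [this, ae_rSymbol_ne_zero k] with ξ h1 h2
  exact h1 h2

lemma locallyIntegrableOn_div {k : ℕ} (f : Kernel2 k) :
    LocallyIntegrableOn (fun ξ => f ξ / (rSymbol ξ : ℂ)) {ξ : Config k | rSymbol ξ ≠ 0} := by
  have h1 : LocallyIntegrable (f : Config k → ℂ) volume :=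
    (Lp.memLp f).locallyIntegrable (by norm_num)
  have h2 : ContinuousOn (fun ξ : Config k => ((rSymbol ξ : ℂ))⁻¹) {ξ : Config k | rSymbol ξ ≠ 0} :=
    (Complex.continuous_ofReal.comp continuous_rSymbol).continuousOn.inv₀ fun ξ hξ => by
      have h : rSymbol ξ ≠ 0 := hξ
      simpa using h
  simp_rw [div_eq_mul_inv]
  exact (h1.locallyIntegrableOn _).mul_continuousOn h2
    (isOpen_rSymbol_ne_zero k).isLocallyClosed

/-- The elements `χ / R` of `L²`. -/
def testSpace (k : ℕ) : Submodule ℂ (Kernel2 k) where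
  carrier := {f | ∃ (χ : Config k → ℂ) (h : IsTest χ), h.eltDiv = f}
  add_mem' := by
    rintro _ _ ⟨χ, h, rfl⟩ ⟨χ', h', rfl⟩
    refine ⟨_, h.add h', ?_⟩
    unfold IsTest.eltDiv
    rw [← MemLp.toLp_add]
    congr 1
    funext ξ
    simp [add_div]
  zero_mem' := by
    refine ⟨_, isTest_zero, ?_⟩
    unfold IsTest.eltDiv
    simp_rw [zero_div]
    exact MemLp.toLp_zero _
  smul_mem' := by
    rintro c _ ⟨χ, h, rfl⟩
    refine ⟨_, h.mul_left (contDiff_const (c := c)), ?_⟩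
    unfold IsTest.eltDiv
    rw [← MemLp.toLp_const_smul]
    congr 1
    funext ξ
    simp [mul_div_assoc]

/-- If `f` is orthogonal to the space, then its conjugate divided by `R` is annihilated by all
admissible test functions, so it vanishes almost everywhere. -/
lemma dense_testSpace (k : ℕ) : Dense (testSpace k : Set (Kernel2 k)) := by
  rw [Submodule.dense_iff_topologicalClosure_eq_top, Submodule.topologicalClosure_eq_top_iff,
    Submodule.eq_bot_iff]
  intro f hf
  rw [Submodule.mem_orthogonal] at hf
  have hz : (fun ξ => conjLp f ξ / (rSymbol ξ : ℂ)) =ᵐ[volume] 0 := by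
    refine ae_eq_zero_of_isTest (locallyIntegrableOn_div _) fun χ h => ?_
    have h1 := hf h.eltDiv ⟨χ, h, rfl⟩
    rw [← inner_conj_symm, ← pair2_conjLp, pair2_comm, IsTest.eltDiv, pair2_toLp] at h1
    have h2 := (starRingEnd ℂ).injective (h1.trans (map_zero _).symm)
    rw [← h2]
    refine integral_congr_ae (Eventually.of_forall fun ξ => ?_)
    simp only
    ring
  have hz2 : f =ᵐ[volume] (0 : Config k → ℂ) := by
    filter_upwards [hz, conjLp_ae f, ae_rSymbol_ne_zero k] with ξ h1 h2 h3
    simp only [h2, Pi.zero_apply, div_eq_zero_iff, Complex.ofReal_eq_zero, h3, or_false,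
      map_eq_zero] at h1
    exact h1
  exact (Lp.eq_zero_iff_ae_eq_zero).2 hz2

lemma kinetic_fourier {k : ℕ} (f : 𝓢'(Config k, ℂ)) {χ : Config k → ℂ} (h : IsTest χ)
    (h' : IsTest fun ξ => (theta ξ : ℂ) * χ ξ) :
    kinetic f (𝓕 h.toSchwartz) = -(2 * Real.pi ^ 2) * (𝓕 f) h'.toSchwartz := by
  have hp : ∀ p : Fin k ⊕ Fin k, IsTest fun ξ => ((‖pos ξ p‖ ^ 2 : ℝ) : ℂ) * χ ξ := fun p =>
    h.mul_left (Complex.ofRealCLM.contDiff.comp (contDiff_norm_pos_sq p))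
  have hl : ∀ p, particleLaplacian p f (𝓕 h.toSchwartz)
      = -(4 * Real.pi ^ 2) * (𝓕 f) (hp p).toSchwartz := fun p =>
    particleLaplacian_fourier p f _ _ fun ξ => rfl
  have e : h'.toSchwartz = ∑ j : Fin k, (hp (Sum.inl j)).toSchwartz
      - ∑ j : Fin k, (hp (Sum.inr j)).toSchwartz := by
    ext ξ
    rw [sub_apply, sum_apply, sum_apply]
    simp only [IsTest.toSchwartz_apply]
    rw [theta_eq]
    push_cast
    rw [sub_mul, Finset.sum_mul, Finset.sum_mul]
  rw [e, map_sub, map_sum, map_sum]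
  have hk : kinetic f (𝓕 h.toSchwartz)
      = (1 / 2 : ℂ) * ∑ j : Fin k, particleLaplacian (Sum.inl j) f (𝓕 h.toSchwartz)
        - (1 / 2 : ℂ) * ∑ j : Fin k, particleLaplacian (Sum.inr j) f (𝓕 h.toSchwartz) := by
    simp [kinetic]
  rw [hk]
  simp_rw [hl]
  rw [← Finset.mul_sum, ← Finset.mul_sum]
  ring


/-! ### The free evolution on the Fourier side -/

/-- The symbol of the free evolution. -/
def phase {k : ℕ} (τ : ℝ) (ξ : Config k) : ℂ :=
  Complex.exp (Complex.I * (2 * Real.pi ^ 2 * τ * theta ξ : ℝ))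

lemma norm_phase {k : ℕ} (τ : ℝ) (ξ : Config k) : ‖phase τ ξ‖ = 1 := by
  rw [phase, mul_comm, Complex.norm_exp_ofReal_mul_I]

lemma enorm_phase {k : ℕ} (τ : ℝ) (ξ : Config k) : ‖phase τ ξ‖ₑ = 1 := by
  rw [← ofReal_norm, norm_phase, ENNReal.ofReal_one]

lemma phase_ne_zero {k : ℕ} (τ : ℝ) (ξ : Config k) : phase τ ξ ≠ 0 := Complex.exp_ne_zero _

lemma contDiff_phase {k : ℕ} (τ : ℝ) : ContDiff ℝ (⊤ : ℕ∞) (phase τ : Config k → ℂ) := by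
  unfold phase
  exact (contDiff_const.mul (Complex.ofRealCLM.contDiff.comp
    (contDiff_const.mul contDiff_theta))).cexp

lemma continuous_phase {k : ℕ} : Continuous fun p : ℝ × Config k => phase p.1 p.2 := by
  have := (contDiff_theta (k := k)).continuous
  unfold phase
  fun_prop

lemma hasDerivAt_phase {k : ℕ} (τ : ℝ) (ξ : Config k) :
    HasDerivAt (fun τ => phase τ ξ) (Complex.I * (2 * Real.pi ^ 2) * theta ξ * phase τ ξ) τ := by
  have h1 : HasDerivAt (fun τ : ℝ => Complex.I * ((2 * Real.pi ^ 2 * τ * theta ξ : ℝ) : ℂ))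
      (Complex.I * ((2 * Real.pi ^ 2 * 1 * theta ξ : ℝ) : ℂ)) τ := by
    refine HasDerivAt.const_mul _ (HasDerivAt.ofReal_comp ?_)
    exact ((hasDerivAt_id τ).const_mul _).mul_const _
  have h2 := h1.cexp
  unfold phase
  convert h2 using 1
  push_cast
  ring

lemma memLp_phase_mul {k : ℕ} (τ : ℝ) (f : Kernel2 k) : MemLp (fun ξ => phase τ ξ * f ξ) 2 := by
  refine (Lp.memLp f).of_le (((contDiff_phase τ).continuous.aestronglyMeasurable).mul
    (Lp.aestronglyMeasurable f)) (Eventually.of_forall fun ξ => ?_)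
  rw [norm_mul, norm_phase, one_mul]

/-- Multiplication by the symbol of the free evolution. -/
def phaseMul {k : ℕ} (τ : ℝ) (f : Kernel2 k) : Kernel2 k := (memLp_phase_mul τ f).toLp _

lemma phaseMul_ae {k : ℕ} (τ : ℝ) (f : Kernel2 k) :
    phaseMul τ f =ᵐ[volume] fun ξ => phase τ ξ * f ξ := MemLp.coeFn_toLp _

lemma phaseMul_toLp {k : ℕ} (τ : ℝ) {f : Config k → ℂ} (hf : MemLp f 2)
    (hf' : MemLp (fun ξ => phase τ ξ * f ξ) 2) : phaseMul τ (hf.toLp f) = hf'.toLp _ := by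
  refine Lp.ext ?_
  filter_upwards [phaseMul_ae τ (hf.toLp f), hf.coeFn_toLp, hf'.coeFn_toLp] with ξ h1 h2 h3
  rw [h1, h2, h3]

lemma norm_phaseMul {k : ℕ} (τ : ℝ) (f : Kernel2 k) : ‖phaseMul τ f‖ = ‖f‖ := by
  rw [Lp.norm_def, Lp.norm_def]
  congr 1
  refine eLpNorm_congr_norm_ae ?_
  filter_upwards [phaseMul_ae τ f] with ξ h
  rw [h, norm_mul, norm_phase, one_mul]

lemma phaseMul_sub {k : ℕ} (τ : ℝ) (f g : Kernel2 k) :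
    phaseMul τ (f - g) = phaseMul τ f - phaseMul τ g := by
  refine Lp.ext ?_
  filter_upwards [phaseMul_ae τ (f - g), phaseMul_ae τ f, phaseMul_ae τ g, Lp.coeFn_sub f g,
    Lp.coeFn_sub (phaseMul τ f) (phaseMul τ g)] with ξ h1 h2 h3 h4 h5
  rw [h1, h5, Pi.sub_apply, h2, h3, h4, Pi.sub_apply, mul_sub]

lemma pair2_phaseMul {k : ℕ} (τ : ℝ) (f g : Kernel2 k) :
    pair2 (phaseMul τ f) g = pair2 f (phaseMul τ g) := by
  rw [pair2_apply, pair2_apply]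
  refine integral_congr_ae ?_
  filter_upwards [phaseMul_ae τ f, phaseMul_ae τ g] with ξ h1 h2
  rw [h1, h2]
  ring

lemma continuous_phaseMul {k : ℕ} (f : Kernel2 k) : Continuous fun τ => phaseMul τ f := by
  refine continuous_iff_seqContinuous.2 fun x τ hx => ?_
  refine tendsto_toLp_of_dominated (G := fun ξ => ‖f ξ‖ₑ)
    (fun n => memLp_phase_mul (x n) f) (memLp_phase_mul τ f)
    (lintegral_enorm_sq_ne_top (Lp.memLp f)) (fun n => ?_) ?_ ?_
  · exact Eventually.of_forall fun ξ => by rw [enorm_mul, enorm_phase, one_mul]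
  · exact Eventually.of_forall fun ξ => by rw [enorm_mul, enorm_phase, one_mul]
  · refine Eventually.of_forall fun ξ => Tendsto.mul_const _ ?_
    have : Continuous fun τ => phase τ ξ := continuous_phase.comp (Continuous.prodMk_left ξ)
    exact (this.tendsto τ).comp hx

lemma isometry_phaseMul {k : ℕ} (τ : ℝ) : Isometry (phaseMul τ : Kernel2 k → Kernel2 k) :=
  Isometry.of_dist_eq fun f g => by
    rw [dist_eq_norm, dist_eq_norm, ← phaseMul_sub, norm_phaseMul]

/-- The action is continuous in the time for a fixed function and isometric in the function for a
fixed time, hence jointly measurable. -/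
lemma aestronglyMeasurable_phaseMul {k : ℕ} {ν : Measure ℝ} {g : ℝ → Kernel2 k}
    (hg : AEStronglyMeasurable g ν) : AEStronglyMeasurable (fun r => phaseMul r (g r)) ν := by
  borelize (Kernel2 k)
  have h : StronglyMeasurable fun p : ℝ × Kernel2 k => phaseMul p.1 p.2 :=
    stronglyMeasurable_uncurry_of_continuous_of_stronglyMeasurable
      (u := fun (τ : ℝ) (f : Kernel2 k) => phaseMul τ f) continuous_phaseMul
      fun τ => (isometry_phaseMul τ).continuous.stronglyMeasurable
  exact (h.measurable.comp_aemeasurable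
    (aemeasurable_id.prodMk hg.aemeasurable)).aestronglyMeasurable

lemma aestronglyMeasurable_pair2 {k : ℕ} {Ω : Type*} [MeasurableSpace Ω] {ν : Measure Ω}
    {f g : Ω → Kernel2 k} (hf : AEStronglyMeasurable f ν) (hg : AEStronglyMeasurable g ν) :
    AEStronglyMeasurable (fun ω => pair2 (f ω) (g ω)) ν :=
  (pair2 : Kernel2 k →L[ℂ] Kernel2 k →L[ℂ] ℂ).aestronglyMeasurable_comp₂ hf hg

lemma integrable_pair2 {k : ℕ} {Ω : Type*} [MeasurableSpace Ω] {ν : Measure Ω}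
    {f g : Ω → Kernel2 k} {M : ℝ} (hf : AEStronglyMeasurable f ν) (hM : ∀ᵐ ω ∂ν, ‖f ω‖ ≤ M)
    (hg : Integrable g ν) : Integrable (fun ω => pair2 (f ω) (g ω)) ν := by
  refine (hg.norm.const_mul M).mono' (aestronglyMeasurable_pair2 hf hg.1) ?_
  filter_upwards [hM] with ω h
  exact (norm_pair2_le _ _).trans (by gcongr)

/-- Differentiation under the integral sign: the time derivative is bounded by a multiple of `|f₁
v|`, which is integrable because `θ f` is assumed to be in `L²`. -/
lemma pair2_phaseMul_eq_add_integral {k : ℕ} {f f₁ : Kernel2 k}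
    (h : f₁ =ᵐ[volume] fun ξ => (theta ξ : ℂ) * f ξ) (v : Kernel2 k) (r τ : ℝ) :
    pair2 (phaseMul τ f) v = pair2 (phaseMul r f) v
      + Complex.I * (2 * Real.pi ^ 2) * ∫ ρ in r..τ, pair2 (phaseMul ρ f₁) v := by
  set κ : ℂ := Complex.I * (2 * Real.pi ^ 2) with hκ
  have e : ∀ (τ : ℝ) (g : Kernel2 k), pair2 (phaseMul τ g) v = ∫ ξ, phase τ ξ * (g ξ * v ξ) := by
    intro τ g
    rw [phaseMul, pair2_toLp]
    simp_rw [mul_assoc]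
  have hi := integrable_mul_lp f₁ v
  have hd : ∀ τ, HasDerivAt (fun τ => pair2 (phaseMul τ f) v) (κ * pair2 (phaseMul τ f₁) v) τ := by
    intro τ
    have e2 : κ * pair2 (phaseMul τ f₁) v
        = ∫ ξ, (Complex.I * (2 * Real.pi ^ 2) * theta ξ * phase τ ξ) * (f ξ * v ξ) := by
      rw [e, ← integral_const_mul]
      refine integral_congr_ae ?_
      filter_upwards [h] with ξ hξ
      rw [hξ, hκ]
      ring
    rw [e2]
    simp_rw [e]
    refine (hasDerivAt_integral_of_dominated_loc_of_deriv_le (F := fun τ ξ => phase τ ξ * (f ξ * v ξ))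
      (F' := fun τ ξ => (Complex.I * (2 * Real.pi ^ 2) * theta ξ * phase τ ξ) * (f ξ * v ξ))
      (s := Set.univ) (bound := fun ξ => ‖κ‖ * ‖f₁ ξ * v ξ‖) Filter.univ_mem
      (Eventually.of_forall fun τ => ?_) ?_ ?_ ?_ (hi.norm.const_mul _) ?_).2
    · exact ((contDiff_phase τ).continuous.aestronglyMeasurable).mul (integrable_mul_lp f v).1
    · refine (integrable_mul_lp f v).bdd_mul
        (contDiff_phase τ).continuous.aestronglyMeasurable (c := 1)
        (Eventually.of_forall fun ξ => (norm_phase τ ξ).le)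
    · refine AEStronglyMeasurable.mul ?_ (integrable_mul_lp f v).1
      have h1 := (contDiff_theta (k := k)).continuous
      have h2 := (contDiff_phase (k := k) τ).continuous
      exact (by fun_prop : Continuous fun ξ : Config k =>
        Complex.I * (2 * Real.pi ^ 2) * theta ξ * phase τ ξ).aestronglyMeasurable
    · filter_upwards [h] with ξ hξ x _
      rw [hξ, ← hκ]
      simp only [norm_mul, norm_phase]
      exact le_of_eq (by ring)
    · exact Eventually.of_forall fun ξ x _ => (hasDerivAt_phase x ξ).mul_const _
  have hc : Continuous fun ρ => pair2 (phaseMul ρ f₁) v :=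
    (pair2.flip v).continuous.comp (continuous_phaseMul f₁)
  have := intervalIntegral.integral_eq_sub_of_hasDerivAt (a := r) (b := τ) (fun x _ => hd x)
    ((hc.const_mul κ).intervalIntegrable _ _)
  rw [← intervalIntegral.integral_const_mul, this]
  ring

set_option maxHeartbeats 1000000 in
/-- Duhamel's formula for the pairings of a solution of `i x' = κ Θ x + y`. -/
lemma duhamel_pair2 {k : ℕ} {s τ : ℝ} (hτ : s ≤ τ) {x y : ℝ → Kernel2 k}
    (hx : IntegrableOn x (Set.Ioc s τ)) (hy : IntegrableOn y (Set.Ioc s τ))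
    {f f₁ f₂ e e₁ : Kernel2 k}
    (hf₂ : f₂ =ᵐ[volume] fun ξ => (theta ξ : ℂ) * f₁ ξ)
    (he₁ : e₁ =ᵐ[volume] fun ξ => (theta ξ : ℂ) * e ξ)
    (h₀ : Complex.I * pair2 (phaseMul τ f) (x τ)
      = ∫ r in s..τ, (2 * Real.pi ^ 2 * pair2 (phaseMul τ f₁) (x r) + pair2 (phaseMul τ e) (y r)))
    (h₁ : ∀ ρ ∈ Set.Icc s τ, Complex.I * pair2 (phaseMul ρ f₁) (x ρ)
      = ∫ r in s..ρ, (2 * Real.pi ^ 2 * pair2 (phaseMul ρ f₂) (x r)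
        + pair2 (phaseMul ρ e₁) (y r))) :
    Complex.I * pair2 (phaseMul τ f) (x τ) = ∫ r in s..τ, pair2 (phaseMul r e) (y r) := by
  set κ : ℂ := 2 * Real.pi ^ 2 with hκ
  set F : ℝ → ℝ → ℂ := fun ρ r => κ * pair2 (phaseMul ρ f₂) (x r) + pair2 (phaseMul ρ e₁) (y r)
    with hF
  -- The solution is not known to be differentiable in time, so time derivatives fall on the test
  -- functions only. Moving their phase from the final time `τ` to the running time `r` leaves the
  -- error `F`.
  have key : ∀ r, κ * pair2 (phaseMul τ f₁) (x r) + pair2 (phaseMul τ e) (y r)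
      = (κ * pair2 (phaseMul r f₁) (x r) + pair2 (phaseMul r e) (y r))
        + Complex.I * κ * ∫ ρ in r..τ, F ρ r := by
    intro r
    have c1 : Continuous fun ρ => κ * pair2 (phaseMul ρ f₂) (x r) :=
      continuous_const.mul ((pair2.flip (x r)).continuous.comp (continuous_phaseMul f₂))
    have c2 : Continuous fun ρ => pair2 (phaseMul ρ e₁) (y r) :=
      (pair2.flip (y r)).continuous.comp (continuous_phaseMul e₁)
    rw [pair2_phaseMul_eq_add_integral hf₂ (x r) r τ, pair2_phaseMul_eq_add_integral he₁ (y r) r τ,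
      hF]
    simp only
    rw [intervalIntegral.integral_add (c1.intervalIntegrable _ _) (c2.intervalIntegrable _ _),
      intervalIntegral.integral_const_mul]
    ring
  have hmeas : ∀ (g : Kernel2 k) (z : ℝ → Kernel2 k), IntegrableOn z (Set.Ioc s τ) →
      Integrable (fun p : ℝ × ℝ => pair2 (phaseMul p.1 g) (z p.2))
        ((volume.restrict (Set.Ioc s τ)).prod (volume.restrict (Set.Ioc s τ))) := by
    intro g z hz
    refine integrable_pair2 (M := ‖g‖) ?_ (Eventually.of_forall fun p => (norm_phaseMul _ _).le) ?_
    · exact ((continuous_phaseMul g).comp continuous_fst).aestronglyMeasurable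
    · exact hz.comp_snd _
  have hFi : Integrable (fun p : ℝ × ℝ => F p.1 p.2)
      ((volume.restrict (Set.Ioc s τ)).prod (volume.restrict (Set.Ioc s τ))) :=
    ((hmeas f₂ x hx).const_mul κ).add (hmeas e₁ y hy)
  have htri := intervalIntegral_triangle hτ F hFi
  have hc : ∀ (g : Kernel2 k) (z : ℝ → Kernel2 k), IntegrableOn z (Set.Ioc s τ) →
      IntervalIntegrable (fun r => pair2 (phaseMul τ g) (z r)) volume s τ := by
    intro g z hz
    rw [intervalIntegrable_iff_integrableOn_Ioc_of_le hτ]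
    exact (pair2 (phaseMul τ g)).integrable_comp hz
  have hv : ∀ (g : Kernel2 k) (z : ℝ → Kernel2 k), IntegrableOn z (Set.Ioc s τ) →
      IntervalIntegrable (fun r => pair2 (phaseMul r g) (z r)) volume s τ := by
    intro g z hz
    rw [intervalIntegrable_iff_integrableOn_Ioc_of_le hτ]
    exact integrable_pair2 (M := ‖g‖) (continuous_phaseMul g).aestronglyMeasurable
      (Eventually.of_forall fun p => (norm_phaseMul _ _).le) hz
  have hA := ((hc f₁ x hx).const_mul κ).add (hc e y hy)
  have hB := ((hv f₁ x hx).const_mul κ).add (hv e y hy)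
  have hAB : ∫ r in s..τ, (κ * pair2 (phaseMul τ f₁) (x r) + pair2 (phaseMul τ e) (y r))
      = (∫ r in s..τ, (κ * pair2 (phaseMul r f₁) (x r) + pair2 (phaseMul r e) (y r)))
        + Complex.I * κ * ∫ r in s..τ, ∫ ρ in r..τ, F ρ r := by
    rw [← intervalIntegral.integral_const_mul, ← sub_eq_iff_eq_add',
      ← intervalIntegral.integral_sub hA hB]
    refine intervalIntegral.integral_congr fun r _ => ?_
    rw [key r]
    ring
  -- With the order of integration exchanged, the error is the right side of the equation tested
  -- with `phaseMul ρ f₁`. Since `I * I = -1`, it cancels the kinetic term.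
  have hin : ∫ ρ in s..τ, ∫ r in s..ρ, F ρ r
      = ∫ ρ in s..τ, Complex.I * pair2 (phaseMul ρ f₁) (x ρ) := by
    refine intervalIntegral.integral_congr fun ρ hρ => ?_
    rw [Set.uIcc_of_le hτ] at hρ
    exact (h₁ ρ hρ).symm
  rw [h₀, hAB, ← htri, hin, intervalIntegral.integral_add ((hv f₁ x hx).const_mul κ) (hv e y hy),
    intervalIntegral.integral_const_mul, intervalIntegral.integral_const_mul]
  have := Complex.I_mul_I
  linear_combination (κ * ∫ r in s..τ, pair2 (phaseMul r f₁) (x r)) * this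


/-! ### Densities of the collapsed kernels -/

/-- The slack `1` permits a choice of density from the infimum without appeal to uniqueness; the
element is `R` times this density. In the pairing with `χ / R` the symbol cancels. -/
lemma exists_density {k : ℕ} (f : 𝓢'(Config k, ℂ)) (hf : rNorm f ≠ ∞) :
    ∃ g : Kernel2 k, ‖g‖ₑ ≤ rNorm f + 1 ∧
      ∀ (χ : Config k → ℂ) (h : IsTest χ), pair2 h.eltDiv g = f (𝓕 h.toSchwartz) := by
  have h1 : rNorm f < rNorm f + 1 := ENNReal.lt_add_right hf one_ne_zero
  obtain ⟨F, hF⟩ := iInf_lt_iff.1 (show (⨅ F, _) < _ from h1)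
  obtain ⟨hF1, hF2⟩ := iInf_lt_iff.1 hF
  have hm : MemLp (fun ξ => (rSymbol ξ : ℂ) * F ξ) 2 volume :=
    ⟨(Complex.continuous_ofReal.comp continuous_rSymbol).aestronglyMeasurable.mul hF1.1,
      hF2.trans_le le_top⟩
  refine ⟨hm.toLp _, ?_, fun χ h => ?_⟩
  · rw [Lp.enorm_toLp]
    exact hF2.le
  · rw [pair2_comm, pair2_toLp, ← TemperedDistribution.fourier_apply, (hF1.2 h.toSchwartz).2]
    refine integral_congr_ae ?_
    filter_upwards [h.memLp_div.coeFn_toLp, ae_rSymbol_ne_zero k] with ξ h2 h3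
    rw [IsTest.eltDiv, h2, IsTest.toSchwartz_apply]
    have h4 : (rSymbol ξ : ℂ) ≠ 0 := by exact_mod_cast h3
    field_simp

open Classical in
/-- An element of `L²` whose quotient by `R` is a Fourier density of `f`. -/
def densityElt {k : ℕ} (f : 𝓢'(Config k, ℂ)) : Kernel2 k :=
  if hf : rNorm f ≠ ∞ then (exists_density f hf).choose else 0

lemma enorm_densityElt_le {k : ℕ} (f : 𝓢'(Config k, ℂ)) : ‖densityElt f‖ₑ ≤ rNorm f + 1 := by
  by_cases hf : rNorm f ≠ ∞
  · rw [densityElt, dif_pos hf]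
    exact (exists_density f hf).choose_spec.1
  · rw [densityElt, dif_neg hf]
    simp

lemma pair2_densityElt {k : ℕ} {f : 𝓢'(Config k, ℂ)} (hf : rNorm f ≠ ∞) {χ : Config k → ℂ}
    (h : IsTest χ) : pair2 h.eltDiv (densityElt f) = f (𝓕 h.toSchwartz) := by
  rw [densityElt, dif_pos hf]
  exact (exists_density f hf).choose_spec.2 χ h

section Path

variable {k : ℕ} {s T K : ℝ} {f : ℝ → 𝓢'(Config k, ℂ)}

lemma ae_rNorm_ne_top (h1 : AEMeasurable (fun τ => rNorm (f τ)) (volume.restrict (Set.Icc s T)))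
    (h2 : ∫⁻ τ in Set.Icc s T, rNorm (f τ) ≤ ENNReal.ofReal K) :
    ∀ᵐ τ ∂(volume.restrict (Set.Icc s T)), rNorm (f τ) ≠ ∞ := by
  filter_upwards [ae_lt_top' h1 (h2.trans_lt ENNReal.ofReal_lt_top).ne] with τ h
  exact h.ne

lemma lintegral_densityElt_le
    (h2 : ∫⁻ τ in Set.Icc s T, rNorm (f τ) ≤ ENNReal.ofReal K) :
    ∫⁻ τ in Set.Icc s T, ‖densityElt (f τ)‖ₑ ≤ ENNReal.ofReal K + ENNReal.ofReal (T - s) := by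
  calc ∫⁻ τ in Set.Icc s T, ‖densityElt (f τ)‖ₑ ≤ ∫⁻ τ in Set.Icc s T, (rNorm (f τ) + 1) :=
        lintegral_mono fun τ => enorm_densityElt_le _
    _ = (∫⁻ τ in Set.Icc s T, rNorm (f τ)) + ENNReal.ofReal (T - s) := by
        rw [lintegral_add_right _ measurable_const]
        simp
    _ ≤ _ := by gcongr

/-- The densities are chosen separately at each time, but their pairings with the dense elements `χ
/ R` are values of the distribution, which are measurable in time. -/
lemma integrableOn_densityElt
    (h1 : AEMeasurable (fun τ => rNorm (f τ)) (volume.restrict (Set.Icc s T)))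
    (h2 : ∫⁻ τ in Set.Icc s T, rNorm (f τ) ≤ ENNReal.ofReal K)
    (h3 : ∀ φ : 𝓢(Config k, ℂ), IntegrableOn (fun τ => f τ φ) (Set.Icc s T)) :
    IntegrableOn (fun τ => densityElt (f τ)) (Set.Icc s T) := by
  refine ⟨?_, ?_⟩
  · refine aestronglyMeasurable_of_pair2 (dense_testSpace k) ?_
    rintro _ ⟨χ, h, rfl⟩
    refine (h3 (𝓕 h.toSchwartz)).1.congr ?_
    filter_upwards [ae_rNorm_ne_top h1 h2] with τ hτ
    exact (pair2_densityElt hτ h).symm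
  · exact (lintegral_densityElt_le h2).trans_lt (by simp)

end Path

/-! ### Weakly continuous paths -/

lemma aestronglyMeasurable_of_weakly_continuous {k : ℕ} {s T : ℝ} {u : ℝ → Kernel2 k}
    (h : ∀ v : Kernel2 k, ContinuousOn (fun τ => inner ℂ v (u τ)) (Set.Icc s T)) :
    AEStronglyMeasurable u (volume.restrict (Set.Icc s T)) :=
  aestronglyMeasurable_of_inner (D := Set.univ) dense_univ fun v _ =>
    (h v).aestronglyMeasurable measurableSet_Icc

/-- Banach–Steinhaus: every scalar pairing is continuous on a compact interval, hence bounded. -/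
lemma exists_bound_of_weakly_continuous {k : ℕ} {s T : ℝ} {u : ℝ → Kernel2 k}
    (h : ∀ v : Kernel2 k, ContinuousOn (fun τ => inner ℂ v (u τ)) (Set.Icc s T)) :
    ∃ M, ∀ τ ∈ Set.Icc s T, ‖u τ‖ ≤ M := by
  obtain ⟨M, hM⟩ := banach_steinhaus (g := fun τ : Set.Icc s T => innerSL ℂ (u τ)) fun v => by
    obtain ⟨M, hM⟩ := isCompact_Icc.exists_bound_of_continuousOn (h v)
    refine ⟨M, fun τ => ?_⟩
    rw [innerSL_apply_apply, norm_inner_symm]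
    exact hM τ τ.2
  refine ⟨M, fun τ hτ => ?_⟩
  have := hM ⟨τ, hτ⟩
  rwa [innerSL_apply_norm] at this

/-! ### The mild form of the hierarchy -/

lemma IsTest.phase_mul {k : ℕ} {χ : Config k → ℂ} (h : IsTest χ) (τ : ℝ) :
    IsTest fun ξ => phase τ ξ * χ ξ := h.mul_left (contDiff_phase τ)

lemma IsTest.theta_mul {k : ℕ} {χ : Config k → ℂ} (h : IsTest χ) :
    IsTest fun ξ => (theta ξ : ℂ) * χ ξ :=
  h.mul_left (Complex.ofRealCLM.contDiff.comp contDiff_theta)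

lemma IsTest.phaseMul_elt {k : ℕ} {χ : Config k → ℂ} (h : IsTest χ) (τ : ℝ) :
    phaseMul τ h.elt = (h.phase_mul τ).elt := phaseMul_toLp _ _ _

lemma IsTest.phaseMul_eltDiv {k : ℕ} {χ : Config k → ℂ} (h : IsTest χ) (τ : ℝ) :
    phaseMul τ h.eltDiv = (h.phase_mul τ).eltDiv := by
  refine Lp.ext ?_
  filter_upwards [phaseMul_ae τ h.eltDiv, h.memLp_div.coeFn_toLp,
    (h.phase_mul τ).memLp_div.coeFn_toLp] with ξ h1 h2 h3
  rw [h1, IsTest.eltDiv, IsTest.eltDiv, h2, h3, mul_div_assoc]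

lemma IsTest.elt_congr {k : ℕ} {χ χ' : Config k → ℂ} (h : IsTest χ) (h' : IsTest χ')
    (e : χ = χ') : h.elt = h'.elt := by subst e; rfl

lemma IsTest.theta_mul_elt_ae {k : ℕ} {χ : Config k → ℂ} (h : IsTest χ) :
    h.theta_mul.elt =ᵐ[volume] fun ξ => (theta ξ : ℂ) * h.elt ξ := by
  filter_upwards [h.memLp.coeFn_toLp, h.theta_mul.memLp.coeFn_toLp] with ξ h1 h2
  rw [IsTest.elt, IsTest.elt, h1, h2]

lemma IsTest.theta_mul_eltDiv_ae {k : ℕ} {χ : Config k → ℂ} (h : IsTest χ) :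
    h.theta_mul.eltDiv =ᵐ[volume] fun ξ => (theta ξ : ℂ) * h.eltDiv ξ := by
  filter_upwards [h.memLp_div.coeFn_toLp, h.theta_mul.memLp_div.coeFn_toLp] with ξ h1 h2
  rw [IsTest.eltDiv, IsTest.eltDiv, h1, h2, mul_div_assoc]

lemma IsTest.elt_eq_toLp {k : ℕ} {χ : Config k → ℂ} (h : IsTest χ) :
    h.elt = h.toSchwartz.toLp 2 volume := rfl

lemma apply_fourier_test {k : ℕ} (u : Kernel2 k) {χ : Config k → ℂ} (h : IsTest χ) :
    (u : 𝓢'(Config k, ℂ)) (𝓕 h.toSchwartz) = pair2 h.elt (𝓕 u) := by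
  rw [pair2_comm, h.elt_eq_toLp, pair2_fourier, SchwartzMap.toLp_fourier_eq, pair2_schwartz]

lemma aestronglyMeasurable_fourier {k : ℕ} {ν : Measure ℝ} {u : ℝ → Kernel2 k}
    (hu : AEStronglyMeasurable u ν) : AEStronglyMeasurable (fun r => (𝓕 (u r) : Kernel2 k)) ν :=
  (Lp.fourierTransformₗᵢ (Config k) ℂ).continuous.comp_aestronglyMeasurable hu

section Mild

variable {k : ℕ} {s T : ℝ} {u y : ℝ → Kernel2 k} {f : ℝ → 𝓢'(Config k, ℂ)}

lemma integrableOn_fourier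
    (hc : ∀ v : Kernel2 k, ContinuousOn (fun τ => inner ℂ v (u τ)) (Set.Icc s T)) :
    IntegrableOn (fun r => (𝓕 (u r) : Kernel2 k)) (Set.Icc s T) := by
  obtain ⟨M, hM⟩ := exists_bound_of_weakly_continuous hc
  refine Integrable.of_bound (aestronglyMeasurable_fourier
    (aestronglyMeasurable_of_weakly_continuous hc)) M ?_
  filter_upwards [ae_restrict_mem measurableSet_Icc] with τ hτ
  rw [Lp.norm_fourier_eq]
  exact hM τ hτ

/-- The mild form of an inhomogeneous equation with a vanishing initial value. -/
lemma mild_pairing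
    (hc : ∀ v : Kernel2 k, ContinuousOn (fun τ => inner ℂ v (u τ)) (Set.Icc s T))
    (hy : IntegrableOn y (Set.Icc s T)) (h0 : u s = 0)
    (hyf : ∀ᵐ r ∂(volume.restrict (Set.Icc s T)), ∀ (χ : Config k → ℂ) (h : IsTest χ),
      pair2 h.eltDiv (y r) = f r (𝓕 h.toSchwartz))
    (heq : ∀ φ : 𝓢(Config k, ℂ), ∀ τ ∈ Set.Icc s T,
      Complex.I * ((u τ : 𝓢'(Config k, ℂ)) φ - (u s : 𝓢'(Config k, ℂ)) φ)
        + ∫ r in s..τ, kinetic (u r : 𝓢'(Config k, ℂ)) φ = ∫ r in s..τ, f r φ)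
    {τ : ℝ} (hτ : τ ∈ Set.Icc s T) {χ : Config k → ℂ} (h : IsTest χ) :
    pair2 h.elt (phaseMul τ (𝓕 (u τ)))
      = pair2 h.eltDiv (-Complex.I • ∫ r in s..τ, phaseMul r (y r)) := by
  have hx := integrableOn_fourier hc
  have heq' : ∀ {χ : Config k → ℂ} (h : IsTest χ), ∀ τ ∈ Set.Icc s T,
      Complex.I * pair2 h.elt (𝓕 (u τ))
        = ∫ r in s..τ, (2 * Real.pi ^ 2 * pair2 h.theta_mul.elt (𝓕 (u r))
          + pair2 h.eltDiv (y r)) := by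
    intro χ h τ hτ
    have e := heq (𝓕 h.toSchwartz) τ hτ
    rw [apply_fourier_test, apply_fourier_test, h0] at e
    have hz : pair2 h.elt (𝓕 (0 : Kernel2 k)) = 0 := by
      have : (𝓕 (0 : Kernel2 k)) = (0 : Kernel2 k) := map_zero (Lp.fourierTransformₗᵢ (Config k) ℂ)
      rw [this, map_zero]
    have ek : ∀ r, kinetic (u r : 𝓢'(Config k, ℂ)) (𝓕 h.toSchwartz)
        = -(2 * Real.pi ^ 2 * pair2 h.theta_mul.elt (𝓕 (u r))) := by
      intro r
      rw [kinetic_fourier _ h h.theta_mul, TemperedDistribution.fourier_apply, apply_fourier_test]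
      ring
    have ef : ∫ r in s..τ, f r (𝓕 h.toSchwartz) = ∫ r in s..τ, pair2 h.eltDiv (y r) := by
      refine intervalIntegral.integral_congr_ae ?_
      have := (ae_restrict_iff' measurableSet_Icc).1 hyf
      filter_upwards [this] with r hr hr'
      rw [Set.uIoc_of_le hτ.1] at hr'
      exact (hr ⟨hr'.1.le, hr'.2.trans hτ.2⟩ χ h).symm
    have hsub : Set.Ioc s τ ⊆ Set.Icc s T := fun r hr => ⟨hr.1.le, hr.2.trans hτ.2⟩
    have i1 : IntervalIntegrable
        (fun r => (2 * Real.pi ^ 2 : ℂ) * pair2 h.theta_mul.elt (𝓕 (u r))) volume s τ := by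
      rw [intervalIntegrable_iff_integrableOn_Ioc_of_le hτ.1]
      exact ((pair2 h.theta_mul.elt).integrable_comp (hx.mono_set hsub)).const_mul _
    have i2 : IntervalIntegrable (fun r => pair2 h.eltDiv (y r)) volume s τ := by
      rw [intervalIntegrable_iff_integrableOn_Ioc_of_le hτ.1]
      exact (pair2 h.eltDiv).integrable_comp (hy.mono_set hsub)
    simp_rw [ek] at e
    rw [hz, sub_zero, ef, intervalIntegral.integral_neg] at e
    rw [intervalIntegral.integral_add i1 i2, ← e]
    ring
  have heq2 : ∀ {χ : Config k → ℂ} (h : IsTest χ), ∀ τ ∈ Set.Icc s T,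
      Complex.I * pair2 (phaseMul τ h.elt) (𝓕 (u τ))
        = ∫ r in s..τ, (2 * Real.pi ^ 2 * pair2 (phaseMul τ h.theta_mul.elt) (𝓕 (u r))
          + pair2 (phaseMul τ h.eltDiv) (y r)) := by
    intro χ h τ hτ
    rw [h.phaseMul_elt, h.theta_mul.phaseMul_elt, h.phaseMul_eltDiv, heq' (h.phase_mul τ) τ hτ]
    rw [IsTest.elt_congr (h.phase_mul τ).theta_mul (h.theta_mul.phase_mul τ) (by
      funext ξ; ring)]
  have hsub : Set.Ioc s τ ⊆ Set.Icc s T := fun r hr => ⟨hr.1.le, hr.2.trans hτ.2⟩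
  -- Here `f`, `f₁`, `f₂` are `χ`, `θ χ`, `θ² χ`, and `e`, `e₁` are `χ / R`, `θ χ / R`. All are
  -- available because admissible test functions are stable under smooth multipliers.
  have key := duhamel_pair2 hτ.1 (hx.mono_set hsub) (hy.mono_set hsub)
    h.theta_mul.theta_mul_elt_ae h.theta_mul_eltDiv_ae (heq2 h τ hτ)
    fun ρ hρ => heq2 h.theta_mul ρ ⟨hρ.1, hρ.2.trans hτ.2⟩
  have hi : IntervalIntegrable (fun r => phaseMul r (y r)) volume s τ := by
    rw [intervalIntegrable_iff_integrableOn_Ioc_of_le hτ.1]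
    refine (hy.mono_set hsub).norm.mono' (aestronglyMeasurable_phaseMul (hy.mono_set hsub).1)
      (Eventually.of_forall fun r => (norm_phaseMul _ _).le)
  rw [← pair2_phaseMul, map_smul, ← (pair2 h.eltDiv).intervalIntegral_comp_comm hi]
  simp_rw [← pair2_phaseMul]
  rw [← key, smul_eq_mul, ← mul_assoc]
  simp

/-- The pairings with admissible test functions determine both sides. There is a gain: `û` is known
only to be in `L²`, while the left side shows that `R û` is in `L²` too. -/
lemma mild_form
    (hc : ∀ v : Kernel2 k, ContinuousOn (fun τ => inner ℂ v (u τ)) (Set.Icc s T))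
    (hy : IntegrableOn y (Set.Icc s T)) (h0 : u s = 0)
    (hyf : ∀ᵐ r ∂(volume.restrict (Set.Icc s T)), ∀ (χ : Config k → ℂ) (h : IsTest χ),
      pair2 h.eltDiv (y r) = f r (𝓕 h.toSchwartz))
    (heq : ∀ φ : 𝓢(Config k, ℂ), ∀ τ ∈ Set.Icc s T,
      Complex.I * ((u τ : 𝓢'(Config k, ℂ)) φ - (u s : 𝓢'(Config k, ℂ)) φ)
        + ∫ r in s..τ, kinetic (u r : 𝓢'(Config k, ℂ)) φ = ∫ r in s..τ, f r φ)
    {τ : ℝ} (hτ : τ ∈ Set.Icc s T) :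
    (-Complex.I • ∫ r in s..τ, phaseMul r (y r) : Kernel2 k) =ᵐ[volume]
      fun ξ => (rSymbol ξ : ℂ) * (phase τ ξ * (𝓕 (u τ) : Kernel2 k) ξ) := by
  set W : Kernel2 k := -Complex.I • ∫ r in s..τ, phaseMul r (y r) with hW
  have hz : (fun ξ => phaseMul τ (𝓕 (u τ)) ξ - W ξ / (rSymbol ξ : ℂ)) =ᵐ[volume] 0 := by
    refine ae_eq_zero_of_isTest ?_ fun χ h => ?_
    · exact (((Lp.memLp _).locallyIntegrable (by norm_num)).locallyIntegrableOn _).sub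
        (locallyIntegrableOn_div W)
    · have h1 := mild_pairing hc hy h0 hyf heq hτ h
      rw [← hW, IsTest.elt, IsTest.eltDiv, pair2_toLp, pair2_toLp] at h1
      have i1 : Integrable fun ξ => χ ξ * phaseMul τ (𝓕 (u τ)) ξ :=
        h.memLp.integrable_mul (Lp.memLp _)
      have i2 : Integrable fun ξ => χ ξ / (rSymbol ξ : ℂ) * W ξ :=
        h.memLp_div.integrable_mul (Lp.memLp _)
      rw [← sub_eq_zero, ← integral_sub i1 i2] at h1
      rw [← h1]
      refine integral_congr_ae (Eventually.of_forall fun ξ => ?_)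
      simp only
      ring
  filter_upwards [hz, phaseMul_ae τ (𝓕 (u τ)), ae_rSymbol_ne_zero k] with ξ h1 h2 h3
  have h4 : (rSymbol ξ : ℂ) ≠ 0 := by exact_mod_cast h3
  rw [← h2, sub_eq_zero.1 h1]
  field_simp

end Mild

lemma rNorm_eq_zero_of_ae {k : ℕ} (u : Kernel2 k) (τ : ℝ)
    (h : (fun ξ => (rSymbol ξ : ℂ) * (phase τ ξ * (𝓕 u : Kernel2 k) ξ)) =ᵐ[volume] 0) :
    rNorm (u : 𝓢'(Config k, ℂ)) = 0 := by
  refine le_antisymm ?_ zero_le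
  refine (iInf₂_le _ (hasFourierDensity_fourier u)).trans (le_of_eq ?_)
  rw [← eLpNorm_zero (α := Config k) (ε := ℂ) (p := 2) (μ := volume)]
  refine eLpNorm_congr_ae ?_
  filter_upwards [h, ae_rSymbol_ne_zero k] with ξ h1 h2
  have h3 : (rSymbol ξ : ℂ) ≠ 0 := by exact_mod_cast h2
  simpa [h3, phase_ne_zero] using h1


/-! ### Splitting off the last pair after a collapse -/

/-- The last pair, and the remaining pairs after the collapse of the last one with the pair `j`. -/
def splitLast {n : ℕ} (j : Fin n) (b : Bool) (ζ : Config (n + 1)) : Pair × Config n :=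
  (pairs ζ (Fin.last n), mergeLast j b ζ)

lemma mergeLast_eq {n : ℕ} (j : Fin n) (b : Bool) (ζ : Config (n + 1)) :
    mergeLast j b ζ = ofPairs ((fun i : Fin n => pairs ζ i.castSucc) + Pi.single j
      (transfer b ((pairs ζ (Fin.last n)).1 + (pairs ζ (Fin.last n)).2))) := by
  rw [mergeLast]
  congr 1
  funext i
  by_cases h : i = j
  · subst h
    simp [merge]
  · simp [h]

instance isAddRightInvariant_pair : (volume : Measure Pair).IsAddRightInvariant :=
  inferInstanceAs (Measure.IsAddRightInvariant ((volume : Measure Space).prod volume))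

lemma measurePreserving_add_single {n : ℕ} (j : Fin n) (c : Pair) :
    MeasurePreserving fun x : Fin n → Pair => x + Pi.single j c := by
  have h : ∀ i : Fin n, MeasurePreserving fun y : Pair => y + (Pi.single j c : Fin n → Pair) i :=
    fun i => measurePreserving_add_right volume _
  exact volume_preserving_pi h

/-- For a fixed last pair the map on the remaining pairs is a translation of the pair `j`, so the
whole map is a skew product. -/
lemma measurePreserving_splitLast {n : ℕ} (j : Fin n) (b : Bool) :
    MeasurePreserving (splitLast j b) := by
  have h1 := measurePreserving_pairs (n + 1)
  have h2 := volume_preserving_piFinSuccAbove (fun _ : Fin (n + 1) => Pair) (Fin.last n)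
  have hm : Measurable (Function.uncurry fun (q : Pair) (x : Fin n → Pair) =>
      ofPairs (x + Pi.single j (transfer b (q.1 + q.2)))) := by
    refine measurable_ofPairs.comp (measurable_pi_lambda _ fun i => ?_)
    have ht := measurable_transfer b
    have h3 : Measurable fun p : Pair × (Fin n → Pair) => transfer b (p.1.1 + p.1.2) :=
      ht.comp ((measurable_fst.comp measurable_fst).add (measurable_snd.comp measurable_fst))
    by_cases h : i = j
    · subst h
      simp only [Pi.add_apply, Pi.single_eq_same]
      exact ((measurable_pi_apply i).comp measurable_snd).add h3
    · simp only [Pi.add_apply, Pi.single_eq_of_ne h, add_zero]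
      exact (measurable_pi_apply i).comp measurable_snd
  have hq : ∀ q : Pair, Measure.map (fun x : Fin n → Pair =>
      ofPairs (x + Pi.single j (transfer b (q.1 + q.2)))) volume = volume := fun q =>
    ((measurePreserving_ofPairs n).comp
      (measurePreserving_add_single j (transfer b (q.1 + q.2)))).map_eq
  have h3 := MeasurePreserving.skew_product (MeasurePreserving.id (volume : Measure Pair))
    (μc := volume) (μd := volume) hm (Eventually.of_forall hq)
  have h4 := (h3.comp h2).comp h1
  refine (congrArg (fun f => MeasurePreserving f volume volume) ?_).mp h4
  funext ζ
  simp only [Function.comp_apply, MeasurableEquiv.piFinSuccAbove_apply, splitLast, mergeLast_eq,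
    id]
  simp [Fin.insertNthEquiv, Fin.init_def]

/-- `(η, η') ↦ (η + η', η')`. -/
def shear (q : Pair) : Pair := (q.1 + q.2, q.2)

lemma measurePreserving_shear : MeasurePreserving shear := by
  exact measurePreserving_add_prod (volume : Measure Space) volume

lemma inner_eq_sum_pairs {n : ℕ} (ζ z : Config n) :
    inner ℝ ζ z = ∑ i, (inner ℝ (pairs ζ i).1 (pairs z i).1 + inner ℝ (pairs ζ i).2 (pairs z i).2) := by
  simp only [PiLp.inner_apply, Fintype.sum_prod_type, Fintype.sum_sum_type, ← Finset.sum_add_distrib]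
  rfl

/-- The component of a pair that takes part in the collapse. -/
def component (b : Bool) (p : Pair) : Space := if b then p.2 else p.1

/-- The transpose of the change of momenta. The momenta `η + η'` and `η'` of the last pair become
dual to the two relative positions in the delta functions, and the merged momenta to the remaining
positions, so characters factorise. -/
lemma inner_splitLast {n : ℕ} (j : Fin n) (b : Bool) (ζ z : Config (n + 1)) :
    inner ℝ ζ z = inner ℝ (shear (splitLast j b ζ).1).1
        ((pairs z (Fin.last n)).1 - component b (pairs z j.castSucc))
      + inner ℝ (shear (splitLast j b ζ).1).2 ((pairs z (Fin.last n)).2 - (pairs z (Fin.last n)).1)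
      + inner ℝ (splitLast j b ζ).2 (dropLast z) := by
  have hd : ∀ i, pairs (dropLast z) i = pairs z i.castSucc := fun i => rfl
  have hm : ∀ i : Fin n, pairs (mergeLast j b ζ) i = pairs ζ i.castSucc + (Pi.single j
      (transfer b ((pairs ζ (Fin.last n)).1 + (pairs ζ (Fin.last n)).2)) : Fin n → Pair) i := by
    intro i
    rw [mergeLast_eq, pairs_ofPairs]
    rfl
  rw [inner_eq_sum_pairs, inner_eq_sum_pairs, Fin.sum_univ_castSucc]
  simp only [splitLast, hd, hm, shear]
  set A := (pairs ζ (Fin.last n)).1 with hA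
  set B := (pairs ζ (Fin.last n)).2 with hB
  have hs : ∑ i : Fin n, (inner ℝ (pairs ζ i.castSucc + (Pi.single j (transfer b (A + B)) :
        Fin n → Pair) i).1 (pairs z i.castSucc).1
      + inner ℝ (pairs ζ i.castSucc + (Pi.single j (transfer b (A + B)) : Fin n → Pair) i).2
        (pairs z i.castSucc).2)
      = ∑ i : Fin n, (inner ℝ (pairs ζ i.castSucc).1 (pairs z i.castSucc).1
        + inner ℝ (pairs ζ i.castSucc).2 (pairs z i.castSucc).2)
        + inner ℝ (A + B) (component b (pairs z j.castSucc)) := by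
    have hj : inner ℝ (A + B) (component b (pairs z j.castSucc)) = ∑ i : Fin n,
        (inner ℝ ((Pi.single j (transfer b (A + B)) : Fin n → Pair) i).1 (pairs z i.castSucc).1
        + inner ℝ ((Pi.single j (transfer b (A + B)) : Fin n → Pair) i).2 (pairs z i.castSucc).2) := by
      rw [Finset.sum_eq_single j]
      · rw [Pi.single_eq_same]
        cases b <;> simp [component, transfer]
      · intro i _ hi
        rw [Pi.single_eq_of_ne hi]
        simp
      · simp
    rw [hj, ← Finset.sum_add_distrib]
    refine Finset.sum_congr rfl fun i _ => ?_
    rw [Prod.fst_add, Prod.snd_add, inner_add_left, inner_add_left]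
    ring
  rw [hs]
  simp only [inner_sub_right, inner_add_left]
  ring

/-! ### The collapse on the Fourier side -/

/-- The regularised collapse, applied to a test function on the Fourier side. -/
def collapseTest {n : ℕ} (j : Fin n) (b : Bool) (ψ : Space → ℂ) (χ : Config n → ℂ)
    (ζ : Config (n + 1)) : ℂ :=
  (ψ (shear (splitLast j b ζ).1).1 * ψ (shear (splitLast j b ζ).1).2) * χ (splitLast j b ζ).2

lemma memLp_two_mul_prod {α β : Type*} [MeasurableSpace α] [MeasurableSpace β] {μ : Measure α}
    {ν : Measure β} [SFinite μ] [SFinite ν] {f : α → ℂ} {g : β → ℂ} (hf : MemLp f 2 μ)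
    (hg : MemLp g 2 ν) : MemLp (fun z : α × β => f z.1 * g z.2) 2 (μ.prod ν) := by
  have hm : AEStronglyMeasurable (fun z : α × β => f z.1 * g z.2) (μ.prod ν) :=
    hf.1.comp_fst.mul hg.1.comp_snd
  rw [memLp_two_iff_integrable_sq_norm hm]
  have h1 := (memLp_two_iff_integrable_sq_norm hf.1).1 hf
  have h2 := (memLp_two_iff_integrable_sq_norm hg.1).1 hg
  simpa only [norm_mul, mul_pow] using h1.mul_prod h2

section

variable {n : ℕ} (j : Fin n) (b : Bool) (ψ : 𝓢(Space, ℂ))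

lemma integrable_collapseTest {χ : Config n → ℂ} (h : IsTest χ) :
    Integrable (collapseTest j b ψ χ) := by
  have h1 : Integrable fun q : Pair => ψ q.1 * ψ q.2 :=
    (ψ.integrable (μ := volume)).mul_prod (ψ.integrable (μ := volume))
  have h2 := (measurePreserving_shear.integrable_comp h1.1).2 h1
  have h3 : Integrable χ := h.smooth.continuous.integrable_of_hasCompactSupport h.compact
  have h4 := h2.mul_prod h3
  exact ((measurePreserving_splitLast j b).integrable_comp h4.1).2 h4

lemma memLp_collapseTest {χ : Config n → ℂ} (h : IsTest χ) :
    MemLp (collapseTest j b ψ χ) 2 := by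
  have h1 : MemLp (fun q : Pair => ψ q.1 * ψ q.2) 2 :=
    memLp_two_mul_prod (ψ.memLp 2 volume) (ψ.memLp 2 volume)
  have h2 := h1.comp_measurePreserving measurePreserving_shear
  have h4 := memLp_two_mul_prod h2 h.memLp
  exact h4.comp_measurePreserving (measurePreserving_splitLast j b)

lemma fourier_collapseTest {χ : Config n → ℂ} (h : IsTest χ) (z : Config (n + 1)) :
    𝓕 (collapseTest j b ψ χ) z
      = 𝓕 ψ ((pairs z (Fin.last n)).1 - component b (pairs z j.castSucc))
        * 𝓕 ψ ((pairs z (Fin.last n)).2 - (pairs z (Fin.last n)).1)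
        * (𝓕 h.toSchwartz) (dropLast z) := by
  set x₁ := (pairs z (Fin.last n)).1 - component b (pairs z j.castSucc) with hx₁
  set x₂ := (pairs z (Fin.last n)).2 - (pairs z (Fin.last n)).1 with hx₂
  set e : ℝ → ℂ := fun t => Complex.exp ((-2 * Real.pi * t : ℝ) * Complex.I) with he
  have he_add : ∀ s t, e (s + t) = e s * e t := by
    intro s t
    rw [he]
    simp only
    rw [← Complex.exp_add]
    congr 1
    push_cast
    ring
  have he1 : ∀ t, ‖e t‖ = 1 := fun t => Complex.norm_exp_ofReal_mul_I _
  have hec : Continuous e := by rw [he]; fun_prop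
  set f : Space → Space → ℂ := fun x α => e (inner ℝ α x) * ψ α with hf
  have hfi : ∀ x, Integrable (f x) := by
    intro x
    refine (ψ.integrable (μ := volume)).bdd_mul (c := 1) ?_
      (Eventually.of_forall fun α => (he1 _).le)
    exact (hec.comp (by fun_prop : Continuous fun α : Space => (inner ℝ α x : ℝ))).aestronglyMeasurable
  set g : Config n → ℂ := fun ξ => e (inner ℝ ξ (dropLast z)) * χ ξ with hg
  have hχi : Integrable χ := h.smooth.continuous.integrable_of_hasCompactSupport h.compact
  have hgi : Integrable g := by
    refine hχi.bdd_mul (c := 1) ?_ (Eventually.of_forall fun α => (he1 _).le)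
    exact (hec.comp (by fun_prop : Continuous fun ξ : Config n =>
      (inner ℝ ξ (dropLast z) : ℝ))).aestronglyMeasurable
  have hff : ∀ x, 𝓕 ψ x = ∫ α, f x α := by
    intro x
    rw [SchwartzMap.fourier_coe, Real.fourier_eq']
    rfl
  have hgg : (𝓕 h.toSchwartz) (dropLast z) = ∫ ξ, g ξ := by
    rw [SchwartzMap.fourier_coe, Real.fourier_eq']
    rfl
  set K : Pair → ℂ := fun q => f x₁ q.1 * f x₂ q.2 with hK
  have hKi : Integrable K := (hfi x₁).mul_prod (hfi x₂)
  have hKs := (measurePreserving_shear.integrable_comp hKi.1).2 hKi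
  have hG : Integrable fun p : Pair × Config n => (K ∘ shear) p.1 * g p.2 := hKs.mul_prod hgi
  rw [Real.fourier_eq', hff, hff, hgg, ← integral_prod_mul, ← Measure.volume_eq_prod]
  have e1 : ∫ q : Pair, f x₁ q.1 * f x₂ q.2 = ∫ q : Pair, (K ∘ shear) q := by
    have hi : AEStronglyMeasurable K (Measure.map shear volume) := by
      rw [measurePreserving_shear.map_eq]; exact hKi.1
    have := integral_map measurePreserving_shear.measurable.aemeasurable hi
    rw [measurePreserving_shear.map_eq] at this
    exact this
  rw [e1, ← integral_prod_mul, ← Measure.volume_eq_prod]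
  have hi : AEStronglyMeasurable (fun p : Pair × Config n => (K ∘ shear) p.1 * g p.2)
      (Measure.map (splitLast j b) volume) := by
    rw [(measurePreserving_splitLast j b).map_eq]; exact hG.1
  have := integral_map (measurePreserving_splitLast j b).measurable.aemeasurable hi
  rw [(measurePreserving_splitLast j b).map_eq] at this
  rw [this]
  refine integral_congr_ae (Eventually.of_forall fun ζ => ?_)
  simp only [smul_eq_mul]
  have e2 : Complex.exp (((-2 * Real.pi * inner ℝ ζ z : ℝ)) * Complex.I) = e (inner ℝ ζ z) := rfl
  rw [e2, inner_splitLast j b, he_add, he_add, ← hx₁, ← hx₂, collapseTest]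
  simp only [hK, hf, hg, Function.comp_apply]
  ring

lemma integral_fourier_collapseTest {χ : Config n → ℂ} (h : IsTest χ) (v : Kernel2 (n + 1)) :
    Integrable (fun z => v z * 𝓕 (collapseTest j b ψ χ) z) ∧
    ∫ z, v z * 𝓕 (collapseTest j b ψ χ) z
      = ∫ ζ, collapseTest j b ψ χ ζ * (𝓕 v : Kernel2 (n + 1)) ζ := by
  have h2 := memLp_collapseTest j b ψ h
  have h3 := fourier_toLp_ae_eq _ (integrable_collapseTest j b ψ h) h2
  have h4 : (fun z => v z * (𝓕 (h2.toLp _) : Kernel2 (n + 1)) z)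
      =ᵐ[volume] fun z => v z * 𝓕 (collapseTest j b ψ χ) z := by
    filter_upwards [h3] with z hz
    rw [hz]
  refine ⟨(integrable_mul_lp v _).congr h4, ?_⟩
  rw [← integral_congr_ae h4, ← pair2_apply, ← pair2_fourier, pair2_comm, pair2_toLp]

end


/-! ### Approximate identities on the Fourier side -/

section Mollifier

variable {ρ : Space → ℝ}

lemma IsMollifier.contDiff_rescale (hρ : IsMollifier ρ) (ε : ℝ) :
    ContDiff ℝ (⊤ : ℕ∞) fun x => (rescale ρ ε x : ℂ) := by
  unfold rescale
  exact Complex.ofRealCLM.contDiff.comp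
    (contDiff_const.mul (hρ.smooth.comp (contDiff_const_smul _)))

lemma IsMollifier.hasCompactSupport_rescale (hρ : IsMollifier ρ) {ε : ℝ} (hε : 0 < ε) :
    HasCompactSupport fun x => (rescale ρ ε x : ℂ) := by
  have h1 : HasCompactSupport fun x => ρ (ε⁻¹ • x) :=
    hρ.compact.comp_homeomorph (Homeomorph.smulOfNeZero ε⁻¹ (inv_ne_zero hε.ne'))
  have h2 : HasCompactSupport fun x => (ε ^ 3)⁻¹ * ρ (ε⁻¹ • x) := h1.mul_left
  exact h2.comp_left (g := fun x : ℝ => (x : ℂ)) Complex.ofReal_zero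

/-- The function `ρ_ε` as a Schwartz function. -/
def IsMollifier.schwartz (hρ : IsMollifier ρ) {ε : ℝ} (hε : 0 < ε) : 𝓢(Space, ℂ) :=
  (hρ.hasCompactSupport_rescale hε).toSchwartzMap (hρ.contDiff_rescale ε)

lemma IsMollifier.schwartz_apply (hρ : IsMollifier ρ) {ε : ℝ} (hε : 0 < ε) (x : Space) :
    hρ.schwartz hε x = rescale ρ ε x := rfl

lemma IsMollifier.fourier_schwartz (hρ : IsMollifier ρ) {ε : ℝ} (hε : 0 < ε) (α : Space) :
    (𝓕 (hρ.schwartz hε)) α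
      = ∫ x, Complex.exp ((-2 * Real.pi * inner ℝ (ε • x) α : ℝ) * Complex.I) * ρ x := by
  rw [SchwartzMap.fourier_coe, Real.fourier_eq']
  have h := Measure.integral_comp_smul (volume : Measure Space) (fun y =>
    Complex.exp ((-2 * Real.pi * inner ℝ (ε • y) α : ℝ) * Complex.I) * (ρ y : ℂ)) ε⁻¹
  have h0 : ((ε ^ 3 : ℝ) : ℂ) ≠ 0 := by exact_mod_cast (pow_pos hε 3).ne'
  rw [finrank_euclideanSpace_fin, inv_pow, inv_inv, abs_of_pos (pow_pos hε 3),
    Complex.real_smul] at h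
  rw [← mul_right_inj' h0, ← h, ← integral_const_mul]
  refine integral_congr_ae (Eventually.of_forall fun x => ?_)
  simp only [smul_eq_mul, hρ.schwartz_apply, rescale]
  rw [smul_smul, mul_inv_cancel₀ hε.ne', one_smul, Complex.ofReal_mul (ε ^ 3)⁻¹, Complex.ofReal_inv,
    mul_left_comm ((ε ^ 3 : ℝ) : ℂ), mul_inv_cancel_left₀ h0]

lemma IsMollifier.integrable (hρ : IsMollifier ρ) : Integrable ρ :=
  hρ.smooth.continuous.integrable_of_hasCompactSupport hρ.compact

lemma IsMollifier.norm_fourier_le (hρ : IsMollifier ρ) {ε : ℝ} (hε : 0 < ε) (α : Space) :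
    ‖(𝓕 (hρ.schwartz hε)) α‖ ≤ 1 := by
  rw [hρ.fourier_schwartz, ← hρ.integral_eq_one]
  refine norm_integral_le_of_norm_le hρ.integrable (Eventually.of_forall fun x => ?_)
  rw [norm_mul, Complex.norm_exp_ofReal_mul_I, one_mul, Complex.norm_real,
    Real.norm_of_nonneg (hρ.nonneg x)]

lemma IsMollifier.tendsto_fourier (hρ : IsMollifier ρ) {ε : ℕ → ℝ} (hε : ∀ n, 0 < ε n)
    (h0 : Tendsto ε atTop (𝓝 0)) (α : Space) :
    Tendsto (fun n => (𝓕 (hρ.schwartz (hε n))) α) atTop (𝓝 1) := by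
  simp_rw [hρ.fourier_schwartz]
  have h1 : (1 : ℂ) = ∫ x, (ρ x : ℂ) := by
    rw [integral_complex_ofReal, hρ.integral_eq_one, Complex.ofReal_one]
  rw [h1]
  refine tendsto_integral_of_dominated_convergence (fun x => ρ x) (fun n => ?_) hρ.integrable
    (fun n => Eventually.of_forall fun x => ?_) (Eventually.of_forall fun x => ?_)
  · have := hρ.smooth.continuous
    exact Continuous.aestronglyMeasurable (by fun_prop)
  · rw [norm_mul, Complex.norm_exp_ofReal_mul_I, one_mul, Complex.norm_real,
      Real.norm_of_nonneg (hρ.nonneg x)]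
  · have hc : Continuous fun t : ℝ =>
        Complex.exp ((-2 * Real.pi * inner ℝ (t • x) α : ℝ) * Complex.I) * (ρ x : ℂ) := by fun_prop
    have := (hc.tendsto 0).comp h0
    simpa [Function.comp_def] using this

end Mollifier

lemma exists_isMollifier : ∃ ρ : Space → ℝ, IsMollifier ρ := by
  let f : ContDiffBump (0 : Space) := ⟨1, 2, one_pos, one_lt_two⟩
  exact ⟨f.normed volume, f.contDiff_normed, f.hasCompactSupport_normed, f.nonneg_normed,
    f.integral_normed⟩

lemma fourier_fourier_apply (f : 𝓢(Space, ℂ)) (x : Space) : (𝓕 (𝓕 f)) x = f (-x) := by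
  have h : (𝓕⁻ (𝓕 f)) (-x) = f (-x) := by rw [FourierTransform.fourierInv_fourier_eq]
  rw [← h, SchwartzMap.fourierInv_coe, Real.fourierInv_eq_fourier_neg, neg_neg,
    SchwartzMap.fourier_coe (𝓕 f)]

/-- The Fourier-side test function is built with the transform of `ρ_ε`. Transforming twice
reflects, and the reflection turns the relative positions of `fourier_collapseTest` into those of
`collapseKernel`. -/
lemma integral_collapse_eq {ρ : Space → ℝ} (hρ : IsMollifier ρ) {ε : ℝ} (hε : 0 < ε) {n : ℕ}
    (j : Fin n) (v : Kernel2 (n + 1)) {χ : Config n → ℂ} (h : IsTest χ) :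
    ∫ z, (collapseKernel j ρ ε z : ℂ) * v z * (𝓕 h.toSchwartz) (dropLast z)
      = ∑ b, branchSign b * ∫ ζ, collapseTest j b (𝓕 (hρ.schwartz hε) : 𝓢(Space, ℂ)) χ ζ
          * (𝓕 v : Kernel2 (n + 1)) ζ := by
  have hi := fun b => integral_fourier_collapseTest j b (𝓕 (hρ.schwartz hε)) h v
  simp_rw [← (hi _).2, ← integral_const_mul]
  rw [← integral_finsetSum _ fun b _ => (hi b).1.const_mul _]
  refine integral_congr_ae (Eventually.of_forall fun z => ?_)
  simp only [fourier_collapseTest j _ (𝓕 (hρ.schwartz hε)) h, fourier_fourier_apply,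
    hρ.schwartz_apply, neg_sub, Fintype.sum_bool]
  simp only [collapseKernel, component, branchSign, pairs]
  push_cast
  ring

/-- Regularised collapses on the Fourier side. -/
lemma exists_regularisation : ∃ ψ : ℕ → 𝓢(Space, ℂ), (∀ m α, ‖ψ m α‖ ≤ 1) ∧
    (∀ α, Tendsto (fun m => ψ m α) atTop (𝓝 1)) ∧
    ∀ (n : ℕ) (j : Fin n) (v : Kernel2 (n + 1)) (f : 𝓢'(Config n, ℂ)), IsCollapse j v f →
      ∀ (χ : Config n → ℂ) (h : IsTest χ), Tendsto (fun m => ∑ b, branchSign b *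
        ∫ ζ, collapseTest j b (ψ m) χ ζ * (𝓕 v : Kernel2 (n + 1)) ζ) atTop
          (𝓝 (f (𝓕 h.toSchwartz))) := by
  obtain ⟨ρ, hρ⟩ := exists_isMollifier
  have hε : ∀ m : ℕ, 0 < 1 / ((m : ℝ) + 1) := fun m => by positivity
  have h0 : Tendsto (fun m : ℕ => 1 / ((m : ℝ) + 1)) atTop (𝓝 0) :=
    tendsto_one_div_add_atTop_nhds_zero_nat
  refine ⟨fun m => 𝓕 (hρ.schwartz (hε m)), fun m α => hρ.norm_fourier_le _ _,
    fun α => hρ.tendsto_fourier hε h0 α, fun n j v f hf χ h => ?_⟩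
  have h1 : Tendsto (fun m : ℕ => 1 / ((m : ℝ) + 1)) atTop (𝓝[>] 0) :=
    tendsto_nhdsWithin_iff.2 ⟨h0, Eventually.of_forall hε⟩
  have h2 := (hf ρ hρ (𝓕 h.toSchwartz)).comp h1
  refine h2.congr fun m => ?_
  exact integral_collapse_eq hρ (hε m) j v h

/-! ### The vertex factor -/

lemma rSymbol_mergeLast {n : ℕ} (j : Fin n) (b : Bool) (ζ : Config (n + 1)) :
    rSymbol (mergeLast j b ζ) * (pairSymbol (pairs ζ j.castSucc) * pairSymbol (pairs ζ (Fin.last n)))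
      = pairSymbol (merge b (pairs ζ j.castSucc) (pairs ζ (Fin.last n))) * rSymbol ζ := by
  rw [rSymbol_eq_prod, rSymbol_eq_prod, Fin.prod_univ_castSucc,
    ← Finset.mul_prod_erase _ _ (Finset.mem_univ j), ← Finset.mul_prod_erase _ _ (Finset.mem_univ j),
    pairs_mergeLast, Function.update_self]
  have : ∏ x ∈ Finset.univ.erase j, pairSymbol (Function.update (fun i => pairs ζ i.castSucc) j
      (merge b (pairs ζ j.castSucc) (pairs ζ (Fin.last n))) x)
      = ∏ x ∈ Finset.univ.erase j, pairSymbol (pairs ζ x.castSucc) :=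
    Finset.prod_congr rfl fun x hx => by rw [Function.update_of_ne (Finset.ne_of_mem_erase hx)]
  rw [this]
  ring

lemma theta_mergeLast {n : ℕ} (j : Fin n) (b : Bool) (ζ : Config (n + 1)) :
    theta (mergeLast j b ζ) = theta ζ + (energy (merge b (pairs ζ j.castSucc) (pairs ζ (Fin.last n)))
      - energy (pairs ζ j.castSucc) - energy (pairs ζ (Fin.last n))) := by
  rw [theta, theta, Fin.sum_univ_castSucc,
    ← Finset.add_sum_erase _ _ (Finset.mem_univ j), ← Finset.add_sum_erase _ _ (Finset.mem_univ j),
    pairs_mergeLast, Function.update_self]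
  have : ∑ x ∈ Finset.univ.erase j, energy (Function.update (fun i => pairs ζ i.castSucc) j
      (merge b (pairs ζ j.castSucc) (pairs ζ (Fin.last n))) x)
      = ∑ x ∈ Finset.univ.erase j, energy (pairs ζ x.castSucc) :=
    Finset.sum_congr rfl fun x hx => by rw [Function.update_of_ne (Finset.ne_of_mem_erase hx)]
  rw [this]
  ring

/-- The pairs that do not take part cancel, so up to its sign the vertex is the quotient of `R`
times the free phase after and before the collapse. -/
lemma vertexLast_mul {n : ℕ} (j : Fin n) (b : Bool) {ζ : Config (n + 1)} (hζ : rSymbol ζ ≠ 0)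
    (r : ℝ) : vertexLast j b ζ r * ((rSymbol ζ : ℂ) * phase r ζ)
      = branchSign b * ((rSymbol (mergeLast j b ζ) : ℂ) * phase r (mergeLast j b ζ)) := by
  have hp : ∀ i, pairSymbol (pairs ζ i) ≠ 0 := by
    rw [rSymbol_eq_prod] at hζ
    exact fun i => Finset.prod_ne_zero_iff.1 hζ i (Finset.mem_univ i)
  have h1 := rSymbol_mergeLast j b ζ
  have h2 : phase r (mergeLast j b ζ) = phase r ζ * Complex.exp (Complex.I * (2 * Real.pi ^ 2 * r
      * (energy (merge b (pairs ζ j.castSucc) (pairs ζ (Fin.last n)))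
        - energy (pairs ζ j.castSucc) - energy (pairs ζ (Fin.last n))) : ℝ)) := by
    rw [phase, phase, theta_mergeLast, ← Complex.exp_add]
    congr 1
    push_cast
    ring
  have h3 : pairSymbol (merge b (pairs ζ j.castSucc) (pairs ζ (Fin.last n)))
      / (pairSymbol (pairs ζ j.castSucc) * pairSymbol (pairs ζ (Fin.last n))) * rSymbol ζ
      = rSymbol (mergeLast j b ζ) := by
    rw [div_mul_eq_mul_div, ← h1, mul_div_assoc, div_self (mul_ne_zero (hp _) (hp _)), mul_one]
  rw [vertexLast, vertex, h2, ← h3]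
  push_cast
  ring


/-! ### Bounded measurable paths in `L²` -/

/-- Jointly measurable functions whose slices are bounded in `L²`. -/
structure IsPath {n : ℕ} (F : ℝ → Config n → ℂ) : Prop where
  measurable : Measurable fun p : ℝ × Config n => F p.1 p.2
  bound : ∃ S : ℝ≥0∞, S ≠ ∞ ∧ ∀ r, ∫⁻ ξ, ‖F r ξ‖ₑ ^ 2 ≤ S

section PathLemmas

variable {n : ℕ} {F G : ℝ → Config n → ℂ}

lemma IsPath.measurable_slice (hF : IsPath F) (r : ℝ) : Measurable (F r) :=
  hF.measurable.comp measurable_prodMk_left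

lemma IsPath.memLp (hF : IsPath F) (r : ℝ) : MemLp (F r) 2 := by
  obtain ⟨S, hS, h⟩ := hF.bound
  exact memLp_two_of_lintegral (hF.measurable_slice r).aestronglyMeasurable
    ((h r).trans_lt hS.lt_top).ne

/-- A path as a function with values in `L²`. -/
def IsPath.elt (hF : IsPath F) (r : ℝ) : Kernel2 n := (hF.memLp r).toLp _

lemma IsPath.aestronglyMeasurable_elt (hF : IsPath F) {ν : Measure ℝ} [SFinite ν] :
    AEStronglyMeasurable hF.elt ν := aestronglyMeasurable_toLp hF.measurable hF.memLp

lemma enorm_add_sq_le (x y : ℂ) : ‖x + y‖ₑ ^ 2 ≤ 2 * ‖x‖ₑ ^ 2 + 2 * ‖y‖ₑ ^ 2 := by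
  have h : ‖x + y‖ ^ 2 ≤ 2 * ‖x‖ ^ 2 + 2 * ‖y‖ ^ 2 := by
    have := norm_add_le x y
    nlinarith [norm_nonneg (x + y), norm_nonneg x, norm_nonneg y, sq_nonneg (‖x‖ - ‖y‖)]
  simp_rw [← ofReal_norm, ← ENNReal.ofReal_pow (norm_nonneg _)]
  rw [← ENNReal.ofReal_ofNat, ← ENNReal.ofReal_mul (by norm_num), ← ENNReal.ofReal_mul (by norm_num),
    ← ENNReal.ofReal_add (by positivity) (by positivity)]
  exact ENNReal.ofReal_le_ofReal h

lemma IsPath.add_smul (hF : IsPath F) (hG : IsPath G) (c : ℂ) :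
    IsPath fun r ξ => F r ξ + c * G r ξ := by
  refine ⟨hF.measurable.add (hG.measurable.const_mul c), ?_⟩
  obtain ⟨S, hS, h⟩ := hF.bound
  obtain ⟨S', hS', h'⟩ := hG.bound
  refine ⟨2 * S + 2 * (‖c‖ₑ ^ 2 * S'), ?_, fun r => ?_⟩
  · exact ENNReal.add_ne_top.2 ⟨ENNReal.mul_ne_top (by simp) hS, ENNReal.mul_ne_top (by simp)
      (ENNReal.mul_ne_top (by simp) hS')⟩
  · calc ∫⁻ ξ, ‖F r ξ + c * G r ξ‖ₑ ^ 2
        ≤ ∫⁻ ξ, (2 * ‖F r ξ‖ₑ ^ 2 + 2 * (‖c‖ₑ ^ 2 * ‖G r ξ‖ₑ ^ 2)) := by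
          refine lintegral_mono fun ξ => (enorm_add_sq_le _ _).trans (le_of_eq ?_)
          rw [enorm_mul, mul_pow]
      _ = 2 * (∫⁻ ξ, ‖F r ξ‖ₑ ^ 2) + 2 * (‖c‖ₑ ^ 2 * ∫⁻ ξ, ‖G r ξ‖ₑ ^ 2) := by
          have m1 := (hF.measurable_slice r).enorm.pow_const 2
          have m2 := (hG.measurable_slice r).enorm.pow_const 2
          rw [lintegral_add_left (m1.const_mul 2), lintegral_const_mul _ m1,
            lintegral_const_mul _ (m2.const_mul _), lintegral_const_mul _ m2]
      _ ≤ _ := by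
          gcongr
          · exact h r
          · exact h' r

lemma IsPath.elt_add_smul (hF : IsPath F) (hG : IsPath G) (c : ℂ) (r : ℝ) :
    (hF.add_smul hG c).elt r = hF.elt r + c • hG.elt r := by
  unfold IsPath.elt
  rw [← MemLp.toLp_const_smul, ← MemLp.toLp_add]
  rfl

end PathLemmas

/-! ### Collapses of paths -/

section Collapse

variable {n : ℕ} {β : ℝ → ℝ} {t : ℝ} {F G : ℝ → Config n → ℂ}

/-- The Duhamel integral of the adjoint collapse of a path. -/
def collapsePath (β : ℝ → ℝ) (j : Fin n) (b : Bool) (F : ℝ → Config n → ℂ) (t σ : ℝ)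
    (ζ : Config (n + 1)) : ℂ :=
  ∫ r in Set.Ioc σ t, (β r : ℂ) * vertexLast j b ζ r * F r (mergeLast j b ζ)

lemma measurable_setIntegral_param {X : Type*} [MeasurableSpace X] {f : X → ℝ → ℂ}
    {a : X → ℝ} (hf : Measurable fun p : X × ℝ => f p.1 p.2) (ha : Measurable a) (t : ℝ) :
    Measurable fun x => ∫ τ in Set.Ioc (a x) t, f x τ := by
  have h1 := measurable_intervalIntegral_param hf (ha.min (measurable_const (a := t)))
    (measurable_const (a := t))
  refine (congrArg Measurable ?_).mp h1
  funext x
  rw [intervalIntegral.integral_of_le (min_le_right _ _)]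
  rcases le_total (a x) t with h | h
  · rw [min_eq_left h]
  · rw [min_eq_right h, Set.Ioc_self, Set.Ioc_eq_empty (not_lt.2 h)]

lemma measurable_collapseIntegrand (hβ : Continuous β) (j : Fin n) (b : Bool) (hF : IsPath F) :
    Measurable fun p : Config (n + 1) × ℝ =>
      (β p.2 : ℂ) * vertexLast j b p.1 p.2 * F p.2 (mergeLast j b p.1) := by
  refine Measurable.mul (Measurable.mul ?_ (measurable_vertexLast j b)) ?_
  · exact (Complex.continuous_ofReal.comp hβ).measurable.comp measurable_snd
  · exact hF.measurable.comp
      (measurable_snd.prodMk ((measurable_mergeLast j b).comp measurable_fst))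

lemma measurable_collapsePath (hβ : Continuous β) (j : Fin n) (b : Bool) (hF : IsPath F) :
    Measurable fun p : ℝ × Config (n + 1) => collapsePath β j b F t p.1 p.2 := by
  have h := (measurable_collapseIntegrand hβ j b hF)
  exact measurable_setIntegral_param (X := ℝ × Config (n + 1))
    (f := fun p r => (β r : ℂ) * vertexLast j b p.2 r * F r (mergeLast j b p.2))
    (h.comp ((measurable_snd.comp measurable_fst).prodMk measurable_snd)) measurable_fst t

/-- In the coordinates of `splitLast` the path depends only on the merged configuration. For each of
these, the last pair ranges over one fibre, where the collapsing estimate applies. -/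
lemma lintegral_collapsePath_le (hβ : Continuous β) (j : Fin n) (b : Bool) (hF : IsPath F)
    {σ B : ℝ} (hB : ∀ r ∈ Set.Icc σ t, |β r| ≤ B) :
    ∫⁻ ζ, ‖collapsePath β j b F t σ ζ‖ₑ ^ 2 ≤ ENNReal.ofReal CollapseTree.fiberConst * (ENNReal.ofReal B ^ 2
      * ∫⁻ r in Set.Ioc σ t, (∫⁻ ξ, ‖F r ξ‖ₑ ^ 2)) := by
  set H : Pair × Config n → ℂ := fun p => ∫ r in Set.Ioc σ t, ((β r : ℂ) * F r p.2) *
    vertex b (pairs p.2 j - transfer b (p.1.1 + p.1.2)) p.1 r with hH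
  have hFm : Measurable fun p : (Pair × Config n) × ℝ => (β p.2 : ℂ) * F p.2 p.1.2 :=
    ((Complex.continuous_ofReal.comp hβ).measurable.comp measurable_snd).mul
      (hF.measurable.comp (measurable_snd.prodMk (measurable_snd.comp measurable_fst)))
  have hpj : Measurable fun p : (Pair × Config n) × ℝ =>
      pairs p.1.2 j - transfer b (p.1.1.1 + p.1.1.2) := by
    refine Measurable.sub ?_ ?_
    · exact ((measurable_pi_apply j).comp measurable_pairs).comp (measurable_snd.comp measurable_fst)
    · exact (measurable_transfer b).comp
        ((measurable_fst.comp (measurable_fst.comp measurable_fst)).add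
          (measurable_snd.comp (measurable_fst.comp measurable_fst)))
  have hv : Measurable fun p : (Pair × Config n) × ℝ =>
      vertex b (pairs p.1.2 j - transfer b (p.1.1.1 + p.1.1.2)) p.1.1 p.2 := by
    have := (measurable_vertex b).comp
      (hpj.prodMk ((measurable_fst.comp measurable_fst).prodMk measurable_snd))
    simpa only [Function.comp_def] using this
  have hHm : Measurable H := measurable_setIntegral_param (a := fun _ => σ)
    (f := fun (p : Pair × Config n) r => ((β r : ℂ) * F r p.2) *
      vertex b (pairs p.2 j - transfer b (p.1.1 + p.1.2)) p.1 r) (hFm.mul hv) measurable_const t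
  have e1 : ∀ ζ, collapsePath β j b F t σ ζ = H (splitLast j b ζ) := by
    intro ζ
    rw [collapsePath, hH]
    refine integral_congr_ae (Eventually.of_forall fun r => ?_)
    simp only [splitLast, pairs_mergeLast, Function.update_self, vertexLast]
    rw [merge, add_sub_cancel_right]
    ring
  calc ∫⁻ ζ, ‖collapsePath β j b F t σ ζ‖ₑ ^ 2 = ∫⁻ ζ, ‖H (splitLast j b ζ)‖ₑ ^ 2 := by
        simp_rw [e1]
    _ = ∫⁻ p : Pair × Config n, ‖H p‖ₑ ^ 2 :=
        (measurePreserving_splitLast j b).lintegral_comp (hHm.enorm.pow_const 2)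
    _ = ∫⁻ ξ, (∫⁻ q, ‖H (q, ξ)‖ₑ ^ 2) := by
        rw [Measure.volume_eq_prod]
        exact lintegral_prod_symm _ (hHm.enorm.pow_const 2).aemeasurable
    _ ≤ ∫⁻ ξ, ENNReal.ofReal CollapseTree.fiberConst * (∫⁻ r in Set.Ioc σ t, ‖(β r : ℂ) * F r ξ‖ₑ ^ 2) := by
        refine lintegral_mono fun ξ => ?_
        refine exists_fiber_estimate.choose_spec.2 b (pairs ξ j) (Set.Ioc σ t) measurableSet_Ioc
          (by simp) (fun r => (β r : ℂ) * F r ξ) ?_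
        have m1 : Measurable fun r => (β r : ℂ) * F r ξ :=
          (Complex.continuous_ofReal.comp hβ).measurable.mul
            (hF.measurable.comp measurable_prodMk_right)
        exact m1.aestronglyMeasurable
    _ ≤ ∫⁻ ξ, ENNReal.ofReal CollapseTree.fiberConst * (ENNReal.ofReal B ^ 2
          * ∫⁻ r in Set.Ioc σ t, ‖F r ξ‖ₑ ^ 2) := by
        refine lintegral_mono fun ξ => mul_le_mul_right ?_ _
        have m2 : Measurable fun r => ‖F r ξ‖ₑ ^ 2 :=
          (hF.measurable.comp measurable_prodMk_right).enorm.pow_const 2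
        rw [← lintegral_const_mul _ m2]
        refine setLIntegral_mono' measurableSet_Ioc fun r hr => ?_
        rw [enorm_mul, mul_pow]
        gcongr
        rw [← ofReal_norm, Complex.norm_real]
        exact ENNReal.ofReal_le_ofReal (hB r ⟨hr.1.le, hr.2⟩)
    _ = _ := by
        have m3 : Measurable fun p : Config n × ℝ => ‖F p.2 p.1‖ₑ ^ 2 :=
          (hF.measurable.comp measurable_swap).enorm.pow_const 2
        rw [lintegral_const_mul _ (m3.lintegral_prod_right'.const_mul _),
          lintegral_const_mul _ m3.lintegral_prod_right', lintegral_lintegral_swap]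
        exact m3.aemeasurable

lemma exists_abs_le (hβ : Continuous β) (a b : ℝ) : ∃ B, 0 ≤ B ∧ ∀ r ∈ Set.Icc a b, |β r| ≤ B := by
  obtain ⟨B, hB⟩ := isCompact_Icc.exists_bound_of_continuousOn (s := Set.Icc a b) hβ.continuousOn
  exact ⟨max B 0, le_max_right _ _, fun r hr => (hB r hr).trans (le_max_left _ _)⟩

lemma memLp_collapsePath (hβ : Continuous β) (j : Fin n) (b : Bool) (hF : IsPath F) (σ : ℝ) :
    MemLp (collapsePath β j b F t σ) 2 := by
  obtain ⟨B, -, hB⟩ := exists_abs_le hβ σ t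
  obtain ⟨S, hS, h⟩ := hF.bound
  refine memLp_two_of_lintegral ((measurable_collapsePath hβ j b hF).comp
    measurable_prodMk_left).aestronglyMeasurable
    ((lintegral_collapsePath_le hβ j b hF hB).trans_lt ?_).ne
  refine ENNReal.mul_lt_top (by simp) (ENNReal.mul_lt_top (by simp) ?_)
  calc ∫⁻ r in Set.Ioc σ t, (∫⁻ ξ, ‖F r ξ‖ₑ ^ 2) ≤ ∫⁻ r in Set.Ioc σ t, S :=
        lintegral_mono fun r => h r
    _ < ∞ := by
        rw [setLIntegral_const]
        exact ENNReal.mul_lt_top hS.lt_top (by simp)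

/-- The collapse of a path as a function with values in `L²`. -/
def collapseElt (hβ : Continuous β) (j : Fin n) (b : Bool) (hF : IsPath F) (t σ : ℝ) :
    Kernel2 (n + 1) := (memLp_collapsePath (t := t) hβ j b hF σ).toLp _

lemma aestronglyMeasurable_collapseElt (hβ : Continuous β) (j : Fin n) (b : Bool) (hF : IsPath F)
    {ν : Measure ℝ} [SFinite ν] : AEStronglyMeasurable (collapseElt hβ j b hF t) ν :=
  aestronglyMeasurable_toLp (measurable_collapsePath hβ j b hF) (memLp_collapsePath hβ j b hF)

lemma enorm_collapseElt_le (hβ : Continuous β) (j : Fin n) (b : Bool) (hF : IsPath F)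
    {s σ B : ℝ} (hB : ∀ r ∈ Set.Icc s t, |β r| ≤ B) (hσ : s ≤ σ) :
    ‖collapseElt hβ j b hF t σ‖ₑ ^ 2 ≤ ENNReal.ofReal CollapseTree.fiberConst * (ENNReal.ofReal B ^ 2
      * ∫⁻ r in Set.Ioc s t, (∫⁻ ξ, ‖F r ξ‖ₑ ^ 2)) := by
  rw [collapseElt, enorm_toLp_sq]
  refine (lintegral_collapsePath_le hβ j b hF fun r hr => hB r ⟨hσ.trans hr.1, hr.2⟩).trans ?_
  gcongr

/-- Needed for the linearity of the collapse. At almost every merged configuration the path is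
square integrable in time, and merging pulls null sets back to null sets. -/
lemma ae_integrableOn_collapse (hβ : Continuous β) (j : Fin n) (b : Bool) (hF : IsPath F) (σ : ℝ) :
    ∀ᵐ ζ, IntegrableOn (fun r => (β r : ℂ) * vertexLast j b ζ r * F r (mergeLast j b ζ))
      (Set.Ioc σ t) := by
  obtain ⟨S, hS, h⟩ := hF.bound
  have m3 : Measurable fun p : Config n × ℝ => ‖F p.2 p.1‖ₑ ^ 2 :=
    (hF.measurable.comp measurable_swap).enorm.pow_const 2
  have h1 : ∀ᵐ ξ, ∫⁻ r in Set.Ioc σ t, ‖F r ξ‖ₑ ^ 2 < ∞ := by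
    refine ae_lt_top m3.lintegral_prod_right' ?_
    rw [lintegral_lintegral_swap m3.aemeasurable]
    refine ((lintegral_mono fun r => h r).trans_lt ?_).ne
    rw [setLIntegral_const]
    exact ENNReal.mul_lt_top hS.lt_top (by simp)
  have hq : Measure.QuasiMeasurePreserving (mergeLast j b : Config (n + 1) → Config n) :=
    (Measure.quasiMeasurePreserving_snd (μ := (volume : Measure Pair))
      (ν := (volume : Measure (Config n)))).comp
      (measurePreserving_splitLast j b).quasiMeasurePreserving
  filter_upwards [hq.ae h1] with ζ hζ
  have hm : AEStronglyMeasurable (fun r => F r (mergeLast j b ζ)) (volume.restrict (Set.Ioc σ t)) :=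
    (hF.measurable.comp measurable_prodMk_right).aestronglyMeasurable
  have h2 : MemLp (fun r => F r (mergeLast j b ζ)) 2 (volume.restrict (Set.Ioc σ t)) :=
    memLp_two_of_lintegral hm hζ.ne
  have h3 := h2.integrable (by norm_num)
  have hc : Continuous fun r => (β r : ℂ) * vertexLast j b ζ r :=
    (Complex.continuous_ofReal.comp hβ).mul (continuous_vertex b _ _)
  obtain ⟨M, hM⟩ := isCompact_Icc.exists_bound_of_continuousOn (s := Set.Icc σ t) hc.continuousOn
  refine h3.bdd_mul hc.aestronglyMeasurable (c := M) ?_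
  filter_upwards [ae_restrict_mem measurableSet_Ioc] with r hr
  exact hM r ⟨hr.1.le, hr.2⟩

lemma collapseElt_add_smul (hβ : Continuous β) (j : Fin n) (b : Bool) (hF : IsPath F)
    (hG : IsPath G) (c : ℂ) (σ : ℝ) :
    collapseElt hβ j b (hF.add_smul hG c) t σ
      = collapseElt hβ j b hF t σ + c • collapseElt hβ j b hG t σ := by
  unfold collapseElt
  rw [← MemLp.toLp_const_smul, ← MemLp.toLp_add, MemLp.toLp_eq_toLp_iff]
  filter_upwards [ae_integrableOn_collapse hβ j b hF σ, ae_integrableOn_collapse hβ j b hG σ]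
    with ζ h1 h2
  simp only [collapsePath, Pi.add_apply, Pi.smul_apply, smul_eq_mul]
  rw [← integral_const_mul, ← integral_add h1 (h2.const_mul c)]
  refine integral_congr_ae (Eventually.of_forall fun r => ?_)
  simp only
  ring

end Collapse


lemma norm_le_of_enorm_sq_le {E : Type*} [NormedAddCommGroup E] {x : E} {X : ℝ≥0∞} (hX : X ≠ ∞)
    (h : ‖x‖ₑ ^ 2 ≤ X) : ‖x‖ ≤ Real.sqrt X.toReal := by
  refine Real.le_sqrt_of_sq_le ?_
  rw [← ofReal_norm, ← ENNReal.ofReal_pow (norm_nonneg _)] at h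
  exact (ENNReal.ofReal_le_iff_le_toReal hX).1 h

/-! ### Duality between collapses of paths and collapses of kernels -/

section Identity

variable {n : ℕ} {β : ℝ → ℝ} {s t : ℝ} {F G : ℝ → Config n → ℂ}

lemma IsPath.enorm_elt_sq (hF : IsPath F) (r : ℝ) :
    ‖hF.elt r‖ₑ ^ 2 = ∫⁻ ξ, ‖F r ξ‖ₑ ^ 2 := enorm_toLp_sq _

lemma IsPath.exists_norm_elt_le (hF : IsPath F) : ∃ M, ∀ r, ‖hF.elt r‖ ≤ M := by
  obtain ⟨S, hS, h⟩ := hF.bound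
  exact ⟨_, fun r => norm_le_of_enorm_sq_le hS ((hF.enorm_elt_sq r).trans_le (h r))⟩

lemma exists_norm_collapseElt_le (hβ : Continuous β) (j : Fin n) (b : Bool) (hF : IsPath F)
    (s t : ℝ) : ∃ D, ∀ σ, s ≤ σ → ‖collapseElt hβ j b hF t σ‖ ≤ D := by
  obtain ⟨B, -, hB⟩ := exists_abs_le hβ s t
  obtain ⟨S, hS, h⟩ := hF.bound
  have hfin : ENNReal.ofReal CollapseTree.fiberConst * (ENNReal.ofReal B ^ 2
      * ∫⁻ r in Set.Ioc s t, (∫⁻ ξ, ‖F r ξ‖ₑ ^ 2)) ≠ ∞ := by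
    refine ENNReal.mul_ne_top (by simp) (ENNReal.mul_ne_top (by simp) ?_)
    refine ((lintegral_mono fun r => h r).trans_lt ?_).ne
    rw [setLIntegral_const]
    exact ENNReal.mul_lt_top hS.lt_top (by simp)
  exact ⟨_, fun σ hσ => norm_le_of_enorm_sq_le hfin (enorm_collapseElt_le hβ j b hF hB hσ)⟩

lemma intervalIntegrable_weight_pair2 (hst : s ≤ t) (hβ : Continuous β) {k : ℕ} {f g : ℝ → Kernel2 k}
    {M : ℝ} (hf : AEStronglyMeasurable f (volume.restrict (Set.Ioc s t)))
    (hM : ∀ᵐ r ∂(volume.restrict (Set.Ioc s t)), ‖f r‖ ≤ M)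
    (hg : IntegrableOn g (Set.Ioc s t)) :
    IntervalIntegrable (fun r => (β r : ℂ) * pair2 (f r) (g r)) volume s t := by
  rw [intervalIntegrable_iff_integrableOn_Ioc_of_le hst]
  obtain ⟨B, -, hB⟩ := exists_abs_le hβ s t
  refine (integrable_pair2 hf hM hg).bdd_mul (c := B)
    (Complex.continuous_ofReal.comp hβ).aestronglyMeasurable ?_
  filter_upwards [ae_restrict_mem measurableSet_Ioc] with r hr
  rw [Complex.norm_real]
  exact hB r ⟨hr.1.le, hr.2⟩

lemma intervalIntegrable_pair2 (hst : s ≤ t) {k : ℕ} {f g : ℝ → Kernel2 k}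
    {M : ℝ} (hf : AEStronglyMeasurable f (volume.restrict (Set.Ioc s t)))
    (hM : ∀ᵐ r ∂(volume.restrict (Set.Ioc s t)), ‖f r‖ ≤ M)
    (hg : IntegrableOn g (Set.Ioc s t)) :
    IntervalIntegrable (fun r => pair2 (f r) (g r)) volume s t := by
  rw [intervalIntegrable_iff_integrableOn_Ioc_of_le hst]
  exact integrable_pair2 hf hM hg

lemma ae_collapseElt_le (hβ : Continuous β) (j : Fin n) (b : Bool) (hF : IsPath F) {D : ℝ}
    (hD : ∀ σ, s ≤ σ → ‖collapseElt hβ j b hF t σ‖ ≤ D) :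
    ∀ᵐ σ ∂(volume.restrict (Set.Ioc s t)), ‖collapseElt hβ j b hF t σ‖ ≤ D := by
  filter_upwards [ae_restrict_mem measurableSet_Ioc] with σ hσ
  exact hD σ hσ.1.le

/-- The duality between the collapse of the path `F` and the pair of paths `g`, `h`. -/
def CollapseIdentity (hβ : Continuous β) (j : Fin n) (s t : ℝ) (g : ℝ → Kernel2 n)
    (h : ℝ → Kernel2 (n + 1)) (hF : IsPath F) : Prop :=
  ∫ r in s..t, (β r : ℂ) * pair2 (hF.elt r) (g r)
    = -Complex.I * ∑ b, ∫ σ in s..t, pair2 (collapseElt hβ j b hF t σ) (h σ)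

variable {g : ℝ → Kernel2 n} {h : ℝ → Kernel2 (n + 1)}

lemma pair2_add_smul {k : ℕ} (x y z : Kernel2 k) (c : ℂ) :
    pair2 (x + c • y) z = pair2 x z + c * pair2 y z := by
  rw [map_add, map_smul]
  rfl

lemma intervalIntegral_pair2_add_smul {k : ℕ} {f f₁ f₂ h : ℝ → Kernel2 k} {c : ℂ}
    (hf : ∀ σ, f σ = f₁ σ + c • f₂ σ)
    (i₁ : IntervalIntegrable (fun r => pair2 (f₁ r) (h r)) volume s t)
    (i₂ : IntervalIntegrable (fun r => pair2 (f₂ r) (h r)) volume s t) :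
    ∫ σ in s..t, pair2 (f σ) (h σ)
      = (∫ σ in s..t, pair2 (f₁ σ) (h σ)) + c * ∫ σ in s..t, pair2 (f₂ σ) (h σ) := by
  rw [← intervalIntegral.integral_const_mul, ← intervalIntegral.integral_add i₁ (i₂.const_mul c)]
  refine intervalIntegral.integral_congr fun σ _ => ?_
  rw [hf, pair2_add_smul]

set_option maxHeartbeats 1000000 in
lemma CollapseIdentity.add_smul (hst : s ≤ t) {hβ : Continuous β} {j : Fin n} {hF : IsPath F}
    {hG : IsPath G} (hg : IntegrableOn g (Set.Ioc s t)) (hh : IntegrableOn h (Set.Ioc s t))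
    (h1 : CollapseIdentity hβ j s t g h hF) (h2 : CollapseIdentity hβ j s t g h hG) (c : ℂ) :
    CollapseIdentity hβ j s t g h (hF.add_smul hG c) := by
  unfold CollapseIdentity at *
  obtain ⟨M, hM⟩ := hF.exists_norm_elt_le
  obtain ⟨M', hM'⟩ := hG.exists_norm_elt_le
  have i1 := intervalIntegrable_weight_pair2 hst hβ hF.aestronglyMeasurable_elt
    (Eventually.of_forall hM) hg
  have i2 := intervalIntegrable_weight_pair2 hst hβ hG.aestronglyMeasurable_elt
    (Eventually.of_forall hM') hg
  have e1 : ∀ r, (β r : ℂ) * pair2 ((hF.add_smul hG c).elt r) (g r)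
      = (β r : ℂ) * pair2 (hF.elt r) (g r) + c * ((β r : ℂ) * pair2 (hG.elt r) (g r)) := by
    intro r
    rw [IsPath.elt_add_smul hF hG, pair2_add_smul]
    ring
  have e2 : ∀ b, ∫ σ in s..t, pair2 (collapseElt hβ j b (hF.add_smul hG c) t σ) (h σ)
      = (∫ σ in s..t, pair2 (collapseElt hβ j b hF t σ) (h σ))
        + c * ∫ σ in s..t, pair2 (collapseElt hβ j b hG t σ) (h σ) := by
    intro b
    obtain ⟨D, hD⟩ := exists_norm_collapseElt_le hβ j b hF s t
    obtain ⟨D', hD'⟩ := exists_norm_collapseElt_le hβ j b hG s t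
    have i3 := intervalIntegrable_pair2 hst (aestronglyMeasurable_collapseElt hβ j b hF)
      (ae_collapseElt_le hβ j b hF hD) hh
    have i4 := intervalIntegrable_pair2 hst (aestronglyMeasurable_collapseElt hβ j b hG)
      (ae_collapseElt_le hβ j b hG hD') hh
    exact intervalIntegral_pair2_add_smul (collapseElt_add_smul hβ j b hF hG c) i3 i4
  rw [Finset.sum_congr rfl fun b _ => e2 b, intervalIntegral.integral_congr fun r _ => e1 r]
  rw [intervalIntegral.integral_add i1 (i2.const_mul c), intervalIntegral.integral_const_mul,
    h1, h2, Finset.sum_add_distrib, ← Finset.mul_sum]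
  ring

/-- The difference of two collapses is the collapse of the difference path, which is controlled by
the time integral of its squared norm; this tends to zero by dominated convergence. -/
lemma tendsto_collapseElt (hβ : Continuous β) (j : Fin n) (b : Bool)
    {Fs : ℕ → ℝ → Config n → ℂ} {hFs : ∀ m, IsPath (Fs m)} {hF : IsPath F} {S : ℝ}
    (hS : ∀ m, ∀ᵐ r ∂(volume.restrict (Set.Ioc s t)), ‖(hFs m).elt r‖ ≤ S)
    (hS' : ∀ᵐ r ∂(volume.restrict (Set.Ioc s t)), ‖hF.elt r‖ ≤ S)
    (hl : ∀ᵐ r ∂(volume.restrict (Set.Ioc s t)),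
      Tendsto (fun m => (hFs m).elt r) atTop (𝓝 (hF.elt r))) {σ : ℝ} (hσ : s ≤ σ) :
    Tendsto (fun m => collapseElt hβ j b (hFs m) t σ) atTop (𝓝 (collapseElt hβ j b hF t σ)) := by
  obtain ⟨B, -, hB⟩ := exists_abs_le hβ s t
  have hd : ∀ m, IsPath (fun r ξ => Fs m r ξ + (-1) * F r ξ) := fun m => (hFs m).add_smul hF (-1)
  have hde : ∀ m r, (hd m).elt r = (hFs m).elt r - hF.elt r := by
    intro m r
    have := IsPath.elt_add_smul (hFs m) hF (-1) r
    rw [neg_one_smul, ← sub_eq_add_neg] at this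
    exact this
  have hint : Tendsto (fun m => ∫⁻ r in Set.Ioc s t, (∫⁻ ξ, ‖Fs m r ξ + (-1) * F r ξ‖ₑ ^ 2)) atTop
      (𝓝 0) := by
    have h0 : (∫⁻ r in Set.Ioc s t, (0 : ℝ≥0∞)) = 0 := by simp
    rw [← h0]
    refine tendsto_lintegral_of_dominated_convergence' (fun _ => ENNReal.ofReal (S + S) ^ 2)
      (fun m => ?_) (fun m => ?_) ?_ ?_
    · have : Measurable fun p : ℝ × Config n => ‖Fs m p.1 p.2 + (-1) * F p.1 p.2‖ₑ ^ 2 :=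
        (hd m).measurable.enorm.pow_const 2
      exact this.lintegral_prod_right'.aemeasurable
    · filter_upwards [hS m, hS'] with r h1 h2
      rw [← (hd m).enorm_elt_sq, hde, ← ofReal_norm]
      gcongr
      exact (norm_sub_le _ _).trans (add_le_add h1 h2)
    · rw [setLIntegral_const]
      exact ENNReal.mul_ne_top (by simp) (by simp)
    · filter_upwards [hl] with r hr
      have h1 : Tendsto (fun m => ‖(hFs m).elt r - hF.elt r‖ₑ ^ 2) atTop (𝓝 0) := by
        have h2 : Tendsto (fun m => (hFs m).elt r - hF.elt r) atTop (𝓝 0) := by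
          simpa using hr.sub_const (hF.elt r)
        have h3 := (continuous_enorm.tendsto (0 : Kernel2 n)).comp h2
        have h4 := ((ENNReal.continuous_pow 2).tendsto ‖(0 : Kernel2 n)‖ₑ).comp h3
        simpa [Function.comp_def] using h4
      refine h1.congr fun m => ?_
      rw [← hde, (hd m).enorm_elt_sq]
  set K : ℝ≥0∞ := ENNReal.ofReal CollapseTree.fiberConst * ENNReal.ofReal B ^ 2 with hK
  have hKt : K ≠ ∞ := ENNReal.mul_ne_top (by simp) (by simp)
  have h5 : Tendsto (fun m => ‖collapseElt hβ j b (hFs m) t σ - collapseElt hβ j b hF t σ‖ₑ ^ 2)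
      atTop (𝓝 0) := by
    have h6 := ENNReal.Tendsto.const_mul hint (Or.inr hKt)
    rw [mul_zero] at h6
    refine tendsto_of_tendsto_of_tendsto_of_le_of_le tendsto_const_nhds h6 (fun m => zero_le)
      fun m => ?_
    have h7 := collapseElt_add_smul (t := t) hβ j b (hFs m) hF (-1) σ
    rw [neg_one_smul, ← sub_eq_add_neg] at h7
    simp only
    rw [← h7, hK, mul_assoc]
    exact enorm_collapseElt_le hβ j b (hd m) hB hσ
  rw [tendsto_iff_norm_sub_tendsto_zero]
  have h8 := ((ENNReal.continuous_rpow_const (y := (1 / 2 : ℝ))).tendsto 0).comp h5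
  have h9 : Tendsto (fun m => ‖collapseElt hβ j b (hFs m) t σ - collapseElt hβ j b hF t σ‖ₑ)
      atTop (𝓝 0) := by
    have : (0 : ℝ≥0∞) ^ (1 / 2 : ℝ) = 0 := by simp
    rw [this] at h8
    refine h8.congr fun m => ?_
    rw [Function.comp_apply, ← ENNReal.rpow_natCast, ← ENNReal.rpow_mul]
    norm_num
  have h10 := (ENNReal.tendsto_toReal ENNReal.zero_ne_top).comp h9
  simpa [Function.comp_def] using h10

lemma CollapseIdentity.of_tendsto (hst : s ≤ t) {hβ : Continuous β} {j : Fin n}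
    {Fs : ℕ → ℝ → Config n → ℂ} {hFs : ∀ m, IsPath (Fs m)} {hF : IsPath F} {S : ℝ}
    (hg : IntegrableOn g (Set.Ioc s t)) (hh : IntegrableOn h (Set.Ioc s t))
    (hS : ∀ m, ∀ᵐ r ∂(volume.restrict (Set.Ioc s t)), ‖(hFs m).elt r‖ ≤ S)
    (hS' : ∀ᵐ r ∂(volume.restrict (Set.Ioc s t)), ‖hF.elt r‖ ≤ S)
    (hl : ∀ᵐ r ∂(volume.restrict (Set.Ioc s t)),
      Tendsto (fun m => (hFs m).elt r) atTop (𝓝 (hF.elt r)))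
    (hI : ∀ m, CollapseIdentity hβ j s t g h (hFs m)) : CollapseIdentity hβ j s t g h hF := by
  obtain ⟨B, hB0, hB⟩ := exists_abs_le hβ s t
  have hΙoc : Set.uIoc s t = Set.Ioc s t := Set.uIoc_of_le hst
  have hL : Tendsto (fun m => ∫ r in s..t, (β r : ℂ) * pair2 ((hFs m).elt r) (g r)) atTop
      (𝓝 (∫ r in s..t, (β r : ℂ) * pair2 (hF.elt r) (g r))) := by
    simp_rw [intervalIntegral.integral_of_le hst]
    refine tendsto_integral_of_dominated_convergence (fun r => B * (S * ‖g r‖)) (fun m => ?_)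
      ((hg.norm.const_mul S).const_mul B) (fun m => ?_) ?_
    · exact (Complex.continuous_ofReal.comp hβ).aestronglyMeasurable.mul
        (aestronglyMeasurable_pair2 (hFs m).aestronglyMeasurable_elt hg.1)
    · filter_upwards [hS m, ae_restrict_mem measurableSet_Ioc] with r h1 h2
      rw [norm_mul, Complex.norm_real]
      refine mul_le_mul (hB r ⟨h2.1.le, h2.2⟩) ?_ (norm_nonneg _) hB0
      exact (norm_pair2_le _ _).trans (by gcongr)
    · filter_upwards [hl] with r hr
      exact (((pair2.flip (g r)).continuous.tendsto _).comp hr).const_mul _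
  have hR : ∀ b, Tendsto (fun m => ∫ σ in s..t, pair2 (collapseElt hβ j b (hFs m) t σ) (h σ)) atTop
      (𝓝 (∫ σ in s..t, pair2 (collapseElt hβ j b hF t σ) (h σ))) := by
    intro b
    set X : ℝ≥0∞ := ENNReal.ofReal CollapseTree.fiberConst * (ENNReal.ofReal B ^ 2
      * ∫⁻ r in Set.Ioc s t, ENNReal.ofReal S ^ 2) with hX
    have hXt : X ≠ ∞ := by
      refine ENNReal.mul_ne_top (by simp) (ENNReal.mul_ne_top (by simp) ?_)
      rw [setLIntegral_const]
      exact ENNReal.mul_ne_top (by simp) (by simp)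
    have hD : ∀ m σ, s ≤ σ → ‖collapseElt hβ j b (hFs m) t σ‖ ≤ Real.sqrt X.toReal := by
      intro m σ hσ
      refine norm_le_of_enorm_sq_le hXt ((enorm_collapseElt_le hβ j b (hFs m) hB hσ).trans ?_)
      rw [hX]
      refine mul_le_mul_right (mul_le_mul_right (lintegral_mono_ae ?_) _) _
      filter_upwards [hS m] with r hr
      rw [← (hFs m).enorm_elt_sq, ← ofReal_norm]
      gcongr
    simp_rw [intervalIntegral.integral_of_le hst]
    refine tendsto_integral_of_dominated_convergence (fun σ => Real.sqrt X.toReal * ‖h σ‖)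
      (fun m => ?_) (hh.norm.const_mul _) (fun m => ?_) ?_
    · exact aestronglyMeasurable_pair2 (aestronglyMeasurable_collapseElt hβ j b (hFs m)) hh.1
    · filter_upwards [ae_restrict_mem measurableSet_Ioc] with σ h2
      refine (norm_pair2_le _ _).trans ?_
      gcongr
      exact hD m σ h2.1.le
    · filter_upwards [ae_restrict_mem measurableSet_Ioc] with σ h2
      exact ((pair2.flip (h σ)).continuous.tendsto _).comp
        (tendsto_collapseElt hβ j b hS hS' hl h2.1.le)
  have hR' : Tendsto (fun m => -Complex.I * ∑ b, ∫ σ in s..t,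
      pair2 (collapseElt hβ j b (hFs m) t σ) (h σ)) atTop
      (𝓝 (-Complex.I * ∑ b, ∫ σ in s..t, pair2 (collapseElt hβ j b hF t σ) (h σ))) :=
    (tendsto_finsetSum _ fun b _ => hR b).const_mul _
  exact tendsto_nhds_unique hL (hR'.congr fun m => (hI m).symm)

end Identity


/-! ### Exchange of integrals for truncated and regularised collapses. -/

section Regularised

variable {n k : ℕ} {s t : ℝ}

/-- Fubini's theorem for the pairing of a dominated path with a primitive. -/
lemma fubini_primitive (hst : s ≤ t) {Q : ℝ → Config k → ℂ} (hQ : IsPath Q) {G : Config k → ℝ}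
    (hG : MemLp G 2) (hQG : ∀ r, ∀ ζ, ‖Q r ζ‖ ≤ G ζ) {a : ℝ → ℂ} (ha : Measurable a) {B : ℝ}
    (haB : ∀ r, ‖a r‖ ≤ B) {h : ℝ → Kernel2 k} (hh : IntegrableOn h (Set.Ioc s t)) :
    ∫ r in s..t, a r * pair2 (hQ.elt r) (-Complex.I • ∫ σ in s..r, h σ)
      = -Complex.I * ∫ σ in s..t, ∫ ζ, (∫ r in Set.Ioc σ t, a r * Q r ζ) * h σ ζ := by
  obtain ⟨M, hM⟩ := hQ.exists_norm_elt_le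
  have e1 : ∀ r ∈ Set.uIcc s t, a r * pair2 (hQ.elt r) (-Complex.I • ∫ σ in s..r, h σ)
      = -Complex.I * ∫ σ in s..r, a r * pair2 (hQ.elt r) (h σ) := by
    intro r hr
    rw [Set.uIcc_of_le hst] at hr
    have hi : IntervalIntegrable h volume s r := by
      rw [intervalIntegrable_iff_integrableOn_Ioc_of_le hr.1]
      exact hh.mono_set (Set.Ioc_subset_Ioc_right hr.2)
    rw [map_smul, ← (pair2 (hQ.elt r)).intervalIntegral_comp_comm hi,
      intervalIntegral.integral_const_mul, smul_eq_mul]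
    ring
  have hF : Integrable (fun p : ℝ × ℝ => a p.1 * pair2 (hQ.elt p.1) (h p.2))
      ((volume.restrict (Set.Ioc s t)).prod (volume.restrict (Set.Ioc s t))) := by
    have h1 : Integrable (fun p : ℝ × ℝ => pair2 (hQ.elt p.1) (h p.2))
        ((volume.restrict (Set.Ioc s t)).prod (volume.restrict (Set.Ioc s t))) :=
      integrable_pair2 (M := M) hQ.aestronglyMeasurable_elt.comp_fst
        (Eventually.of_forall fun p => hM _) (hh.comp_snd _)
    exact h1.bdd_mul (ha.comp measurable_fst).aestronglyMeasurable (c := B)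
      (Eventually.of_forall fun p => haB _)
  rw [intervalIntegral.integral_congr e1, intervalIntegral.integral_const_mul,
    intervalIntegral_triangle hst (fun r σ => a r * pair2 (hQ.elt r) (h σ)) hF]
  congr 1
  refine intervalIntegral.integral_congr fun σ hσ => ?_
  rw [Set.uIcc_of_le hst] at hσ
  rw [intervalIntegral.integral_of_le hσ.2]
  have e2 : ∀ r, a r * pair2 (hQ.elt r) (h σ) = ∫ ζ, a r * Q r ζ * h σ ζ := by
    intro r
    rw [IsPath.elt, pair2_toLp, ← integral_const_mul]
    simp_rw [mul_assoc]
  simp_rw [e2, ← integral_mul_const]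
  refine integral_integral_swap ?_
  have hGh : Integrable fun ζ => G ζ * ‖h σ ζ‖ := hG.integrable_mul (Lp.memLp (h σ)).norm
  refine ((hGh.const_mul B).comp_snd (volume.restrict (Set.Ioc σ t))).mono' ?_
    (Eventually.of_forall fun p => ?_)
  · have h1 : Measurable fun p : ℝ × Config k => a p.1 * Q p.1 p.2 :=
      (ha.comp measurable_fst).mul hQ.measurable
    exact h1.aestronglyMeasurable.mul (Lp.aestronglyMeasurable (h σ)).comp_snd
  · simp only [Function.uncurry]
    rw [norm_mul, norm_mul, ← mul_assoc]
    have := (norm_nonneg _).trans (haB p.1)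
    gcongr
    · exact haB _
    · exact hQG _ _

/-- Dominated convergence for bounded multipliers. -/
lemma tendsto_multiplier (hst : s ≤ t) {e : ℝ → Config k → ℂ}
    (hem : Measurable fun p : ℝ × Config k => e p.1 p.2) (he : ∀ σ, MemLp (e σ) 2) {D : ℝ}
    (hD : ∀ σ ∈ Set.Ioc s t, ‖(he σ).toLp (e σ)‖ ≤ D) {h : ℝ → Kernel2 k}
    (hh : IntegrableOn h (Set.Ioc s t)) {μ : ℕ → Config k → ℂ} {μ' : Config k → ℂ}
    (hμ : ∀ m, Measurable (μ m)) (hμ1 : ∀ m ζ, ‖μ m ζ‖ ≤ 1)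
    (hl : ∀ᵐ ζ, Tendsto (fun m => μ m ζ) atTop (𝓝 (μ' ζ))) :
    Tendsto (fun m => ∫ σ in s..t, ∫ ζ, (μ m ζ * e σ ζ) * h σ ζ) atTop
      (𝓝 (∫ σ in s..t, ∫ ζ, (μ' ζ * e σ ζ) * h σ ζ)) := by
  have hi : ∀ σ, Integrable fun ζ => e σ ζ * h σ ζ := fun σ =>
    (he σ).integrable_mul (Lp.memLp (h σ))
  have hme : ∀ m σ, MemLp (fun ζ => μ m ζ * e σ ζ) 2 := by
    intro m σ
    refine (he σ).of_le ((hμ m).aestronglyMeasurable.mul (he σ).1)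
      (Eventually.of_forall fun ζ => ?_)
    rw [norm_mul]
    exact mul_le_of_le_one_left (norm_nonneg _) (hμ1 m ζ)
  simp_rw [intervalIntegral.integral_of_le hst]
  refine tendsto_integral_of_dominated_convergence (fun σ => D * ‖h σ‖) (fun m => ?_)
    (hh.norm.const_mul D) (fun m => ?_) ?_
  · have h1 : AEStronglyMeasurable (fun σ => (hme m σ).toLp (fun ζ => μ m ζ * e σ ζ))
        (volume.restrict (Set.Ioc s t)) :=
      aestronglyMeasurable_toLp (F := fun σ ζ => μ m ζ * e σ ζ)
        (((hμ m).comp measurable_snd).mul hem) (hme m)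
    have h2 := aestronglyMeasurable_pair2 h1 hh.1
    simpa only [pair2_toLp] using h2
  · filter_upwards [ae_restrict_mem measurableSet_Ioc] with σ hσ
    rw [← pair2_toLp (hme m σ)]
    refine (norm_pair2_le _ _).trans ?_
    gcongr
    refine le_trans ?_ (hD σ hσ)
    rw [Lp.norm_toLp, Lp.norm_toLp]
    refine ENNReal.toReal_mono (he σ).2.ne (eLpNorm_mono fun ζ => ?_)
    rw [norm_mul]
    exact mul_le_of_le_one_left (norm_nonneg _) (hμ1 m ζ)
  · refine Eventually.of_forall fun σ => ?_
    refine tendsto_integral_of_dominated_convergence (fun ζ => ‖e σ ζ * h σ ζ‖) (fun m => ?_)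
      (hi σ).norm (fun m => Eventually.of_forall fun ζ => ?_) ?_
    · exact ((hme m σ).integrable_mul (Lp.memLp (h σ))).1
    · rw [mul_assoc, norm_mul]
      exact mul_le_of_le_one_left (norm_nonneg _) (hμ1 m ζ)
    · filter_upwards [hl] with ζ hζ
      exact (hζ.mul_const _).mul_const _

end Regularised

/-! ### Multipliers and truncations that make the collapse integrable. -/

section Base

variable {n : ℕ} {β : ℝ → ℝ} {s t : ℝ}

/-- The multiplier of the regularised collapse. -/
def collapseMultiplier (n : ℕ) (ψ : Space → ℂ) (ζ : Config (n + 1)) : ℂ :=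
  ψ (shear (pairs ζ (Fin.last n))).1 * ψ (shear (pairs ζ (Fin.last n))).2

lemma collapseTest_eq (j : Fin n) (b : Bool) (ψ : Space → ℂ) (χ : Config n → ℂ)
    (ζ : Config (n + 1)) :
    collapseTest j b ψ χ ζ = collapseMultiplier n ψ ζ * χ (mergeLast j b ζ) := rfl

lemma measurable_collapseMultiplier (ψ : 𝓢(Space, ℂ)) : Measurable (collapseMultiplier n ψ) := by
  have h1 : Measurable fun ζ : Config (n + 1) => shear (pairs ζ (Fin.last n)) :=
    measurePreserving_shear.measurable.comp ((measurable_pi_apply _).comp measurable_pairs)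
  exact (ψ.continuous.measurable.comp (measurable_fst.comp h1)).mul
    (ψ.continuous.measurable.comp (measurable_snd.comp h1))

/-- Truncation of the zeros of `R`. -/
def cutoff (N : ℕ) (ζ : Config n) : ℂ := if 1 / ((N : ℝ) + 1) ≤ rSymbol ζ then 1 else 0

lemma measurable_cutoff (N : ℕ) : Measurable (cutoff N : Config n → ℂ) :=
  Measurable.ite (measurableSet_le measurable_const continuous_rSymbol.measurable)
    measurable_const measurable_const

lemma norm_cutoff_le (N : ℕ) (ζ : Config n) : ‖cutoff N ζ‖ ≤ 1 := by
  unfold cutoff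
  split_ifs <;> simp

lemma tendsto_cutoff {ζ : Config n} (h : rSymbol ζ ≠ 0) :
    Tendsto (fun N => cutoff N ζ) atTop (𝓝 1) := by
  have h1 : 0 < rSymbol ζ := lt_of_le_of_ne (rSymbol_nonneg ζ) (Ne.symm h)
  have h2 : ∀ᶠ N : ℕ in atTop, 1 / ((N : ℝ) + 1) < rSymbol ζ :=
    tendsto_one_div_add_atTop_nhds_zero_nat.eventually_lt_const h1
  refine tendsto_const_nhds.congr' ?_
  filter_upwards [h2] with N hN
  rw [cutoff, if_pos hN.le]

/-- The vertex factor turns a test function divided by `R` into a phase. -/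
lemma vertexLast_mul_test {j : Fin n} {b : Bool} {χ : Config n → ℂ} (hχ : IsTest χ)
    {ζ : Config (n + 1)} (hζ : rSymbol ζ ≠ 0) (r : ℝ) :
    vertexLast j b ζ r * (χ (mergeLast j b ζ) / (rSymbol (mergeLast j b ζ) : ℂ))
      * ((rSymbol ζ : ℂ) * phase r ζ)
      = branchSign b * (phase r (mergeLast j b ζ) * χ (mergeLast j b ζ)) := by
  by_cases h0 : rSymbol (mergeLast j b ζ) = 0
  · have h1 : χ (mergeLast j b ζ) = 0 := by
      by_contra h
      exact hχ.support (subset_tsupport _ h) h0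
    rw [h1]
    simp
  · have h1 : (rSymbol (mergeLast j b ζ) : ℂ) ≠ 0 := by exact_mod_cast h0
    have h2 := vertexLast_mul j b hζ r
    rw [mul_right_comm, h2]
    field_simp

lemma norm_branchSign (b : Bool) : ‖branchSign b‖ = 1 := by
  cases b <;> simp [branchSign]

/-- The truncated integrand of a collapse. -/
def truncatedVertex (j : Fin n) (b : Bool) (ψ : Space → ℂ) (χ : Config n → ℂ) (N : ℕ) (r : ℝ)
    (ζ : Config (n + 1)) : ℂ :=
  cutoff N ζ * collapseMultiplier n ψ ζ
    * (vertexLast j b ζ r * (χ (mergeLast j b ζ) / (rSymbol (mergeLast j b ζ) : ℂ)))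

/-- Where the cutoff is nonzero, `1 ≤ (N + 1) R`. The factor `R` turns the vertex times `χ / R` into
`χ` of the merged momenta, up to modulus one. -/
lemma norm_truncatedVertex_le (j : Fin n) (b : Bool) (ψ : Space → ℂ) {χ : Config n → ℂ}
    (hχ : IsTest χ) (N : ℕ) (r : ℝ) (ζ : Config (n + 1)) :
    ‖truncatedVertex j b ψ χ N r ζ‖ ≤ ((N : ℝ) + 1) * ‖collapseTest j b ψ χ ζ‖ := by
  have hN : (0 : ℝ) < N + 1 := by positivity
  by_cases h : 1 / ((N : ℝ) + 1) ≤ rSymbol ζ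
  · have hR : 0 < rSymbol ζ := lt_of_lt_of_le (by positivity) h
    have h1 := congrArg norm (vertexLast_mul_test (j := j) (b := b) hχ hR.ne' r)
    rw [norm_mul, norm_mul (rSymbol ζ : ℂ), norm_phase, mul_one, norm_mul (branchSign b),
      norm_branchSign, one_mul, norm_mul (phase _ _), norm_phase, one_mul, Complex.norm_real,
      Real.norm_of_nonneg hR.le] at h1
    rw [truncatedVertex, cutoff, if_pos h, one_mul, norm_mul (collapseMultiplier n ψ ζ),
      collapseTest_eq, norm_mul (collapseMultiplier n ψ ζ) (χ _), ← h1]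
    have h2 : 1 ≤ ((N : ℝ) + 1) * rSymbol ζ := by
      rw [div_le_iff₀ hN] at h
      linarith
    set x := ‖vertexLast j b ζ r * (χ (mergeLast j b ζ) / (rSymbol (mergeLast j b ζ) : ℂ))‖ with hx
    have hx0 : 0 ≤ x := norm_nonneg _
    set y := ‖collapseMultiplier n ψ ζ‖ with hy
    have hy0 : 0 ≤ y := norm_nonneg _
    calc y * x = (y * x) * 1 := by ring
      _ ≤ (y * x) * (((N : ℝ) + 1) * rSymbol ζ) := by gcongr
      _ = _ := by ring
  · rw [truncatedVertex, cutoff, if_neg h]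
    simp only [zero_mul, norm_zero]
    positivity

lemma isPath_of_norm_le {k : ℕ} {Q : ℝ → Config k → ℂ}
    (hQ : Measurable fun p : ℝ × Config k => Q p.1 p.2) {G : Config k → ℂ} (hG : MemLp G 2) {c : ℝ}
    (h : ∀ r ζ, ‖Q r ζ‖ ≤ c * ‖G ζ‖) : IsPath Q := by
  refine ⟨hQ, ∫⁻ ζ, ‖(c : ℂ) * G ζ‖ₑ ^ 2, lintegral_enorm_sq_ne_top (hG.const_mul _), fun r =>
    lintegral_mono fun ζ => ?_⟩
  gcongr
  refine enorm_le_iff_norm_le.2 ((h r ζ).trans ?_)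
  rw [norm_mul, Complex.norm_real]
  gcongr
  exact le_abs_self c

lemma measurable_truncatedVertex (j : Fin n) (b : Bool) (ψ : 𝓢(Space, ℂ)) {χ : Config n → ℂ}
    (hχ : IsTest χ) (N : ℕ) :
    Measurable fun p : ℝ × Config (n + 1) => truncatedVertex j b ψ χ N p.1 p.2 := by
  have h1 : Measurable fun p : ℝ × Config (n + 1) => mergeLast j b p.2 :=
    (measurable_mergeLast j b).comp measurable_snd
  have h2 : Measurable fun p : ℝ × Config (n + 1) => vertexLast j b p.2 p.1 :=
    (measurable_vertexLast j b).comp (f := fun p : ℝ × Config (n + 1) => (p.2, p.1))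
      (measurable_snd.prodMk measurable_fst)
  have h3 : Measurable fun p : ℝ × Config (n + 1) =>
      χ (mergeLast j b p.2) / (rSymbol (mergeLast j b p.2) : ℂ) :=
    hχ.continuous_div.measurable.comp h1
  have h4 : Measurable fun p : ℝ × Config (n + 1) => cutoff N p.2 :=
    (measurable_cutoff (n := n + 1) N).comp measurable_snd
  have h5 : Measurable fun p : ℝ × Config (n + 1) => collapseMultiplier n ψ p.2 :=
    (measurable_collapseMultiplier ψ).comp measurable_snd
  simp only [truncatedVertex]
  exact (h4.mul h5).mul (h2.mul h3)

lemma isPath_truncatedVertex (j : Fin n) (b : Bool) (ψ : 𝓢(Space, ℂ)) {χ : Config n → ℂ}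
    (hχ : IsTest χ) (N : ℕ) : IsPath (truncatedVertex j b ψ χ N) :=
  isPath_of_norm_le (measurable_truncatedVertex j b ψ hχ N) (memLp_collapseTest j b ψ hχ)
    (norm_truncatedVertex_le j b ψ hχ N)

/-- The regularised collapse of a test function that is moved by the free evolution. -/
def collapsePhase (j : Fin n) (b : Bool) (ψ : Space → ℂ) (χ : Config n → ℂ) (r : ℝ)
    (ζ : Config (n + 1)) : ℂ :=
  collapseMultiplier n ψ ζ * (phase r (mergeLast j b ζ) * χ (mergeLast j b ζ))

lemma norm_collapsePhase (j : Fin n) (b : Bool) (ψ : Space → ℂ) (χ : Config n → ℂ) (r : ℝ)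
    (ζ : Config (n + 1)) : ‖collapsePhase j b ψ χ r ζ‖ = ‖collapseTest j b ψ χ ζ‖ := by
  rw [collapsePhase, collapseTest_eq, norm_mul (collapseMultiplier n ψ ζ),
    norm_mul (collapseMultiplier n ψ ζ), norm_mul (phase _ _), norm_phase, one_mul]

lemma measurable_collapsePhase (j : Fin n) (b : Bool) (ψ : 𝓢(Space, ℂ)) {χ : Config n → ℂ}
    (hχ : IsTest χ) : Measurable fun p : ℝ × Config (n + 1) => collapsePhase j b ψ χ p.1 p.2 := by
  have h1 : Measurable fun p : ℝ × Config (n + 1) => mergeLast j b p.2 :=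
    (measurable_mergeLast j b).comp measurable_snd
  have h2 : Measurable fun p : ℝ × Config (n + 1) => phase p.1 (mergeLast j b p.2) :=
    (continuous_phase (k := n)).measurable.comp (measurable_fst.prodMk h1)
  have h3 : Measurable fun p : ℝ × Config (n + 1) => χ (mergeLast j b p.2) :=
    hχ.smooth.continuous.measurable.comp h1
  exact ((measurable_collapseMultiplier ψ).comp measurable_snd).mul (h2.mul h3)

lemma isPath_collapsePhase (j : Fin n) (b : Bool) (ψ : 𝓢(Space, ℂ)) {χ : Config n → ℂ}
    (hχ : IsTest χ) : IsPath (collapsePhase j b ψ χ) :=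
  isPath_of_norm_le (c := 1) (measurable_collapsePhase j b ψ hχ) (memLp_collapseTest j b ψ hχ)
    fun r ζ => by rw [norm_collapsePhase, one_mul]

end Base


/-! ### The duality for the indicator of a set of times times a test function. -/

section Cells

variable {n : ℕ} {β : ℝ → ℝ} {s t : ℝ}

/-- The path that is `χ / R` for times in `A`. -/
def cell (A : Set ℝ) (χ : Config n → ℂ) (r : ℝ) (ξ : Config n) : ℂ :=
  A.indicator (fun _ => χ ξ / (rSymbol ξ : ℂ)) r

lemma isPath_cell {A : Set ℝ} (hA : MeasurableSet A) {χ : Config n → ℂ} (hχ : IsTest χ) :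
    IsPath (cell A χ) := by
  refine isPath_of_norm_le (c := 1) ?_ hχ.memLp_div fun r ξ => ?_
  · have h : Measurable fun p : ℝ × Config n => χ p.2 / (rSymbol p.2 : ℂ) :=
      hχ.continuous_div.measurable.comp measurable_snd
    exact h.indicator (measurable_fst hA)
  · rw [one_mul]
    exact norm_indicator_le_norm_self (fun _ => χ ξ / (rSymbol ξ : ℂ)) r

lemma elt_cell {A : Set ℝ} (hA : MeasurableSet A) {χ : Config n → ℂ} (hχ : IsTest χ) (r : ℝ) :
    (isPath_cell hA hχ).elt r = A.indicator (fun _ => hχ.eltDiv) r := by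
  by_cases h : r ∈ A
  · rw [Set.indicator_of_mem h, IsPath.elt, IsTest.eltDiv]
    congr 1
    funext ξ
    exact Set.indicator_of_mem h _
  · rw [Set.indicator_of_notMem h]
    refine Lp.ext ?_
    filter_upwards [((isPath_cell hA hχ).memLp r).coeFn_toLp,
      Lp.coeFn_zero ℂ 2 (volume : Measure (Config n))] with ξ h1 h2
    rw [IsPath.elt, h1, h2, Pi.zero_apply]
    exact Set.indicator_of_notMem h _

/-- The weight `β`, restricted to the times in `A` between `s` and `t`. -/
def cellWeight (β : ℝ → ℝ) (A : Set ℝ) (s t : ℝ) (r : ℝ) : ℂ :=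
  (A ∩ Set.Ioc s t).indicator (fun r => (β r : ℂ)) r

lemma measurable_cellWeight (hβ : Continuous β) {A : Set ℝ} (hA : MeasurableSet A) :
    Measurable (cellWeight β A s t) :=
  (Complex.continuous_ofReal.comp hβ).measurable.indicator (hA.inter measurableSet_Ioc)

lemma norm_cellWeight_le {A : Set ℝ} {B : ℝ} (hB0 : 0 ≤ B) (hB : ∀ r ∈ Set.Icc s t, |β r| ≤ B)
    (r : ℝ) : ‖cellWeight β A s t r‖ ≤ B := by
  unfold cellWeight
  by_cases h : r ∈ A ∩ Set.Ioc s t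
  · rw [Set.indicator_of_mem h, Complex.norm_real]
    exact hB r ⟨h.2.1.le, h.2.2⟩
  · rw [Set.indicator_of_notMem h, norm_zero]
    exact hB0

lemma integral_cellWeight_truncatedVertex (j : Fin n) (b : Bool) (ψ : Space → ℂ)
    (χ : Config n → ℂ) (A : Set ℝ) (N : ℕ) {σ : ℝ} (hσ : s ≤ σ) (ζ : Config (n + 1)) :
    ∫ r in Set.Ioc σ t, cellWeight β A s t r * truncatedVertex j b ψ χ N r ζ
      = (cutoff N ζ * collapseMultiplier n ψ ζ) * collapsePath β j b (cell A χ) t σ ζ := by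
  rw [collapsePath, ← integral_const_mul]
  refine setIntegral_congr_fun measurableSet_Ioc fun r hr => ?_
  simp only [truncatedVertex, cellWeight, cell]
  by_cases h : r ∈ A
  · have hm : r ∈ A ∩ Set.Ioc s t := ⟨h, hσ.trans_lt hr.1, hr.2⟩
    rw [Set.indicator_of_mem hm, Set.indicator_of_mem h]
    ring
  · rw [Set.indicator_of_notMem (fun h' => h h'.1), Set.indicator_of_notMem h]
    ring

/-- The factor `R` times phase carried by the integrated source recombines with the vertex, which
leaves the regularised collapse paired with `v` itself. -/
lemma pair2_truncatedVertex (j : Fin n) (b : Bool) (ψ : 𝓢(Space, ℂ)) {χ : Config n → ℂ}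
    (hχ : IsTest χ) (N : ℕ) (r : ℝ) {W v : Kernel2 (n + 1)}
    (hW : W =ᵐ[volume] fun ξ => (rSymbol ξ : ℂ) * (phase r ξ * v ξ)) :
    pair2 ((isPath_truncatedVertex j b ψ hχ N).elt r) W
      = branchSign b * ∫ ζ, cutoff N ζ * collapsePhase j b ψ χ r ζ * v ζ := by
  rw [IsPath.elt, pair2_toLp, ← integral_const_mul]
  refine integral_congr_ae ?_
  filter_upwards [hW, ae_rSymbol_ne_zero (n + 1)] with ζ h1 h2
  have h3 := vertexLast_mul_test (j := j) (b := b) hχ h2 r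
  rw [h1, truncatedVertex, collapsePhase]
  linear_combination (cutoff N ζ * collapseMultiplier n ψ ζ * v ζ) * h3

/-- Paths after a truncation. -/
lemma isPath_cutoff_collapsePhase (j : Fin n) (b : Bool) (ψ : 𝓢(Space, ℂ)) {χ : Config n → ℂ}
    (hχ : IsTest χ) (N : ℕ) : IsPath fun r ζ => cutoff N ζ * collapsePhase j b ψ χ r ζ := by
  refine isPath_of_norm_le (c := 1) ?_ (memLp_collapseTest j b ψ hχ) fun r ζ => ?_
  · have h4 : Measurable fun p : ℝ × Config (n + 1) => cutoff N p.2 :=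
      (measurable_cutoff (n := n + 1) N).comp measurable_snd
    exact h4.mul (measurable_collapsePhase j b ψ hχ)
  · rw [norm_mul, norm_collapsePhase]
    gcongr
    exact norm_cutoff_le N ζ

variable {h v : ℝ → Kernel2 (n + 1)} {M : ℝ}

lemma norm_collapsePhase_elt_le (j : Fin n) (b : Bool) (ψ : 𝓢(Space, ℂ)) {χ : Config n → ℂ}
    (hχ : IsTest χ) (r : ℝ) :
    ‖(isPath_collapsePhase j b ψ hχ).elt r‖ ≤ ‖(memLp_collapseTest j b ψ hχ).toLp _‖ := by
  rw [IsPath.elt, Lp.norm_toLp, Lp.norm_toLp]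
  refine ENNReal.toReal_mono (memLp_collapseTest j b ψ hχ).2.ne (eLpNorm_mono fun ζ => ?_)
  rw [norm_collapsePhase]

/-- Away from the zeros of `R` this is Fubini's theorem with `R` times phase times `v` replaced by
the primitive of `h`. Then the cutoff is removed with `ψ` kept fixed: the Schwartz multiplier
dominates on the left, the collapsing estimate on the right. -/
lemma regularised_identity (hst : s ≤ t) (hβ : Continuous β) (j : Fin n) (b : Bool)
    (ψ : 𝓢(Space, ℂ)) (hψ : ∀ α, ‖ψ α‖ ≤ 1) {χ : Config n → ℂ} (hχ : IsTest χ) {A : Set ℝ}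
    (hA : MeasurableSet A) (hh : IntegrableOn h (Set.Ioc s t))
    (hv : AEStronglyMeasurable v (volume.restrict (Set.Ioc s t)))
    (hM : ∀ r ∈ Set.Ioc s t, ‖v r‖ ≤ M)
    (hW : ∀ r ∈ Set.Icc s t, (-Complex.I • ∫ σ in s..r, h σ : Kernel2 (n + 1)) =ᵐ[volume]
      fun ξ => (rSymbol ξ : ℂ) * (phase r ξ * v r ξ)) :
    ∫ r in s..t, cellWeight β A s t r
        * (branchSign b * pair2 ((isPath_collapsePhase j b ψ hχ).elt r) (v r))
      = -Complex.I * ∫ σ in s..t, ∫ ζ, (collapseMultiplier n ψ ζ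
          * collapsePath β j b (cell A χ) t σ ζ) * h σ ζ := by
  obtain ⟨B, hB0, hB⟩ := exists_abs_le hβ s t
  have hT : ∀ N, ∫ r in s..t, cellWeight β A s t r
        * (branchSign b * ∫ ζ, cutoff N ζ * collapsePhase j b ψ χ r ζ * v r ζ)
      = -Complex.I * ∫ σ in s..t, ∫ ζ, ((cutoff N ζ * collapseMultiplier n ψ ζ)
          * collapsePath β j b (cell A χ) t σ ζ) * h σ ζ := by
    intro N
    have h1 := fubini_primitive hst (isPath_truncatedVertex j b ψ hχ N)
      ((memLp_collapseTest j b ψ hχ).norm.const_mul ((N : ℝ) + 1))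
      (norm_truncatedVertex_le j b ψ hχ N) (measurable_cellWeight (s := s) (t := t) hβ hA)
      (norm_cellWeight_le hB0 hB) hh
    have h2 : ∀ r ∈ Set.uIcc s t, cellWeight β A s t r
          * (branchSign b * ∫ ζ, cutoff N ζ * collapsePhase j b ψ χ r ζ * v r ζ)
        = cellWeight β A s t r * pair2 ((isPath_truncatedVertex j b ψ hχ N).elt r)
          (-Complex.I • ∫ σ in s..r, h σ) := by
      intro r hr
      rw [Set.uIcc_of_le hst] at hr
      rw [pair2_truncatedVertex j b ψ hχ N r (hW r hr)]
    rw [intervalIntegral.integral_congr h2, h1]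
    congr 1
    refine intervalIntegral.integral_congr fun σ hσ => ?_
    rw [Set.uIcc_of_le hst] at hσ
    refine integral_congr_ae (Eventually.of_forall fun ζ => ?_)
    simp only
    rw [integral_cellWeight_truncatedVertex j b ψ χ A N hσ.1]
  have hae : ∀ᵐ ζ : Config (n + 1), Tendsto (fun N => cutoff N ζ) atTop (𝓝 1) := by
    filter_upwards [ae_rSymbol_ne_zero (n + 1)] with ζ hζ
    exact tendsto_cutoff hζ
  have hmu : ∀ ζ, ‖collapseMultiplier n ψ ζ‖ ≤ 1 := by
    intro ζ
    rw [collapseMultiplier, norm_mul]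
    exact mul_le_one₀ (hψ _) (norm_nonneg _) (hψ _)
  have hR : Tendsto (fun N => -Complex.I * ∫ σ in s..t, ∫ ζ,
      ((cutoff N ζ * collapseMultiplier n ψ ζ) * collapsePath β j b (cell A χ) t σ ζ) * h σ ζ) atTop
      (𝓝 (-Complex.I * ∫ σ in s..t, ∫ ζ, (collapseMultiplier n ψ ζ
          * collapsePath β j b (cell A χ) t σ ζ) * h σ ζ)) := by
    obtain ⟨D, hD⟩ := exists_norm_collapseElt_le hβ j b (isPath_cell hA hχ) s t
    refine (tendsto_multiplier hst (measurable_collapsePath hβ j b (isPath_cell hA hχ))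
      (memLp_collapsePath hβ j b (isPath_cell hA hχ)) (fun σ hσ => hD σ hσ.1.le) hh
      (fun N => (measurable_cutoff N).mul (measurable_collapseMultiplier ψ)) (fun N ζ => ?_)
      ?_).const_mul _
    · rw [Pi.mul_apply, norm_mul]
      exact mul_le_one₀ (norm_cutoff_le N ζ) (norm_nonneg _) (hmu ζ)
    · filter_upwards [hae] with ζ hζ
      simpa using hζ.mul_const (collapseMultiplier n ψ ζ)
  have hL : Tendsto (fun N => ∫ r in s..t, cellWeight β A s t r
        * (branchSign b * ∫ ζ, cutoff N ζ * collapsePhase j b ψ χ r ζ * v r ζ)) atTop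
      (𝓝 (∫ r in s..t, cellWeight β A s t r
        * (branchSign b * pair2 ((isPath_collapsePhase j b ψ hχ).elt r) (v r)))) := by
    have hint : ∀ r, Integrable fun ζ => collapsePhase j b ψ χ r ζ * v r ζ := fun r =>
      ((isPath_collapsePhase j b ψ hχ).memLp r).integrable_mul (Lp.memLp (v r))
    have hcut : ∀ N r, ∫ ζ, cutoff N ζ * collapsePhase j b ψ χ r ζ * v r ζ
        = pair2 ((isPath_cutoff_collapsePhase j b ψ hχ N).elt r) (v r) := by
      intro N r
      rw [IsPath.elt, pair2_toLp]
    simp_rw [intervalIntegral.integral_of_le hst]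
    refine tendsto_integral_of_dominated_convergence
      (fun r => B * (1 * (‖(memLp_collapseTest j b ψ hχ).toLp _‖ * M))) (fun N => ?_)
      (integrable_const _) (fun N => ?_) ?_
    · simp_rw [hcut]
      exact (measurable_cellWeight hβ hA).aestronglyMeasurable.mul (aestronglyMeasurable_const.mul
        (aestronglyMeasurable_pair2 (isPath_cutoff_collapsePhase j b ψ hχ N).aestronglyMeasurable_elt
          hv))
    · filter_upwards [ae_restrict_mem measurableSet_Ioc] with r hr
      rw [norm_mul, norm_mul, norm_branchSign, hcut]
      refine mul_le_mul (norm_cellWeight_le hB0 hB r) ?_ (by positivity) hB0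
      gcongr
      refine (norm_pair2_le _ _).trans (mul_le_mul ?_ (hM r hr) (norm_nonneg _) (norm_nonneg _))
      rw [IsPath.elt, Lp.norm_toLp, Lp.norm_toLp]
      refine ENNReal.toReal_mono (memLp_collapseTest j b ψ hχ).2.ne (eLpNorm_mono fun ζ => ?_)
      rw [norm_mul, norm_collapsePhase]
      exact mul_le_of_le_one_left (norm_nonneg _) (norm_cutoff_le N ζ)
    · refine Eventually.of_forall fun r => Tendsto.const_mul _ (Tendsto.const_mul _ ?_)
      rw [IsPath.elt, pair2_toLp]
      refine tendsto_integral_of_dominated_convergence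
        (fun ζ => ‖collapsePhase j b ψ χ r ζ * v r ζ‖) (fun N => ?_) (hint r).norm
        (fun N => Eventually.of_forall fun ζ => ?_) ?_
      · exact (((isPath_cutoff_collapsePhase j b ψ hχ N).memLp r).integrable_mul
          (Lp.memLp (v r))).1
      · rw [mul_assoc, norm_mul]
        exact mul_le_of_le_one_left (norm_nonneg _) (norm_cutoff_le N ζ)
      · filter_upwards [hae] with ζ hζ
        simpa using (hζ.mul_const (collapsePhase j b ψ χ r ζ)).mul_const (v r ζ)
  exact tendsto_nhds_unique (hL.congr hT) hR

end Cells


/-! ### The duality for general paths. -/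

section General

variable {n : ℕ} {β : ℝ → ℝ} {s t : ℝ} {g : ℝ → Kernel2 n} {h v : ℝ → Kernel2 (n + 1)} {M : ℝ}

/-- The regularised pairing of a collapsed kernel with a test function. -/
def regularisedPairing (j : Fin n) (ψ : 𝓢(Space, ℂ)) {χ : Config n → ℂ} (hχ : IsTest χ)
    (v : ℝ → Kernel2 (n + 1)) (r : ℝ) : ℂ :=
  ∑ b, branchSign b * pair2 ((isPath_collapsePhase j b ψ hχ).elt r) (v r)

lemma aestronglyMeasurable_regularisedPairing (j : Fin n) (ψ : 𝓢(Space, ℂ)) {χ : Config n → ℂ}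
    (hχ : IsTest χ) (hv : AEStronglyMeasurable v (volume.restrict (Set.Ioc s t))) :
    AEStronglyMeasurable (regularisedPairing j ψ hχ v) (volume.restrict (Set.Ioc s t)) :=
  Finset.aestronglyMeasurable_fun_sum _ fun b _ => aestronglyMeasurable_const.mul
    (aestronglyMeasurable_pair2 (isPath_collapsePhase j b ψ hχ).aestronglyMeasurable_elt hv)

/-- The regularisation is removed. On the right the multipliers are bounded by one and tend to one;
on the left pointwise convergence in time is the definition of the collapse, and the bound `X` on
`A` supplies domination. -/
lemma cell_identity_of_bounded (hst : s ≤ t) (hβ : Continuous β) (j : Fin n)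
    {ψ : ℕ → 𝓢(Space, ℂ)} (hψ : ∀ m α, ‖ψ m α‖ ≤ 1)
    (hψl : ∀ α, Tendsto (fun m => ψ m α) atTop (𝓝 1)) {χ : Config n → ℂ} (hχ : IsTest χ)
    {A : Set ℝ} (hA : MeasurableSet A) (hh : IntegrableOn h (Set.Ioc s t))
    (hv : AEStronglyMeasurable v (volume.restrict (Set.Ioc s t)))
    (hM : ∀ r ∈ Set.Ioc s t, ‖v r‖ ≤ M)
    (hW : ∀ r ∈ Set.Icc s t, (-Complex.I • ∫ σ in s..r, h σ : Kernel2 (n + 1)) =ᵐ[volume]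
      fun ξ => (rSymbol ξ : ℂ) * (phase r ξ * v r ξ))
    (hc : ∀ᵐ r ∂(volume.restrict (Set.Ioc s t)),
      Tendsto (fun m => regularisedPairing j (ψ m) hχ v r) atTop (𝓝 (pair2 hχ.eltDiv (g r))))
    {X : ℝ} (hX : ∀ᵐ r ∂(volume.restrict (Set.Ioc s t)), r ∈ A →
      ∀ m, ‖regularisedPairing j (ψ m) hχ v r‖ ≤ X) :
    CollapseIdentity hβ j s t g h (isPath_cell hA hχ) := by
  obtain ⟨B, hB0, hB⟩ := exists_abs_le hβ s t
  have hT : ∀ m, ∫ r in s..t, cellWeight β A s t r * regularisedPairing j (ψ m) hχ v r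
      = -Complex.I * ∑ b, ∫ σ in s..t, ∫ ζ, (collapseMultiplier n (ψ m) ζ
          * collapsePath β j b (cell A χ) t σ ζ) * h σ ζ := by
    intro m
    rw [Finset.mul_sum, ← Finset.sum_congr rfl fun b _ =>
      regularised_identity hst hβ j b (ψ m) (hψ m) hχ hA hh hv hM hW,
      ← intervalIntegral.integral_finsetSum]
    · refine intervalIntegral.integral_congr fun r _ => ?_
      simp only [regularisedPairing, Finset.mul_sum]
    · intro b _
      rw [intervalIntegrable_iff_integrableOn_Ioc_of_le hst]
      refine Integrable.of_bound ((measurable_cellWeight hβ hA).aestronglyMeasurable.mul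
        (aestronglyMeasurable_const.mul (aestronglyMeasurable_pair2
          (isPath_collapsePhase j b (ψ m) hχ).aestronglyMeasurable_elt hv)))
        (B * (1 * (‖(memLp_collapseTest j b (ψ m) hχ).toLp _‖ * M))) ?_
      filter_upwards [ae_restrict_mem measurableSet_Ioc] with r hr
      rw [norm_mul, norm_mul, norm_branchSign]
      refine mul_le_mul (norm_cellWeight_le hB0 hB r) ?_ (by positivity) hB0
      gcongr
      exact (norm_pair2_le _ _).trans (mul_le_mul (norm_collapsePhase_elt_le j b (ψ m) hχ r)
        (hM r hr) (norm_nonneg _) (norm_nonneg _))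
  have hL : Tendsto (fun m => ∫ r in s..t, cellWeight β A s t r
      * regularisedPairing j (ψ m) hχ v r) atTop
      (𝓝 (∫ r in s..t, (β r : ℂ) * pair2 ((isPath_cell hA hχ).elt r) (g r))) := by
    have e1 : ∫ r in s..t, (β r : ℂ) * pair2 ((isPath_cell hA hχ).elt r) (g r)
        = ∫ r in s..t, cellWeight β A s t r * pair2 hχ.eltDiv (g r) := by
      simp_rw [intervalIntegral.integral_of_le hst]
      refine setIntegral_congr_fun measurableSet_Ioc fun r hr => ?_
      rw [elt_cell hA hχ, cellWeight]
      by_cases hr' : r ∈ A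
      · have hm : r ∈ A ∩ Set.Ioc s t := ⟨hr', hr⟩
        rw [Set.indicator_of_mem hr', Set.indicator_of_mem hm]
      · rw [Set.indicator_of_notMem hr', Set.indicator_of_notMem (fun h' => hr' h'.1), map_zero,
          zero_apply]
        ring
    rw [e1]
    simp_rw [intervalIntegral.integral_of_le hst]
    refine tendsto_integral_of_dominated_convergence (fun _ => B * |X|) (fun m => ?_)
      (integrable_const _) (fun m => ?_) ?_
    · exact (measurable_cellWeight hβ hA).aestronglyMeasurable.mul
        (aestronglyMeasurable_regularisedPairing j (ψ m) hχ hv)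
    · filter_upwards [hX] with r hr
      by_cases hr' : r ∈ A
      · rw [norm_mul]
        exact mul_le_mul (norm_cellWeight_le hB0 hB r) ((hr hr' m).trans (le_abs_self X))
          (norm_nonneg _) hB0
      · rw [cellWeight, Set.indicator_of_notMem (fun h' => hr' h'.1), zero_mul, norm_zero]
        positivity
    · filter_upwards [hc] with r hr
      exact hr.const_mul _
  have hR : ∀ b, Tendsto (fun m => ∫ σ in s..t, ∫ ζ, (collapseMultiplier n (ψ m) ζ
      * collapsePath β j b (cell A χ) t σ ζ) * h σ ζ) atTop
      (𝓝 (∫ σ in s..t, pair2 (collapseElt hβ j b (isPath_cell hA hχ) t σ) (h σ))) := by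
    intro b
    obtain ⟨D, hD⟩ := exists_norm_collapseElt_le hβ j b (isPath_cell hA hχ) s t
    have h1 := tendsto_multiplier hst (measurable_collapsePath hβ j b (isPath_cell hA hχ))
      (memLp_collapsePath hβ j b (isPath_cell hA hχ)) (fun σ hσ => hD σ hσ.1.le) hh
      (μ := fun m => collapseMultiplier n (ψ m)) (μ' := fun _ => 1)
      (fun m => measurable_collapseMultiplier (ψ m)) (fun m ζ => by
        rw [collapseMultiplier, norm_mul]
        exact mul_le_one₀ (hψ _ _) (norm_nonneg _) (hψ _ _))
      (Eventually.of_forall fun ζ => by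
        have := (hψl (shear (pairs ζ (Fin.last n))).1).mul (hψl (shear (pairs ζ (Fin.last n))).2)
        simpa [collapseMultiplier] using this)
    simp only [one_mul] at h1
    simpa only [collapseElt, pair2_toLp] using h1
  refine tendsto_nhds_unique hL (Tendsto.congr (fun m => (hT m).symm) ?_)
  exact (tendsto_finsetSum _ fun b _ => hR b).const_mul _

lemma norm_elt_cell_le {A : Set ℝ} (hA : MeasurableSet A) {χ : Config n → ℂ} (hχ : IsTest χ)
    (r : ℝ) : ‖(isPath_cell hA hχ).elt r‖ ≤ ‖hχ.eltDiv‖ := by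
  rw [elt_cell hA hχ]
  exact norm_indicator_le_norm_self (fun _ => hχ.eltDiv) r

/-- The regularised pairings converge at almost every time without a common majorant. The sets `E
N`, where all of them are at most `N`, exhaust almost all times because convergent sequences are
bounded, and the identity is a limit of those for `A ∩ E N`. -/
lemma cell_identity (hst : s ≤ t) (hβ : Continuous β) (j : Fin n)
    {ψ : ℕ → 𝓢(Space, ℂ)} (hψ : ∀ m α, ‖ψ m α‖ ≤ 1)
    (hψl : ∀ α, Tendsto (fun m => ψ m α) atTop (𝓝 1)) {χ : Config n → ℂ} (hχ : IsTest χ)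
    {A : Set ℝ} (hA : MeasurableSet A) (hg : IntegrableOn g (Set.Ioc s t))
    (hh : IntegrableOn h (Set.Ioc s t))
    (hv : AEStronglyMeasurable v (volume.restrict (Set.Ioc s t)))
    (hM : ∀ r ∈ Set.Ioc s t, ‖v r‖ ≤ M)
    (hW : ∀ r ∈ Set.Icc s t, (-Complex.I • ∫ σ in s..r, h σ : Kernel2 (n + 1)) =ᵐ[volume]
      fun ξ => (rSymbol ξ : ℂ) * (phase r ξ * v r ξ))
    (hc : ∀ᵐ r ∂(volume.restrict (Set.Ioc s t)),
      Tendsto (fun m => regularisedPairing j (ψ m) hχ v r) atTop (𝓝 (pair2 hχ.eltDiv (g r)))) :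
    CollapseIdentity hβ j s t g h (isPath_cell hA hχ) := by
  have hm := fun m => aestronglyMeasurable_regularisedPairing j (ψ m) hχ hv
  set E : ℕ → Set ℝ := fun N => ⋂ m, {r | ‖(hm m).mk _ r‖ ≤ N} with hE
  have hEm : ∀ N, MeasurableSet (E N) := fun N => MeasurableSet.iInter fun m =>
    measurableSet_le (hm m).stronglyMeasurable_mk.measurable.norm measurable_const
  have hae : ∀ᵐ r ∂(volume.restrict (Set.Ioc s t)), ∀ m,
      regularisedPairing j (ψ m) hχ v r = (hm m).mk _ r := ae_all_iff.2 fun m => (hm m).ae_eq_mk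
  refine CollapseIdentity.of_tendsto hst (S := ‖hχ.eltDiv‖)
    (hFs := fun N => isPath_cell (hA.inter (hEm N)) hχ) hg hh
    (fun N => Eventually.of_forall fun r => norm_elt_cell_le (hA.inter (hEm N)) hχ r)
    (Eventually.of_forall fun r => norm_elt_cell_le hA hχ r) ?_ fun N => ?_
  · filter_upwards [hae, hc] with r h1 h2
    obtain ⟨C, hC⟩ := (Metric.isBounded_range_of_tendsto _ h2).exists_norm_le
    refine tendsto_const_nhds.congr' ?_
    filter_upwards [eventually_ge_atTop ⌈C⌉₊] with N hN
    have hr : r ∈ E N := by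
      simp only [hE, Set.mem_iInter, Set.mem_ofPred_eq]
      intro m
      rw [← h1 m]
      exact (hC _ ⟨m, rfl⟩).trans ((Nat.le_ceil C).trans (by exact_mod_cast hN))
    rw [elt_cell (hA.inter (hEm N)) hχ, elt_cell hA hχ]
    by_cases hr' : r ∈ A
    · rw [Set.indicator_of_mem hr', Set.indicator_of_mem (Set.mem_inter hr' hr)]
    · rw [Set.indicator_of_notMem hr', Set.indicator_of_notMem fun h' => hr' h'.1]
  · refine cell_identity_of_bounded hst hβ j hψ hψl hχ (hA.inter (hEm N)) hh hv hM hW hc (X := N) ?_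
    filter_upwards [hae] with r h1 hr m
    rw [h1 m]
    exact Set.mem_iInter.1 hr.2 m

lemma exists_path_of_simpleFunc {P : ∀ {F : ℝ → Config n → ℂ}, IsPath F → Prop}
    (hcell : ∀ {A : Set ℝ} (hA : MeasurableSet A) {χ : Config n → ℂ} (hχ : IsTest χ),
      P (isPath_cell hA hχ))
    (hadd : ∀ {F G : ℝ → Config n → ℂ} (hF : IsPath F) (hG : IsPath G), P hF → P hG →
      P (hF.add_smul hG 1)) (f : SimpleFunc ℝ (Kernel2 n)) (hf : ∀ r, f r ∈ testSpace n) :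
    ∃ (F : ℝ → Config n → ℂ) (hF : IsPath F), (∀ r, hF.elt r = f r) ∧ P hF := by
  have key : ∀ I : Finset (Kernel2 n), (∀ y ∈ I, y ∈ testSpace n) →
      ∃ (F : ℝ → Config n → ℂ) (hF : IsPath F),
        (∀ r, hF.elt r = ∑ y ∈ I, (f ⁻¹' {y}).indicator (fun _ => y) r) ∧ P hF := by
    classical
    intro I
    induction I using Finset.induction_on with
    | empty =>
      intro _
      refine ⟨_, isPath_cell MeasurableSet.empty isTest_zero, fun r => ?_, hcell MeasurableSet.empty isTest_zero⟩
      rw [elt_cell MeasurableSet.empty isTest_zero]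
      simp
    | insert y I hy ih =>
      intro hI
      obtain ⟨F, hF, hFe, hFP⟩ := ih fun z hz => hI z (Finset.mem_insert_of_mem hz)
      obtain ⟨χ, hχ, he⟩ := hI y (Finset.mem_insert_self _ _)
      refine ⟨_, hF.add_smul (isPath_cell (f.measurableSet_fiber y) hχ) 1, fun r => ?_,
        hadd hF (isPath_cell (f.measurableSet_fiber y) hχ) hFP (hcell (f.measurableSet_fiber y) hχ)⟩
      rw [IsPath.elt_add_smul hF (isPath_cell (f.measurableSet_fiber y) hχ), hFe,
        elt_cell (f.measurableSet_fiber y) hχ, Finset.sum_insert hy, one_smul, he, add_comm]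
  obtain ⟨F, hF, hFe, hFP⟩ := key f.range fun y hy => by
    obtain ⟨r, rfl⟩ := SimpleFunc.mem_range.1 hy
    exact hf r
  refine ⟨F, hF, fun r => ?_, hFP⟩
  rw [hFe, Finset.sum_eq_single (f r)]
  · rw [Set.indicator_of_mem (by simp)]
  · intro y _ hy
    rw [Set.indicator_of_notMem]
    intro h'
    exact hy (by simpa using h'.symm)
  · intro h'
    exact absurd (f.mem_range_self r) h'

/-- The duality of collapses for all bounded measurable paths. -/
theorem collapse_identity (hst : s ≤ t) (hβ : Continuous β) (j : Fin n)
    {ψ : ℕ → 𝓢(Space, ℂ)} (hψ : ∀ m α, ‖ψ m α‖ ≤ 1)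
    (hψl : ∀ α, Tendsto (fun m => ψ m α) atTop (𝓝 1)) (hg : IntegrableOn g (Set.Ioc s t))
    (hh : IntegrableOn h (Set.Ioc s t))
    (hv : AEStronglyMeasurable v (volume.restrict (Set.Ioc s t)))
    (hM : ∀ r ∈ Set.Ioc s t, ‖v r‖ ≤ M)
    (hW : ∀ r ∈ Set.Icc s t, (-Complex.I • ∫ σ in s..r, h σ : Kernel2 (n + 1)) =ᵐ[volume]
      fun ξ => (rSymbol ξ : ℂ) * (phase r ξ * v r ξ))
    (hc : ∀ᵐ r ∂(volume.restrict (Set.Ioc s t)), ∀ {χ : Config n → ℂ} (hχ : IsTest χ),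
      Tendsto (fun m => regularisedPairing j (ψ m) hχ v r) atTop (𝓝 (pair2 hχ.eltDiv (g r))))
    {F : ℝ → Config n → ℂ} (hF : IsPath F) : CollapseIdentity hβ j s t g h hF := by
  have hsimple := fun (f : SimpleFunc ℝ (Kernel2 n)) (hf : ∀ r, f r ∈ testSpace n) =>
    exists_path_of_simpleFunc (P := fun hF => CollapseIdentity hβ j s t g h hF)
      (fun {_} hA {_} hχ => cell_identity hst hβ j hψ hψl hχ hA hg hh hv hM hW
        (hc.mono fun r hr => hr hχ))
      (fun {_ _} hF hG h1 h2 => CollapseIdentity.add_smul hst hg hh h1 h2 1) f hf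
  borelize (Kernel2 n)
  have hem : AEStronglyMeasurable hF.elt (volume.restrict (Set.Ioc s t)) :=
    hF.aestronglyMeasurable_elt
  have h0 : (0 : Kernel2 n) ∈ (testSpace n : Set (Kernel2 n)) := (testSpace n).zero_mem
  set f : ℕ → SimpleFunc ℝ (Kernel2 n) := fun N => SimpleFunc.approxOn (hem.mk _)
    hem.stronglyMeasurable_mk.measurable (testSpace n : Set (Kernel2 n)) 0 h0 N with hf
  choose Fs hFs hFe hFP using fun N => hsimple (f N) fun r => SimpleFunc.approxOn_mem _ h0 N r
  obtain ⟨S, hS⟩ := hF.exists_norm_elt_le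
  have hS0 : 0 ≤ S := (norm_nonneg _).trans (hS 0)
  -- The approximating simple functions are bounded by twice the norm of the path. They take values
  -- in the dense space of elements `χ / R`, hence are finite sums of cells.
  refine CollapseIdentity.of_tendsto hst (S := S + S) (hFs := hFs) hg hh (fun N => ?_)
    (Eventually.of_forall fun r => (hS r).trans (by linarith)) ?_ hFP
  · filter_upwards [hem.ae_eq_mk] with r hr
    rw [hFe]
    refine (SimpleFunc.norm_approxOn_zero_le _ h0 r N).trans ?_
    rw [← hr]
    exact add_le_add (hS r) (hS r)
  · filter_upwards [hem.ae_eq_mk] with r hr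
    simp_rw [hFe]
    rw [hr]
    exact SimpleFunc.tendsto_approxOn _ h0 (dense_testSpace n _)

end General


/-! ### Permutations of kernels -/

section Permutations

variable {k : ℕ} (σ : Equiv.Perm (Fin k))

/-- A permutation of the particles as an isometry. -/
def permuteIsometry : Config k ≃ₗᵢ[ℝ] Config k :=
  LinearIsometryEquiv.piLpCongrLeft 2 ℝ ℝ
    ((Equiv.sumCongr σ.symm σ.symm).prodCongr (Equiv.refl (Fin 3)))

lemma coe_permuteIsometry : ⇑(permuteIsometry σ) = permute σ := by
  funext z
  ext ⟨p, i⟩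
  cases p <;> rfl

lemma measurePreserving_permute :
    MeasurePreserving (permute σ : Config k → Config k) := by
  rw [← coe_permuteIsometry]
  exact (permuteIsometry σ).measurePreserving

/-- The action of a permutation of the particles on kernels. -/
def permuteKernel : Kernel2 k →ₗᵢ[ℂ] Kernel2 k :=
  Lp.compMeasurePreservingₗᵢ ℂ (permute σ) (measurePreserving_permute σ)

lemma permuteKernel_ae (u : Kernel2 k) :
    permuteKernel σ u =ᵐ[volume] fun ξ => u (permute σ ξ) :=
  Lp.coeFn_compMeasurePreserving u (measurePreserving_permute σ)

lemma permuteKernel_toLp {f : Config k → ℂ} (hf : MemLp f 2)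
    (hf' : MemLp (fun ξ => f (permute σ ξ)) 2) : permuteKernel σ (hf.toLp f) = hf'.toLp _ := by
  refine Lp.ext ?_
  filter_upwards [permuteKernel_ae σ (hf.toLp f), hf'.coeFn_toLp,
    (measurePreserving_permute σ).quasiMeasurePreserving.ae hf.coeFn_toLp] with ξ h1 h2 h3
  rw [h1, h2, h3]

lemma pair2_permuteKernel (u v : Kernel2 k) :
    pair2 (permuteKernel σ u) (permuteKernel σ v) = pair2 u v := by
  have h : MeasurableEmbedding (permute σ : Config k → Config k) := by
    rw [← coe_permuteIsometry]
    exact (permuteIsometry σ).toHomeomorph.measurableEmbedding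
  rw [pair2_apply, pair2_apply,
    ← (measurePreserving_permute σ).integral_comp h fun ξ => u ξ * v ξ]
  refine integral_congr_ae ?_
  filter_upwards [permuteKernel_ae σ u, permuteKernel_ae σ v] with ξ h1 h2
  rw [h1, h2]

/-- Permutations of the particles are orthogonal maps, for which this is clear on Schwartz
functions; density does the rest. -/
lemma fourier_permuteKernel (u : Kernel2 k) :
    (𝓕 (permuteKernel σ u) : Kernel2 k) = permuteKernel σ (𝓕 u) := by
  have h := (SchwartzMap.denseRange_toLpCLM (E := Config k) (F := ℂ) (p := 2) (by simp)
    (μ := (volume : Measure (Config k))))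
  have c1 : Continuous fun u : Kernel2 k => (𝓕 u : Kernel2 k) :=
    (Lp.fourierTransformₗᵢ (Config k) ℂ).continuous
  have key : (fun u : Kernel2 k => (𝓕 (permuteKernel σ u) : Kernel2 k))
      = fun u => permuteKernel σ (𝓕 u) := by
    refine DenseRange.equalizer h (c1.comp (permuteKernel σ).continuous)
      ((permuteKernel σ).continuous.comp c1) ?_
    funext φ
    simp only [Function.comp_apply, SchwartzMap.toLpCLM_apply]
    set φ' : 𝓢(Config k, ℂ) := SchwartzMap.compCLMOfContinuousLinearEquiv ℂ
      (permuteIsometry σ).toContinuousLinearEquiv φ with hφ'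
    have hc : ⇑φ' = φ ∘ permuteIsometry σ := rfl
    have e1 : permuteKernel σ (φ.toLp 2 volume) = φ'.toLp 2 volume := by
      refine (permuteKernel_toLp σ (φ.memLp 2) ?_).trans ?_
      · have := φ'.memLp 2 volume
        rwa [hc, coe_permuteIsometry] at this
      · refine MemLp.toLp_congr _ _ (Eventually.of_forall fun ξ => ?_)
        rw [hc, coe_permuteIsometry]
        rfl
    rw [e1, SchwartzMap.toLp_fourier_eq, SchwartzMap.toLp_fourier_eq]
    have hc' : ∀ ξ, (𝓕 φ' : 𝓢(Config k, ℂ)) ξ = (𝓕 φ : 𝓢(Config k, ℂ)) (permute σ ξ) := by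
      intro ξ
      rw [SchwartzMap.fourier_coe, SchwartzMap.fourier_coe, hc, Real.fourier_comp_linearIsometry,
        coe_permuteIsometry]
    refine Eq.symm ((permuteKernel_toLp σ ((𝓕 φ).memLp 2) ?_).trans ?_)
    · refine ((𝓕 φ' : 𝓢(Config k, ℂ)).memLp 2 volume).congr_norm ?_ ?_
      · exact ((𝓕 φ : 𝓢(Config k, ℂ)).continuous.measurable.comp
          (measurePreserving_permute σ).measurable).aestronglyMeasurable
      · exact Eventually.of_forall fun ξ => by rw [hc']
    · exact MemLp.toLp_congr _ _ (Eventually.of_forall fun ξ => (hc' ξ).symm)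
  exact congrFun key u

lemma theta_permute (ξ : Config k) : theta (permute σ ξ) = theta ξ :=
  Equiv.sum_comp σ fun j => energy (pairs ξ j)

lemma phase_permute (τ : ℝ) (ξ : Config k) : phase τ (permute σ ξ) = phase τ ξ := by
  unfold phase
  rw [theta_permute]

lemma rSymbol_permute (ξ : Config k) : rSymbol (permute σ ξ) = rSymbol ξ :=
  Equiv.prod_comp (Equiv.sumCongr σ σ) fun p => 2 * Real.pi * ‖pos ξ p‖

/-- Lebesgue differentiation. It carries the symmetry of the integrated source over to the source
itself at almost every time. -/
lemma ae_eq_zero_of_intervalIntegral_eq_zero {E : Type*} [NormedAddCommGroup E] [NormedSpace ℝ E]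
    [CompleteSpace E] {f : ℝ → E} {s t : ℝ} (hf : IntegrableOn f (Set.Icc s t))
    (h : ∀ r ∈ Set.Icc s t, ∫ x in s..r, f x = 0) :
    ∀ᵐ r ∂(volume.restrict (Set.Icc s t)), f r = 0 := by
  rcases lt_or_ge t s with hst | hst
  · simp [Set.Icc_eq_empty (not_le.2 hst)]
  have hi : IntervalIntegrable f volume s t :=
    (intervalIntegrable_iff_integrableOn_Icc_of_le hst).2 hf
  rw [Measure.restrict_congr_set Ioo_ae_eq_Icc.symm]
  refine (ae_restrict_iff' measurableSet_Ioo).2 ?_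
  filter_upwards [hi.ae_hasDerivAt_integral] with x hx hx'
  rw [Set.uIcc_of_le hst] at hx
  have h1 := hx ⟨hx'.1.le, hx'.2.le⟩ s ⟨le_rfl, hst⟩
  have h2 : HasDerivAt (fun y => ∫ z in s..y, f z) 0 x := by
    refine (hasDerivAt_const x (0 : E)).congr_of_eventuallyEq ?_
    filter_upwards [Ioo_mem_nhds hx'.1 hx'.2] with y hy
    exact h y ⟨hy.1.le, hy.2.le⟩
  exact h1.unique h2

variable {σ}

/-- The integrand of a symmetric Duhamel integral is symmetric. -/
lemma ae_permuteKernel_eq {s t : ℝ} {h v : ℝ → Kernel2 k} (hh : IntegrableOn h (Set.Icc s t))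
    (hv : ∀ r ∈ Set.Icc s t, permuteKernel σ (v r) = v r)
    (hW : ∀ r ∈ Set.Icc s t, (-Complex.I • ∫ x in s..r, h x : Kernel2 k) =ᵐ[volume]
      fun ξ => (rSymbol ξ : ℂ) * (phase r ξ * v r ξ)) :
    ∀ᵐ r ∂(volume.restrict (Set.Icc s t)), permuteKernel σ (h r) = h r := by
  have hp : IntegrableOn (fun r => permuteKernel σ (h r)) (Set.Icc s t) :=
    (permuteKernel σ).toContinuousLinearMap.integrable_comp hh
  have h0 := ae_eq_zero_of_intervalIntegral_eq_zero (hp.sub hh) fun r hr => ?_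
  · filter_upwards [h0] with r hr
    exact sub_eq_zero.1 hr
  · have i1 : IntervalIntegrable h volume s r :=
      (intervalIntegrable_iff_integrableOn_Icc_of_le hr.1).2
        (hh.mono_set (Set.Icc_subset_Icc le_rfl hr.2))
    have i2 : IntervalIntegrable (fun r => permuteKernel σ (h r)) volume s r :=
      (intervalIntegrable_iff_integrableOn_Icc_of_le hr.1).2
        (hp.mono_set (Set.Icc_subset_Icc le_rfl hr.2))
    have e := (permuteKernel σ).toContinuousLinearMap.intervalIntegral_comp_comm i1
    have e' : permuteKernel σ (-Complex.I • ∫ x in s..r, h x) = -Complex.I • ∫ x in s..r, h x := by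
      have hve := permuteKernel_ae σ (v r)
      rw [hv r hr] at hve
      refine Lp.ext ?_
      filter_upwards [permuteKernel_ae σ (-Complex.I • ∫ x in s..r, h x), hW r hr, hve,
        (measurePreserving_permute σ).quasiMeasurePreserving.ae (hW r hr)] with ξ h1 h2 h3 h4
      rw [h1, h2, h4, rSymbol_permute, phase_permute, h3]
    rw [map_smul] at e'
    have e'' := smul_right_injective (Kernel2 k) (neg_ne_zero.2 Complex.I_ne_zero) e'
    simp only [Pi.sub_apply]
    rw [intervalIntegral.integral_sub i2 i1, sub_eq_zero]
    exact e.trans e''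

end Permutations


/-! ### Iterated Duhamel expansions -/

section Iteration

variable {β : ℝ → ℝ} {k : ℕ} {ψ : Config k → ℂ} {s t T₁ B : ℝ}

/-- The history sums with end time `t`, for times between `s` and `t`. -/
def historyPath (β : ℝ → ℝ) (k N : ℕ) (ψ : Config k → ℂ) (s t r : ℝ) (ζ : Config (k + N)) : ℂ :=
  (Set.Icc s t).indicator (fun r => historySum β k N ψ ζ r t) r

/-- The bound for histories uses a window of fixed length `T₁` that starts at the running time `r`.
It may reach beyond `t`, and therefore `β` is bounded up to `t + T₁`. -/
lemma lintegral_historyPath_le (hβ : Continuous β) (hT : 0 < T₁) (ht : t ≤ s + T₁)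
    (hB : ∀ τ ∈ Set.Icc s (t + T₁), |β τ| ≤ B) (N : ℕ) (hψ : Measurable ψ) (r : ℝ) :
    ∫⁻ ζ, ‖historyPath β k N ψ s t r ζ‖ₑ ^ 2 ≤ (((N + 1) ^ k * 8 ^ N : ℕ) : ℝ≥0∞) ^ 2 *
        (2 ^ k * ENNReal.ofReal (4 * (CollapseTree.fiberConst * B ^ 2 * T₁)) ^ N)
          * ∫⁻ z, ‖ψ z‖ₑ ^ 2 := by
  by_cases hr : r ∈ Set.Icc s t
  · simp_rw [historyPath, Set.indicator_of_mem hr]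
    exact lintegral_historySum_le hβ hT hr.2 (by linarith [hr.1])
      (fun τ hτ => hB τ ⟨hr.1.trans hτ.1, hτ.2.trans (by linarith [hr.2])⟩) N hψ
  · simp_rw [historyPath, Set.indicator_of_notMem hr]
    simp

lemma isPath_historyPath (hβ : Continuous β) (hT : 0 < T₁) (ht : t ≤ s + T₁)
    (hB : ∀ τ ∈ Set.Icc s (t + T₁), |β τ| ≤ B) (N : ℕ) (hψ : Measurable ψ)
    (hψ2 : ∫⁻ z, ‖ψ z‖ₑ ^ 2 ≠ ∞) : IsPath (historyPath β k N ψ s t) := by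
  refine ⟨?_, _, ?_, lintegral_historyPath_le hβ hT ht hB N hψ⟩
  · have h : Measurable fun p : ℝ × Config (k + N) => historySum β k N ψ p.2 p.1 t := by
      exact (measurable_historySum hβ N hψ).comp
        (f := fun p : ℝ × Config (k + N) => (p.2, p.1, t))
        (measurable_snd.prodMk (measurable_fst.prodMk measurable_const))
    exact h.indicator (measurable_fst measurableSet_Icc)
  · refine ENNReal.mul_ne_top (ENNReal.mul_ne_top ?_ ?_) hψ2
    · exact ENNReal.pow_ne_top (ENNReal.natCast_ne_top _)
    · exact ENNReal.mul_ne_top (by simp) (ENNReal.pow_ne_top ENNReal.ofReal_ne_top)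

lemma historyPath_zero {r : ℝ} (hr : r ∈ Set.Icc s t) (ζ : Config (k + 0)) :
    historyPath β k 0 ψ s t r ζ = ψ ζ := by
  rw [historyPath, Set.indicator_of_mem hr, historySum_zero]

lemma historyPath_succ (hβ : Continuous β) {N : ℕ} {σ : ℝ} (hσ : σ ∈ Set.Icc s t)
    (ζ : Config (k + N + 1)) :
    historyPath β k (N + 1) ψ s t σ ζ = ∑ j, ∑ b, collapsePath β j b (historyPath β k N ψ s t) t σ
      (permute (movePerm j).symm ζ) := by
  rw [historyPath, Set.indicator_of_mem hσ, historySum_succ hβ k N ψ ζ hσ.2]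
  refine Finset.sum_congr rfl fun j _ => Finset.sum_congr rfl fun b _ => ?_
  rw [intervalIntegral.integral_of_le hσ.2, collapsePath]
  refine setIntegral_congr_fun measurableSet_Ioc fun r hr => ?_
  have hr' : r ∈ Set.Icc s t := ⟨hσ.1.trans hr.1.le, hr.2⟩
  simp only [historyPath, Set.indicator_of_mem hr']

lemma toLp_finsetSum {ι α : Type*} [Fintype ι] [MeasurableSpace α] {μ : Measure α}
    {f : ι → α → ℂ} (hf : ∀ i, MemLp (f i) 2 μ) (h : MemLp (fun x => ∑ i, f i x) 2 μ) :
    h.toLp _ = ∑ i, (hf i).toLp (f i) := by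
  refine Lp.ext (h.coeFn_toLp.trans ?_)
  filter_upwards [Lp.coeFn_finsetSum Finset.univ fun i => (hf i).toLp (f i),
    ae_all_iff.2 fun i => (hf i).coeFn_toLp] with x h1 h2
  rw [h1, Finset.sum_apply]
  exact Finset.sum_congr rfl fun i _ => (h2 i).symm

lemma elt_historyPath_succ (hβ : Continuous β) {N : ℕ} {σ : ℝ} (hσ : σ ∈ Set.Icc s t)
    (hP : IsPath (historyPath β k N ψ s t)) (hP' : IsPath (historyPath β k (N + 1) ψ s t)) :
    hP'.elt σ = ∑ p : Fin (k + N) × Bool, permuteKernel (movePerm p.1).symm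
      (collapseElt hβ p.1 p.2 hP t σ) := by
  have hm : ∀ p : Fin (k + N) × Bool, MemLp (fun ζ => collapsePath β p.1 p.2
      (historyPath β k N ψ s t) t σ (permute (movePerm p.1).symm ζ)) 2 := fun p =>
    (memLp_collapsePath hβ p.1 p.2 hP σ).comp_measurePreserving (measurePreserving_permute _)
  have he : ∀ ζ, historyPath β k (N + 1) ψ s t σ ζ = ∑ p : Fin (k + N) × Bool, collapsePath β p.1
      p.2 (historyPath β k N ψ s t) t σ (permute (movePerm p.1).symm ζ) := fun ζ => by
    rw [historyPath_succ hβ hσ, Fintype.sum_prod_type]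
  have hs : MemLp (fun ζ => ∑ p : Fin (k + N) × Bool, collapsePath β p.1
      p.2 (historyPath β k N ψ s t) t σ (permute (movePerm p.1).symm ζ)) 2 :=
    (hP'.memLp σ).ae_eq (Eventually.of_forall he)
  calc hP'.elt σ = hs.toLp _ := MemLp.toLp_congr _ _ (Eventually.of_forall he)
    _ = ∑ p, (hm p).toLp _ := toLp_finsetSum hm hs
    _ = _ := Finset.sum_congr rfl fun p _ => (permuteKernel_toLp _ _ (hm p)).symm

/-- The right-hand side of level `n` of the hierarchy. -/
def source (β : ℝ → ℝ) (g : ∀ n : ℕ, Fin n → ℝ → Kernel2 n) (n : ℕ) (r : ℝ) : Kernel2 n :=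
  ∑ j, (β r : ℂ) • g n j r

/-- A family of symmetric integrable paths that satisfies the hierarchy in the dual form, with
vanishing initial data. -/
structure IsDuhamelFamily (hβ : Continuous β) (s t C : ℝ) (g : ∀ n : ℕ, Fin n → ℝ → Kernel2 n) :
    Prop where
  integrableOn : ∀ n, 1 ≤ n → ∀ j, IntegrableOn (g n j) (Set.Ioc s t)
  identity : ∀ n, 1 ≤ n → ∀ (j : Fin n) {F : ℝ → Config n → ℂ} (hF : IsPath F),
    CollapseIdentity hβ j s t (g n j) (source β g (n + 1)) hF
  symmetric : ∀ n, 1 ≤ n → ∀ σ : Equiv.Perm (Fin n), ∀ᵐ r ∂(volume.restrict (Set.Ioc s t)),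
    permuteKernel σ (source β g n r) = source β g n r
  integral_le : ∀ n, 1 ≤ n → ∀ j, ∫ r in s..t, ‖g n j r‖ ≤ C ^ n

variable {hβ : Continuous β} {C : ℝ} {g : ∀ n : ℕ, Fin n → ℝ → Kernel2 n}

lemma IsDuhamelFamily.integrableOn_source (hg : IsDuhamelFamily hβ s t C g) {n : ℕ} (hn : 1 ≤ n) :
    IntegrableOn (source β g n) (Set.Ioc s t) := by
  obtain ⟨D, -, hD⟩ := exists_abs_le hβ s t
  refine integrable_finsetSum _ fun j _ => ?_
  refine (hg.integrableOn n hn j).bdd_smul D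
    (Complex.continuous_ofReal.comp hβ).aestronglyMeasurable ?_
  filter_upwards [ae_restrict_mem measurableSet_Ioc] with r hr
  rw [Function.comp_apply, Complex.norm_real]
  exact hD r ⟨hr.1.le, hr.2⟩

lemma IsDuhamelFamily.integral_norm_source_le (hg : IsDuhamelFamily hβ s t C g) (hst : s ≤ t)
    (hB : ∀ τ ∈ Set.Icc s t, |β τ| ≤ B) {n : ℕ} (hn : 1 ≤ n) :
    ∫ r in s..t, ‖source β g n r‖ ≤ n * (B * C ^ n) := by
  have hB0 : 0 ≤ B := (abs_nonneg _).trans (hB s ⟨le_rfl, hst⟩)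
  have hi : ∀ j, IntervalIntegrable (fun r => B * ‖g n j r‖) volume s t := fun j =>
    ((intervalIntegrable_iff_integrableOn_Ioc_of_le hst).2 (hg.integrableOn n hn j)).norm.const_mul B
  calc ∫ r in s..t, ‖source β g n r‖ ≤ ∫ r in s..t, ∑ j, B * ‖g n j r‖ := by
        refine intervalIntegral.integral_mono_on hst ?_ ?_ fun r hr => ?_
        · exact ((intervalIntegrable_iff_integrableOn_Ioc_of_le hst).2
            (hg.integrableOn_source hn)).norm
        · have := IntervalIntegrable.sum Finset.univ fun j _ => hi j
          simpa only [Finset.sum_fn] using this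
        · refine (norm_sum_le _ _).trans (Finset.sum_le_sum fun j _ => ?_)
          rw [norm_smul, Complex.norm_real]
          gcongr
          exact hB r hr
    _ = ∑ j, B * ∫ r in s..t, ‖g n j r‖ := by
        rw [intervalIntegral.integral_finsetSum fun j _ => hi j]
        simp_rw [intervalIntegral.integral_const_mul]
    _ ≤ ∑ _j : Fin n, B * C ^ n := by
        refine Finset.sum_le_sum fun j _ => ?_
        gcongr
        exact hg.integral_le n hn j
    _ = _ := by simp

/-- Duality moves every collapse onto the history path. The next history path consists of these
collapses up to permutations, and since the next source is symmetric the permutations may be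
inserted in the pairing. -/
lemma IsDuhamelFamily.expand (hg : IsDuhamelFamily hβ s t C g) (hst : s ≤ t) {N : ℕ}
    (hk : 1 ≤ k) (hP : IsPath (historyPath β k N ψ s t))
    (hP' : IsPath (historyPath β k (N + 1) ψ s t)) :
    ∫ r in s..t, pair2 (hP.elt r) (source β g (k + N) r)
      = -Complex.I * ∫ r in s..t, pair2 (hP'.elt r) (source β g (k + N + 1) r) := by
  have hn : 1 ≤ k + N := by omega
  obtain ⟨M, hM⟩ := hP.exists_norm_elt_le
  have hh := hg.integrableOn_source (n := k + N + 1) (by omega)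
  calc ∫ r in s..t, pair2 (hP.elt r) (source β g (k + N) r)
      = ∫ r in s..t, ∑ j, (β r : ℂ) * pair2 (hP.elt r) (g (k + N) j r) := by
        refine intervalIntegral.integral_congr fun r _ => ?_
        simp only [source, map_sum, map_smul, smul_eq_mul]
    _ = ∑ j, ∫ r in s..t, (β r : ℂ) * pair2 (hP.elt r) (g (k + N) j r) :=
        intervalIntegral.integral_finsetSum fun j _ => intervalIntegrable_weight_pair2 hst hβ
          hP.aestronglyMeasurable_elt (Eventually.of_forall hM) (hg.integrableOn _ hn j)
    _ = -Complex.I * ∑ p : Fin (k + N) × Bool, ∫ σ in s..t,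
          pair2 (collapseElt hβ p.1 p.2 hP t σ) (source β g (k + N + 1) σ) := by
        rw [Fintype.sum_prod_type, Finset.mul_sum]
        exact Finset.sum_congr rfl fun j _ => hg.identity _ hn j hP
    _ = -Complex.I * ∫ σ in s..t, ∑ p : Fin (k + N) × Bool,
          pair2 (collapseElt hβ p.1 p.2 hP t σ) (source β g (k + N + 1) σ) := by
        congr 1
        refine (intervalIntegral.integral_finsetSum fun p _ => ?_).symm
        obtain ⟨D, hD⟩ := exists_norm_collapseElt_le hβ p.1 p.2 hP s t
        exact intervalIntegrable_pair2 hst (aestronglyMeasurable_collapseElt hβ p.1 p.2 hP)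
          (ae_collapseElt_le hβ p.1 p.2 hP hD) hh
    _ = _ := by
        congr 1
        simp_rw [intervalIntegral.integral_of_le hst]
        refine integral_congr_ae ?_
        have hsym := ae_all_iff.2 (hg.symmetric (k + N + 1) (by omega))
        filter_upwards [hsym, ae_restrict_mem measurableSet_Ioc] with σ h1 h2
        rw [elt_historyPath_succ hβ ⟨h2.1.le, h2.2⟩ hP hP', map_sum, sum_apply]
        refine Finset.sum_congr rfl fun p _ => ?_
        conv_rhs => rw [← h1 (movePerm p.1).symm]
        exact (pair2_permuteKernel _ _ _).symm

end Iteration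


/-! ### Vanishing of the integrated source on a short interval. -/

section Vanishing

variable {β : ℝ → ℝ} {hβ : Continuous β} {k : ℕ} {s t T₁ B C q : ℝ}
  {g : ∀ n : ℕ, Fin n → ℝ → Kernel2 n}

lemma norm_elt_historyPath_le (hβ : Continuous β) (hT : 0 < T₁) (ht : t ≤ s + T₁)
    (hB : ∀ τ ∈ Set.Icc s (t + T₁), |β τ| ≤ B) (hq0 : 0 ≤ q)
    (hq : 4 * (CollapseTree.fiberConst * B ^ 2 * T₁) ≤ q ^ 2) {N : ℕ} {ψ : Config k → ℂ}
    (hψ : Measurable ψ) {X : ℝ} (hX0 : 0 ≤ X) (hX : ∫⁻ z, ‖ψ z‖ₑ ^ 2 ≤ ENNReal.ofReal X ^ 2)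
    (hP : IsPath (historyPath β k N ψ s t)) (r : ℝ) :
    ‖hP.elt r‖ ≤ (N + 1) ^ k * 8 ^ N * (2 ^ k * q ^ N) * X := by
  have h0 : 0 ≤ (N + 1 : ℝ) ^ k * 8 ^ N * (2 ^ k * q ^ N) * X := by positivity
  have h : ‖hP.elt r‖ₑ ^ 2
      ≤ ENNReal.ofReal ((N + 1) ^ k * 8 ^ N * (2 ^ k * q ^ N) * X) ^ 2 := by
    rw [hP.enorm_elt_sq]
    refine (lintegral_historyPath_le hβ hT ht hB N hψ r).trans ?_
    have e : ENNReal.ofReal ((N + 1) ^ k * 8 ^ N * (2 ^ k * q ^ N) * X)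
        = ENNReal.ofReal ((N + 1) ^ k * 8 ^ N) * ENNReal.ofReal (2 ^ k * q ^ N)
          * ENNReal.ofReal X := by
      rw [ENNReal.ofReal_mul (by positivity), ENNReal.ofReal_mul (by positivity)]
    rw [e, mul_pow, mul_pow]
    refine mul_le_mul' (mul_le_mul' (le_of_eq ?_) ?_) hX
    · congr 1
      rw [← ENNReal.ofReal_natCast]
      push_cast
      rfl
    · have e' : ENNReal.ofReal (2 ^ k * q ^ N) ^ 2 = (2 ^ k) ^ 2 * ENNReal.ofReal (q ^ 2) ^ N := by
        rw [ENNReal.ofReal_mul (by positivity), mul_pow, ENNReal.ofReal_pow hq0,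
          ENNReal.ofReal_pow hq0, ENNReal.ofReal_pow zero_le_two, ENNReal.ofReal_ofNat]
        ring
      rw [e']
      refine mul_le_mul' ?_ (pow_le_pow_left' (ENNReal.ofReal_le_ofReal hq) N)
      rw [← pow_mul]
      exact pow_le_pow_right₀ (by norm_num) (by omega)
  rw [← ofReal_norm, ← ENNReal.ofReal_pow (norm_nonneg _), ← ENNReal.ofReal_pow h0,
    ENNReal.ofReal_le_ofReal_iff (by positivity)] at h
  exact (pow_le_pow_iff_left₀ (norm_nonneg _) h0 two_ne_zero).1 h

/-- Every expansion step is an identity and preserves the modulus of the pairing, so the initial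
pairing is bounded by the last one for every `N`. Its history path is of size `(8 q)ᴺ` and its
source of size `C ^ (k + N)`, up to polynomial factors. -/
theorem IsDuhamelFamily.integral_source_eq_zero (hg : IsDuhamelFamily hβ s t C g) (hst : s ≤ t)
    (hC : 0 < C) (hT : 0 < T₁) (ht : t ≤ s + T₁) (hB : ∀ τ ∈ Set.Icc s (t + T₁), |β τ| ≤ B)
    (hq0 : 0 ≤ q) (hq : 4 * (CollapseTree.fiberConst * B ^ 2 * T₁) ≤ q ^ 2)
    (hqC : 8 * q * C ≤ 1 / 2) (hk : 1 ≤ k) : ∫ r in s..t, source β g k r = 0 := by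
  have hB' : ∀ τ ∈ Set.Icc s t, |β τ| ≤ B := fun τ hτ => hB τ ⟨hτ.1, hτ.2.trans (by linarith)⟩
  have hB0 : 0 ≤ B := (abs_nonneg _).trans (hB' s ⟨le_rfl, hst⟩)
  have hi : ∀ {n}, 1 ≤ n → IntervalIntegrable (source β g n) volume s t := fun hn =>
    (intervalIntegrable_iff_integrableOn_Ioc_of_le hst).2 (hg.integrableOn_source hn)
  refine eq_zero_of_pair2_eq_zero fun Ψ => ?_
  set ψ : Config k → ℂ := (Lp.aestronglyMeasurable Ψ).mk Ψ with hψd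
  have hψ : Measurable ψ := (Lp.aestronglyMeasurable Ψ).stronglyMeasurable_mk.measurable
  have hψΨ : Ψ =ᵐ[volume] ψ := (Lp.aestronglyMeasurable Ψ).ae_eq_mk
  have hX : ∫⁻ z, ‖ψ z‖ₑ ^ 2 ≤ ENNReal.ofReal ‖Ψ‖ ^ 2 := by
    rw [ofReal_norm, ← lintegral_lp_sq]
    refine le_of_eq (lintegral_congr_ae ?_)
    filter_upwards [hψΨ] with z hz
    rw [hz]
  have hX' : ∫⁻ z, ‖ψ z‖ₑ ^ 2 ≠ ∞ :=
    (hX.trans_lt (ENNReal.pow_lt_top ENNReal.ofReal_lt_top)).ne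
  have hP := fun N => isPath_historyPath (k := k) hβ hT ht hB N hψ hX'
  have h0 : pair2 Ψ (∫ r in s..t, source β g k r)
      = ∫ r in s..t, pair2 ((hP 0).elt r) (source β g k r) := by
    rw [← (pair2 Ψ).intervalIntegral_comp_comm (hi hk)]
    refine intervalIntegral.integral_congr fun r hr => ?_
    rw [Set.uIcc_of_le hst] at hr
    have : Ψ = (hP 0).elt r := by
      refine Lp.ext ?_
      filter_upwards [hψΨ, ((hP 0).memLp r).coeFn_toLp] with z h1 h2
      rw [h1, IsPath.elt, h2]
      exact (historyPath_zero hr z).symm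
    exact congrArg (fun x => pair2 x (source β g k r)) this
  have hN : ∀ N, ‖∫ r in s..t, pair2 ((hP 0).elt r) (source β g k r)‖
      = ‖∫ r in s..t, pair2 ((hP N).elt r) (source β g (k + N) r)‖ := by
    intro N
    induction N with
    | zero => rfl
    | succ N ih =>
      rw [ih, hg.expand hst hk (hP N) (hP (N + 1)), norm_mul, norm_neg, Complex.norm_I, one_mul]
      rfl
  set K : ℝ := 2 ^ k * ‖Ψ‖ * (B * C ^ k * (k + 1)) * 2 with hK
  have hbd : ∀ N : ℕ, ‖pair2 Ψ (∫ r in s..t, source β g k r)‖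
      ≤ K * (((N + 1 : ℕ) : ℝ) ^ (k + 1) * (1 / 2) ^ (N + 1)) := by
    intro N
    have hkN : 1 ≤ k + N := by omega
    have hY := norm_elt_historyPath_le hβ hT ht hB hq0 hq hψ (norm_nonneg Ψ) hX (hP N)
    set Y : ℝ := (N + 1) ^ k * 8 ^ N * (2 ^ k * q ^ N) * ‖Ψ‖ with hYd
    have hY0 : 0 ≤ Y := (norm_nonneg _).trans (hY s)
    rw [h0, hN N]
    calc ‖∫ r in s..t, pair2 ((hP N).elt r) (source β g (k + N) r)‖
        ≤ ∫ r in s..t, Y * ‖source β g (k + N) r‖ := by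
          refine intervalIntegral.norm_integral_le_of_norm_le hst
            (Eventually.of_forall fun r _ => ?_) ((hi hkN).norm.const_mul Y)
          exact (norm_pair2_le _ _).trans (by gcongr; exact hY r)
      _ = Y * ∫ r in s..t, ‖source β g (k + N) r‖ := intervalIntegral.integral_const_mul _ _
      _ ≤ Y * ((k + N : ℕ) * (B * C ^ (k + N))) := by
          gcongr
          exact hg.integral_norm_source_le hst hB' hkN
      _ = 2 ^ k * ‖Ψ‖ * (B * C ^ k) * ((N + 1) ^ k * (k + N : ℕ) * (8 * q * C) ^ N) := by
          rw [hYd, pow_add, mul_pow, mul_pow]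
          ring
      -- Uses `k + N ≤ (k + 1)(N + 1)` and `8 q C ≤ 1/2`. The final `2` in `K` adjusts the exponent
      -- from `N` to `N + 1`.
      _ ≤ 2 ^ k * ‖Ψ‖ * (B * C ^ k)
            * ((N + 1) ^ k * ((k + 1) * (N + 1)) * (1 / 2) ^ N) := by
          gcongr
          push_cast
          nlinarith [(Nat.cast_nonneg k : (0 : ℝ) ≤ k), (Nat.cast_nonneg N : (0 : ℝ) ≤ N),
            mul_nonneg (Nat.cast_nonneg k : (0 : ℝ) ≤ k) (Nat.cast_nonneg N : (0 : ℝ) ≤ N)]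
      _ = _ := by
          rw [hK]
          push_cast
          ring
  have hlim : Tendsto (fun N : ℕ => K * (((N + 1 : ℕ) : ℝ) ^ (k + 1) * (1 / 2) ^ (N + 1))) atTop
      (𝓝 0) := by
    have h1 := (tendsto_pow_const_mul_const_pow_of_abs_lt_one (k + 1)
      (r := (1 / 2 : ℝ)) (by rw [abs_of_pos] <;> norm_num)).comp (tendsto_add_atTop_nat 1)
    simpa [Function.comp_def] using h1.const_mul K
  exact norm_le_zero_iff.1 (ge_of_tendsto' hlim hbd)

end Vanishing


/-! ### Solutions of the hierarchy in the interaction picture -/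

lemma phaseMul_sum_smul {k : ℕ} {ι : Type*} (S : Finset ι) (τ : ℝ) (c : ℂ) (f : ι → Kernel2 k) :
    phaseMul τ (∑ i ∈ S, c • f i) = ∑ i ∈ S, c • phaseMul τ (f i) := by
  refine sub_eq_zero.1 (eq_zero_of_pair2_eq_zero fun x => ?_)
  rw [map_sub, ← pair2_phaseMul, map_sum, map_sum, sub_eq_zero]
  refine Finset.sum_congr rfl fun i _ => ?_
  rw [map_smul, map_smul, pair2_phaseMul]

/-- The time-dependent coupling constant. -/
def coupling (ω b₀ r : ℝ) : ℝ := Real.sqrt (1 + ω ^ 2 * r ^ 2) * b₀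

lemma continuous_coupling (ω b₀ : ℝ) : Continuous (coupling ω b₀) := by
  unfold coupling
  fun_prop

/-- `R B_{j,n+1} u` in the interaction picture, on the Fourier side. -/
def interactionPath (Bu : ∀ n : ℕ, Fin n → ℝ → 𝓢'(Config n, ℂ)) (n : ℕ) (j : Fin n) (r : ℝ) :
    Kernel2 n := phaseMul r (densityElt (Bu n j r))

section Solution

variable {ω b₀ s T C : ℝ} {u : ∀ k : ℕ, ℝ → Kernel2 k}
  {Bu : ∀ k : ℕ, Fin k → ℝ → 𝓢'(Config k, ℂ)}

lemma IsGPSolution.integrableOn_densityElt (hsol : IsGPSolution ω b₀ s T u Bu)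
    (hb : SpaceTimeBound s T C Bu) {n : ℕ} (hn : 1 ≤ n) (j : Fin n) :
    IntegrableOn (fun r => densityElt (Bu n j r)) (Set.Icc s T) :=
  GrossPitaevskii.integrableOn_densityElt (hb n hn j).1 (hb n hn j).2 (hsol.integrable n hn j)

lemma IsGPSolution.integrableOn_interactionPath (hsol : IsGPSolution ω b₀ s T u Bu)
    (hb : SpaceTimeBound s T C Bu) {n : ℕ} (hn : 1 ≤ n) (j : Fin n) :
    IntegrableOn (interactionPath Bu n j) (Set.Icc s T) := by
  have h := hsol.integrableOn_densityElt hb hn j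
  refine h.norm.mono' (aestronglyMeasurable_phaseMul h.1) (Eventually.of_forall fun r => ?_)
  exact (norm_phaseMul _ _).le

/-- The slack `1` in the choice of densities costs `T - s` after integration in time. It is absorbed
by enlarging the constant `C`, so that the bound is again a pure power. -/
lemma IsGPSolution.integral_norm_interactionPath_le (hsol : IsGPSolution ω b₀ s T u Bu)
    (hb : SpaceTimeBound s T C Bu) (hC : 0 < C) (hsT : s ≤ T) {n : ℕ} (hn : 1 ≤ n) (j : Fin n) {s' t' : ℝ} (h1 : s ≤ s') (h2 : s' ≤ t') (h3 : t' ≤ T) :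
    ∫ r in s'..t', ‖interactionPath Bu n j r‖ ≤ (C + (1 + (T - s))) ^ n := by
  have hK : 0 ≤ C ^ n + (T - s) := by
    have := pow_pos hC n
    linarith
  have h4 : ∫⁻ r in Set.Ioc s' t', ‖interactionPath Bu n j r‖ₑ
      ≤ ENNReal.ofReal (C ^ n + (T - s)) := by
    rw [ENNReal.ofReal_add (pow_pos hC n).le (by linarith)]
    refine (lintegral_mono_set (Set.Ioc_subset_Icc_self.trans (Set.Icc_subset_Icc h1 h3))).trans
      (le_trans (le_of_eq (lintegral_congr fun r => ?_)) (lintegral_densityElt_le (hb n hn j).2))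
    rw [← ofReal_norm, interactionPath, norm_phaseMul, ofReal_norm]
  rw [intervalIntegral.integral_of_le h2]
  calc ∫ r in Set.Ioc s' t', ‖interactionPath Bu n j r‖ ≤ C ^ n + (T - s) := by
        rw [integral_norm_eq_lintegral_enorm ((hsol.integrableOn_interactionPath hb hn j).1.mono_set
          (Set.Ioc_subset_Icc_self.trans (Set.Icc_subset_Icc h1 h3)))]
        exact ENNReal.toReal_le_of_le_ofReal hK h4
    _ ≤ C ^ n + (1 + (T - s)) ^ n := by
        have : 1 + (T - s) ≤ (1 + (T - s)) ^ n := le_self_pow₀ (by linarith) (by omega)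
        linarith
    _ ≤ (C + (1 + (T - s))) ^ n := pow_add_pow_le hC.le (by linarith) (by omega)

lemma IsGPSolution.mild (hsol : IsGPSolution ω b₀ s T u Bu) (hb : SpaceTimeBound s T C Bu)
    (hzero : ∀ k : ℕ, 1 ≤ k → u k s = 0) {n : ℕ} (hn : 1 ≤ n) {τ : ℝ} (hτ : τ ∈ Set.Icc s T) :
    (-Complex.I • ∫ r in s..τ, source (coupling ω b₀) (interactionPath Bu) n r : Kernel2 n)
      =ᵐ[volume] fun ξ => (rSymbol ξ : ℂ) * (phase τ ξ * (𝓕 (u n τ) : Kernel2 n) ξ) := by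
  set y : ℝ → Kernel2 n := fun r => ∑ j, (coupling ω b₀ r : ℂ) • densityElt (Bu n j r) with hy
  have hyI : IntegrableOn y (Set.Icc s T) := by
    obtain ⟨D, -, hD⟩ := exists_abs_le (continuous_coupling ω b₀) s T
    refine integrable_finsetSum _ fun j _ => ?_
    refine (hsol.integrableOn_densityElt hb hn j).bdd_smul D
      (Complex.continuous_ofReal.comp (continuous_coupling ω b₀)).aestronglyMeasurable ?_
    filter_upwards [ae_restrict_mem measurableSet_Icc] with r hr
    rw [Function.comp_apply, Complex.norm_real]
    exact hD r hr
  have hs : ∀ r, source (coupling ω b₀) (interactionPath Bu) n r = phaseMul r (y r) := fun r =>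
    (phaseMul_sum_smul _ _ _ _).symm
  simp_rw [hs]
  refine mild_form (f := fun r => ∑ j, (coupling ω b₀ r : ℂ) • Bu n j r)
    (hsol.weakly_continuous n hn) hyI (hzero n hn) ?_ (fun φ τ' hτ' => ?_) hτ
  · have h := ae_all_iff.2 fun j => ae_rNorm_ne_top (hb n hn j).1 (hb n hn j).2
    filter_upwards [h] with r hr χ hχ
    simp only [hy, map_sum, map_smul, sum_apply, smul_apply]
    exact Finset.sum_congr rfl fun j _ => by rw [pair2_densityElt (hr j) hχ]
  · refine (hsol.equation n hn φ τ' hτ').trans (intervalIntegral.integral_congr fun r _ => ?_)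
    simp only [sum_apply, smul_apply, coupling, Complex.ofReal_mul, smul_eq_mul, Finset.mul_sum]

lemma IsGPSolution.permuteKernel_fourier (hsol : IsGPSolution ω b₀ s T u Bu) {n : ℕ} (hn : 1 ≤ n)
    (σ : Equiv.Perm (Fin n)) {τ : ℝ} (hτ : τ ∈ Set.Icc s T) :
    permuteKernel σ (𝓕 (u n τ) : Kernel2 n) = 𝓕 (u n τ) := by
  rw [← fourier_permuteKernel]
  congr 1
  refine Lp.ext ?_
  filter_upwards [permuteKernel_ae σ (u n τ), hsol.symmetric n hn τ hτ σ] with z h1 h2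
  rw [h1, h2]

/-- The free phase is moved onto `χ`, which stays an admissible test function; then the convergence
of the regularised collapses applies. -/
lemma tendsto_regularisedPairing {n : ℕ} {j : Fin n} {ψ : ℕ → 𝓢(Space, ℂ)} {v : Kernel2 (n + 1)}
    {f : 𝓢'(Config n, ℂ)} (hf : rNorm f ≠ ∞)
    (hψ : ∀ χ (h : IsTest χ), Tendsto (fun m => ∑ b, branchSign b * ∫ ζ,
      collapseTest j b (ψ m) χ ζ * (𝓕 v : Kernel2 (n + 1)) ζ) atTop (𝓝 (f (𝓕 h.toSchwartz))))
    {w : ℝ → Kernel2 (n + 1)} {r : ℝ} (hw : w r = 𝓕 v) {χ : Config n → ℂ} (hχ : IsTest χ) :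
    Tendsto (fun m => regularisedPairing j (ψ m) hχ w r) atTop
      (𝓝 (pair2 hχ.eltDiv (phaseMul r (densityElt f)))) := by
  rw [← pair2_phaseMul, hχ.phaseMul_eltDiv, pair2_densityElt hf]
  refine (hψ _ (hχ.phase_mul r)).congr fun m => Finset.sum_congr rfl fun b _ => ?_
  rw [hw, IsPath.elt, pair2_toLp]
  rfl

lemma IsGPSolution.ae_tendsto (hsol : IsGPSolution ω b₀ s T u Bu) (hb : SpaceTimeBound s T C Bu)
    {ψ : ℕ → 𝓢(Space, ℂ)}
    (hψ : ∀ n j v f, IsCollapse j v f → ∀ χ (h : IsTest χ), Tendsto (fun m => ∑ b, branchSign b *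
      ∫ ζ, collapseTest (n := n) j b (ψ m) χ ζ * (𝓕 v : Kernel2 (n + 1)) ζ) atTop
        (𝓝 (f (𝓕 h.toSchwartz)))) {n : ℕ} (hn : 1 ≤ n) (j : Fin n) :
    ∀ᵐ r ∂(volume.restrict (Set.Icc s T)), ∀ {χ : Config n → ℂ} (hχ : IsTest χ),
      Tendsto (fun m => regularisedPairing j (ψ m) hχ (fun r => 𝓕 (u (n + 1) r)) r) atTop
        (𝓝 (pair2 hχ.eltDiv (interactionPath Bu n j r))) := by
  filter_upwards [hsol.collapse n hn j, ae_rNorm_ne_top (hb n hn j).1 (hb n hn j).2]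
    with r h1 h2 χ hχ
  exact tendsto_regularisedPairing h2 (hψ n j _ _ h1) rfl hχ

/-- The hypothesis on `[s, s']` allows a restart at `s'`: the primitive of the source from `s`
equals the one from `s'`, so the mild form holds with zero data at `s'`. -/
lemma IsGPSolution.isDuhamelFamily (hsol : IsGPSolution ω b₀ s T u Bu)
    (hb : SpaceTimeBound s T C Bu) (hC : 0 < C) (hzero : ∀ k : ℕ, 1 ≤ k → u k s = 0)
    {s' t' : ℝ} (h1 : s ≤ s') (h2 : s' ≤ t') (h3 : t' ≤ T)
    (hs' : ∀ n, 1 ≤ n → ∫ r in s..s', source (coupling ω b₀) (interactionPath Bu) n r = 0) :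
    IsDuhamelFamily (continuous_coupling ω b₀) s' t' (C + (1 + (T - s))) (interactionPath Bu) := by
  have hsub : Set.Icc s' t' ⊆ Set.Icc s T := Set.Icc_subset_Icc h1 h3
  have hsub' : Set.Ioc s' t' ⊆ Set.Icc s T := Set.Ioc_subset_Icc_self.trans hsub
  have hI : ∀ {n}, 1 ≤ n →
      IntegrableOn (source (coupling ω b₀) (interactionPath Bu) n) (Set.Icc s T) := by
    intro n hn
    obtain ⟨D, -, hD⟩ := exists_abs_le (continuous_coupling ω b₀) s T
    refine integrable_finsetSum _ fun j _ => ?_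
    refine (hsol.integrableOn_interactionPath hb hn j).bdd_smul D
      (Complex.continuous_ofReal.comp (continuous_coupling ω b₀)).aestronglyMeasurable ?_
    filter_upwards [ae_restrict_mem measurableSet_Icc] with r hr
    rw [Function.comp_apply, Complex.norm_real]
    exact hD r hr
  obtain ⟨ψ, hψ1, hψ2, hψ3⟩ := exists_regularisation
  refine ⟨fun n hn j => (hsol.integrableOn_interactionPath hb hn j).mono_set hsub', ?_, ?_,
    fun n hn j => hsol.integral_norm_interactionPath_le hb hC (by linarith) hn j h1 h2 h3⟩
  · intro n hn j F hF
    obtain ⟨M, hM⟩ := exists_bound_of_weakly_continuous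
      (hsol.weakly_continuous (n + 1) (by omega))
    refine collapse_identity h2 (continuous_coupling ω b₀) j hψ1 hψ2
      (v := fun r => (𝓕 (u (n + 1) r) : Kernel2 (n + 1))) (M := M)
      ((hsol.integrableOn_interactionPath hb hn j).mono_set hsub')
      ((hI (by omega)).mono_set hsub') ?_ (fun r hr => ?_) (fun r hr => ?_) ?_ hF
    · exact (integrableOn_fourier (hsol.weakly_continuous (n + 1) (by omega))).1.mono_measure
        (Measure.restrict_mono hsub' le_rfl)
    · rw [Lp.norm_fourier_eq]
      exact hM r (hsub' hr)
    · have hi : ∀ {a b}, s ≤ a → a ≤ b → b ≤ T → IntervalIntegrable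
          (source (coupling ω b₀) (interactionPath Bu) (n + 1)) volume a b := fun ha hab hb' =>
        (intervalIntegrable_iff_integrableOn_Icc_of_le hab).2
          ((hI (by omega)).mono_set (Set.Icc_subset_Icc ha hb'))
      have e := intervalIntegral.integral_add_adjacent_intervals (hi le_rfl h1 (h2.trans h3))
        (hi h1 hr.1 (hr.2.trans h3))
      rw [hs' _ (by omega), zero_add] at e
      rw [e]
      exact hsol.mild hb hzero (by omega) (hsub hr)
    · exact ae_restrict_of_ae_restrict_of_subset hsub' (hsol.ae_tendsto hb hψ3 hn j)
  · intro n hn σ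
    exact ae_restrict_of_ae_restrict_of_subset hsub' (ae_permuteKernel_eq (hI hn)
      (fun r hr => hsol.permuteKernel_fourier hn σ hr) fun r hr => hsol.mild hb hzero hn hr)

lemma IsGPSolution.integral_source_eq_zero (hsol : IsGPSolution ω b₀ s T u Bu)
    (hb : SpaceTimeBound s T C Bu) (hC : 0 < C) (hzero : ∀ k : ℕ, 1 ≤ k → u k s = 0) {τ : ℝ}
    (hτ : τ ∈ Set.Icc s T) {n : ℕ} (hn : 1 ≤ n) :
    ∫ r in s..τ, source (coupling ω b₀) (interactionPath Bu) n r = 0 := by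
  -- The windows of length at most one may extend past `T`.
  obtain ⟨B, -, hB⟩ := exists_abs_le (continuous_coupling ω b₀) s (T + 1)
  set C' : ℝ := C + (1 + (T - s)) with hC'
  have hC0 : 0 < C' := by linarith [hτ.1, hτ.2]
  -- Makes `8 q C'` equal to `1/2`. The summand `1` in `A` below only keeps the denominator of `T₁`
  -- positive.
  set q : ℝ := 1 / (16 * C') with hq
  have hq0 : 0 < q := by positivity
  have hqC : 8 * q * C' ≤ 1 / 2 := by
    rw [hq]
    field_simp
    norm_num
  have hc := CollapseTree.fiberConst_pos
  set A : ℝ := 4 * (CollapseTree.fiberConst * B ^ 2) + 1 with hA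
  have hA0 : 0 < A := by positivity
  set T₁ : ℝ := min 1 (q ^ 2 / A) with hT₁
  have hT0 : 0 < T₁ := by positivity
  have hT1 : T₁ ≤ 1 := min_le_left _ _
  have hqT : 4 * (CollapseTree.fiberConst * B ^ 2 * T₁) ≤ q ^ 2 := by
    have h1 : T₁ ≤ q ^ 2 / A := min_le_right _ _
    rw [le_div_iff₀ hA0] at h1
    nlinarith
  -- The length `T₁` depends on neither the window nor the level, so windows of this length are
  -- added one at a time. All levels are treated together because a restart needs every one of them.
  have key : ∀ m : ℕ, ∀ t ∈ Set.Icc s T, t ≤ s + m * T₁ → ∀ n, 1 ≤ n →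
      ∫ r in s..t, source (coupling ω b₀) (interactionPath Bu) n r = 0 := by
    intro m
    induction m with
    | zero =>
      intro t ht htm n hn
      have : t = s := le_antisymm (by simpa using htm) ht.1
      rw [this, intervalIntegral.integral_same]
    | succ m ih =>
      intro t ht htm n hn
      set s' : ℝ := min t (s + m * T₁) with hs'
      have h1 : s ≤ s' := le_min ht.1 (by linarith [mul_nonneg (Nat.cast_nonneg m : (0 : ℝ) ≤ m) hT0.le])
      have h2 : s' ≤ t := min_le_left _ _
      have h0 := ih s' ⟨h1, h2.trans ht.2⟩ (min_le_right _ _)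
      have ht' : t ≤ s' + T₁ := by
        rw [hs', ← sub_le_iff_le_add]
        push_cast at htm
        exact le_min (by linarith) (by linarith)
      have hfam := hsol.isDuhamelFamily hb hC hzero h1 h2 ht.2 h0
      have hfam0 := hsol.isDuhamelFamily hb hC hzero le_rfl h1 (h2.trans ht.2)
        fun n _ => intervalIntegral.integral_same
      have h3 := hfam.integral_source_eq_zero h2 hC0 hT0 ht' (fun r hr => hB r
        ⟨h1.trans hr.1, hr.2.trans (by linarith [ht.2])⟩) hq0.le hqT hqC hn
      rw [← intervalIntegral.integral_add_adjacent_intervals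
        ((intervalIntegrable_iff_integrableOn_Ioc_of_le h1).2 (hfam0.integrableOn_source hn))
        ((intervalIntegrable_iff_integrableOn_Ioc_of_le h2).2 (hfam.integrableOn_source hn)),
        h0 n hn, h3, add_zero]
  obtain ⟨m, hm⟩ := exists_nat_ge ((τ - s) / T₁)
  rw [div_le_iff₀ hT0] at hm
  exact key m τ hτ (by linarith) n hn

theorem IsGPSolution.rNorm_eq_zero (hsol : IsGPSolution ω b₀ s T u Bu)
    (hb : SpaceTimeBound s T C Bu) (hC : 0 < C) (hzero : ∀ k : ℕ, 1 ≤ k → u k s = 0) {n : ℕ}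
    (hn : 1 ≤ n) {τ : ℝ} (hτ : τ ∈ Set.Icc s T) : rNorm (u n τ : 𝓢'(Config n, ℂ)) = 0 := by
  have h := hsol.mild hb hzero hn hτ
  rw [hsol.integral_source_eq_zero hb hC hzero hτ hn, smul_zero] at h
  exact rNorm_eq_zero_of_ae (u n τ) τ (h.symm.trans (Lp.coeFn_zero ℂ 2 volume))

end Solution

end GrossPitaevskii

end

theorem theorem4p2 (ω b₀ s T : ℝ) (hs : 0 ≤ s) (hsT : s ≤ T)
    (u : ∀ k : ℕ, ℝ → GrossPitaevskii.Kernel2 k)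
    (Bu : ∀ k : ℕ, Fin k → ℝ → 𝓢'(GrossPitaevskii.Config k, ℂ))
    (hsol : GrossPitaevskii.IsGPSolution ω b₀ s T u Bu)
    (hzero : ∀ k : ℕ, 1 ≤ k → u k s = 0)
    (hbound : ∃ C : ℝ, 0 < C ∧ GrossPitaevskii.SpaceTimeBound s T C Bu) :
    ∀ k : ℕ, 1 ≤ k → ∀ τ ∈ Set.Icc s T,
      GrossPitaevskii.rNorm (u k τ : 𝓢'(GrossPitaevskii.Config k, ℂ)) = 0 := by
  obtain ⟨C, hC, hb⟩ := hbound
  exact fun k hk τ hτ => hsol.rNorm_eq_zero hb hC hzero hk hτ
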